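/- Let $G=SL(2,\mathbb C)$ and $g_{03}(\lambda)=\mathrm{diag}(e^{\lambda/2},e^{-\lambda/2})$, $g_{12}(\theta)=\mathrm{diag}(e^{i\theta/2},e^{-i\theta/2})$, $g_{13}(\theta)=\begin{pmatrix}\cos\frac\theta2&\sin\frac\theta2\\-\sin\frac\theta2&\cos\frac\theta2\end{pmatrix}$. Indices are $\alpha=(l,m)$, $l=1,2,\dots$, $-l\le m\le l$. Let $P_{l,m}$ be the associated Legendre functions (with the factor $(-1)^m$, and $P_{l,-m}=(-1)^m\frac{(l-m)!}{(l+m)!}P_{l,m}$), put $$A_{lm,l'm'}(\lambda)=\delta_{mm'}\sqrt{\tfrac{l(l+1)(2l+1)(l-m)!\,(2l'+1)(l'-m')!}{l'(l'+1)\,2(l+m)!\,2(l'+m')!}}\int_{-1}^{1}P_{l,m}(y)\,P_{l',m'}\Big(\tfrac{\tanh\lambda+y}{1+y\tanh\lambda}\Big)dy ,$$ and for $a\in SU(2)$ $$T^l_{mm'}(a)=(-1)^{2l-m-m'}\sqrt{\tfrac{(l-m)!(l+m)!}{(l-m')!(l+m')!}}\sum_{r=\max\{0,-m-m'\}}^{\min\{l-m,l-m'\}}\tbinom{l-m'}{r}\tbinom{l+m'}{l-m-r}a_{11}^{r}a_{12}^{l-m-r}a_{21}^{l-m'-r}a_{22}^{m+m'+r}.$$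 For $\mathfrak e\in\mathbb R$ (so $\mathfrak e^2\ge0$ is arbitrary) put $B_{l,m}(\lambda)=i\mathfrak e\sqrt{8/3}\int_0^\lambda A_{10,lm}(\lambda')\,d\lambda'$, which vanishes for $m\ne0$. 1. Every $g\in G$ can be written $g=g_{12}(\theta_1)g_{13}(\varphi_1)g_{12}(\vartheta_1)\,g_{12}(-\vartheta)g_{13}(-\varphi)\,g_{03}(\lambda)\,g_{13}(\varphi)g_{12}(\vartheta)$ with $\theta_1\in[0,4\pi]$, $\varphi_1,\varphi\in[0,\pi]$, $\vartheta_1,\vartheta\in[0,2\pi]$, $\lambda\ge0$; in particular $g=k\,g_{03}(\lambda)\,a$ with $k,a\in SU(2)$. 2. There is a well-defined matrix-valued function $A$ on $G$ with $A(k\,g_{03}(\lambda)\,a)=T(k)A(\lambda)T(a)$ for all $k,a\in SU(2)$, $\lambda\in\mathbb R$, where $T=\bigoplus_{l\ge1}T^l$; in particular $A(g_{03}(\lambda))=A(\lambda)$ and $A(a)=T(a)$. It is a unitary matrix with continuous entries, $\frac{d}{d\lambda}A(g_{03}(\lambda))|_{\lambda=0}$ is the boost generator of the irreducible unitary representation $(l_0,l_1)=(1,0)$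 in its canonical basis (entries $C_{l+1,m}$ at $(l,m),(l+1,m)$ and $-C_{l,m}$ at $(l,m),(l-1,m)$, with $C_{l,m}=\sqrt{l^2-m^2}\sqrt{\frac{l^2-1}{4l^2-1}}$, all others $0$), so that $A=U^{(1,0)}$, and (I) $A(gh)=A(g)A(h)$ for all $g,h\in G$. 3. There is a well-defined vector-valued function $B$ on $G$ with $B_{l,m}(k\,g_{03}(\lambda)\,a)=B_{l,0}(\lambda)A_{l0,lm}(a)$ for all $k,a\in SU(2)$, $\lambda\in\mathbb R$; in particular $B(g_{03}(\lambda))=B(\lambda)$. One has $B_{l,m}(\lambda)=(-1)^lB_{l,m}(-\lambda)$ and (II) $B(gh)=B(g)A(h)+B(h)$ for all $g,h\in G$; (III) $B=0$ on $SU(2)$; (*) $B(g)A(g^{-1})=-B(g^{-1})$ for all $g\in G$, with $B_{l,m}(g^{-1})=B_{l,0}(-\lambda)A_{l0,lm}(k^{-1})$ for $g=k\,g_{03}(\lambda)\,a$; $\|B(g)\|^2=\sum_\alpha|B_\alpha(g)|^2=8\mathfrak e^2(\lambda\coth\lambda-1)$ for $g=k\,g_{03}(\lambda)\,a$, $\lambda\ne0$.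 All matrix products are unconditionally convergent sums. 4. For every $\mathfrak e\in\mathbb R$ Staruszkiewicz's axioms of the quantum Coulomb field have a unitary implementation: there are a complex Hilbert space $\mathcal H$, a dense subspace $D$, operators $Q,c_\alpha,c^+_\alpha:D\to D$ ($Q$ symmetric, $c_\alpha^+$ adjoint to $c_\alpha$ on $D$), a unitary operator $V=e^{-iS(u)}$ with $VD=D$, and a unit vector $|0\rangle\in D$ such that on $D$ $$QV=V(Q+\mathfrak e)\ \ (\text{i.e. }[Q,S(u)]=i\mathfrak e),\quad [Q,c_\alpha]=[Q,c_\alpha^+]=0,\quad [V,c_\alpha]=[V,c_\alpha^+]=0,$$ $$[c_\alpha,c_\beta]=[c^+_\alpha,c^+_\beta]=0,\quad [c_\alpha,c_\beta^+]=4\pi\mathfrak e^2\delta_{\alpha\beta},\quad c_\alpha|0\rangle=Q|0\rangle=0,$$ the vectors $c^+_{\alpha_1}\cdots c^+_{\alpha_q}V^n|0\rangle$ ($n\in\mathbb Z$, $q\ge0$) span a dense subspace, and there is a strongly continuous unitary representation $U$ of $G$ on $\mathcal H$ that preserves $D$ and satisfies $U|0\rangle=|0\rangle$, $UQU^{-1}=Q$,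 $$U(g)c_\alpha U(g)^{-1}=\sum_\beta c_\beta A_{\beta\alpha}(g)+B_\alpha(g)Q,\qquad U(g)c^+_\alpha U(g)^{-1}=\sum_\beta c^+_\beta\overline{A_{\beta\alpha}(g)}+\overline{B_\alpha(g)}\,Q,$$ $$U(g)S(u)U(g)^{-1}=S(u)+\tfrac1{4\pi i\mathfrak e}\sum_{\alpha,\beta}\big[c_\alpha^+\overline{A_{\alpha\beta}(g)}B_\beta(g)-c_\alpha A_{\alpha\beta}(g)\overline{B_\beta(g)}\big].$$ Here $S(u)$ is a phase, defined modulo $2\pi$, and the last rule is understood in its exponential form: with $b=B/\mathfrak e$ (for $\mathfrak e=0$: $b$ is $B$ for charge $1$), $v_\alpha=\sum_\beta\overline{A_{\alpha\beta}}\,b_\beta$ and $X=\frac1{4\pi}\sum_\alpha(\overline{v_\alpha}c_\alpha-v_\alpha c^+_\alpha)$ on $D$, one has $U(g)VU(g)^{-1}=V\exp X$, where $\exp X$ is the time-one value of the unique one-parameter unitary group that preserves $D$ and has derivative $X$ on $D$ at time $0$. -/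

import Mathlib

noncomputable section

open scoped Nat ComplexConjugate

namespace Coulomb

/-! ### The group `SL(2, ℂ)`, its maximal compact subgroup, rotations and boosts -/

abbrev SL2C : Type := Matrix.SpecialLinearGroup (Fin 2) ℂ

/-- The subgroup `SU(2)` of `SL(2, ℂ)`, as a set. -/
def SU2 : Set SL2C := {a | (a : Matrix (Fin 2) (Fin 2) ℂ) ∈ Matrix.unitaryGroup (Fin 2) ℂ}

/-- The boost in the `03` plane with hyperbolic angle `s`. -/
def g03 (s : ℝ) : SL2C :=
  ⟨!![((Real.exp (s / 2) : ℝ) : ℂ), 0; 0, ((Real.exp (-(s / 2)) : ℝ) : ℂ)], by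
    rw [Matrix.det_fin_two_of, ← Complex.ofReal_mul, ← Real.exp_add]; simp⟩

/-- The rotation in the `12` plane by the angle `θ`. -/
def g12 (θ : ℝ) : SL2C :=
  ⟨!![Complex.exp (((θ / 2 : ℝ) : ℂ) * Complex.I), 0;
      0, Complex.exp (-(((θ / 2 : ℝ) : ℂ) * Complex.I))], by
    rw [Matrix.det_fin_two_of, ← Complex.exp_add]; simp⟩

/-- The rotation in the `13` plane by the angle `θ`. -/
def g13 (θ : ℝ) : SL2C :=
  ⟨!![((Real.cos (θ / 2) : ℝ) : ℂ), ((Real.sin (θ / 2) : ℝ) : ℂ);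
      -((Real.sin (θ / 2) : ℝ) : ℂ), ((Real.cos (θ / 2) : ℝ) : ℂ)], by
    rw [Matrix.det_fin_two_of]
    have h := Real.cos_sq_add_sin_sq (θ / 2)
    have h' : (((Real.cos (θ / 2)) ^ 2 + (Real.sin (θ / 2)) ^ 2 : ℝ) : ℂ) = 1 := by
      rw [h]; simp
    push_cast at h' ⊢
    linear_combination h'⟩

/-- `p = (k, s, a)` is a decomposition `g = k g₀₃(s) a` with `k, a ∈ SU(2)`, `s ≥ 0`. -/
def IsPolar (g : SL2C) (p : SL2C × ℝ × SL2C) : Prop :=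
  p.1 ∈ SU2 ∧ 0 ≤ p.2.1 ∧ p.2.2 ∈ SU2 ∧ g = p.1 * g03 p.2.1 * p.2.2

/-- A chosen decomposition of `g`. -/
def polar (g : SL2C) : SL2C × ℝ × SL2C := Classical.epsilon (IsPolar g)

/-! ### Indices and special functions -/

/-- The indices `(l, m)` with `l = 1, 2, …` and `-l ≤ m ≤ l`. -/
abbrev Idx : Type := {p : ℕ × ℤ // 1 ≤ p.1 ∧ |p.2| ≤ (p.1 : ℤ)}

/-- The degree `l` of the index `(l, m)`. -/
abbrev Idx.l (α : Idx) : ℕ := α.1.1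

/-- The order `m` of the index `(l, m)`. -/
abbrev Idx.m (α : Idx) : ℤ := α.1.2

/-- The index `(l, 0)`. -/
def idx0 (l : ℕ) (hl : 1 ≤ l) : Idx := ⟨(l, 0), hl, by simp⟩

/-- The generalized binomial coefficient `w (w - 1) ⋯ (w - k + 1) / k!`. -/
def genBinom (w : ℝ) (k : ℕ) : ℝ := (∏ j ∈ Finset.range k, (w - j)) / (k ! : ℝ)

/-- The associated Legendre function `P_{l,m}` on `[-1, 1]`, for `m ≥ 0`. -/
def legendreNonneg (l m : ℕ) (y : ℝ) : ℝ :=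
  (-1) ^ m * 2 ^ l * Real.sqrt (1 - y ^ 2) ^ m *
    ∑ k ∈ Finset.Icc m l,
      ((k ! : ℝ) / ((k - m)! : ℝ)) * (l.choose k : ℝ) *
        genBinom (((l : ℝ) + k - 1) / 2) l * y ^ (k - m)

/-- The associated Legendre function `P_{l,m}` for `m` of any sign, with
`P_{l,-m} = (-1)^m (l-m)!/(l+m)! P_{l,m}`. -/
def legendreP (l : ℕ) (m : ℤ) (y : ℝ) : ℝ :=
  if 0 ≤ m then legendreNonneg l m.natAbs y
  else (-1) ^ m.natAbs * (((l - m.natAbs)! : ℝ) / ((l + m.natAbs)! : ℝ)) *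
    legendreNonneg l m.natAbs y

/-- The matrix element of `U^{(1,0)}(g₀₃(s))` between `(l, m)` and `(l', m')`. -/
def boostEntry (l : ℕ) (m : ℤ) (l' : ℕ) (m' : ℤ) (s : ℝ) : ℝ :=
  if m = m' then
    Real.sqrt
      (((l : ℝ) * (l + 1) * (2 * l + 1) * ((((l : ℤ) - m).toNat)! : ℝ) *
          (2 * l' + 1) * ((((l' : ℤ) - m').toNat)! : ℝ)) /
        ((l' : ℝ) * (l' + 1) * (2 * ((((l : ℤ) + m).toNat)! : ℝ)) *
          (2 * ((((l' : ℤ) + m').toNat)! : ℝ)))) *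
      ∫ y in (-1 : ℝ)..1,
        legendreP l m y * legendreP l' m' ((Real.tanh s + y) / (1 + Real.tanh s * y))
  else 0

/-- The standard matrices `T^l_{m m'}(a)` of the representation of `SU(2)` of weight `l`. -/
def wignerT (l : ℕ) (m m' : ℤ) (a : Matrix (Fin 2) (Fin 2) ℂ) : ℂ :=
  (-1) ^ (2 * (l : ℤ) - m - m').toNat *
    ((Real.sqrt
      (((((l : ℤ) - m).toNat)! : ℝ) * ((((l : ℤ) + m).toNat)! : ℝ) /
        (((((l : ℤ) - m').toNat)! : ℝ) * ((((l : ℤ) + m').toNat)! : ℝ))) : ℝ) : ℂ) *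
    ∑ r ∈ Finset.Icc (max 0 (-m - m')) (min ((l : ℤ) - m) ((l : ℤ) - m')),
      ((((l : ℤ) - m').toNat.choose r.toNat : ℕ) : ℂ) *
        ((((l : ℤ) + m').toNat.choose ((l : ℤ) - m - r).toNat : ℕ) : ℂ) *
        a 0 0 ^ r.toNat * a 0 1 ^ ((l : ℤ) - m - r).toNat *
        a 1 0 ^ ((l : ℤ) - m' - r).toNat * a 1 1 ^ (m + m' + r).toNat

/-! ### The matrix-valued function `A` and the vector-valued function `B` -/

/-- The matrix `T(k) A(s) T(a)`, written out with `T` block diagonal and `A(s)` diagonal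
in the order. -/
def kakEntry (k : SL2C) (s : ℝ) (a : SL2C) (α β : Idx) : ℂ :=
  ∑ μ ∈ Finset.Icc (-((min α.l β.l : ℕ) : ℤ)) ((min α.l β.l : ℕ) : ℤ),
    wignerT α.l α.m μ (k : Matrix (Fin 2) (Fin 2) ℂ) *
      ((boostEntry α.l μ β.l μ s : ℝ) : ℂ) *
      wignerT β.l μ β.m (a : Matrix (Fin 2) (Fin 2) ℂ)

/-- `A(g) = U^{(1,0)}(g)`. -/
def A (g : SL2C) (α β : Idx) : ℂ := kakEntry (polar g).1 (polar g).2.1 (polar g).2.2 α β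

/-- The vector `B(s) = B(g₀₃(s))`, where `e` is the elementary charge. -/
def boostB (e : ℝ) (s : ℝ) (l : ℕ) (m : ℤ) : ℂ :=
  Complex.I * e * (Real.sqrt (8 / 3) : ℝ) * ((∫ t in (0 : ℝ)..s, boostEntry 1 0 l m t : ℝ) : ℂ)

/-- `B(g)_{l,m} = B_{l,0}(s) T^l_{0,m}(a)` for `g = k g₀₃(s) a`. -/
def B (e : ℝ) (g : SL2C) (α : Idx) : ℂ :=
  boostB e (polar g).2.1 α.l 0 *
    wignerT α.l 0 α.m ((polar g).2.2 : Matrix (Fin 2) (Fin 2) ℂ)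

/-- The matrix of `d/ds U(g₀₃(s))` at `s = 0` in the canonical basis of the irreducible
representation `(l₀, l₁) = (1, 0)`; its coefficients are
`C_l √(l² - m²)` with `C_l = √((l² - 1) / (4 l² - 1))`. -/
def boostGenerator (α β : Idx) : ℝ :=
  if α.m = β.m then
    if β.l = α.l + 1 then
      Real.sqrt (((β.l : ℝ) ^ 2 - 1) / (4 * (β.l : ℝ) ^ 2 - 1)) *
        Real.sqrt ((β.l : ℝ) ^ 2 - (β.m : ℝ) ^ 2)
    else if α.l = β.l + 1 then
      -(Real.sqrt (((α.l : ℝ) ^ 2 - 1) / (4 * (α.l : ℝ) ^ 2 - 1)) *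
        Real.sqrt ((α.l : ℝ) ^ 2 - (α.m : ℝ) ^ 2))
    else 0
  else 0

/-! ### The axioms of the quantum Coulomb field -/

/-- A realization, for the elementary charge `e`, of the axioms on a Hilbert space `H`, with the
unbounded operators `Q`, `c_α`, `c_α⁺` on a common invariant dense domain `D`. The phase `S(u)`
is defined modulo `2π` only and enters through the unitary operator `V = e^{-iS(u)}`. -/
structure CoulombField (e : ℝ) (H : Type) [NormedAddCommGroup H] [InnerProductSpace ℂ H] where
  /-- The common domain. -/
  D : Submodule ℂ H
  dense_D : Dense (D : Set H)
  /-- The total charge. -/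
  Q : D →ₗ[ℂ] D
  /-- The annihilation operators `c_α`. -/
  c : Idx → D →ₗ[ℂ] D
  /-- The creation operators `c_α⁺`. -/
  cd : Idx → D →ₗ[ℂ] D
  /-- The phase operator `e^{-iS(u)}`. -/
  V : H ≃ₗᵢ[ℂ] H
  V_mem : ∀ x : D, V (x : H) ∈ D
  V_symm_mem : ∀ x : D, V.symm (x : H) ∈ D
  /-- The vacuum `|0⟩`. -/
  vac : D
  norm_vac : ‖(vac : H)‖ = 1
  Q_symm : ∀ x y : D, inner ℂ (Q x : H) (y : H) = inner ℂ (x : H) (Q y : H)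
  cd_adjoint : ∀ (α : Idx) (x y : D), inner ℂ (c α x : H) (y : H) = inner ℂ (x : H) (cd α y : H)
  /-- `[Q, S(u)] = i e`, that is `Q e^{-iS(u)} = e^{-iS(u)} (Q + e)`. -/
  Q_V : ∀ x : D, (Q ⟨V x, V_mem x⟩ : H) = V (Q x : H) + (e : ℂ) • V (x : H)
  Q_c : ∀ (α : Idx) (x : D), Q (c α x) = c α (Q x)
  Q_cd : ∀ (α : Idx) (x : D), Q (cd α x) = cd α (Q x)
  V_c : ∀ (α : Idx) (x : D), (c α ⟨V x, V_mem x⟩ : H) = V (c α x : H)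
  V_cd : ∀ (α : Idx) (x : D), (cd α ⟨V x, V_mem x⟩ : H) = V (cd α x : H)
  c_c : ∀ (α β : Idx) (x : D), c α (c β x) = c β (c α x)
  cd_cd : ∀ (α β : Idx) (x : D), cd α (cd β x) = cd β (cd α x)
  c_cd : ∀ (α β : Idx) (x : D),
    c α (cd β x) - cd β (c α x) = (if α = β then ((4 * Real.pi * e ^ 2 : ℝ) : ℂ) else 0) • x
  c_vac : ∀ α : Idx, c α vac = 0
  Q_vac : Q vac = 0
  /-- The vectors `c_{α₁}⁺ ⋯ c_{α_q}⁺ e^{-inS(u)} |0⟩`, `n ∈ ℤ`, `q ≥ 0`, span a dense subspace. -/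
  complete : Dense ((Submodule.span ℂ {z : H | ∃ (n : ℤ) (αs : List Idx) (y : D),
    (y : H) = (V ^ n) (vac : H) ∧ z = (αs.foldr (fun α w => cd α w) y : D)} : Submodule ℂ H) :
      Set H)

/-- `W = exp X` for a skew-symmetric operator `X` on `D`: `W` is the value at time one of a
one-parameter unitary group that preserves the domain `D` and has the derivative `X` on it at
time zero (on a dense `D` there is at most one such group). -/
def IsUnitaryExp {H : Type} [NormedAddCommGroup H] [InnerProductSpace ℂ H]
    (D : Submodule ℂ H) (X : D → H) (W : H ≃ₗᵢ[ℂ] H) : Prop :=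
  ∃ w : ℝ → (H ≃ₗᵢ[ℂ] H),
    (∀ s t : ℝ, w (s + t) = w s * w t) ∧
    (∀ (s : ℝ) (x : D), w s (x : H) ∈ D) ∧
    (∀ x : D, HasDerivAt (fun s : ℝ => w s (x : H)) (X x) 0) ∧
    w 1 = W

/-- The vector `e⁻¹ Ā(g) B(g)`; as `B(g)` is proportional to `e`, this is `Ā(g) B(g)` for the
charge one. -/
def phaseShift (g : SL2C) (α : Idx) : ℂ := ∑' β : Idx, conj (A g α β) * B 1 g β

/-- A unitary implementation of the transformation rules with the functions `A` and `B`. -/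
structure LorentzAction {e : ℝ} {H : Type} [NormedAddCommGroup H] [InnerProductSpace ℂ H]
    (F : CoulombField e H) where
  /-- The unitary representation. -/
  U : SL2C →* (H ≃ₗᵢ[ℂ] H)
  continuous_U : ∀ x : H, Continuous fun g : SL2C => U g x
  U_mem : ∀ (g : SL2C) (x : F.D), U g (x : H) ∈ F.D
  U_vac : ∀ g : SL2C, U g (F.vac : H) = F.vac
  /-- `U Q U⁻¹ = Q`. -/
  U_Q : ∀ (g : SL2C) (x : F.D), U g (F.Q x : H) = F.Q ⟨U g x, U_mem g x⟩
  /-- `U c_α U⁻¹ = ∑_β c_β A_{β α} + B_α Q`, evaluated at `U x`. -/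
  U_c : ∀ (g : SL2C) (α : Idx) (x : F.D),
    HasSum (fun β : Idx => A g β α • (F.c β ⟨U g x, U_mem g x⟩ : H))
      (U g (F.c α x : H) - B e g α • (F.Q ⟨U g x, U_mem g x⟩ : H))
  /-- The adjoint rule for `U c_α⁺ U⁻¹`. -/
  U_cd : ∀ (g : SL2C) (α : Idx) (x : F.D),
    HasSum (fun β : Idx => conj (A g β α) • (F.cd β ⟨U g x, U_mem g x⟩ : H))
      (U g (F.cd α x : H) - conj (B e g α) • (F.Q ⟨U g x, U_mem g x⟩ : H))
  /-- `U S(u) U⁻¹ = S(u) + (4πi e)⁻¹ ∑_{α,β} (c_α⁺ Ā_{α β} B_β - c_α A_{α β} B̄_β)` in its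
  exponential form `U e^{-iS(u)} U⁻¹ = e^{-iS(u)} exp X`, where
  `X = (4π e)⁻¹ ∑_{α,β} (c_α A_{α β} B̄_β - c_α⁺ Ā_{α β} B_β)`. -/
  U_V : ∀ g : SL2C, ∃ (X : F.D → H) (W : H ≃ₗᵢ[ℂ] H),
    (∀ x : F.D, HasSum (fun α : Idx => ((1 / (4 * Real.pi) : ℝ) : ℂ) •
      (conj (phaseShift g α) • (F.c α x : H) - phaseShift g α • (F.cd α x : H))) (X x)) ∧
    IsUnitaryExp F.D X W ∧
    U g * F.V * (U g)⁻¹ = F.V * W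

end Coulomb

end

/-!
The group `SL(2, ℂ)` acts on the functions on `ℂ² ∖ {0}` that are homogeneous of degree zero, that
is, on the functions on the sphere, by `f ↦ f ∘ g`. Both `A` and `B` are parts of the matrix of
this one representation in the basis of spherical harmonics (`sph`, with matrix elements
`sphInt`). The constant functions are invariant. The block of the degrees `l ≥ 1`, rescaled by the
weights `√(l (l + 1))`, is `A` (`A_eq_aMat`), and the row of the constant function, rescaled in
the same way, is `B` (`B_eq`). Hence neither depends on the polar decomposition by which it is
defined, and the group law for `A` and the cocycle identity for `B` are the two cases of one rule
for the product of matrices, `hasSum_sphInt_mul`. That rule is Parseval's identity. Its two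
ingredients are the orthogonality relations (`sphInt_one`), obtained in the manner of Schur's
lemma, and the completeness of the spherical harmonics, obtained from the theorem of Weierstrass
in the form that the transformed spherical harmonics lie in the closed span of the spherical
harmonics (`inSpan_sph_act`).

The representation is not unitary for the area of the sphere, but the rescaling by `√(l (l + 1))`
passes from the `L²` norm to the energy norm `∫ |∇f|²`, which is conformally invariant. For a
boost this invariance is an identity between integrals of Legendre functions (`boostInt_symm`),
and it follows from Green's identity (`integral_wronskian`); together with the unitarity of `T^l`
it gives `A_inv`. The same identity for the potential `-log (cosh s - y sinh s)`, whose Laplacian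
is one minus the Jacobian of the boost, makes the norm of `B` an elementary integral
(`boostInt_zero_eq_log`, `hasSum_norm_B_g03`). Square-summability and continuity of `B` follow,
and `vVec` is a continuous cocycle of the unitary representation `repA` on the one-particle space
`ℓ²`. The functions involved are real, so the inner products of its values are real
(`conj_inner_vVec`).

The quantum field lives on a Fock space for every charge number `n`. All these spaces together are
the Hilbert space with the reproducing kernel `δ exp (c ⟪u, w⟫)` on the pairs `(n, u)`, with `c =
4 π e²` (`exists_isCoherent`). It is spanned by coherent states `E (n, u)`, and a vector is known
from the function `⟪E (n, u), ·⟫`. On these functions a creation operator is a multiplication and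
an annihilation operator a derivative, which gives the commutation relations. All the unitary
operators needed (the phase operator `V`, the displacements `exp X` and the operators of the
group) are of one kind, `IsCoherent.trans`: a shift of `n` with an affine isometry of `u` that may
depend on `n`. An element `g` acts by `u ↦ repA g u + n • dVec g`, with the cocycle `dVec = -vVec
/ (4 π)`. The composition law `IsCoherent.trans_mul` holds up to phases, which cancel since the
inner products of the cocycle are real; so this is a true representation. Comparing `n` with `n +
1` gives the transformation of the phase operator (`IsCoherent.lorentz_shift`). That `c⁺` is
adjoint to `c` is read off from the skew symmetry of the generators of the displacements
(`IsCoherent.inner_ann_left`).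
-/

noncomputable section

open scoped Nat ComplexConjugate
open Polynomial MeasureTheory

set_option linter.unusedSimpArgs false
set_option linter.unusedSectionVars false

namespace Coulomb


/-! ### The representations of `SU(2)` on homogeneous polynomials -/

/-- The coefficient of `X ^ i Y ^ (n - i)` in
`(a₀₀ X + a₁₀ Y) ^ j (a₀₁ X + a₁₁ Y) ^ (n - j)`, dehomogenized at `Y = 1`: the matrix of the
linear substitution given by `a` on the homogeneous polynomials of degree `n`. -/
def substCoeff (n i j : ℕ) (a : Matrix (Fin 2) (Fin 2) ℂ) : ℂ :=
  ((C (a 0 0) * X + C (a 1 0)) ^ j * (C (a 0 1) * X + C (a 1 1)) ^ (n - j)).coeff i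

lemma coeff_linear_pow (a b : ℂ) (j r : ℕ) :
    ((C a * X + C b) ^ j).coeff r = a ^ r * b ^ (j - r) * (j.choose r : ℂ) := by
  have : (C a * X + C b) ^ j = ((X + C b) ^ j).comp (C a * X) := by simp
  rw [this, comp_C_mul_X_coeff, coeff_X_add_C_pow]
  ring

lemma substCoeff_eq_sum (n i j : ℕ) (a : Matrix (Fin 2) (Fin 2) ℂ) :
    substCoeff n i j a = ∑ r ∈ Finset.range (i + 1),
      (j.choose r : ℂ) * ((n - j).choose (i - r) : ℂ) *
        a 0 0 ^ r * a 0 1 ^ (i - r) * a 1 0 ^ (j - r) * a 1 1 ^ (n - j - (i - r)) := by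
  rw [substCoeff, coeff_mul, Finset.Nat.sum_antidiagonal_eq_sum_range_succ_mk]
  refine Finset.sum_congr rfl fun r _ => ?_
  simp only [coeff_linear_pow]
  ring

/-- The substitution with both variables restored. -/
lemma sum_substCoeff_mul (n j : ℕ) (hj : j ≤ n) (a : Matrix (Fin 2) (Fin 2) ℂ) (p q : ℂ[X]) :
    (C (a 0 0) * p + C (a 1 0) * q) ^ j * (C (a 0 1) * p + C (a 1 1) * q) ^ (n - j) =
      ∑ i ∈ Finset.range (n + 1), C (substCoeff n i j a) * (p ^ i * q ^ (n - i)) := by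
  have hlin : ∀ (u v : ℂ) (k : ℕ), MvPolynomial.aeval ![p, q] (((C u * X + C v) ^ k).homogenize k)
      = (C u * p + C v * q) ^ k := by
    intro u v k
    have := homogenize_finsetProd (R := ℂ) (s := Finset.range k) (p := fun _ => C u * X + C v)
      (n := fun _ => 1) (fun _ _ => natDegree_linear_le)
    simp only [Finset.prod_const, Finset.sum_const, Finset.card_range, smul_eq_mul, mul_one] at this
    rw [this]
    simp [homogenize_X (R := ℂ) one_ne_zero, Polynomial.C_mul']
  have h1 := natDegree_pow_le_of_le j (natDegree_linear_le (a := a 0 0) (b := a 1 0))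
  have h2 := natDegree_pow_le_of_le (n - j) (natDegree_linear_le (a := a 0 1) (b := a 1 1))
  rw [mul_one] at h1 h2
  have hm := homogenize_mul _ _ h1 h2
  rw [Nat.add_sub_cancel' hj] at hm
  have hm' := congrArg (MvPolynomial.aeval ![p, q]) hm
  rw [map_mul, hlin, hlin] at hm'
  rw [← hm', homogenize, map_sum, Finset.Nat.sum_antidiagonal_eq_sum_range_succ_mk]
  refine Finset.sum_congr rfl fun i _ => ?_
  rw [MvPolynomial.aeval_monomial, Finsupp.prod_fintype _ _ (by simp)]
  simp [substCoeff]

lemma substCoeff_mul (n i j : ℕ) (hj : j ≤ n) (a b : Matrix (Fin 2) (Fin 2) ℂ) :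
    substCoeff n i j (a * b) =
      ∑ k ∈ Finset.range (n + 1), substCoeff n i k a * substCoeff n k j b := by
  have h := sum_substCoeff_mul n j hj b (C (a 0 0) * X + C (a 1 0)) (C (a 0 1) * X + C (a 1 1))
  have h' := congrArg (fun p : ℂ[X] => p.coeff i) h
  simp only [finsetSum_coeff, coeff_C_mul] at h'
  rw [substCoeff, show (∑ k ∈ Finset.range (n + 1), substCoeff n i k a * substCoeff n k j b) =
    ∑ k ∈ Finset.range (n + 1), substCoeff n k j b * substCoeff n i k a from
      Finset.sum_congr rfl fun _ _ => mul_comm _ _]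
  refine Eq.trans ?_ h'
  congr 1
  simp only [Matrix.mul_apply, Fin.sum_univ_two, C_add, C_mul]
  ring

lemma substCoeff_diag (n i j : ℕ) (p q : ℂ) :
    substCoeff n i j !![p, 0; 0, q] = if i = j then p ^ j * q ^ (n - j) else 0 := by
  simp only [substCoeff, Matrix.of_apply, Matrix.cons_val', Matrix.cons_val_zero,
    Matrix.cons_val_one, C_0, add_zero, zero_mul, zero_add, Matrix.cons_val_fin_one]
  rw [mul_pow, ← C_pow, ← C_pow, mul_assoc, mul_comm (X ^ j), ← mul_assoc, ← C_mul, coeff_C_mul,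
    coeff_X_pow]
  simp

lemma choose_mul_choose_symm (n i j r : ℕ) (hi : i ≤ n) (hj : j ≤ n) (hr : r ≤ i) (hr' : r ≤ j) :
    j.choose r * (n - j).choose (i - r) * (i ! * (n - i)!) =
      i.choose r * (n - i).choose (j - r) * (j ! * (n - j)!) := by
  by_cases h : i - r ≤ n - j
  · have h' : j - r ≤ n - i := by omega
    have e1 := Nat.choose_mul_factorial_mul_factorial hr
    have e2 := Nat.choose_mul_factorial_mul_factorial hr'
    have e3 := Nat.choose_mul_factorial_mul_factorial h
    have e4 := Nat.choose_mul_factorial_mul_factorial h'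
    have e5 : n - j - (i - r) = n - i - (j - r) := by omega
    rw [← e1, ← e2, ← e3, ← e4, e5]
    ring
  · rw [Nat.choose_eq_zero_of_lt (not_le.1 h), Nat.choose_eq_zero_of_lt (by omega : n - i < j - r)]
    simp

lemma substCoeff_eq_sum_min (n i j : ℕ) (a : Matrix (Fin 2) (Fin 2) ℂ) :
    substCoeff n i j a = ∑ r ∈ Finset.range (min i j + 1),
      (j.choose r : ℂ) * ((n - j).choose (i - r) : ℂ) *
        a 0 0 ^ r * a 0 1 ^ (i - r) * a 1 0 ^ (j - r) * a 1 1 ^ (n - j - (i - r)) := by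
  rw [substCoeff_eq_sum]
  symm
  refine Finset.sum_subset (fun r hr => by simp at hr ⊢; omega) fun r hr hr' => ?_
  simp only [Finset.mem_range] at hr hr'
  rw [Nat.choose_eq_zero_of_lt (by omega : j < r)]
  simp

/-- The substitution by the transposed matrix is the adjoint for the inner product in which the
monomials `X ^ i Y ^ (n - i)` are orthogonal with squared norms `i! (n - i)!`; this is why the square
roots of factorials in `wignerT` make it unitary on `SU(2)`. -/
lemma substCoeff_transpose (n i j : ℕ) (hi : i ≤ n) (hj : j ≤ n) (a : Matrix (Fin 2) (Fin 2) ℂ) :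
    ((i ! * (n - i)! : ℕ) : ℂ) * substCoeff n i j a =
      ((j ! * (n - j)! : ℕ) : ℂ) * substCoeff n j i a.transpose := by
  rw [substCoeff_eq_sum_min, substCoeff_eq_sum_min, min_comm j i, Finset.mul_sum, Finset.mul_sum]
  refine Finset.sum_congr rfl fun r hr => ?_
  simp only [Finset.mem_range] at hr
  have h := congrArg (Nat.cast (R := ℂ)) (choose_mul_choose_symm n i j r hi hj (by omega) (by omega))
  have e5 : n - j - (i - r) = n - i - (j - r) := by omega
  simp only [Matrix.transpose_apply, e5]
  push_cast at h ⊢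
  linear_combination h * a 0 0 ^ r * a 0 1 ^ (i - r) * a 1 0 ^ (j - r) *
    a 1 1 ^ (n - i - (j - r))

lemma conj_substCoeff (n i j : ℕ) (a : Matrix (Fin 2) (Fin 2) ℂ) :
    conj (substCoeff n i j a) = substCoeff n i j (a.map conj) := by
  rw [substCoeff_eq_sum, substCoeff_eq_sum, map_sum]
  simp

/-- The exchange of the two variables. -/
lemma substCoeff_reflect (n i j : ℕ) (hi : i ≤ n) (hj : j ≤ n) (a : Matrix (Fin 2) (Fin 2) ℂ) :
    substCoeff n (n - i) (n - j) a = substCoeff n i j !![a 1 1, a 1 0; a 0 1, a 0 0] := by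
  have hl : ∀ u v : ℂ, reflect 1 (C u * X + C v) = C v * X + C u := by
    intro u v
    rw [reflect_add, reflect_C_mul, reflect_C]
    simp [reflect_one_X, add_comm, pow_one]
  have hp : ∀ (u v : ℂ) (k : ℕ), reflect k ((C u * X + C v) ^ k) = (C v * X + C u) ^ k := by
    intro u v k
    induction k with
    | zero => simp
    | succ k ih =>
      have h1 := natDegree_pow_le_of_le k (natDegree_linear_le (a := u) (b := v))
      rw [mul_one] at h1
      rw [pow_succ, reflect_mul _ _ h1 natDegree_linear_le, ih, hl, pow_succ]
  have h1 := natDegree_pow_le_of_le (n - j) (natDegree_linear_le (a := a 0 0) (b := a 1 0))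
  have h2 := natDegree_pow_le_of_le j (natDegree_linear_le (a := a 0 1) (b := a 1 1))
  rw [mul_one] at h1 h2
  have h := reflect_mul _ _ h1 h2
  rw [hp, hp, Nat.sub_add_cancel hj] at h
  have h' := congrArg (fun p : ℂ[X] => p.coeff i) h
  simp only [coeff_reflect] at h'
  rw [revAt_le hi] at h'
  rw [substCoeff, substCoeff, show n - (n - j) = j by omega, h']
  simp only [Matrix.of_apply, Matrix.cons_val', Matrix.cons_val_zero, Matrix.cons_val_one,
    Matrix.cons_val_fin_one]
  rw [mul_comm]

/-- `wignerT` in terms of the substitution matrix, with the indices `i = l - m`, `j = l - m'`. -/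
lemma wignerT_eq (l : ℕ) (m m' : ℤ) (hm : |m| ≤ l) (hm' : |m'| ≤ l)
    (a : Matrix (Fin 2) (Fin 2) ℂ) :
    wignerT l m m' a = (-1) ^ (((l : ℤ) - m).toNat + ((l : ℤ) - m').toNat) *
      ((Real.sqrt (((((l : ℤ) - m).toNat)! : ℝ) * ((2 * l - ((l : ℤ) - m).toNat)! : ℝ) /
        (((((l : ℤ) - m').toNat)! : ℝ) * ((2 * l - ((l : ℤ) - m').toNat)! : ℝ))) : ℝ) : ℂ) *
      substCoeff (2 * l) ((l : ℤ) - m).toNat ((l : ℤ) - m').toNat a := by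
  rw [abs_le] at hm hm'
  obtain ⟨i, hi⟩ : ∃ i : ℕ, (i : ℤ) = l - m := ⟨_, Int.toNat_of_nonneg (by omega)⟩
  obtain ⟨j, hj⟩ : ∃ j : ℕ, (j : ℤ) = l - m' := ⟨_, Int.toNat_of_nonneg (by omega)⟩
  have e1 : ((l : ℤ) - m).toNat = i := by omega
  have e2 : ((l : ℤ) - m').toNat = j := by omega
  have e3 : ((l : ℤ) + m).toNat = 2 * l - i := by omega
  have e4 : ((l : ℤ) + m').toNat = 2 * l - j := by omega
  have e5 : (2 * (l : ℤ) - m - m').toNat = i + j := by omega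
  rw [wignerT, e1, e2, e3, e4, e5, substCoeff_eq_sum_min]
  congr 1
  symm
  refine Finset.sum_bij_ne_zero (fun (r : ℕ) _ _ => (r : ℤ)) ?_ ?_ ?_ ?_
  · intro r hr h0
    simp only [Finset.mem_range, Finset.mem_Icc] at hr ⊢
    have : ¬ 2 * l - j < i - r := fun h => h0 (by rw [Nat.choose_eq_zero_of_lt h]; simp)
    omega
  · intro r _ _ s _ _ h
    exact_mod_cast h
  · intro r hr h0
    simp only [Finset.mem_Icc] at hr
    obtain ⟨s, rfl⟩ := Int.eq_ofNat_of_zero_le (show 0 ≤ r by omega)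
    have f1 : ((l : ℤ) - m - s).toNat = i - s := by omega
    have f2 : ((l : ℤ) - m' - s).toNat = j - s := by omega
    have f3 : (m + m' + s).toNat = 2 * l - j - (i - s) := by omega
    rw [f1, f2, f3, Int.toNat_natCast] at h0
    exact ⟨s, by simp only [Finset.mem_range]; omega, h0, rfl⟩
  · intro r hr h0
    simp only [Finset.mem_range] at hr
    have : ¬ 2 * l - j < i - r := fun h => h0 (by rw [Nat.choose_eq_zero_of_lt h]; simp)
    have f1 : ((l : ℤ) - m - r).toNat = i - r := by omega
    have f2 : ((l : ℤ) - m' - r).toNat = j - r := by omega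
    have f3 : (m + m' + r).toNat = 2 * l - j - (i - r) := by omega
    rw [f1, f2, f3, Int.toNat_natCast]

lemma sum_Icc_eq_sum_range (l : ℕ) (f : ℤ → ℂ) :
    ∑ μ ∈ Finset.Icc (-(l : ℤ)) l, f μ = ∑ i ∈ Finset.range (2 * l + 1), f ((l : ℤ) - i) := by
  refine Finset.sum_nbij' (fun μ => ((l : ℤ) - μ).toNat) (fun i => (l : ℤ) - i) ?_ ?_ ?_ ?_ ?_
  · intro μ hμ; simp only [Finset.mem_Icc, Finset.mem_range] at hμ ⊢; omega
  · intro i hi; simp only [Finset.mem_Icc, Finset.mem_range] at hi ⊢; omega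
  · intro μ hμ; simp only [Finset.mem_Icc] at hμ ⊢; omega
  · intro i hi; simp
  · intro μ hμ
    simp only [Finset.mem_Icc] at hμ
    congr 1
    omega

lemma mem_Icc_iff_abs_le (l : ℕ) (m : ℤ) : m ∈ Finset.Icc (-(l : ℤ)) l ↔ |m| ≤ l := by
  rw [Finset.mem_Icc, abs_le]

lemma wignerT_mul (l : ℕ) (m m' : ℤ) (hm : |m| ≤ l) (hm' : |m'| ≤ l)
    (a b : Matrix (Fin 2) (Fin 2) ℂ) :
    wignerT l m m' (a * b) =
      ∑ μ ∈ Finset.Icc (-(l : ℤ)) l, wignerT l m μ a * wignerT l μ m' b := by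
  rw [wignerT_eq l m m' hm hm', substCoeff_mul _ _ _ (by rw [abs_le] at hm'; omega),
    sum_Icc_eq_sum_range, Finset.mul_sum]
  refine Finset.sum_congr rfl fun k hk => ?_
  have hk' : k ≤ 2 * l := by simp only [Finset.mem_range] at hk; omega
  have hkl : |(l : ℤ) - k| ≤ l := by rw [abs_le]; omega
  rw [wignerT_eq l m _ hm hkl, wignerT_eq l _ m' hkl hm']
  have ek : ((l : ℤ) - (l - k)).toNat = k := by omega
  rw [ek]
  set i := ((l : ℤ) - m).toNat
  set j := ((l : ℤ) - m').toNat
  have hs : ∀ p q r : ℕ, Real.sqrt (((p ! : ℝ) * ((2 * l - p)! : ℝ)) / (r ! * (2 * l - r)!)) =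
      Real.sqrt (((p ! : ℝ) * ((2 * l - p)! : ℝ)) / (q ! * (2 * l - q)!)) *
      Real.sqrt (((q ! : ℝ) * ((2 * l - q)! : ℝ)) / (r ! * (2 * l - r)!)) := by
    intro p q r
    rw [← Real.sqrt_mul (by positivity)]
    congr 1
    have : (q ! : ℝ) ≠ 0 := by positivity
    have : ((2 * l - q)! : ℝ) ≠ 0 := by positivity
    field_simp
  rw [hs i k j]
  have h1 : ((-1 : ℂ)) ^ k * (-1) ^ k = 1 := by rw [← mul_pow]; simp
  push_cast [pow_add]
  linear_combination (-((-1 : ℂ) ^ i * (-1) ^ j * substCoeff (2 * l) i k a *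
    substCoeff (2 * l) k j b *
      (Real.sqrt (((i ! : ℝ) * ((2 * l - i)! : ℝ)) / (k ! * (2 * l - k)!)) : ℂ) *
      (Real.sqrt (((k ! : ℝ) * ((2 * l - k)! : ℝ)) / (j ! * (2 * l - j)!)) : ℂ))) * h1

lemma wignerT_diag (l : ℕ) (m m' : ℤ) (hm : |m| ≤ l) (hm' : |m'| ≤ l) (p q : ℂ) :
    wignerT l m m' !![p, 0; 0, q] =
      if m = m' then p ^ ((l : ℤ) - m).toNat * q ^ ((l : ℤ) + m).toNat else 0 := by
  rw [wignerT_eq l m m' hm hm', substCoeff_diag]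
  rw [abs_le] at hm hm'
  by_cases h : m = m'
  · subst h
    have : (2 * l - ((l : ℤ) - m).toNat) = ((l : ℤ) + m).toNat := by omega
    rw [this, div_self (by positivity)]
    simp [← two_mul]
  · rw [if_neg h, if_neg (by omega), mul_zero]

lemma wignerT_one (l : ℕ) (m m' : ℤ) (hm : |m| ≤ l) (hm' : |m'| ≤ l) :
    wignerT l m m' 1 = if m = m' then 1 else 0 := by
  rw [Matrix.one_fin_two, wignerT_diag l m m' hm hm']
  simp

/-- Unitarity of `T^l`, in a form that holds for all matrices. -/
lemma conj_wignerT (l : ℕ) (m m' : ℤ) (hm : |m| ≤ l) (hm' : |m'| ≤ l)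
    (a : Matrix (Fin 2) (Fin 2) ℂ) :
    conj (wignerT l m m' a) = wignerT l m' m a.conjTranspose := by
  rw [wignerT_eq l m m' hm hm', wignerT_eq l m' m hm' hm]
  rw [abs_le] at hm hm'
  set i := ((l : ℤ) - m).toNat
  set j := ((l : ℤ) - m').toNat
  have hi : i ≤ 2 * l := by omega
  have hj : j ≤ 2 * l := by omega
  have h := substCoeff_transpose (2 * l) i j hi hj (a.map conj)
  rw [map_mul, map_mul, conj_substCoeff, Complex.conj_ofReal, map_pow, map_neg, map_one,
    add_comm j i, mul_assoc, mul_assoc]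
  congr 1
  have hct : a.conjTranspose = (a.map conj).transpose := by
    ext u v; simp [Matrix.conjTranspose_apply]
  rw [hct]
  set P : ℝ := (i ! : ℝ) * ((2 * l - i)! : ℝ) with hP
  set R : ℝ := (j ! : ℝ) * ((2 * l - j)! : ℝ) with hR
  have hP0 : 0 < P := by positivity
  have hR0 : 0 < R := by positivity
  have h' : (P : ℂ) * substCoeff (2 * l) i j (a.map conj) =
      (R : ℂ) * substCoeff (2 * l) j i (a.map conj).transpose := by
    rw [hP, hR]; push_cast at h ⊢; exact h
  have e1 : Real.sqrt (P / R) = P / Real.sqrt (P * R) := by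
    rw [eq_div_iff (by positivity), ← Real.sqrt_mul (by positivity),
      show P / R * (P * R) = P * P by field_simp, Real.sqrt_mul_self hP0.le]
  have e2 : Real.sqrt (R / P) = R / Real.sqrt (P * R) := by
    rw [eq_div_iff (by positivity), ← Real.sqrt_mul (by positivity),
      show R / P * (P * R) = R * R by field_simp, Real.sqrt_mul_self hR0.le]
  rw [e1, e2]
  push_cast
  rw [div_mul_eq_mul_div, div_mul_eq_mul_div, h']

lemma negOnePow_toNat_add (l : ℕ) (m m' : ℤ) (hm : |m| ≤ l) (hm' : |m'| ≤ l) :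
    (-1 : ℂ) ^ (((l : ℤ) - m).toNat + ((l : ℤ) - m').toNat) = (-1 : ℂ) ^ (m + m').natAbs := by
  rw [abs_le] at hm hm'
  rcases Nat.even_or_odd (m + m').natAbs with h | h
  · rw [h.neg_one_pow, Even.neg_one_pow]
    rw [Nat.even_iff] at h ⊢; omega
  · rw [h.neg_one_pow, Odd.neg_one_pow]
    rw [Nat.odd_iff] at h ⊢; omega

/-- Matrices of the form `(p, q; -q̄, p̄)`, the real multiples of the elements of `SU(2)`. -/
def IsQuaternionic (a : Matrix (Fin 2) (Fin 2) ℂ) : Prop :=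
  a 1 0 = -conj (a 0 1) ∧ a 1 1 = conj (a 0 0)

/-- The representation `T^l` of `SU(2)` is real for the real structure `e_m ↦ (-1)^m e_{-m}`. -/
lemma conj_wignerT_eq_neg (l : ℕ) (m m' : ℤ) (hm : |m| ≤ l) (hm' : |m'| ≤ l)
    (a : Matrix (Fin 2) (Fin 2) ℂ) (ha : IsQuaternionic a) :
    conj (wignerT l m m' a) = (-1) ^ (m + m').natAbs * wignerT l (-m) (-m') a := by
  have hmn : |(-m)| ≤ (l : ℤ) := by rwa [abs_neg]
  have hmn' : |(-m')| ≤ (l : ℤ) := by rwa [abs_neg]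
  rw [wignerT_eq l m m' hm hm', wignerT_eq l (-m) (-m') hmn hmn', negOnePow_toNat_add l _ _ hm hm',
    negOnePow_toNat_add l _ _ hmn hmn']
  have hs := negOnePow_toNat_add l _ _ hm hm'
  rw [abs_le] at hm hm'
  set i := ((l : ℤ) - m).toNat with hi
  set j := ((l : ℤ) - m').toNat with hj
  have e1 : ((l : ℤ) - -m).toNat = 2 * l - i := by omega
  have e2 : ((l : ℤ) - -m').toNat = 2 * l - j := by omega
  rw [e1, e2, substCoeff_reflect _ _ _ (by omega) (by omega), 
    show 2 * l - (2 * l - i) = i by omega, show 2 * l - (2 * l - j) = j by omega,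
    map_mul, map_mul, conj_substCoeff, Complex.conj_ofReal, map_pow, map_neg, map_one,
    mul_comm (((2 * l - i)! : ℕ) : ℝ), mul_comm (((2 * l - j)! : ℕ) : ℝ),
    show (-m + -m').natAbs = (m + m').natAbs by omega]
  have key : substCoeff (2 * l) i j (a.map conj) =
      (-1) ^ (m + m').natAbs * substCoeff (2 * l) i j !![a 1 1, a 1 0; a 0 1, a 0 0] := by
    rw [← hs, substCoeff_eq_sum_min, substCoeff_eq_sum_min, Finset.mul_sum]
    refine Finset.sum_congr rfl fun r hr => ?_
    simp only [Finset.mem_range] at hr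
    have hpar : (-1 : ℂ) ^ (i + j) = (-1) ^ (i - r) * (-1) ^ (j - r) := by
      rw [← pow_add, show i + j = (i - r + (j - r)) + 2 * r by omega, pow_add, pow_mul]
      simp
    have h01 : (a.map conj) 0 1 = -a 1 0 := by simp [ha.1]
    have h00 : (a.map conj) 0 0 = a 1 1 := by simp [ha.2]
    have h10 : (a.map conj) 1 0 = -a 0 1 := by simp [ha.1]
    have h11 : (a.map conj) 1 1 = a 0 0 := by simp [ha.2]
    rw [h00, h01, h10, h11, hpar, neg_pow (a 1 0), neg_pow (a 0 1)]
    simp only [Matrix.of_apply, Matrix.cons_val', Matrix.cons_val_zero, Matrix.cons_val_one,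
      Matrix.cons_val_fin_one]
    ring
  rw [key]
  ring


/-! ### Legendre polynomials -/

/-- The Legendre polynomial of degree `l`, by Rodrigues' formula. -/
def legPoly (l : ℕ) : ℝ[X] := C (1 / (2 ^ l * (l ! : ℝ))) * derivative^[l] ((X ^ 2 - 1) ^ l)

/-- The `m`-th derivative of the Legendre polynomial of degree `l`. -/
def legQ (l m : ℕ) : ℝ[X] := derivative^[m] (legPoly l)

lemma derivative_legQ (l m : ℕ) : derivative (legQ l m) = legQ l (m + 1) := by
  rw [legQ, legQ, Function.iterate_succ_apply']

lemma legQ_eq (l m : ℕ) :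
    legQ l m = C (1 / (2 ^ l * (l ! : ℝ))) * derivative^[l + m] ((X ^ 2 - 1) ^ l) := by
  rw [legQ, legPoly, iterate_derivative_C_mul, add_comm, Function.iterate_add_apply]

/-- The differential equation for the derivatives of `(X² - 1) ^ l`, obtained by differentiating
`(X² - 1) R' = 2 l X R`. -/
lemma iterate_derivative_ode (l n : ℕ) :
    (X ^ 2 - 1) * derivative^[n + 2] ((X ^ 2 - 1 : ℝ[X]) ^ l) +
      C (2 * ((n : ℝ) + 1 - l)) * X * derivative^[n + 1] ((X ^ 2 - 1) ^ l) +
      C (((n : ℝ) + 1) * (n - 2 * l)) * derivative^[n] ((X ^ 2 - 1) ^ l) = 0 := by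
  induction n with
  | zero =>
    have h1 : (X ^ 2 - 1) * derivative ((X ^ 2 - 1 : ℝ[X]) ^ l) =
        C (2 * (l : ℝ)) * X * (X ^ 2 - 1) ^ l := by
      cases l with
      | zero => simp
      | succ l =>
        rw [derivative_pow]
        simp only [Nat.cast_add, Nat.cast_one, derivative_sub, derivative_X_pow, derivative_one,
          C_add, C_mul, C_1, map_ofNat, add_tsub_cancel_right, Nat.cast_ofNat, map_natCast]
        ring
    have h2 := congrArg derivative h1
    simp only [derivative_mul, derivative_sub, derivative_X_pow, derivative_one, derivative_C,
      derivative_X] at h2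
    simp only [Function.iterate_succ_apply', Function.iterate_zero_apply]
    simp only [C_mul, C_add, C_sub, C_1, map_ofNat, map_natCast, C_0, Nat.cast_zero,
      Nat.cast_ofNat, Nat.cast_one] at h2 ⊢
    linear_combination h2
  | succ n ih =>
    have h2 := congrArg derivative ih
    simp only [derivative_mul, derivative_add, derivative_sub, derivative_X_pow, derivative_one,
      derivative_C, derivative_X, ← Function.iterate_succ_apply', derivative_zero] at h2
    simp only [Nat.succ_eq_add_one] at h2
    simp only [C_mul, C_add, C_sub, C_1, map_ofNat, map_natCast, Nat.cast_add,
      Nat.cast_ofNat, Nat.cast_one] at h2 ⊢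
    linear_combination h2

/-- The differential equation of the derivatives of the Legendre polynomials. -/
lemma legQ_ode (l m : ℕ) :
    (X ^ 2 - 1) * legQ l (m + 2) + C (2 * ((m : ℝ) + 1)) * X * legQ l (m + 1) =
      C (((l : ℝ) - m) * (l + m + 1)) * legQ l m := by
  have h := iterate_derivative_ode l (l + m)
  simp only [legQ_eq, ← add_assoc]
  simp only [C_mul, C_add, C_sub, C_1, map_ofNat, map_natCast, Nat.cast_add] at h ⊢
  linear_combination C (1 / (2 ^ l * (l ! : ℝ))) * h

/-- `P_{l+1}' = (l + 1) P_l + X P_l'`. -/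
lemma legQ_succ_one (l : ℕ) :
    legQ (l + 1) 1 = C ((l : ℝ) + 1) * legQ l 0 + X * legQ l 1 := by
  have h0 : derivative ((X ^ 2 - 1 : ℝ[X]) ^ (l + 1)) =
      C (2 * ((l : ℝ) + 1)) * (X * (X ^ 2 - 1) ^ l) := by
    rw [derivative_pow]
    simp only [Nat.cast_add, Nat.cast_one, derivative_sub, derivative_X_pow, derivative_one,
      C_add, C_mul, C_1, map_ofNat, add_tsub_cancel_right, Nat.cast_ofNat, map_natCast]
    ring
  have h1 : derivative^[l + 1 + 1] ((X ^ 2 - 1 : ℝ[X]) ^ (l + 1)) =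
      C (2 * ((l : ℝ) + 1)) * (X * derivative^[l + 1] ((X ^ 2 - 1) ^ l) +
        C ((l : ℝ) + 1) * derivative^[l] ((X ^ 2 - 1) ^ l)) := by
    rw [Function.iterate_succ_apply, h0, iterate_derivative_C_mul, mul_comm X,
      iterate_derivative_mul_X]
    simp [Polynomial.smul_eq_C_mul, mul_comm]
  rw [legQ_eq, legQ_eq, legQ_eq, h1, ← mul_assoc, ← C_mul]
  have h2 : 1 / (2 ^ (l + 1) * ((l + 1)! : ℝ)) * (2 * ((l : ℝ) + 1)) = 1 / (2 ^ l * (l ! : ℝ)) := by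
    rw [Nat.factorial_succ]; push_cast; field_simp; ring
  rw [h2, add_zero]
  ring

lemma eval_one_legPoly (l : ℕ) : (legPoly l).eval 1 = 1 := by
  induction l with
  | zero => simp [legPoly]
  | succ l ih =>
    have h1 := congrArg (eval 1) (legQ_ode (l + 1) 0)
    have h2 := congrArg (eval 1) (legQ_succ_one l)
    have h3 := congrArg (eval 1) (legQ_ode l 0)
    have e : ∀ k, (legQ k 0) = legPoly k := fun k => rfl
    simp [e] at h1 h2 h3
    rw [ih] at h2 h3
    have : ((l : ℝ) + 1) * (l + 1 + 1) ≠ 0 := by positivity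
    apply mul_left_cancel₀ this
    linear_combination (-1 : ℝ) * h1 + 2 * h2 + h3

/-- `(X² - 1) P_l' = (l + 1) (P_{l+1} - X P_l)`. -/
lemma legQ_lower (l : ℕ) :
    (X ^ 2 - 1) * legQ l 1 = C ((l : ℝ) + 1) * (legQ (l + 1) 0 - X * legQ l 0) := by
  have hd : derivative ((X ^ 2 - 1) * legQ l 1 - C ((l : ℝ) + 1) * (legQ (l + 1) 0 - X * legQ l 0))
      = 0 := by
    have h2 := legQ_succ_one l
    have h3 := legQ_ode l 0
    simp only [derivative_mul, derivative_add, derivative_sub, derivative_X_pow, derivative_one,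
      derivative_C, derivative_X, derivative_legQ]
    simp only [C_mul, C_add, C_sub, C_1, map_ofNat, map_natCast, Nat.cast_zero, C_0,
      Nat.cast_ofNat, Nat.cast_one, zero_add] at h2 h3 ⊢
    linear_combination h3 - ((l : ℝ[X]) + 1) * h2
  have e : ∀ k, (legQ k 0).eval 1 = 1 := fun k => eval_one_legPoly k
  have h1 : eval 1 ((X ^ 2 - 1) * legQ l 1 - C ((l : ℝ) + 1) * (legQ (l + 1) 0 - X * legQ l 0))
      = 0 := by
    simp [e]
  rw [eq_C_of_derivative_eq_zero hd, eval_C] at h1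
  have he := eq_C_of_derivative_eq_zero hd
  rw [h1, C_0] at he
  exact sub_eq_zero.1 he

/-- `(2l+1) X P_l' = (l+1) P_{l-1}' + l P_{l+1}'`, with `l` shifted by one. -/
lemma legQ_X_mul (l m : ℕ) :
    C (2 * (l : ℝ) + 3) * (X * legQ (l + 1) (m + 1) + C (m : ℝ) * legQ (l + 1) m) =
      C ((l : ℝ) + 2) * legQ l (m + 1) + C ((l : ℝ) + 1) * legQ (l + 2) (m + 1) := by
  induction m with
  | zero =>
    have h1 := legQ_succ_one (l + 1)
    have h2 := legQ_succ_one l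
    have h3 := legQ_lower l
    simp only [C_mul, C_add, C_sub, C_1, map_ofNat, map_natCast, Nat.cast_zero, C_0, Nat.cast_add,
      Nat.cast_ofNat, Nat.cast_one, zero_add] at h1 h2 h3 ⊢
    have h1' : legQ (l + 2) 1 = ((l : ℝ[X]) + 1 + 1) * legQ (l + 1) 0 + X * legQ (l + 1) 1 := h1
    rw [h1']
    linear_combination ((l : ℝ[X]) + 2) * X * h2 + ((l : ℝ[X]) + 2) * h3
  | succ m ih =>
    have h2 := congrArg derivative ih
    simp only [derivative_mul, derivative_add, derivative_C, derivative_X, derivative_legQ] at h2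
    simp only [C_mul, C_add, C_sub, C_1, map_ofNat, map_natCast, Nat.cast_add,
      Nat.cast_ofNat, Nat.cast_one] at h2 ⊢
    linear_combination h2

/-- The action of an infinitesimal boost on `P_l^{(m)}`. -/
lemma legQ_boost (l m : ℕ) :
    C (2 * (l : ℝ) + 3) * ((1 - X ^ 2) * legQ (l + 1) (m + 1) - C (m : ℝ) * X * legQ (l + 1) m) =
      C (((l : ℝ) + 2) * (l + 1 + m)) * legQ l m -
        C (((l : ℝ) + 1) * (l + 2 - m)) * legQ (l + 2) m := by
  induction m with
  | zero =>
    have h1 := legQ_X_mul l 0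
    have h3 := legQ_lower l
    have h4 := legQ_lower (l + 1)
    have h2 := legQ_succ_one l
    have h5 : legQ (l + 1 + 1) 0 = legQ (l + 2) 0 := rfl
    rw [h5] at h4
    simp only [C_mul, C_add, C_sub, C_1, map_ofNat, map_natCast, Nat.cast_zero, C_0, Nat.cast_add,
      Nat.cast_ofNat, Nat.cast_one, zero_add] at h1 h2 h3 h4 ⊢
    linear_combination (-((l : ℝ[X]) + 1)) * h4 - ((l : ℝ[X]) + 2) * X * h3 +
      ((l : ℝ[X]) + 2) * (1 - X ^ 2) * h2
  | succ m ih =>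
    have h2 := congrArg derivative ih
    have h1 := legQ_X_mul l m
    simp only [derivative_mul, derivative_add, derivative_sub, derivative_X_pow, derivative_one,
      derivative_C, derivative_X, derivative_legQ] at h2
    simp only [C_mul, C_add, C_sub, C_1, map_ofNat, map_natCast, Nat.cast_add,
      Nat.cast_ofNat, Nat.cast_one] at h1 h2 ⊢
    linear_combination h2 + h1

lemma prod_half_add (j : ℕ) :
    ∏ i ∈ Finset.range j, ((i : ℝ) + 1 / 2) = (2 * j)! / (4 ^ j * j !) := by
  induction j with
  | zero => simp
  | succ j ih =>
    rw [Finset.prod_range_succ, ih, show 2 * (j + 1) = 2 * j + 1 + 1 by ring, Nat.factorial_succ,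
      Nat.factorial_succ, Nat.factorial_succ]
    push_cast
    field_simp
    ring

lemma genBinom_half (j p : ℕ) :
    genBinom ((j : ℝ) - 1 / 2) (j + p) =
      (2 * j)! / (4 ^ j * j !) * ((-1) ^ p * ((2 * p)! / (4 ^ p * p !))) / (j + p)! := by
  rw [genBinom, Finset.prod_range_add]
  congr 2
  · rw [← prod_half_add, ← Finset.prod_range_reflect]
    refine Finset.prod_congr rfl fun i hi => ?_
    simp only [Finset.mem_range] at hi
    rw [Nat.sub_sub, Nat.cast_sub (by omega)]
    push_cast
    ring
  · rw [← prod_half_add, ← Finset.card_range p, ← Finset.prod_const, Finset.card_range,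
      ← Finset.prod_mul_distrib]
    refine Finset.prod_congr rfl fun i _ => ?_
    push_cast
    ring

lemma coeff_X_sub_one_pow (l j : ℕ) :
    ((X - C 1 : ℝ[X]) ^ l).coeff j = (-1) ^ (l - j) * (l.choose j : ℝ) := by
  rw [sub_eq_add_neg, ← C_neg, coeff_X_add_C_pow]

lemma iterate_derivative_monomial' (m k : ℕ) (a : ℝ) :
    derivative^[m] (monomial k a) = monomial (k - m) (a * k.descFactorial m) := by
  rw [← C_mul_X_pow_eq_monomial, iterate_derivative_C_mul, iterate_derivative_X_pow_eq_C_mul,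
    ← mul_assoc, ← C_mul, C_mul_X_pow_eq_monomial]

lemma coeff_legPoly (l k : ℕ) :
    (legPoly l).coeff k = 2 ^ l * (l.choose k : ℝ) * genBinom (((l : ℝ) + k - 1) / 2) l := by
  have hexp : (X ^ 2 - 1 : ℝ[X]) ^ l = expand ℝ 2 ((X - C 1) ^ l) := by simp
  rw [legPoly, coeff_C_mul, coeff_iterate_derivative, hexp, coeff_expand (by norm_num)]
  rcases le_or_gt k l with hk | hk
  swap
  · rw [Nat.choose_eq_zero_of_lt hk]
    split_ifs with h
    · rw [coeff_X_sub_one_pow, Nat.choose_eq_zero_of_lt (by omega : l < (k + l) / 2)]; simp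
    · simp
  rcases Nat.even_or_odd' (k + l) with ⟨j, hj | hj⟩
  · obtain ⟨p, rfl⟩ : ∃ p, l = j + p := ⟨l - j, by omega⟩
    have hkp : k + p = j := by omega
    subst hkp
    have e1 : (((k + p + p : ℕ) : ℝ) + k - 1) / 2 = ((k + p : ℕ) : ℝ) - 1 / 2 := by
      push_cast; ring
    rw [if_pos (by omega), hj, Nat.mul_div_cancel_left _ (by norm_num), coeff_X_sub_one_pow, e1,
      genBinom_half, Nat.cast_choose ℝ (by omega), Nat.cast_choose ℝ (by omega),
      show k + p + p - (k + p) = p by omega, show k + p + p - k = 2 * p by omega]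
    have hd := Nat.factorial_mul_descFactorial (show k + p + p ≤ 2 * (k + p) by omega)
    rw [show 2 * (k + p) - (k + p + p) = k by omega] at hd
    have hd' : ((2 * (k + p)).descFactorial (k + p + p) : ℝ) = (2 * (k + p))! / k ! := by
      rw [eq_div_iff (by positivity), ← hd]; push_cast; ring
    rw [nsmul_eq_mul, hd']
    have h4 : ∀ i : ℕ, (4 : ℝ) ^ i = 2 ^ (2 * i) := fun i => by rw [pow_mul]; norm_num
    rw [h4, h4]
    field_simp
    ring
  · rw [if_neg (by omega)]
    have : genBinom (((l : ℝ) + k - 1) / 2) l = 0 := by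
      rw [genBinom, Finset.prod_eq_zero (i := j), zero_div]
      · simp only [Finset.mem_range]; omega
      · have : (k : ℝ) + l = 2 * j + 1 := by exact_mod_cast hj
        linarith
    rw [this]
    simp

lemma natDegree_legPoly_le (l : ℕ) : (legPoly l).natDegree ≤ l := by
  rw [natDegree_le_iff_coeff_eq_zero]
  intro k hk
  rw [coeff_legPoly, Nat.choose_eq_zero_of_lt hk]
  simp

lemma natDegree_legQ_le (l m : ℕ) : (legQ l m).natDegree ≤ l - m := by
  have := natDegree_iterate_derivative (legPoly l) m
  have := natDegree_legPoly_le l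
  rw [legQ]
  omega

lemma coeff_legQ_ne_zero (l m : ℕ) (hm : m ≤ l) : (legQ l m).coeff (l - m) ≠ 0 := by
  rw [legQ, coeff_iterate_derivative, coeff_legPoly, Nat.sub_add_cancel hm, nsmul_eq_mul]
  have e1 : ((l : ℝ) + l - 1) / 2 = (l : ℝ) - 1 / 2 := by ring
  have := genBinom_half l 0
  rw [add_zero] at this
  rw [e1, this, Nat.choose_self]
  have hd : 0 < l.descFactorial m := Nat.descFactorial_pos.2 hm
  have : (0 : ℝ) < l.descFactorial m := by exact_mod_cast hd
  simp only [pow_zero, mul_zero, Nat.factorial_zero]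
  positivity

lemma legendreNonneg_eq (l m : ℕ) (y : ℝ) :
    legendreNonneg l m y = (-1) ^ m * Real.sqrt (1 - y ^ 2) ^ m * (legQ l m).eval y := by
  have h : (legQ l m).eval y = ∑ k ∈ Finset.Icc m l,
      ((k ! : ℝ) / ((k - m)! : ℝ)) * (legPoly l).coeff k * y ^ (k - m) := by
    have h1 := as_sum_range' (legPoly l) (l + 1) (by have := natDegree_legPoly_le l; omega)
    rw [legQ]
    conv_lhs => rw [h1]
    rw [iterate_derivative_sum, eval_finsetSum]
    symm
    refine Finset.sum_subset_zero_on_sdiff (fun k hk => by simp at hk ⊢; omega) ?_ ?_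
    · intro k hk
      simp only [Finset.mem_sdiff, Finset.mem_range, Finset.mem_Icc] at hk
      rw [iterate_derivative_monomial', Nat.descFactorial_of_lt (by omega)]
      simp
    · intro k hk
      simp only [Finset.mem_Icc] at hk
      have hd := Nat.factorial_mul_descFactorial hk.1
      rw [iterate_derivative_monomial', eval_monomial, ← hd]
      push_cast
      field_simp
  rw [legendreNonneg, h]
  have : ∀ s : ℝ, (-1 : ℝ) ^ m * 2 ^ l * Real.sqrt (1 - y ^ 2) ^ m * s =
      (-1) ^ m * Real.sqrt (1 - y ^ 2) ^ m * (2 ^ l * s) := fun s => by ring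
  rw [this, Finset.mul_sum]
  congr 1
  refine Finset.sum_congr rfl fun k _ => ?_
  rw [coeff_legPoly]
  ring

/-- Leibniz' rule for the derivative of order `l + m` of `(X - 1) ^ l (X + 1) ^ l`. -/
lemma legQ_leibniz (l m : ℕ) (hm : m ≤ l) :
    legQ l m = C ((l ! : ℝ) / (2 ^ l * (l - m)!)) * ∑ r ∈ Finset.range (l - m + 1),
      C (((l - m).choose r : ℝ) * ((l + m).choose (l - r) : ℝ)) *
        ((X + 1) ^ r * (X - 1) ^ (l - m - r)) := by
  have h0 : (X ^ 2 - 1 : ℝ[X]) ^ l = (X + C 1) ^ l * (X - C 1) ^ l := by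
    rw [← mul_pow]; congr 1; simp; ring
  rw [legQ_eq, h0, iterate_derivative_mul]
  have hpl : ∀ k, derivative^[k] ((X + C (1 : ℝ)) ^ l) = C ((l.descFactorial k : ℝ)) * (X + 1) ^ (l - k) := by
    intro k
    rw [iterate_derivative_X_add_pow]; simp
  have hmi : ∀ k, derivative^[k] ((X - C (1 : ℝ)) ^ l) = C ((l.descFactorial k : ℝ)) * (X - 1) ^ (l - k) := by
    intro k
    rw [iterate_derivative_X_sub_pow]; simp
  rw [Finset.mul_sum, Finset.mul_sum]
  simp only [hpl, hmi]
  symm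
  -- The terms of Leibniz' rule for the derivative of order `l + m` vanish unless `m ≤ k ≤ l`;
  -- substitute `k = r + m`.
  refine Finset.sum_of_injOn (fun r => r + m) (fun r _ s _ h => Nat.add_right_cancel h) ?_ ?_ ?_
  · intro r hr
    simp only [Finset.coe_range, Set.mem_Iio] at hr ⊢
    omega
  · intro k hk hk'
    simp only [Finset.mem_range] at hk
    rcases lt_or_ge k m with h | h
    · rw [Nat.descFactorial_of_lt (by omega : l < l + m - k)]; simp
    · have : l < k := by
        by_contra hlk
        exact hk' ⟨k - m, by simp; omega, by simp; omega⟩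
      rw [Nat.descFactorial_of_lt this]; simp
  · intro r hr
    simp only [Finset.mem_range] at hr
    have hr1 : r ≤ l - m := by omega
    have hc : (l + m).choose (r + m) = (l + m).choose (l - r) := by
      rw [← Nat.choose_symm (by omega : r + m ≤ l + m)]; congr 1; omega
    have hd1 := Nat.factorial_mul_descFactorial (show l - r ≤ l by omega)
    have hd2 := Nat.factorial_mul_descFactorial (show r + m ≤ l by omega)
    rw [show l - (l - r) = r by omega] at hd1
    have hd1' : (l.descFactorial (l - r) : ℝ) = l ! / r ! := by
      rw [eq_div_iff (by positivity), ← hd1]; push_cast; ring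
    have hd2' : (l.descFactorial (r + m) : ℝ) = l ! / (l - (r + m))! := by
      rw [eq_div_iff (by positivity)]
      have := congrArg (Nat.cast (R := ℝ)) hd2
      push_cast at this
      linarith
    rw [show l + m - (r + m) = l - r by omega, show l - (l - r) = r by omega, hc, hd1', hd2',
      nsmul_eq_mul, ← C_eq_natCast, Nat.cast_choose ℝ hr1, show l - (r + m) = l - m - r by omega]
    have : (l ! : ℝ) / (2 ^ l * (l - m)!) * ((l - m)! / (r ! * (l - m - r)!) *
        ((l + m).choose (l - r) : ℝ)) = 1 / (2 ^ l * (l ! : ℝ)) * ((l + m).choose (l - r) : ℝ) *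
        (l ! / r !) * (l ! / (l - m - r)!) := by
      field_simp
    rw [← mul_assoc, ← C_mul, this]
    simp only [C_mul]
    ring


/-! ### Spherical harmonics as functions on `ℂ² ∖ {0}` -/

/-- The quaternionic matrix with first row `z`. -/
def rowMat (z : ℂ × ℂ) : Matrix (Fin 2) (Fin 2) ℂ := !![z.1, z.2; -conj z.2, conj z.1]

lemma isQuaternionic_rowMat (z : ℂ × ℂ) : IsQuaternionic (rowMat z) := by
  simp [IsQuaternionic, rowMat]

/-- The right action of matrices on row vectors. -/
def act (a : Matrix (Fin 2) (Fin 2) ℂ) : ℂ × ℂ →ₗ[ℂ] ℂ × ℂ where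
  toFun z := (z.1 * a 0 0 + z.2 * a 1 0, z.1 * a 0 1 + z.2 * a 1 1)
  map_add' z w := by ext <;> simp <;> ring
  map_smul' c z := by ext <;> simp <;> ring

lemma act_apply (a : Matrix (Fin 2) (Fin 2) ℂ) (z : ℂ × ℂ) :
    act a z = (z.1 * a 0 0 + z.2 * a 1 0, z.1 * a 0 1 + z.2 * a 1 1) := rfl

lemma act_mul (a b : Matrix (Fin 2) (Fin 2) ℂ) (z : ℂ × ℂ) : act (a * b) z = act b (act a z) := by
  simp only [act_apply, Matrix.mul_apply, Fin.sum_univ_two]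
  ext <;> simp <;> ring

lemma act_one (z : ℂ × ℂ) : act 1 z = z := by
  simp [act_apply]

lemma act_inv_act (g : SL2C) (z : ℂ × ℂ) : act (g⁻¹ : SL2C) (act (g : SL2C) z) = z := by
  rw [← act_mul, ← Matrix.SpecialLinearGroup.coe_mul, mul_inv_cancel,
    Matrix.SpecialLinearGroup.coe_one, act_one]

lemma act_act_inv (g : SL2C) (z : ℂ × ℂ) : act (g : SL2C) (act (g⁻¹ : SL2C) z) = z := by
  rw [← act_mul, ← Matrix.SpecialLinearGroup.coe_mul, inv_mul_cancel,
    Matrix.SpecialLinearGroup.coe_one, act_one]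

lemma act_ne_zero (g : SL2C) {z : ℂ × ℂ} (hz : z ≠ 0) : act (g : SL2C) z ≠ 0 := by
  intro h
  apply hz
  rw [← act_inv_act g z, h, map_zero]

lemma continuous_act (a : Matrix (Fin 2) (Fin 2) ℂ) : Continuous (act a) := by
  change Continuous fun z : ℂ × ℂ => act a z
  simp only [act_apply]
  fun_prop

/-- The squared Euclidean norm on `ℂ²`. -/
def nsq (z : ℂ × ℂ) : ℝ := Complex.normSq z.1 + Complex.normSq z.2

lemma nsq_nonneg (z : ℂ × ℂ) : 0 ≤ nsq z := add_nonneg (Complex.normSq_nonneg _) (Complex.normSq_nonneg _)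

lemma nsq_pos {z : ℂ × ℂ} (hz : z ≠ 0) : 0 < nsq z := by
  rcases (nsq_nonneg z).lt_or_eq with h | h
  · exact h
  · exfalso
    apply hz
    have h1 := Complex.normSq_nonneg z.1
    have h2 := Complex.normSq_nonneg z.2
    rw [nsq] at h
    ext1
    · exact Complex.normSq_eq_zero.1 (by linarith)
    · exact Complex.normSq_eq_zero.1 (by linarith)

lemma continuous_nsq : Continuous nsq := by unfold nsq; fun_prop

lemma rowMat_mul_conjTranspose (z : ℂ × ℂ) :
    rowMat z * (rowMat z).conjTranspose = !![(nsq z : ℂ), 0; 0, (nsq z : ℂ)] := by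
  have h : (nsq z : ℂ) = z.1 * conj z.1 + z.2 * conj z.2 := by
    rw [Complex.mul_conj, Complex.mul_conj, nsq]; push_cast; rfl
  rw [h, rowMat]
  ext i j
  fin_cases i <;> fin_cases j <;>
    simp [Matrix.mul_apply, Fin.sum_univ_two, Matrix.conjTranspose_apply] <;> ring

lemma mem_SU2_iff (a : SL2C) : a ∈ SU2 ↔ (a⁻¹ : SL2C) = (a : Matrix (Fin 2) (Fin 2) ℂ).conjTranspose := by
  rw [SU2, Set.mem_ofPred_eq, Matrix.mem_unitaryGroup_iff, Matrix.star_eq_conjTranspose]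
  have h1 : (a : Matrix (Fin 2) (Fin 2) ℂ) * (a⁻¹ : SL2C) = 1 := by
    rw [← Matrix.SpecialLinearGroup.coe_mul, mul_inv_cancel, Matrix.SpecialLinearGroup.coe_one]
  have h2 : ((a⁻¹ : SL2C) : Matrix (Fin 2) (Fin 2) ℂ) * a = 1 := by
    rw [← Matrix.SpecialLinearGroup.coe_mul, inv_mul_cancel, Matrix.SpecialLinearGroup.coe_one]
  constructor
  · intro h
    calc ((a⁻¹ : SL2C) : Matrix (Fin 2) (Fin 2) ℂ)
        = (a⁻¹ : SL2C) * (a * (a : Matrix (Fin 2) (Fin 2) ℂ).conjTranspose) := by rw [h, mul_one]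
      _ = _ := by rw [← mul_assoc, h2, one_mul]
  · intro h
    rw [← h, h1]

lemma one_mem_SU2 : (1 : SL2C) ∈ SU2 := by
  rw [SU2, Set.mem_ofPred_eq, Matrix.SpecialLinearGroup.coe_one]; exact one_mem _

lemma mul_mem_SU2 {a b : SL2C} (ha : a ∈ SU2) (hb : b ∈ SU2) : a * b ∈ SU2 := by
  rw [SU2, Set.mem_ofPred_eq, Matrix.SpecialLinearGroup.coe_mul]; exact mul_mem ha hb

lemma inv_mem_SU2 {a : SL2C} (ha : a ∈ SU2) : a⁻¹ ∈ SU2 := by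
  have h := (mem_SU2_iff a).1 ha
  rw [mem_SU2_iff, inv_inv, h, Matrix.conjTranspose_conjTranspose]

lemma isQuaternionic_of_mem_SU2 {a : SL2C} (ha : a ∈ SU2) :
    IsQuaternionic (a : Matrix (Fin 2) (Fin 2) ℂ) := by
  have h := (mem_SU2_iff a).1 ha
  rw [Matrix.SpecialLinearGroup.coe_inv, Matrix.adjugate_fin_two] at h
  have h1 := congrFun (congrFun h 1) 0
  have h2 := congrFun (congrFun h 0) 0
  simp [Matrix.conjTranspose_apply] at h1 h2
  exact ⟨by linear_combination -h1, h2⟩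

lemma rowMat_act {a : Matrix (Fin 2) (Fin 2) ℂ} (ha : IsQuaternionic a) (z : ℂ × ℂ) :
    rowMat (act a z) = rowMat z * a := by
  obtain ⟨h1, h2⟩ := ha
  ext i j
  fin_cases i <;> fin_cases j <;>
    simp [rowMat, act_apply, Matrix.mul_apply, Fin.sum_univ_two, h1, h2] <;> ring

lemma nsq_act {a : SL2C} (ha : a ∈ SU2) (z : ℂ × ℂ) : nsq (act (a : SL2C) z) = nsq z := by
  have h1 := rowMat_mul_conjTranspose (act (a : SL2C) z)
  have h3 : (a : Matrix (Fin 2) (Fin 2) ℂ) * (a : Matrix (Fin 2) (Fin 2) ℂ).conjTranspose = 1 := by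
    have := Matrix.mem_unitaryGroup_iff.1 (show (a : Matrix (Fin 2) (Fin 2) ℂ) ∈ _ from ha)
    rwa [Matrix.star_eq_conjTranspose] at this
  rw [rowMat_act (isQuaternionic_of_mem_SU2 ha), Matrix.conjTranspose_mul, mul_assoc,
    ← mul_assoc (a : Matrix (Fin 2) (Fin 2) ℂ), h3, one_mul, rowMat_mul_conjTranspose] at h1
  have h2 := congrFun (congrFun h1 0) 0
  simp only [Matrix.of_apply, Matrix.cons_val', Matrix.cons_val_zero, 
    Matrix.cons_val_fin_one] at h2
  exact_mod_cast h2.symm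

/-- The spherical harmonic of degree `l` and order `m`, normalized to `∑_m |·|² = 1`, as a function
on `ℂ² ∖ {0}`: the matrix element `T^l_{0m}` of the element of `SU(2)` with first row
proportional to `z`. -/
def sph (l : ℕ) (m : ℤ) (z : ℂ × ℂ) : ℂ := wignerT l 0 m (rowMat z) / (nsq z : ℂ) ^ l

lemma abs_zero_le (l : ℕ) : |(0 : ℤ)| ≤ (l : ℤ) := by simp

lemma sph_act (l : ℕ) (m : ℤ) (hm : |m| ≤ l) {a : SL2C} (ha : a ∈ SU2) (z : ℂ × ℂ) :
    sph l m (act (a : SL2C) z) = ∑ μ ∈ Finset.Icc (-(l : ℤ)) l, sph l μ z * wignerT l μ m a := by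
  simp only [sph]
  rw [nsq_act ha, rowMat_act (isQuaternionic_of_mem_SU2 ha), wignerT_mul l 0 m (abs_zero_le l) hm,
    Finset.sum_div]
  exact Finset.sum_congr rfl fun μ _ => by ring

lemma sum_norm_sph_sq (l : ℕ) {z : ℂ × ℂ} (hz : z ≠ 0) :
    ∑ μ ∈ Finset.Icc (-(l : ℤ)) l, ‖sph l μ z‖ ^ 2 = 1 := by
  have h1 := wignerT_mul l 0 0 (abs_zero_le l) (abs_zero_le l) (rowMat z) (rowMat z).conjTranspose
  rw [rowMat_mul_conjTranspose, wignerT_diag l 0 0 (abs_zero_le l) (abs_zero_le l), if_pos rfl] at h1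
  have hN : (nsq z : ℂ) ≠ 0 := by exact_mod_cast (nsq_pos hz).ne'
  have h2 : (∑ μ ∈ Finset.Icc (-(l : ℤ)) l, ((‖sph l μ z‖ ^ 2 : ℝ) : ℂ)) = 1 := by
    have : ∀ μ ∈ Finset.Icc (-(l : ℤ)) l, ((‖sph l μ z‖ ^ 2 : ℝ) : ℂ) =
        wignerT l 0 μ (rowMat z) * wignerT l μ 0 (rowMat z).conjTranspose / (nsq z : ℂ) ^ (2 * l) := by
      intro μ hμ
      rw [← conj_wignerT l 0 μ (abs_zero_le l) ((mem_Icc_iff_abs_le l μ).1 hμ),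
        ← Complex.normSq_eq_norm_sq, ← Complex.mul_conj, sph, map_div₀, map_pow,
        Complex.conj_ofReal]
      field_simp
      ring
    rw [Finset.sum_congr rfl this, ← Finset.sum_div, ← h1]
    simp only [sub_zero, add_zero, Int.toNat_natCast]
    rw [← pow_add, ← two_mul]
    field_simp
  exact_mod_cast h2

lemma norm_sph_le (l : ℕ) (m : ℤ) (hm : |m| ≤ l) {z : ℂ × ℂ} (hz : z ≠ 0) : ‖sph l m z‖ ≤ 1 := by
  have h := sum_norm_sph_sq l hz
  have h1 := Finset.single_le_sum (f := fun μ => ‖sph l μ z‖ ^ 2) (fun _ _ => sq_nonneg _)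
    ((mem_Icc_iff_abs_le l m).2 hm)
  rw [h] at h1
  have h0 := norm_nonneg (sph l m z)
  nlinarith

lemma sph_neg (l : ℕ) (m : ℤ) (hm : |m| ≤ l) (z : ℂ × ℂ) :
    sph l (-m) z = (-1) ^ m.natAbs * conj (sph l m z) := by
  have h := conj_wignerT_eq_neg l 0 m (abs_zero_le l) hm (rowMat z) (isQuaternionic_rowMat z)
  rw [zero_add, neg_zero] at h
  rw [sph, sph, map_div₀, map_pow, Complex.conj_ofReal, h, ← mul_div_assoc, ← mul_assoc, ← mul_pow]
  simp

/-- The height `(|z₀|² - |z₁|²) / |z|²` of a point of the sphere. -/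
def height (z : ℂ × ℂ) : ℝ := (Complex.normSq z.1 - Complex.normSq z.2) / nsq z

/-- The horizontal coordinate `2 z̄₀ z₁ / |z|²` of a point of the sphere. -/
def horiz (z : ℂ × ℂ) : ℂ := 2 * conj z.1 * z.2 / (nsq z : ℂ)

lemma height_mem {z : ℂ × ℂ} (hz : z ≠ 0) : height z ∈ Set.Icc (-1 : ℝ) 1 := by
  have h := nsq_pos hz
  have h1 := Complex.normSq_nonneg z.1
  have h2 := Complex.normSq_nonneg z.2
  rw [height, Set.mem_Icc, le_div_iff₀ h, div_le_one h, nsq]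
  constructor <;> linarith

lemma normSq_horiz {z : ℂ × ℂ} (hz : z ≠ 0) : Complex.normSq (horiz z) = 1 - height z ^ 2 := by
  have h := (nsq_pos hz).ne'
  rw [horiz, height, map_div₀, map_mul, map_mul, Complex.normSq_conj, Complex.normSq_ofReal]
  have h2 : Complex.normSq 2 = 4 := by rw [Complex.normSq_ofNat]; norm_num
  rw [h2]
  field_simp
  rw [nsq]; ring

/-- The spherical harmonics in terms of the Legendre polynomials. -/
lemma sph_eq (l m : ℕ) (hm : m ≤ l) {z : ℂ × ℂ} (hz : z ≠ 0) :
    sph l m z = (-1) ^ m * ((Real.sqrt ((l - m)! / (l + m)!) : ℝ) : ℂ) * horiz z ^ m *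
      (((legQ l m).eval (height z) : ℝ) : ℂ) := by
  have hN := (nsq_pos hz).ne'
  have hNc : (nsq z : ℂ) ≠ 0 := by exact_mod_cast hN
  have hml : |(m : ℤ)| ≤ l := by rw [abs_le]; omega
  rw [sph, wignerT_eq l 0 m (abs_zero_le l) hml]
  have e1 : ((l : ℤ) - 0).toNat = l := by omega
  have e2 : ((l : ℤ) - m).toNat = l - m := by omega
  rw [e1, e2, substCoeff_eq_sum_min, show 2 * l - l = l by omega,
    show 2 * l - (l - m) = l + m by omega, show min l (l - m) = l - m by omega, legQ_leibniz l m hm]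
  have hs : Real.sqrt ((l ! : ℝ) * l ! / ((l - m)! * (l + m)!)) =
      l ! / (l - m)! * Real.sqrt ((l - m)! / (l + m)!) := by
    rw [← Real.sqrt_sq (show (0 : ℝ) ≤ l ! / (l - m)! by positivity), ← Real.sqrt_mul (by positivity)]
    congr 1
    field_simp
  have hsgn : (-1 : ℂ) ^ (l + (l - m)) = (-1) ^ m := by
    rw [show l + (l - m) = m + 2 * (l - m) by omega, pow_add, pow_mul]; simp
  rw [hs, hsgn]
  have hy1 : height z + 1 = 2 * Complex.normSq z.1 / nsq z := by
    rw [height, nsq] at *; field_simp; ring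
  have hy2 : height z - 1 = (-1) * (2 * Complex.normSq z.2) / nsq z := by
    rw [height, nsq] at *; field_simp; ring
  simp only [eval_mul, eval_C, eval_finsetSum, eval_pow, eval_add, eval_sub, eval_X, eval_one, hy1,
    hy2]
  push_cast
  rw [Finset.mul_sum, Finset.mul_sum, Finset.mul_sum, Finset.sum_div]
  refine Finset.sum_congr rfl fun r hr => ?_
  simp only [Finset.mem_range] at hr
  obtain ⟨p, rfl⟩ : ∃ p, l = m + (r + p) := ⟨l - m - r, by omega⟩
  rw [show m + (r + p) - m = r + p by omega, show r + p - r = p by omega,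
    show m + (r + p) - r = m + p by omega, show m + (r + p) + m - (m + p) = m + r by omega,
    ← Complex.mul_conj, ← Complex.mul_conj, horiz]
  simp only [rowMat, Matrix.of_apply, Matrix.cons_val', Matrix.cons_val_zero, Matrix.cons_val_one,
    Matrix.cons_val_fin_one]
  have hf : (((r + p)! : ℕ) : ℂ) ≠ 0 := by exact_mod_cast Nat.factorial_ne_zero _
  simp only [div_pow, mul_pow]
  field_simp
  ring

lemma act_g03 (s : ℝ) (z : ℂ × ℂ) :
    act (g03 s : SL2C) z = (z.1 * (Real.exp (s / 2) : ℝ), z.2 * (Real.exp (-(s / 2)) : ℝ)) := by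
  simp [act_apply, g03]

lemma nsq_g03 (s : ℝ) {z : ℂ × ℂ} (hz : z ≠ 0) :
    nsq (act (g03 s : SL2C) z) = nsq z * (Real.cosh s + height z * Real.sinh s) := by
  have hN := (nsq_pos hz).ne'
  rw [act_g03, height]
  simp only [nsq, map_mul, Complex.normSq_ofReal, ← Real.exp_add] at *
  rw [mul_add, ← mul_assoc, mul_div_cancel₀ _ hN, Real.cosh_eq, Real.sinh_eq,
    show s / 2 + s / 2 = s by ring, show -(s / 2) + -(s / 2) = -s by ring]
  ring

lemma cosh_add_mul_sinh_pos (s : ℝ) {y : ℝ} (hy : y ∈ Set.Icc (-1 : ℝ) 1) :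
    0 < Real.cosh s + y * Real.sinh s := by
  have e1 := Real.exp_pos s
  have e2 := Real.exp_pos (-s)
  rw [Real.cosh_eq, Real.sinh_eq]
  rcases hy.1.lt_or_eq with h | h
  · nlinarith [hy.2, mul_pos e1 (by linarith : 0 < 1 + y), mul_nonneg e2.le (by linarith [hy.2] : 0 ≤ 1 - y)]
  · rw [← h]; linarith

/-- The boost acts on the height by a fractional linear map. -/
def boostMap (s y : ℝ) : ℝ := (Real.sinh s + y * Real.cosh s) / (Real.cosh s + y * Real.sinh s)

lemma height_g03 (s : ℝ) {z : ℂ × ℂ} (hz : z ≠ 0) :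
    height (act (g03 s : SL2C) z) = boostMap s (height z) := by
  have hN := (nsq_pos hz).ne'
  have hD := (cosh_add_mul_sinh_pos s (height_mem hz)).ne'
  rw [height, nsq_g03 s hz, boostMap]
  rw [div_eq_div_iff (mul_ne_zero hN hD) hD, ← mul_assoc]
  congr 1
  rw [act_g03, height]
  simp only [nsq, map_mul, Complex.normSq_ofReal, ← Real.exp_add] at *
  rw [add_mul, div_mul_eq_mul_div, div_mul_cancel₀ _ hN, Real.cosh_eq, Real.sinh_eq,
    show s / 2 + s / 2 = s by ring, show -(s / 2) + -(s / 2) = -s by ring]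
  ring

lemma horiz_g03 (s : ℝ) {z : ℂ × ℂ} (hz : z ≠ 0) :
    horiz (act (g03 s : SL2C) z) = horiz z / ((Real.cosh s + height z * Real.sinh s : ℝ) : ℂ) := by
  have hN := (nsq_pos hz).ne'
  have hD := (cosh_add_mul_sinh_pos s (height_mem hz)).ne'
  rw [horiz, nsq_g03 s hz, act_g03, horiz, div_div, Complex.ofReal_mul]
  congr 1
  simp only [map_mul, Complex.conj_ofReal]
  have : ((Real.exp (s / 2) : ℝ) : ℂ) * ((Real.exp (-(s / 2)) : ℝ) : ℂ) = 1 := by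
    rw [← Complex.ofReal_mul, ← Real.exp_add]; simp
  linear_combination (2 * conj z.1 * z.2) * this


/-! ### The invariant measure -/

/-- The density `(1 + |z|²)⁻³` on `ℂ²`. It is invariant under `SU(2)` and changes by a bounded
factor only under `SL(2, ℂ)`. -/
def dens (z : ℂ × ℂ) : ℝ := ((1 + nsq z) ^ 3)⁻¹

lemma dens_pos (z : ℂ × ℂ) : 0 < dens z := by
  have := nsq_nonneg z
  unfold dens; positivity

lemma continuous_dens : Continuous dens := by
  have := continuous_nsq
  unfold dens
  refine Continuous.inv₀ (by fun_prop) fun z => ?_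
  have := nsq_nonneg z
  positivity

instance : (volume : Measure (ℂ × ℂ)).IsAddHaarMeasure :=
  Measure.prod.instIsAddHaarMeasure (volume : Measure ℂ) (volume : Measure ℂ)

lemma integrable_dens : Integrable dens := by
  have h : Integrable (fun z : ℂ × ℂ => ((1 : ℝ) + ‖z‖ ^ 2) ^ (-(6 : ℝ) / 2)) := by
    apply integrable_rpow_neg_one_add_norm_sq
    rw [Module.finrank_prod, Complex.finrank_real_complex]
    norm_num
  refine h.mono' continuous_dens.aestronglyMeasurable (Filter.Eventually.of_forall fun z => ?_)
  rw [Real.norm_of_nonneg (dens_pos z).le, show (-(6 : ℝ) / 2) = -((3 : ℕ) : ℝ) by norm_num,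
    Real.rpow_neg (by positivity), Real.rpow_natCast, dens]
  have : ‖z‖ ^ 2 ≤ nsq z := by
    rw [nsq, Complex.normSq_eq_norm_sq, Complex.normSq_eq_norm_sq, Prod.norm_def]
    rcases max_choice ‖z.1‖ ‖z.2‖ with h | h <;> rw [h] <;> nlinarith [sq_nonneg ‖z.1‖, sq_nonneg ‖z.2‖]
  have h0 := sq_nonneg ‖z‖
  gcongr

/-- The total mass of the density. -/
def densMass : ℝ := ∫ z, dens z

lemma densMass_pos : 0 < densMass := by
  rw [densMass, integral_pos_iff_support_of_nonneg (fun z => (dens_pos z).le) integrable_dens]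
  have : Function.support dens = Set.univ := by
    ext z; simp [(dens_pos z).ne']
  rw [this]
  simp

/-- A probability measure on `ℂ²` that is invariant under `SU(2)`; for functions that are
homogeneous of degree zero it is the normalized area on the sphere. -/
def sphMeasure : Measure (ℂ × ℂ) :=
  volume.withDensity fun z => ENNReal.ofReal (dens z / densMass)

lemma integral_sphMeasure {E : Type*} [NormedAddCommGroup E] [NormedSpace ℝ E] (f : ℂ × ℂ → E) :
    ∫ z, f z ∂sphMeasure = ∫ z, (dens z / densMass) • f z := by
  have hm : Measurable fun z => dens z / densMass := (continuous_dens.div_const _).measurable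
  rw [sphMeasure, integral_withDensity_eq_integral_toReal_smul hm.ennreal_ofReal
    (Filter.Eventually.of_forall fun z => ENNReal.ofReal_lt_top)]
  refine integral_congr_ae (Filter.Eventually.of_forall fun z => ?_)
  simp only
  rw [ENNReal.toReal_ofReal (div_nonneg (dens_pos z).le densMass_pos.le)]

instance : IsProbabilityMeasure sphMeasure := by
  constructor
  rw [sphMeasure, withDensity_apply _ MeasurableSet.univ, Measure.restrict_univ,
    ← ofReal_integral_eq_lintegral_ofReal (integrable_dens.div_const _)
      (Filter.Eventually.of_forall fun z => div_nonneg (dens_pos z).le densMass_pos.le),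
    integral_div, ← densMass, div_self densMass_pos.ne', ENNReal.ofReal_one]

lemma ae_ne_zero : ∀ᵐ z ∂sphMeasure, z ≠ 0 := by
  have h : ∀ᵐ z : ℂ × ℂ, z ≠ 0 := by
    rw [ae_iff]; simp
  exact (withDensity_absolutelyContinuous _ _).ae_le h

/-- The action of `SL(2, ℂ)` by measurable bijections. -/
def actEquiv (g : SL2C) : ℂ × ℂ ≃ᵐ ℂ × ℂ where
  toFun := act (g : SL2C)
  invFun := act (g⁻¹ : SL2C)
  left_inv := act_inv_act g
  right_inv := act_act_inv g
  measurable_toFun := (continuous_act _).measurable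
  measurable_invFun := (continuous_act _).measurable

lemma det_act (a : Matrix (Fin 2) (Fin 2) ℂ) : LinearMap.det (act a) = a.det := by
  rw [← LinearMap.det_toMatrix (Module.Basis.finTwoProd ℂ), Matrix.det_fin_two, Matrix.det_fin_two]
  simp [LinearMap.toMatrix_apply, act_apply]
  ring

lemma measurePreserving_act (g : SL2C) : MeasurePreserving (actEquiv g) volume volume := by
  refine ⟨(actEquiv g).measurable, ?_⟩
  have hdet : LinearMap.det ((act (g : SL2C)).restrictScalars ℝ) = 1 := by
    rw [LinearMap.det_restrictScalars, det_act, Matrix.SpecialLinearGroup.det_coe, map_one]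
  have h := Measure.map_linearMap_addHaar_eq_smul_addHaar (volume : Measure (ℂ × ℂ))
    (f := (act (g : SL2C)).restrictScalars ℝ) (by rw [hdet]; exact one_ne_zero)
  rw [hdet, inv_one, abs_one, ENNReal.ofReal_one, one_smul] at h
  exact h

lemma measurePreserving_act_SU2 {a : SL2C} (ha : a ∈ SU2) :
    MeasurePreserving (actEquiv a) sphMeasure sphMeasure := by
  refine ⟨(actEquiv a).measurable, ?_⟩
  ext s hs
  rw [Measure.map_apply (actEquiv a).measurable hs, sphMeasure, withDensity_apply _ hs,
    withDensity_apply _ ((actEquiv a).measurable hs)]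
  refine Eq.trans ?_ ((measurePreserving_act a).setLIntegral_comp_preimage_emb
    (actEquiv a).measurableEmbedding _ s)
  refine lintegral_congr fun z => ?_
  have : dens (actEquiv a z) = dens z := by
    rw [dens, dens, show actEquiv a z = act (a : SL2C) z from rfl, nsq_act ha]
  rw [this]

lemma integral_act_SU2 {E : Type*} [NormedAddCommGroup E] [NormedSpace ℝ E] {a : SL2C}
    (ha : a ∈ SU2) (f : ℂ × ℂ → E) :
    ∫ z, f (act (a : SL2C) z) ∂sphMeasure = ∫ z, f z ∂sphMeasure :=
  (measurePreserving_act_SU2 ha).integral_comp' (g := f)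

/-- The density of the image of the measure under `g`. -/
def jac (g : SL2C) (w : ℂ × ℂ) : ℝ := dens (act (g⁻¹ : SL2C) w) / dens w

lemma integral_act_mul (g : SL2C) (f h : ℂ × ℂ → ℂ) :
    ∫ z, h z * f (act (g : SL2C) z) ∂sphMeasure =
      ∫ w, (jac g w : ℂ) * h (act (g⁻¹ : SL2C) w) * f w ∂sphMeasure := by
  rw [integral_sphMeasure, integral_sphMeasure]
  refine Eq.trans ?_ ((measurePreserving_act g).integral_comp' _)
  refine integral_congr_ae (Filter.Eventually.of_forall fun z => ?_)
  have : actEquiv g z = act (g : SL2C) z := rfl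
  simp only [this, jac, act_inv_act, Complex.real_smul]
  have hd := (dens_pos (act (g : SL2C) z)).ne'
  have hd' : (dens (act (g : SL2C) z) : ℂ) ≠ 0 := by exact_mod_cast hd
  push_cast
  field_simp

lemma nsq_act_le (a : Matrix (Fin 2) (Fin 2) ℂ) : ∃ C : ℝ, 0 ≤ C ∧ ∀ z, nsq (act a z) ≤ C * nsq z := by
  have hcs : ∀ p q u v : ℂ, Complex.normSq (p * u + q * v) ≤
      (Complex.normSq u + Complex.normSq v) * (Complex.normSq p + Complex.normSq q) := by
    intro p q u v
    have : Complex.normSq (p * u + q * v) + Complex.normSq (p * conj v - q * conj u) =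
      (Complex.normSq u + Complex.normSq v) * (Complex.normSq p + Complex.normSq q) := by
      simp only [Complex.normSq_apply, Complex.add_re, Complex.add_im, Complex.mul_re,
        Complex.mul_im, Complex.sub_re, Complex.sub_im, Complex.conj_re, Complex.conj_im]
      ring
    linarith [Complex.normSq_nonneg (p * conj v - q * conj u)]
  refine ⟨(Complex.normSq (a 0 0) + Complex.normSq (a 1 0)) +
    (Complex.normSq (a 0 1) + Complex.normSq (a 1 1)), ?_, fun z => ?_⟩
  · have := fun i j => Complex.normSq_nonneg (a i j)
    linarith [this 0 0, this 0 1, this 1 0, this 1 1]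
  · rw [act_apply, nsq, add_mul]
    exact add_le_add (hcs _ _ _ _) (hcs _ _ _ _)

lemma jac_nonneg (g : SL2C) (w : ℂ × ℂ) : 0 ≤ jac g w :=
  div_nonneg (dens_pos _).le (dens_pos _).le

lemma jac_le (g : SL2C) : ∃ C : ℝ, ∀ w, jac g w ≤ C := by
  obtain ⟨C, hC0, hC⟩ := nsq_act_le (g : SL2C)
  refine ⟨(1 + C) ^ 3, fun w => ?_⟩
  have h := hC (act (g⁻¹ : SL2C) w)
  rw [act_act_inv] at h
  have h1 := nsq_nonneg w
  have h2 := nsq_nonneg (act (g⁻¹ : SL2C) w)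
  rw [jac, dens, dens, div_inv_eq_mul, inv_mul_eq_div, div_le_iff₀ (by positivity), ← mul_pow]
  apply pow_le_pow_left₀ (by positivity)
  nlinarith

lemma continuous_jac (g : SL2C) : Continuous (jac g) := by
  unfold jac
  exact (continuous_dens.comp (continuous_act _)).div continuous_dens fun w => (dens_pos w).ne'

/-! ### Orthogonality relations -/

lemma continuous_wignerT (l : ℕ) (m m' : ℤ) : Continuous (wignerT l m m') := by
  unfold wignerT
  fun_prop

lemma continuous_rowMat : Continuous rowMat := by
  unfold rowMat
  refine continuous_matrix fun i j => ?_
  fin_cases i <;> fin_cases j <;> simp <;> fun_prop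

lemma measurable_sph (l : ℕ) (m : ℤ) : Measurable (sph l m) := by
  unfold sph
  have h1 : Measurable fun z => wignerT l 0 m (rowMat z) :=
    ((continuous_wignerT l 0 m).comp continuous_rowMat).measurable
  have h2 : Measurable fun z => (nsq z : ℂ) ^ l :=
    ((Complex.continuous_ofReal.comp continuous_nsq).pow l).measurable
  exact h1.div h2

lemma integrable_sph_mul (l l' : ℕ) (m m' : ℤ) (hm : |m| ≤ l) (hm' : |m'| ≤ l') (g : SL2C) :
    Integrable (fun z => conj (sph l m z) * sph l' m' (act (g : SL2C) z)) sphMeasure := by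
  refine Integrable.of_bound (C := 1) ?_ ?_
  · refine Measurable.aestronglyMeasurable ?_
    exact (Complex.continuous_conj.measurable.comp (measurable_sph l m)).mul
      ((measurable_sph l' m').comp (continuous_act _).measurable)
  · filter_upwards [ae_ne_zero] with z hz
    rw [norm_mul, Complex.norm_conj]
    exact mul_le_one₀ (norm_sph_le l m hm hz) (norm_nonneg _)
      (norm_sph_le l' m' hm' (act_ne_zero g hz))

/-- The matrix elements of `f ↦ f ∘ g` between spherical harmonics. -/
def sphInt (l : ℕ) (m : ℤ) (l' : ℕ) (m' : ℤ) (g : SL2C) : ℂ :=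
  ∫ z, conj (sph l m z) * sph l' m' (act (g : SL2C) z) ∂sphMeasure

lemma sphInt_mul_right (l : ℕ) (m : ℤ) (l' : ℕ) (m' : ℤ) (hm : |m| ≤ l) (hm' : |m'| ≤ l')
    (g : SL2C) {a : SL2C} (ha : a ∈ SU2) :
    sphInt l m l' m' (g * a) =
      ∑ μ ∈ Finset.Icc (-(l' : ℤ)) l', sphInt l m l' μ g * wignerT l' μ m' a := by
  have h : ∀ z, conj (sph l m z) * sph l' m' (act ((g * a : SL2C) : Matrix (Fin 2) (Fin 2) ℂ) z) =
      ∑ μ ∈ Finset.Icc (-(l' : ℤ)) l',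
        conj (sph l m z) * sph l' μ (act (g : SL2C) z) * wignerT l' μ m' a := by
    intro z
    rw [Matrix.SpecialLinearGroup.coe_mul, act_mul, sph_act l' m' hm' ha, Finset.mul_sum]
    exact Finset.sum_congr rfl fun μ _ => by ring
  simp only [sphInt, h]
  rw [integral_finsetSum]
  · exact Finset.sum_congr rfl fun μ _ => integral_mul_const _ _
  · intro μ hμ
    exact (integrable_sph_mul l l' m μ hm ((mem_Icc_iff_abs_le l' μ).1 hμ) g).mul_const _

lemma sphInt_mul_left (l : ℕ) (m : ℤ) (l' : ℕ) (m' : ℤ) (hm : |m| ≤ l) (hm' : |m'| ≤ l')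
    (g : SL2C) {k : SL2C} (hk : k ∈ SU2) :
    sphInt l m l' m' (k * g) =
      ∑ μ ∈ Finset.Icc (-(l : ℤ)) l, wignerT l m μ k * sphInt l μ l' m' g := by
  have h0 := integral_act_SU2 hk
    (fun z => conj (sph l m (act (k⁻¹ : SL2C) z)) * sph l' m' (act (g : SL2C) z))
  have hkg : ∀ z, act ((k * g : SL2C) : Matrix (Fin 2) (Fin 2) ℂ) z =
      act (g : SL2C) (act (k : SL2C) z) := fun z => by
    rw [Matrix.SpecialLinearGroup.coe_mul, act_mul]
  simp only [act_inv_act] at h0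
  simp only [sphInt, hkg]
  rw [h0]
  have h : ∀ z, conj (sph l m (act (k⁻¹ : SL2C) z)) * sph l' m' (act (g : SL2C) z) =
      ∑ μ ∈ Finset.Icc (-(l : ℤ)) l,
        wignerT l m μ k * (conj (sph l μ z) * sph l' m' (act (g : SL2C) z)) := by
    intro z
    rw [sph_act l m hm (inv_mem_SU2 hk), map_sum, Finset.sum_mul]
    refine Finset.sum_congr rfl fun μ hμ => ?_
    rw [map_mul, conj_wignerT l μ m ((mem_Icc_iff_abs_le l μ).1 hμ) hm, (mem_SU2_iff k).1 hk,
      Matrix.conjTranspose_conjTranspose]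
    ring
  simp only [h]
  rw [integral_finsetSum]
  · exact Finset.sum_congr rfl fun μ _ => integral_const_mul _ _
  · intro μ hμ
    exact (integrable_sph_mul l l' μ m' ((mem_Icc_iff_abs_le l μ).1 hμ) hm' g).const_mul _

lemma g12_mem_SU2 (θ : ℝ) : g12 θ ∈ SU2 := by
  rw [mem_SU2_iff, Matrix.SpecialLinearGroup.coe_inv, Matrix.adjugate_fin_two]
  ext i j
  fin_cases i <;> fin_cases j <;>
    simp [g12, Matrix.conjTranspose_apply, ← Complex.exp_conj, map_ofNat]

lemma g13_mem_SU2 (θ : ℝ) : g13 θ ∈ SU2 := by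
  rw [mem_SU2_iff, Matrix.SpecialLinearGroup.coe_inv, Matrix.adjugate_fin_two]
  ext i j
  fin_cases i <;> fin_cases j <;> simp [g13, Matrix.conjTranspose_apply,
    -Complex.ofReal_sin, -Complex.ofReal_cos]

lemma wignerT_g12 (l : ℕ) (m m' : ℤ) (hm : |m| ≤ l) (hm' : |m'| ≤ l) (θ : ℝ) :
    wignerT l m m' (g12 θ : SL2C) = if m = m' then Complex.exp (-(m * θ * Complex.I)) else 0 := by
  change wignerT l m m' !![_, 0; 0, _] = _
  rw [wignerT_diag l m m' hm hm']
  congr 1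
  rw [← Complex.exp_nat_mul, ← Complex.exp_nat_mul, ← Complex.exp_add]
  congr 1
  rw [abs_le] at hm
  have e1 : ((((l : ℤ) - m).toNat : ℕ) : ℂ) = l - m := by
    exact_mod_cast congrArg (Int.cast (R := ℂ)) (Int.toNat_of_nonneg (show 0 ≤ (l : ℤ) - m by omega))
  have e2 : ((((l : ℤ) + m).toNat : ℕ) : ℂ) = l + m := by
    exact_mod_cast congrArg (Int.cast (R := ℂ)) (Int.toNat_of_nonneg (show 0 ≤ (l : ℤ) + m by omega))
  rw [e1, e2]
  push_cast
  ring


/-- A boost (or `g = 1`) commutes with the rotations about the axis, so that its matrix elements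
between different orders vanish. -/
lemma sphInt_g03_of_ne (l : ℕ) (m : ℤ) (l' : ℕ) (m' : ℤ) (hm : |m| ≤ l) (hm' : |m'| ≤ l')
    (s : ℝ) (h : m ≠ m') : sphInt l m l' m' (g03 s) = 0 := by
  set θ : ℝ := Real.pi / (m - m') with hθ
  have hmm : (m : ℝ) - m' ≠ 0 := sub_ne_zero.2 (by exact_mod_cast h)
  have hcomm : g12 θ * g03 s = g03 s * g12 θ := by
    ext i j
    rw [Matrix.SpecialLinearGroup.coe_mul, Matrix.SpecialLinearGroup.coe_mul]
    fin_cases i <;> fin_cases j <;> simp [g12, g03, Matrix.mul_apply, Fin.sum_univ_two, mul_comm]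
  have h1 := sphInt_mul_left l m l' m' hm hm' (g03 s) (g12_mem_SU2 θ)
  have h2 := sphInt_mul_right l m l' m' hm hm' (g03 s) (g12_mem_SU2 θ)
  rw [hcomm, h2, Finset.sum_eq_single_of_mem m' ((mem_Icc_iff_abs_le _ _).2 hm'),
    Finset.sum_eq_single_of_mem m ((mem_Icc_iff_abs_le _ _).2 hm), wignerT_g12 _ _ _ hm hm,
    wignerT_g12 _ _ _ hm' hm', if_pos rfl, if_pos rfl] at h1
  · have hexp : Complex.exp (-(m * θ * Complex.I)) = -Complex.exp (-(m' * θ * Complex.I)) := by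
      have : (-(m * θ * Complex.I) : ℂ) = -(m' * θ * Complex.I) + -(Real.pi * Complex.I) := by
        have h3 : ((m : ℂ) - m') * θ = Real.pi := by
          rw [hθ]; push_cast
          have : (m : ℂ) - m' ≠ 0 := by exact_mod_cast hmm
          field_simp
        linear_combination (-Complex.I) * h3
      rw [this, Complex.exp_add, Complex.exp_neg (Real.pi * Complex.I), Complex.exp_pi_mul_I]
      norm_num
    rw [hexp] at h1
    have h3 : Complex.exp (-(m' * θ * Complex.I)) * sphInt l m l' m' (g03 s) = 0 := by
      linear_combination (1 / 2 : ℂ) * h1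
    exact (mul_eq_zero.1 h3).resolve_left (Complex.exp_ne_zero _)
  · intro μ hμ hne
    rw [wignerT_g12 _ _ _ hm ((mem_Icc_iff_abs_le _ _).1 hμ), if_neg (Ne.symm hne), zero_mul]
  · intro μ hμ hne
    rw [wignerT_g12 _ _ _ ((mem_Icc_iff_abs_le _ _).1 hμ) hm', if_neg hne, mul_zero]

lemma g03_zero : g03 0 = 1 := by
  ext i j
  fin_cases i <;> fin_cases j <;> simp [g03]

/-- Every matrix element of the last column of `T^l` is nonzero at the rotation by `π/2`. -/
lemma wignerT_g13_ne_zero (l : ℕ) (m : ℤ) (hm : |m| ≤ l) :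
    wignerT l m l (g13 (Real.pi / 2) : SL2C) ≠ 0 := by
  have hl : |(l : ℤ)| ≤ l := by simp
  rw [wignerT_eq l m l hm hl, substCoeff_eq_sum_min]
  have e : ((l : ℤ) - l).toNat = 0 := by omega
  rw [e, Nat.min_zero]
  have hi : ((l : ℤ) - m).toNat ≤ 2 * l := by rw [abs_le] at hm; omega
  have hs : Real.sin (Real.pi / 2 / 2) ≠ 0 := by
    rw [div_div, show (2 : ℝ) * 2 = 4 by norm_num, Real.sin_pi_div_four]; positivity
  have hc : Real.cos (Real.pi / 2 / 2) ≠ 0 := by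
    rw [div_div, show (2 : ℝ) * 2 = 4 by norm_num, Real.cos_pi_div_four]; positivity
  refine mul_ne_zero (mul_ne_zero (pow_ne_zero _ (by norm_num)) ?_) ?_
  · exact_mod_cast (Real.sqrt_pos.2 (by positivity)).ne'
  · simp only [zero_add, Finset.sum_range_one, Nat.sub_zero, Nat.choose_self, pow_zero]
    have h01 : (g13 (Real.pi / 2) : Matrix (Fin 2) (Fin 2) ℂ) 0 1 =
      ((Real.sin (Real.pi / 2 / 2) : ℝ) : ℂ) := rfl
    have h11 : (g13 (Real.pi / 2) : Matrix (Fin 2) (Fin 2) ℂ) 1 1 =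
      ((Real.cos (Real.pi / 2 / 2) : ℝ) : ℂ) := rfl
    rw [h01, h11]
    have : ((2 * l).choose ((l : ℤ) - m).toNat : ℂ) ≠ 0 := by
      exact_mod_cast (Nat.choose_pos hi).ne'
    have h1 : ((Real.sin (Real.pi / 2 / 2) : ℝ) : ℂ) ≠ 0 := by exact_mod_cast hs
    have h2 : ((Real.cos (Real.pi / 2 / 2) : ℝ) : ℂ) ≠ 0 := by exact_mod_cast hc
    simp only [mul_one, Nat.cast_one, one_mul]
    positivity

/-- The Gram matrix of the spherical harmonics of degrees `l` and `l'` intertwines `T^l` and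
`T^{l'}`. -/
lemma sphInt_one_intertwine (l : ℕ) (ν : ℤ) (l' : ℕ) (m' : ℤ) (hν : |ν| ≤ l) (hm' : |m'| ≤ l')
    {a : SL2C} (ha : a ∈ SU2) :
    ∑ μ ∈ Finset.Icc (-(l : ℤ)) l, wignerT l ν μ a * sphInt l μ l' m' 1 =
      ∑ μ ∈ Finset.Icc (-(l' : ℤ)) l', sphInt l ν l' μ 1 * wignerT l' μ m' a := by
  rw [← sphInt_mul_left l ν l' m' hν hm' 1 ha, ← sphInt_mul_right l ν l' m' hν hm' 1 ha, mul_one,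
    one_mul]

lemma conj_sphInt_one (l : ℕ) (m : ℤ) (l' : ℕ) (m' : ℤ) :
    conj (sphInt l m l' m' 1) = sphInt l' m' l m 1 := by
  rw [sphInt, sphInt, ← integral_conj]
  refine integral_congr_ae (Filter.Eventually.of_forall fun z => ?_)
  simp only [Matrix.SpecialLinearGroup.coe_one, act_one, map_mul, Complex.conj_conj]
  ring

/-- Spherical harmonics of different degree are orthogonal: the Gram matrix is diagonal in the order
and intertwines `T^l` and `T^{l'}`. In the column of the highest order `l' > l` one side of the
intertwining relation is zero and the other has a single term with a nonvanishing matrix element. -/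
lemma sphInt_one_of_lt {l l' : ℕ} (h : l < l') (m m' : ℤ) (hm : |m| ≤ l) (hm' : |m'| ≤ l') :
    sphInt l m l' m' 1 = 0 := by
  by_cases hmm : m = m'
  swap
  · rw [← g03_zero]; exact sphInt_g03_of_ne l m l' m' hm hm' 0 hmm
  subst hmm
  have hl' : |(l' : ℤ)| ≤ l' := by simp
  have h1 := sphInt_one_intertwine l m l' l' hm hl' (g13_mem_SU2 (Real.pi / 2))
  rw [Finset.sum_eq_zero, Finset.sum_eq_single_of_mem m ((mem_Icc_iff_abs_le _ _).2 hm')] at h1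
  · exact (mul_eq_zero.1 h1.symm).resolve_right (wignerT_g13_ne_zero l' m hm')
  · intro μ hμ hne
    rw [← g03_zero, sphInt_g03_of_ne l m l' μ hm ((mem_Icc_iff_abs_le _ _).1 hμ) 0 (Ne.symm hne),
      zero_mul]
  · intro μ hμ
    rw [← g03_zero, sphInt_g03_of_ne l μ l' l' ((mem_Icc_iff_abs_le _ _).1 hμ) hl' 0, mul_zero]
    simp only [Finset.mem_Icc] at hμ
    omega

/-- The norm does not depend on the order by the intertwining relation in the column of the highest
order, and the squares of the spherical harmonics of one degree add up to one. -/
lemma sphInt_one_self (l : ℕ) (m : ℤ) (hm : |m| ≤ l) :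
    sphInt l m l m 1 = 1 / (2 * l + 1) := by
  have hl : |(l : ℤ)| ≤ l := by simp
  have hconst : ∀ ν : ℤ, |ν| ≤ l → sphInt l ν l ν 1 = sphInt l l l l 1 := by
    intro ν hν
    have h1 := sphInt_one_intertwine l ν l l hν hl (g13_mem_SU2 (Real.pi / 2))
    rw [Finset.sum_eq_single_of_mem (l : ℤ) ((mem_Icc_iff_abs_le _ _).2 hl),
      Finset.sum_eq_single_of_mem ν ((mem_Icc_iff_abs_le _ _).2 hν)] at h1
    · have := wignerT_g13_ne_zero l ν hν
      apply mul_left_cancel₀ this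
      linear_combination -h1
    · intro μ hμ hne
      rw [← g03_zero, sphInt_g03_of_ne l ν l μ hν ((mem_Icc_iff_abs_le _ _).1 hμ) 0 (Ne.symm hne),
        zero_mul]
    · intro μ hμ hne
      rw [← g03_zero, sphInt_g03_of_ne l μ l l ((mem_Icc_iff_abs_le _ _).1 hμ) hl 0 hne, mul_zero]
  have hsum : ∑ ν ∈ Finset.Icc (-(l : ℤ)) l, sphInt l ν l ν 1 = 1 := by
    simp only [sphInt]
    rw [← integral_finsetSum]
    · have : ∀ᵐ z ∂sphMeasure, ∑ ν ∈ Finset.Icc (-(l : ℤ)) l, conj (sph l ν z) *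
          sph l ν (act ((1 : SL2C) : Matrix (Fin 2) (Fin 2) ℂ) z) = 1 := by
        filter_upwards [ae_ne_zero] with z hz
        have h := congrArg (Complex.ofReal) (sum_norm_sph_sq l hz)
        push_cast at h
        refine Eq.trans ?_ h
        refine Finset.sum_congr rfl fun ν _ => ?_
        rw [Matrix.SpecialLinearGroup.coe_one, act_one, Complex.conj_mul']
      rw [integral_congr_ae this]
      simp
    · intro ν hν
      have := (mem_Icc_iff_abs_le _ _).1 hν
      exact integrable_sph_mul l l ν ν this this 1
  rw [Finset.sum_congr rfl fun ν hν => hconst ν ((mem_Icc_iff_abs_le _ _).1 hν), Finset.sum_const,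
    Int.card_Icc, nsmul_eq_mul] at hsum
  have e : ((((l : ℤ) + 1 - -l).toNat : ℕ) : ℂ) = 2 * l + 1 := by
    rw [show ((l : ℤ) + 1 - -l).toNat = 2 * l + 1 by omega]; push_cast; ring
  rw [e] at hsum
  have h0 : (2 * (l : ℂ) + 1) ≠ 0 := by exact_mod_cast Nat.succ_ne_zero (2 * l)
  rw [hconst m hm, eq_div_iff h0]
  linear_combination hsum

lemma sphInt_one (l : ℕ) (m : ℤ) (l' : ℕ) (m' : ℤ) (hm : |m| ≤ l) (hm' : |m'| ≤ l') :
    sphInt l m l' m' 1 = if l = l' ∧ m = m' then (1 / (2 * l + 1) : ℂ) else 0 := by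
  rcases lt_trichotomy l l' with h | h | h
  · rw [sphInt_one_of_lt h m m' hm hm', if_neg (by omega)]
  · subst h
    by_cases hmm : m = m'
    · subst hmm; rw [sphInt_one_self l m hm]; simp
    · rw [if_neg (by tauto), ← g03_zero]; exact sphInt_g03_of_ne l m l m' hm hm' 0 hmm
  · rw [← conj_sphInt_one, sphInt_one_of_lt h m' m hm' hm, if_neg (by omega), map_zero]

/-! ### The distribution of the height -/

/-- A subspace of the polynomials that contains one of every degree is everything. -/
lemma mem_of_degree_family {S : Submodule ℝ ℝ[X]} (q : ℕ → ℝ[X]) (hq : ∀ k, q k ∈ S)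
    (hd : ∀ k, (q k).natDegree ≤ k) (hc : ∀ k, (q k).coeff k ≠ 0) (p : ℝ[X]) : p ∈ S := by
  suffices h : ∀ n : ℕ, ∀ p : ℝ[X], p.natDegree < n → p ∈ S from h _ p (Nat.lt_succ_self _)
  intro n
  induction n with
  | zero => intro p hp; omega
  | succ n ih =>
    intro p hp
    set c := p.coeff n / (q n).coeff n with hcdef
    have h1 : p - c • q n ∈ S := by
      rcases Nat.eq_zero_or_pos n with hn | hn
      · have : p - c • q n = 0 := by
          have hp0 := eq_C_of_natDegree_le_zero (show p.natDegree ≤ 0 by omega)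
          have hq0 := eq_C_of_natDegree_le_zero (show (q n).natDegree ≤ 0 by have := hd n; omega)
          subst hn
          rw [hp0, hq0, smul_C, ← C_sub, hcdef]
          simp only [smul_eq_mul]
          rw [div_mul_cancel₀ _ (hc 0)]
          simp
        rw [this]; exact S.zero_mem
      · apply ih
        have hle : (p - c • q n).natDegree ≤ n :=
          (natDegree_sub_le _ _).trans (max_le (by omega) ((natDegree_smul_le _ _).trans (hd n)))
        rcases hle.lt_or_eq with h | h
        · exact h
        · exfalso
          have : (p - c • q n).coeff n = 0 := by
            rw [coeff_sub, coeff_smul, smul_eq_mul, hcdef, div_mul_cancel₀ _ (hc n), sub_self]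
          have h3 : (p - c • q n).leadingCoeff = 0 := by rw [leadingCoeff, h, this]
          rw [leadingCoeff_eq_zero] at h3
          rw [h3, natDegree_zero] at h
          omega
    have := S.add_mem h1 (S.smul_mem c (hq n))
    simpa using this

lemma measurable_height : Measurable height := by
  unfold height nsq
  fun_prop

lemma integrable_comp_height {f : ℝ → ℝ} (hf : ContinuousOn f (Set.Icc (-1) 1)) :
    Integrable (fun z => f (height z)) sphMeasure := by
  obtain ⟨C, hC⟩ := isCompact_Icc.exists_bound_of_continuousOn hf
  have hm : Measurable fun z => Set.indicator (Set.Icc (-1 : ℝ) 1) f (height z) := by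
    refine Measurable.comp (g := Set.indicator (Set.Icc (-1 : ℝ) 1) f) ?_ measurable_height
    rw [← Set.piecewise_eq_indicator]
    exact hf.measurable_piecewise continuousOn_const measurableSet_Icc
  have hae : (fun z => Set.indicator (Set.Icc (-1 : ℝ) 1) f (height z)) =ᵐ[sphMeasure]
      fun z => f (height z) := by
    filter_upwards [ae_ne_zero] with z hz
    rw [Set.indicator_of_mem (height_mem hz)]
  refine Integrable.of_bound (C := C) (hm.aestronglyMeasurable.congr hae) ?_
  filter_upwards [ae_ne_zero] with z hz
  exact hC _ (height_mem hz)

lemma integral_legPoly_succ (l : ℕ) : ∫ y in (-1 : ℝ)..1, (legPoly (l + 1)).eval y = 0 := by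
  have h := legQ_ode (l + 1) 0
  have hd : ∀ y ∈ Set.uIcc (-1 : ℝ) 1, HasDerivAt
      (fun y => ((X ^ 2 - 1) * legQ (l + 1) 1 : ℝ[X]).eval y)
      ((((l : ℝ) + 1) * (l + 2)) * (legPoly (l + 1)).eval y) y := by
    intro y _
    convert! ((X ^ 2 - 1) * legQ (l + 1) 1 : ℝ[X]).hasDerivAt y using 1
    rw [derivative_mul, derivative_legQ]
    have h' := congrArg (eval y) h
    have e : legQ (l + 1) 0 = legPoly (l + 1) := rfl
    rw [e] at h'
    simp at h' ⊢
    linear_combination -h'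
  have h2 := intervalIntegral.integral_eq_sub_of_hasDerivAt hd
    (by apply Continuous.intervalIntegrable; fun_prop)
  rw [intervalIntegral.integral_const_mul] at h2
  simp at h2
  rcases h2 with h2 | h2
  · exfalso
    have : ((l : ℝ) + 1) * (l + 2) ≠ 0 := by positivity
    apply this
    rcases h2 with h2 | h2 <;> simp [h2]
  · exact h2

lemma sph_zero_order (l : ℕ) {z : ℂ × ℂ} (hz : z ≠ 0) :
    sph l 0 z = (((legPoly l).eval (height z) : ℝ) : ℂ) := by
  have := sph_eq l 0 (Nat.zero_le _) hz
  simp only [Nat.cast_zero, pow_zero, Nat.sub_zero, Nat.add_zero, one_mul, mul_one] at this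
  rw [this, div_self (by positivity)]
  simp [legQ]

lemma sph_zero_zero (z : ℂ × ℂ) : sph 0 0 z = 1 := by
  simp [sph, wignerT]

/-- Archimedes: the height is uniformly distributed on `[-1, 1]`. -/
lemma integral_comp_height {f : ℝ → ℝ} (hf : ContinuousOn f (Set.Icc (-1) 1)) :
    ∫ z, f (height z) ∂sphMeasure = (1 / 2) * ∫ y in (-1 : ℝ)..1, f y := by
  -- For Legendre polynomials both sides are known from orthogonality to the constants, hence they
  -- agree on all polynomials, and on continuous functions by the theorem of Weierstrass.
  have hpoly : ∀ p : ℝ[X], ∫ z, p.eval (height z) ∂sphMeasure =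
      (1 / 2) * ∫ y in (-1 : ℝ)..1, p.eval y := by
    let L : ℝ[X] →ₗ[ℝ] ℝ :=
      { toFun := fun p => ∫ z, p.eval (height z) ∂sphMeasure - (1 / 2) * ∫ y in (-1 : ℝ)..1, p.eval y
        map_add' := fun p q => by
          simp only [eval_add]
          rw [integral_add (integrable_comp_height p.continuous.continuousOn)
            (integrable_comp_height q.continuous.continuousOn),
            intervalIntegral.integral_add (p.continuous.intervalIntegrable _ _)
            (q.continuous.intervalIntegrable _ _)]
          ring
        map_smul' := fun c p => by
          simp only [eval_smul, smul_eq_mul, integral_const_mul,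
            intervalIntegral.integral_const_mul, RingHom.id_apply]
          ring }
    intro p
    have : p ∈ LinearMap.ker L := by
      refine mem_of_degree_family legPoly (fun l => ?_) natDegree_legPoly_le
        (fun l => coeff_legQ_ne_zero l 0 (Nat.zero_le _)) p
      rw [LinearMap.mem_ker]
      change ∫ z, (legPoly l).eval (height z) ∂sphMeasure - (1 / 2) * ∫ y in (-1 : ℝ)..1, (legPoly l).eval y = 0
      have h1 : ((∫ z, (legPoly l).eval (height z) ∂sphMeasure : ℝ) : ℂ) = sphInt 0 0 l 0 1 := by
        rw [← integral_complex_ofReal, sphInt]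
        refine integral_congr_ae ?_
        filter_upwards [ae_ne_zero] with z hz
        rw [Matrix.SpecialLinearGroup.coe_one, act_one, sph_zero_order l hz, sph_zero_zero]
        simp
      rw [sphInt_one 0 0 l 0 (by simp) (by simp)] at h1
      cases l with
      | zero =>
        have e : legPoly 0 = 1 := by simp [legPoly]
        simp only [e, eval_one] at h1 ⊢
        norm_num
      | succ l =>
        rw [if_neg (by omega)] at h1
        have h1' : ∫ z, (legPoly (l + 1)).eval (height z) ∂sphMeasure = 0 := by exact_mod_cast h1
        rw [h1', integral_legPoly_succ]
        simp
    exact sub_eq_zero.1 this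
  refine eq_of_forall_dist_le fun ε hε => ?_
  obtain ⟨p, hp⟩ := exists_polynomial_near_of_continuousOn (-1) 1 f hf (ε / 2) (by positivity)
  have h1 : ‖∫ z, (p.eval (height z) - f (height z)) ∂sphMeasure‖ ≤ ε / 2 := by
    refine (norm_integral_le_of_norm_le_const (C := ε / 2) ?_).trans (by simp)
    filter_upwards [ae_ne_zero] with z hz
    exact (hp _ (height_mem hz)).le
  have h2 : ‖∫ y in (-1 : ℝ)..1, (p.eval y - f y)‖ ≤ ε / 2 * |1 - (-1)| := by
    refine intervalIntegral.norm_integral_le_of_norm_le_const fun y hy => ?_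
    rw [Set.uIoc_of_le (by norm_num)] at hy
    exact (hp _ ⟨hy.1.le, hy.2⟩).le
  rw [integral_sub (integrable_comp_height p.continuous.continuousOn) (integrable_comp_height hf),
    hpoly] at h1
  rw [intervalIntegral.integral_sub (p.continuous.intervalIntegrable _ _)
    (hf.intervalIntegrable_of_Icc (by norm_num))] at h2
  rw [Real.dist_eq]
  rw [Real.norm_eq_abs, abs_le] at h1 h2
  norm_num at h2
  rw [abs_le]
  constructor <;> linarith [h1.1, h1.2, h2.1, h2.2]


/-! ### The matrix elements of the boosts -/

/-- The matrix element of a boost of order `m` between Legendre functions, up to normalization. -/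
def boostInt (l l' m : ℕ) (s : ℝ) : ℝ :=
  ∫ y in (-1 : ℝ)..1, ((1 - y ^ 2) / (Real.cosh s + y * Real.sinh s)) ^ m *
    (legQ l m).eval y * (legQ l' m).eval (boostMap s y)

lemma continuousOn_boostMap (s : ℝ) : ContinuousOn (boostMap s) (Set.Icc (-1) 1) := by
  unfold boostMap
  exact ContinuousOn.div (by fun_prop) (by fun_prop) fun y hy => (cosh_add_mul_sinh_pos s hy).ne'

lemma continuousOn_boostInt (l l' m : ℕ) (s : ℝ) :
    ContinuousOn (fun y : ℝ => ((1 - y ^ 2) / (Real.cosh s + y * Real.sinh s)) ^ m *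
      (legQ l m).eval y * (legQ l' m).eval (boostMap s y)) (Set.Icc (-1) 1) := by
  refine ContinuousOn.mul (ContinuousOn.mul (ContinuousOn.pow ?_ m) ?_) ?_
  · exact ContinuousOn.div (by fun_prop) (by fun_prop) fun y hy => (cosh_add_mul_sinh_pos s hy).ne'
  · exact (legQ l m).continuous.continuousOn
  · exact (legQ l' m).continuous.comp_continuousOn (continuousOn_boostMap s)

lemma sphInt_g03_natCast (l l' m : ℕ) (hm : m ≤ l) (hm' : m ≤ l') (s : ℝ) :
    sphInt l m l' m (g03 s) = ((1 / 2 * Real.sqrt ((l - m)! / (l + m)!) *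
      Real.sqrt ((l' - m)! / (l' + m)!) * boostInt l l' m s : ℝ) : ℂ) := by
  have h1 := integral_comp_height (continuousOn_boostInt l l' m s)
  rw [← boostInt] at h1
  have h2 : ∀ᵐ z ∂sphMeasure, conj (sph l m z) * sph l' m (act (g03 s : SL2C) z) =
      ((Real.sqrt ((l - m)! / (l + m)!) * Real.sqrt ((l' - m)! / (l' + m)!) *
        (((1 - height z ^ 2) / (Real.cosh s + height z * Real.sinh s)) ^ m *
      (legQ l m).eval (height z) * (legQ l' m).eval (boostMap s (height z))) : ℝ) : ℂ) := by
    filter_upwards [ae_ne_zero] with z hz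
    have hD := (cosh_add_mul_sinh_pos s (height_mem hz)).ne'
    have hD' : ((Real.cosh s + height z * Real.sinh s : ℝ) : ℂ) ≠ 0 := by exact_mod_cast hD
    rw [sph_eq l m hm hz, sph_eq l' m hm' (act_ne_zero _ hz), height_g03 s hz, horiz_g03 s hz,
      ← normSq_horiz hz]
    simp only [Complex.ofReal_mul, Complex.ofReal_pow, Complex.ofReal_div]
    rw [← Complex.mul_conj]
    simp only [map_mul, map_pow, Complex.conj_ofReal, map_neg, map_one]
    have h1 : ((-1 : ℂ)) ^ m * (-1) ^ m = 1 := by rw [← mul_pow]; simp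
    simp only [div_pow, mul_pow]
    linear_combination (((Real.sqrt ((l - m)! / (l + m)!) : ℝ) : ℂ) *
      ((Real.sqrt ((l' - m)! / (l' + m)!) : ℝ) : ℂ) *
      (horiz z ^ m * conj (horiz z) ^ m / ((Real.cosh s + height z * Real.sinh s : ℝ) : ℂ) ^ m) *
      (((legQ l m).eval (height z) : ℝ) : ℂ) *
      (((legQ l' m).eval (boostMap s (height z)) : ℝ) : ℂ)) * h1
  rw [sphInt, integral_congr_ae h2, integral_complex_ofReal, integral_const_mul, h1]
  congr 1
  ring

lemma sphInt_g03_neg (l l' : ℕ) (m : ℤ) (hm : |m| ≤ l) (hm' : |m| ≤ l') (s : ℝ) :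
    sphInt l (-m) l' (-m) (g03 s) = conj (sphInt l m l' m (g03 s)) := by
  rw [sphInt, sphInt, ← integral_conj]
  refine integral_congr_ae (Filter.Eventually.of_forall fun z => ?_)
  simp only
  rw [sph_neg l m hm, sph_neg l' m hm']
  simp only [map_mul, map_pow, Complex.conj_conj, map_neg, map_one]
  have h1 : ((-1 : ℂ)) ^ m.natAbs * (-1) ^ m.natAbs = 1 := by rw [← mul_pow]; simp
  linear_combination (sph l m z * conj (sph l' m (act (g03 s : SL2C) z))) * h1

lemma sphInt_g03 (l l' : ℕ) (m : ℤ) (hm : |m| ≤ l) (hm' : |m| ≤ l') (s : ℝ) :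
    sphInt l m l' m (g03 s) = ((1 / 2 * Real.sqrt ((l - m.natAbs)! / (l + m.natAbs)!) *
      Real.sqrt ((l' - m.natAbs)! / (l' + m.natAbs)!) * boostInt l l' m.natAbs s : ℝ) : ℂ) := by
  have e1 : m.natAbs ≤ l := by rw [abs_le] at hm; omega
  have e2 : m.natAbs ≤ l' := by rw [abs_le] at hm'; omega
  rw [← sphInt_g03_natCast l l' _ e1 e2]
  rcases Int.natAbs_eq m with h | h
  · rw [← h]
  · have h' := sphInt_g03_neg l l' m hm hm' s
    rw [show ((m.natAbs : ℕ) : ℤ) = -m by omega, h']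
    have h3 := sphInt_g03_natCast l l' _ e1 e2 s
    rw [show ((m.natAbs : ℕ) : ℤ) = -m by omega, h'] at h3
    rw [h3, ← Complex.conj_ofReal, ← h3, Complex.conj_conj]

lemma one_sub_boostMap_sq (s : ℝ) {y : ℝ} (hy : y ∈ Set.Icc (-1 : ℝ) 1) :
    1 - boostMap s y ^ 2 = (1 - y ^ 2) / (Real.cosh s + y * Real.sinh s) ^ 2 := by
  have hD := (cosh_add_mul_sinh_pos s hy).ne'
  rw [boostMap, div_pow, eq_div_iff (pow_ne_zero 2 hD), sub_mul, div_mul_cancel₀ _ (pow_ne_zero 2 hD)]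
  have := Real.cosh_sq s
  linear_combination (1 - y ^ 2) * this

lemma boostMap_eq (s y : ℝ) :
    (Real.tanh s + y) / (1 + Real.tanh s * y) = boostMap s y := by
  have hc := (Real.cosh_pos s).ne'
  rw [boostMap, Real.tanh_eq_sinh_div_cosh, ← mul_div_mul_left _ _ hc]
  congr 1 <;> field_simp

/-- The weight `√(l (l + 1))`, by which the energy norm differs from the `L²` norm. -/
def wt (l : ℕ) : ℝ := Real.sqrt ((l : ℝ) * (l + 1))

lemma wt_pos {l : ℕ} (hl : 1 ≤ l) : 0 < wt l := by
  have : (0 : ℝ) < l := by exact_mod_cast hl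
  unfold wt; positivity

/-- The normalization of `T^l_{0m}` in `L²`. -/
def dm (l : ℕ) : ℝ := Real.sqrt (2 * l + 1)

lemma dm_pos (l : ℕ) : 0 < dm l := by unfold dm; positivity

lemma legendreP_mul (l l' : ℕ) (m : ℤ) (s : ℝ) {y : ℝ} (hy : y ∈ Set.Icc (-1 : ℝ) 1) :
    legendreNonneg l m.natAbs y * legendreNonneg l' m.natAbs (boostMap s y) =
      ((1 - y ^ 2) / (Real.cosh s + y * Real.sinh s)) ^ m.natAbs *
    (legQ l m.natAbs).eval y * (legQ l' m.natAbs).eval (boostMap s y) := by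
  have hD := cosh_add_mul_sinh_pos s hy
  have hy2 : 0 ≤ 1 - y ^ 2 := by nlinarith [hy.1, hy.2]
  have hs : Real.sqrt (1 - y ^ 2) * Real.sqrt (1 - boostMap s y ^ 2) =
      (1 - y ^ 2) / (Real.cosh s + y * Real.sinh s) := by
    rw [one_sub_boostMap_sq s hy, Real.sqrt_div hy2, Real.sqrt_sq hD.le, ← mul_div_assoc,
      Real.mul_self_sqrt hy2]
  rw [legendreNonneg_eq, legendreNonneg_eq, ← hs, mul_pow]
  have h1 : ((-1 : ℝ)) ^ m.natAbs * (-1) ^ m.natAbs = 1 := by rw [← mul_pow]; simp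
  linear_combination (Real.sqrt (1 - y ^ 2) ^ m.natAbs * Real.sqrt (1 - boostMap s y ^ 2) ^ m.natAbs *
    (legQ l m.natAbs).eval y * (legQ l' m.natAbs).eval (boostMap s y)) * h1

lemma boostEntry_eq_boostInt (l l' : ℕ) (m : ℤ) (hm : |m| ≤ l) (hm' : |m| ≤ l') (s : ℝ) :
    boostEntry l m l' m s = wt l * dm l * dm l' / wt l' *
      (1 / 2 * Real.sqrt ((l - m.natAbs)! / (l + m.natAbs)!) *
      Real.sqrt ((l' - m.natAbs)! / (l' + m.natAbs)!) * boostInt l l' m.natAbs s) := by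
  rw [abs_le] at hm hm'
  rw [boostEntry, if_pos rfl]
  simp only [boostMap_eq]
  have hint : ∀ c : ℝ, (∀ y, legendreP l m y * legendreP l' m (boostMap s y) =
      c * (legendreNonneg l m.natAbs y * legendreNonneg l' m.natAbs (boostMap s y))) →
      ∫ y in (-1 : ℝ)..1, legendreP l m y * legendreP l' m (boostMap s y) =
        c * boostInt l l' m.natAbs s := by
    intro c hc
    rw [boostInt, ← intervalIntegral.integral_const_mul]
    refine intervalIntegral.integral_congr fun y hy => ?_
    rw [Set.uIcc_of_le (by norm_num)] at hy
    simp only [hc]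
    rw [legendreP_mul l l' m s hy]
  -- The prefactor of `boostEntry` without the factorials.
  have hwd : wt l * dm l * dm l' / wt l' * (1 / 2) = Real.sqrt (((l : ℝ) * (l + 1) * (2 * l + 1) *
      (2 * l' + 1)) / ((l' : ℝ) * (l' + 1) * 4)) := by
    rw [Real.sqrt_div (by positivity), Real.sqrt_mul (by positivity), Real.sqrt_mul (by positivity),
      Real.sqrt_mul' _ (show (0 : ℝ) ≤ 4 by norm_num), show (4 : ℝ) = 2 ^ 2 by norm_num,
      Real.sqrt_sq (by norm_num : (0 : ℝ) ≤ 2), wt, dm, dm, wt]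
    ring
  have hassoc : ∀ a b c d e f : ℝ, a / b * (1 / 2 * c * d * e) = (a / b * (1 / 2)) * c * d * e :=
    fun _ _ _ _ _ _ => by ring
  rw [hassoc _ _ _ _ _ 0, hwd]
  obtain ⟨n, hn | hn⟩ := Int.eq_nat_or_neg m
  · subst hn
    have e1 : ((l : ℤ) - n).toNat = l - n := by omega
    have e2 : ((l : ℤ) + n).toNat = l + n := by omega
    have e3 : ((l' : ℤ) - n).toNat = l' - n := by omega
    have e4 : ((l' : ℤ) + n).toNat = l' + n := by omega
    rw [hint 1 (fun y => by rw [legendreP, legendreP, if_pos (by omega), if_pos (by omega)]; ring),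
      e1, e2, e3, e4, Int.natAbs_natCast, one_mul, ← Real.sqrt_mul (by positivity),
      ← Real.sqrt_mul (by positivity)]
    congr 2
    field_simp
    norm_num
  · rcases Nat.eq_zero_or_pos n with h0 | h0
    · subst h0
      subst hn
      rw [hint 1 (fun y => by rw [legendreP, legendreP, if_pos (by omega), if_pos (by omega)]; simp)]
      simp only [Nat.cast_zero, neg_zero, sub_zero, add_zero, Int.natAbs_zero, Nat.sub_zero,
        Int.toNat_natCast]
      rw [one_mul, ← Real.sqrt_mul (by positivity), ← Real.sqrt_mul (by positivity)]
      congr 2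
      field_simp
      norm_num
    · subst hn
      have e1 : ((l : ℤ) - -n).toNat = l + n := by omega
      have e2 : ((l : ℤ) + -n).toNat = l - n := by omega
      have e3 : ((l' : ℤ) - -n).toNat = l' + n := by omega
      have e4 : ((l' : ℤ) + -n).toNat = l' - n := by omega
      have e5 : (-(n : ℤ)).natAbs = n := by omega
      -- For negative orders the factors that define `P_{l,-m}` turn the ratios of factorials
      -- into their inverses.
      rw [hint ((((l - n)! : ℝ) / ((l + n)! : ℝ)) * (((l' - n)! : ℝ) / ((l' + n)! : ℝ))) (fun y => by
        rw [legendreP, legendreP, if_neg (by omega), if_neg (by omega), e5]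
        have h1 : ((-1 : ℝ)) ^ n * (-1) ^ n = 1 := by rw [← mul_pow]; simp
        linear_combination ((((l - n)! : ℝ) / ((l + n)! : ℝ)) * (((l' - n)! : ℝ) / ((l' + n)! : ℝ)) *
          legendreNonneg l n y * legendreNonneg l' n (boostMap s y)) * h1),
        e1, e2, e3, e4, e5, ← mul_assoc]
      congr 1
      have hpos : (0 : ℝ) ≤ (((l - n)! : ℝ) / ((l + n)! : ℝ)) * (((l' - n)! : ℝ) / ((l' + n)! : ℝ)) := by
        positivity
      rw [← Real.sqrt_sq hpos, ← Real.sqrt_mul (by positivity), ← Real.sqrt_mul (by positivity),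
        ← Real.sqrt_mul (by positivity)]
      congr 1
      field_simp
      norm_num

/-- The matrix of `f ↦ f ∘ g` in the basis that is orthonormal for the energy norm. -/
def aMat (g : SL2C) (α β : Idx) : ℂ :=
  ((wt α.l * dm α.l * dm β.l / wt β.l : ℝ) : ℂ) * sphInt α.l α.m β.l β.m g

lemma Idx.abs_le (α : Idx) : |α.m| ≤ (α.l : ℤ) := α.2.2

lemma boostEntry_eq_sphInt (l l' : ℕ) (m : ℤ) (hm : |m| ≤ l) (hm' : |m| ≤ l') (s : ℝ) :
    ((boostEntry l m l' m s : ℝ) : ℂ) =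
      ((wt l * dm l * dm l' / wt l' : ℝ) : ℂ) * sphInt l m l' m (g03 s) := by
  rw [boostEntry_eq_boostInt l l' m hm hm', sphInt_g03 l l' m hm hm', ← Complex.ofReal_mul]

lemma kakEntry_eq_aMat {k a : SL2C} (hk : k ∈ SU2) (ha : a ∈ SU2) (s : ℝ) (α β : Idx) :
    kakEntry k s a α β = aMat (k * g03 s * a) α β := by
  rw [aMat, sphInt_mul_right _ _ _ _ α.abs_le β.abs_le _ ha]
  have h1 : ∀ ν ∈ Finset.Icc (-(β.l : ℤ)) β.l, sphInt α.l α.m β.l ν (k * g03 s) * wignerT β.l ν β.m a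
      = if |ν| ≤ (α.l : ℤ) then
        wignerT α.l α.m ν k * sphInt α.l ν β.l ν (g03 s) * wignerT β.l ν β.m a else 0 := by
    intro ν hν
    have hν' := (mem_Icc_iff_abs_le _ _).1 hν
    rw [sphInt_mul_left _ _ _ _ α.abs_le hν' _ hk]
    split_ifs with h
    · rw [Finset.sum_eq_single_of_mem ν ((mem_Icc_iff_abs_le _ _).2 h)]
      intro μ hμ hne
      rw [sphInt_g03_of_ne _ _ _ _ ((mem_Icc_iff_abs_le _ _).1 hμ) hν' s hne, mul_zero]
    · rw [Finset.sum_eq_zero, zero_mul]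
      intro μ hμ
      have hμ' := (mem_Icc_iff_abs_le _ _).1 hμ
      rw [sphInt_g03_of_ne _ _ _ _ hμ' hν' s, mul_zero]
      rintro rfl
      exact h hμ'
  rw [Finset.sum_congr rfl h1, ← Finset.sum_filter, Finset.mul_sum, kakEntry]
  have hset : Finset.Icc (-((min α.l β.l : ℕ) : ℤ)) ((min α.l β.l : ℕ) : ℤ) =
      Finset.filter (fun ν : ℤ => |ν| ≤ (α.l : ℤ)) (Finset.Icc (-(β.l : ℤ)) β.l) := by
    ext ν
    simp only [Finset.mem_Icc, Finset.mem_filter, abs_le]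
    omega
  rw [hset]
  refine Finset.sum_congr rfl fun μ hμ => ?_
  rw [Finset.mem_filter] at hμ
  rw [boostEntry_eq_sphInt _ _ _ hμ.2 ((mem_Icc_iff_abs_le _ _).1 hμ.1)]
  ring


/-! ### Completeness of the spherical harmonics and the group law -/

/-- Degree and order of an index, where `none` stands for `(0, 0)`. -/
def oIdx : Option Idx → ℕ × ℤ
  | none => (0, 0)
  | some α => α.1

lemma oIdx_abs_le (j : Option Idx) : |(oIdx j).2| ≤ ((oIdx j).1 : ℤ) := by
  cases j with
  | none => simp [oIdx]
  | some α => exact α.2.2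

lemma oIdx_injective : Function.Injective oIdx := by
  intro i j h
  rcases i with _ | α <;> rcases j with _ | β
  · rfl
  · have := β.2.1
    simp only [oIdx, Prod.ext_iff] at h
    omega
  · have := α.2.1
    simp only [oIdx, Prod.ext_iff] at h
    omega
  · exact congrArg some (Subtype.ext h)

lemma exists_oIdx_eq (l : ℕ) (m : ℤ) (hm : |m| ≤ l) : ∃ j, oIdx j = (l, m) := by
  rcases Nat.eq_zero_or_pos l with h | h
  · subst h
    have : m = 0 := by simpa using hm
    exact ⟨none, by simp [oIdx, this]⟩
  · exact ⟨some ⟨(l, m), h, hm⟩, rfl⟩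

/-- The spherical harmonics as functions on `ℂ²`, normalized in `L²`. -/
def yFun (j : Option Idx) (z : ℂ × ℂ) : ℂ := (dm (oIdx j).1 : ℂ) * sph (oIdx j).1 (oIdx j).2 z

lemma memLp_sph_act (l : ℕ) (m : ℤ) (hm : |m| ≤ l) (g : SL2C) :
    MemLp (fun z => sph l m (act (g : SL2C) z)) 2 sphMeasure := by
  refine MemLp.of_bound ((measurable_sph l m).comp
    (continuous_act _).measurable).aestronglyMeasurable 1 ?_
  filter_upwards [ae_ne_zero] with z hz
  exact norm_sph_le l m hm (act_ne_zero g hz)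

lemma memLp_sph (l : ℕ) (m : ℤ) (hm : |m| ≤ l) : MemLp (sph l m) 2 sphMeasure := by
  have := memLp_sph_act l m hm 1
  simpa only [Matrix.SpecialLinearGroup.coe_one, act_one] using this

lemma memLp_yFun (j : Option Idx) : MemLp (yFun j) 2 sphMeasure :=
  (memLp_sph _ _ (oIdx_abs_le j)).const_mul _

/-- The spherical harmonics as elements of `L²`. -/
def yLp (j : Option Idx) : Lp ℂ 2 sphMeasure := (memLp_yFun j).toLp _

lemma inner_toLp {f h : ℂ × ℂ → ℂ} (hf : MemLp f 2 sphMeasure) (hh : MemLp h 2 sphMeasure) :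
    inner ℂ (hf.toLp f) (hh.toLp h) = ∫ z, conj (f z) * h z ∂sphMeasure := by
  rw [L2.inner_def]
  refine integral_congr_ae ?_
  filter_upwards [hf.coeFn_toLp, hh.coeFn_toLp] with z h1 h2
  rw [h1, h2, RCLike.inner_apply, mul_comm]

lemma orthonormal_yLp : Orthonormal ℂ yLp := by
  rw [orthonormal_iff_ite]
  intro i j
  rw [yLp, yLp, inner_toLp]
  have h : ∀ z, conj (yFun i z) * yFun j z = ((dm (oIdx i).1 : ℂ) * dm (oIdx j).1) *
      (conj (sph (oIdx i).1 (oIdx i).2 z) * sph (oIdx j).1 (oIdx j).2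
        (act ((1 : SL2C) : Matrix (Fin 2) (Fin 2) ℂ) z)) := by
    intro z
    rw [Matrix.SpecialLinearGroup.coe_one, act_one, yFun, yFun, map_mul, Complex.conj_ofReal]
    ring
  simp only [h]
  rw [integral_const_mul, ← sphInt, sphInt_one _ _ _ _ (oIdx_abs_le i) (oIdx_abs_le j)]
  by_cases hij : i = j
  · subst hij
    rw [if_pos rfl, if_pos ⟨rfl, rfl⟩, ← Complex.ofReal_mul, dm, Real.mul_self_sqrt (by positivity)]
    have : (2 * ((oIdx i).1 : ℂ) + 1) ≠ 0 := by exact_mod_cast Nat.succ_ne_zero (2 * (oIdx i).1)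
    push_cast
    field_simp
  · rw [if_neg hij, if_neg, mul_zero]
    rintro ⟨h1, h2⟩
    exact hij (oIdx_injective (Prod.ext h1 h2))

/-- The closed span of the spherical harmonics. -/
def ySpan : Submodule ℂ (Lp ℂ 2 sphMeasure) := (Submodule.span ℂ (Set.range yLp)).topologicalClosure

/-- Parseval's identity for an orthonormal system and a vector in its closed span. -/
lemma hasSum_inner_mul_inner_of_mem {E ι : Type*} [NormedAddCommGroup E] [InnerProductSpace ℂ E]
    [CompleteSpace E] {e : ι → E} (he : Orthonormal ℂ e) {v : E}
    (hv : v ∈ (Submodule.span ℂ (Set.range e)).topologicalClosure) (u : E) :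
    HasSum (fun i => inner ℂ u (e i) * inner ℂ (e i) v) (inner ℂ u v) := by
  classical
  set K := (Submodule.span ℂ (Set.range e)).topologicalClosure with hK
  have : CompleteSpace K := (Submodule.isClosed_topologicalClosure _).completeSpace_coe
  have hmem : ∀ i, e i ∈ K := fun i =>
    Submodule.le_topologicalClosure _ (Submodule.subset_span ⟨i, rfl⟩)
  let e' : ι → K := fun i => ⟨e i, hmem i⟩
  have he' : Orthonormal ℂ e' := by
    rw [orthonormal_iff_ite] at he ⊢
    exact he
  have hd : ⊤ ≤ (Submodule.span ℂ (Set.range e')).topologicalClosure := by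
    intro x _
    have hmap : (Submodule.span ℂ (Set.range e')).map K.subtype = Submodule.span ℂ (Set.range e) := by
      rw [Submodule.map_span, ← Set.range_comp]; rfl
    have hx : (x : E) ∈ closure (K.subtype '' (Submodule.span ℂ (Set.range e') : Set K)) := by
      rw [← Submodule.map_coe, hmap]
      exact x.2
    exact closure_subtype.2 hx
  have h1 := (HilbertBasis.mk he' hd).hasSum_repr ⟨v, hv⟩
  have h2 := h1.mapL ((innerSL ℂ u).comp K.subtypeL)
  have hb : ∀ i, (HilbertBasis.mk he' hd) i = e' i := fun i => by rw [HilbertBasis.coe_mk]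
  convert! h2 using 2 with i
  rw [map_smul, HilbertBasis.repr_apply_apply, hb, smul_eq_mul, mul_comm]
  rfl

/-- The function `f` represents an element of the closed span of the spherical harmonics. -/
def InSpan (f : ℂ × ℂ → ℂ) : Prop := ∃ h : MemLp f 2 sphMeasure, h.toLp f ∈ ySpan

lemma InSpan.congr {f h : ℂ × ℂ → ℂ} (hf : InSpan f) (hfh : f =ᵐ[sphMeasure] h) : InSpan h := by
  obtain ⟨h1, h2⟩ := hf
  refine ⟨h1.ae_eq hfh, ?_⟩
  rwa [← MemLp.toLp_congr h1 _ hfh]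

lemma InSpan.add {f h : ℂ × ℂ → ℂ} (hf : InSpan f) (hh : InSpan h) :
    InSpan fun z => f z + h z := by
  obtain ⟨h1, h2⟩ := hf
  obtain ⟨h3, h4⟩ := hh
  have := ySpan.add_mem h2 h4
  rw [← MemLp.toLp_add h1 h3] at this
  exact ⟨h1.add h3, this⟩

lemma InSpan.const_mul {f : ℂ × ℂ → ℂ} (hf : InSpan f) (c : ℂ) : InSpan fun z => c * f z := by
  obtain ⟨h1, h2⟩ := hf
  have := ySpan.smul_mem c h2
  rw [← MemLp.toLp_const_smul] at this
  exact ⟨h1.const_smul c, this⟩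

lemma inSpan_yFun (j : Option Idx) : InSpan (yFun j) :=
  ⟨memLp_yFun j, Submodule.le_topologicalClosure _ (Submodule.subset_span ⟨j, rfl⟩)⟩

lemma InSpan.zero : InSpan fun _ => 0 :=
  ((inSpan_yFun none).const_mul 0).congr (Filter.Eventually.of_forall fun _ => zero_mul _)

lemma InSpan.sum {ι : Type*} {s : Finset ι} {f : ι → ℂ × ℂ → ℂ} (hf : ∀ i ∈ s, InSpan (f i)) :
    InSpan fun z => ∑ i ∈ s, f i z := by
  classical
  induction s using Finset.induction_on with
  | empty => simpa using InSpan.zero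
  | insert a s ha ih =>
    simp only [Finset.sum_insert ha]
    exact (hf a (by simp)).add (ih fun i hi => hf i (by simp [hi]))

lemma inSpan_sph (l : ℕ) (m : ℤ) (hm : |m| ≤ l) : InSpan (sph l m) := by
  obtain ⟨j, hj⟩ := exists_oIdx_eq l m hm
  have h2 := (inSpan_yFun j).const_mul ((dm l : ℂ)⁻¹)
  refine h2.congr (Filter.Eventually.of_forall fun z => ?_)
  have : (dm l : ℂ) ≠ 0 := by exact_mod_cast (dm_pos l).ne'
  simp only [yFun, hj]
  field_simp

/-- Uniform limits of elements of the span belong to the span. -/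
lemma InSpan.of_approx {f : ℂ × ℂ → ℂ} (hf : MemLp f 2 sphMeasure)
    (h : ∀ ε > 0, ∃ k, InSpan k ∧ ∀ᵐ z ∂sphMeasure, ‖k z - f z‖ ≤ ε) : InSpan f := by
  refine ⟨hf, ?_⟩
  have hc : IsClosed (ySpan : Set (Lp ℂ 2 sphMeasure)) := Submodule.isClosed_topologicalClosure _
  rw [← SetLike.mem_coe, ← hc.closure_eq, Metric.mem_closure_iff]
  intro ε hε
  obtain ⟨k, ⟨hk, hk'⟩, hkf⟩ := h (ε / 2) (by positivity)
  refine ⟨hk.toLp k, hk', ?_⟩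
  rw [dist_comm, dist_eq_norm, ← MemLp.toLp_sub hk hf]
  have : ‖(hk.sub hf).toLp (k - f)‖ ≤ ε / 2 := by
    have h1 := Lp.norm_le_of_ae_bound (μ := sphMeasure) (p := 2) (f := (hk.sub hf).toLp (k - f)) (C := ε / 2)
      (by positivity) (by
        filter_upwards [(hk.sub hf).coeFn_toLp, hkf] with z h1 h2
        rw [h1]; exact h2)
    have h2 : measureUnivNNReal sphMeasure = 1 := by simp [measureUnivNNReal]
    rw [h2] at h1
    simpa using h1
  linarith

/-- If the span contains `x · P_{m+k}^{(m)}(height)` for all `k`, then it contains all products of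
`x` and a continuous function of the height. -/
lemma inSpan_mul_comp_height (m : ℕ) (x : ℂ × ℂ → ℂ) (hx : Measurable x)
    (hx1 : ∀ z, z ≠ 0 → ‖x z‖ ≤ 1)
    (h : ∀ k, InSpan fun z => x z * (((legQ (m + k) m).eval (height z) : ℝ) : ℂ))
    {f : ℝ → ℝ} (hf : ContinuousOn f (Set.Icc (-1) 1)) :
    InSpan fun z => x z * (f (height z) : ℂ) := by
  have hpoly : ∀ p : ℝ[X], InSpan fun z => x z * ((p.eval (height z) : ℝ) : ℂ) := by
    let S : Submodule ℝ ℝ[X] :=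
      { carrier := {p | InSpan fun z => x z * ((p.eval (height z) : ℝ) : ℂ)}
        add_mem' := fun {p q} hp hq => by
          refine (InSpan.add hp hq).congr (Filter.Eventually.of_forall fun z => ?_)
          simp only [eval_add]; push_cast; ring
        zero_mem' := by
          refine InSpan.zero.congr (Filter.Eventually.of_forall fun z => ?_)
          simp
        smul_mem' := fun c p hp => by
          refine (InSpan.const_mul hp c).congr (Filter.Eventually.of_forall fun z => ?_)
          simp only [eval_smul, smul_eq_mul]; push_cast; ring }
    intro p
    refine mem_of_degree_family (S := S) (fun k => legQ (m + k) m) h (fun k => ?_) (fun k => ?_) p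
    · have := natDegree_legQ_le (m + k) m
      omega
    · have := coeff_legQ_ne_zero (m + k) m (by omega)
      rwa [Nat.add_sub_cancel_left] at this
  have hmem : MemLp (fun z => x z * (f (height z) : ℂ)) 2 sphMeasure := by
    obtain ⟨C, hC⟩ := isCompact_Icc.exists_bound_of_continuousOn hf
    refine MemLp.of_bound (C := C) ?_ ?_
    · exact hx.aestronglyMeasurable.mul
        (Complex.continuous_ofReal.comp_aestronglyMeasurable (integrable_comp_height hf).1)
    · filter_upwards [ae_ne_zero] with z hz
      rw [norm_mul, Complex.norm_real]
      have h1 := hC _ (height_mem hz)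
      calc ‖x z‖ * ‖f (height z)‖ ≤ 1 * C :=
            mul_le_mul (hx1 z hz) h1 (norm_nonneg _) zero_le_one
        _ = C := one_mul C
  refine InSpan.of_approx hmem fun ε hε => ?_
  obtain ⟨p, hp⟩ := exists_polynomial_near_of_continuousOn (-1) 1 f hf ε hε
  refine ⟨_, hpoly p, ?_⟩
  filter_upwards [ae_ne_zero] with z hz
  rw [← mul_sub, norm_mul, ← Complex.ofReal_sub, Complex.norm_real]
  calc ‖x z‖ * ‖eval (height z) p - f (height z)‖ ≤ 1 * ε :=
        mul_le_mul (hx1 z hz) (hp _ (height_mem hz)).le (norm_nonneg _) zero_le_one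
    _ = ε := one_mul ε

lemma measurable_horiz : Measurable horiz := by
  unfold horiz
  have h1 : Measurable fun z : ℂ × ℂ => 2 * conj z.1 * z.2 := by
    apply Continuous.measurable; fun_prop
  exact h1.div (Complex.continuous_ofReal.comp continuous_nsq).measurable

lemma norm_horiz_le {z : ℂ × ℂ} (hz : z ≠ 0) : ‖horiz z‖ ≤ 1 := by
  have h := normSq_horiz hz
  rw [Complex.normSq_eq_norm_sq] at h
  nlinarith [norm_nonneg (horiz z), sq_nonneg (height z)]

/-- The spherical harmonics of order `m` are `horiz ^ m` times derivatives of Legendre polynomials,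
one of each degree, so the closed span contains `horiz ^ m` times any continuous function of the
height. -/
lemma inSpan_horiz_pow_mul (m : ℕ) {f : ℝ → ℝ} (hf : ContinuousOn f (Set.Icc (-1) 1)) :
    InSpan fun z => horiz z ^ m * (f (height z) : ℂ) := by
  refine inSpan_mul_comp_height m _ (measurable_horiz.pow_const m)
    (fun z hz => by rw [norm_pow]; exact pow_le_one₀ (norm_nonneg _) (norm_horiz_le hz)) ?_ hf
  intro k
  set c : ℂ := (-1) ^ m * ((Real.sqrt ((m + k - m)! / (m + k + m)!) : ℝ) : ℂ) with hc
  have hc0 : c ≠ 0 := by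
    refine mul_ne_zero (pow_ne_zero _ (by norm_num)) ?_
    exact_mod_cast (Real.sqrt_pos.2 (by positivity)).ne'
  have hm : |(m : ℤ)| ≤ ((m + k : ℕ) : ℤ) := by rw [abs_le]; omega
  refine ((inSpan_sph (m + k) m hm).const_mul c⁻¹).congr ?_
  filter_upwards [ae_ne_zero] with z hz
  rw [sph_eq (m + k) m (by omega) hz, ← hc]
  field_simp

lemma inSpan_conj_horiz_pow_mul (m : ℕ) {f : ℝ → ℝ} (hf : ContinuousOn f (Set.Icc (-1) 1)) :
    InSpan fun z => conj (horiz z) ^ m * (f (height z) : ℂ) := by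
  refine inSpan_mul_comp_height m (fun z => conj (horiz z) ^ m)
    ((Complex.continuous_conj.measurable.comp measurable_horiz).pow_const m)
    (fun z hz => by
      rw [norm_pow, Complex.norm_conj]; exact pow_le_one₀ (norm_nonneg _) (norm_horiz_le hz)) ?_ hf
  intro k
  set c : ℂ := ((Real.sqrt ((m + k - m)! / (m + k + m)!) : ℝ) : ℂ) with hc
  have hc0 : c ≠ 0 := by
    rw [hc]
    exact_mod_cast (Real.sqrt_pos.2 (by positivity)).ne'
  have hm : |(m : ℤ)| ≤ ((m + k : ℕ) : ℤ) := by rw [abs_le]; omega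
  refine ((inSpan_sph (m + k) (-m) (by rwa [abs_neg])).const_mul c⁻¹).congr ?_
  filter_upwards [ae_ne_zero] with z hz
  rw [sph_neg _ _ hm, sph_eq (m + k) m (by omega) hz, ← hc]
  simp only [map_mul, map_pow, map_neg, map_one, Complex.conj_ofReal, Int.natAbs_natCast]
  have h1 : ((-1 : ℂ)) ^ m * (-1) ^ m = 1 := by rw [← mul_pow]; simp
  rw [hc, Complex.conj_ofReal, ← hc]
  field_simp
  linear_combination (conj (horiz z) ^ m * (((legQ (m + k) m).eval (height z) : ℝ) : ℂ)) * h1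

lemma continuousOn_boost_factor (l m : ℕ) (s : ℝ) :
    ContinuousOn (fun y : ℝ => ((Real.cosh s + y * Real.sinh s) ^ m)⁻¹ *
      (legQ l m).eval (boostMap s y)) (Set.Icc (-1) 1) := by
  refine ContinuousOn.mul (ContinuousOn.inv₀ (by fun_prop) fun y hy =>
    pow_ne_zero _ (cosh_add_mul_sinh_pos s hy).ne') ?_
  exact (legQ l m).continuous.comp_continuousOn (continuousOn_boostMap s)

/-- Boosted spherical harmonics lie in the closed span: a boost acts on the height alone and
multiplies `horiz` by a function of the height. -/
lemma inSpan_sph_g03 (l : ℕ) (m : ℤ) (hm : |m| ≤ l) (s : ℝ) :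
    InSpan fun z => sph l m (act (g03 s : SL2C) z) := by
  have key : ∀ n : ℕ, n ≤ l → ∀ᵐ z ∂sphMeasure, sph l n (act (g03 s : SL2C) z) =
      ((-1) ^ n * ((Real.sqrt ((l - n)! / (l + n)!) : ℝ) : ℂ)) * (horiz z ^ n *
        ((((Real.cosh s + height z * Real.sinh s) ^ n)⁻¹ *
          (legQ l n).eval (boostMap s (height z)) : ℝ) : ℂ)) := by
    intro n hn
    filter_upwards [ae_ne_zero] with z hz
    rw [sph_eq l n hn (act_ne_zero _ hz), horiz_g03 s hz, height_g03 s hz, div_pow]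
    push_cast
    ring
  obtain ⟨n, hn | hn⟩ := Int.eq_nat_or_neg m
  · subst hn
    have hn : n ≤ l := by rw [abs_le] at hm; omega
    refine ((inSpan_horiz_pow_mul n (continuousOn_boost_factor l n s)).const_mul
      ((-1) ^ n * ((Real.sqrt ((l - n)! / (l + n)!) : ℝ) : ℂ))).congr ?_
    filter_upwards [key n hn] with z hz
    rw [hz]
  · subst hn
    rw [abs_neg] at hm
    have hn : n ≤ l := by rw [abs_le] at hm; omega
    refine ((inSpan_conj_horiz_pow_mul n (continuousOn_boost_factor l n s)).const_mul
      (((Real.sqrt ((l - n)! / (l + n)!) : ℝ) : ℂ))).congr ?_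
    filter_upwards [key n hn] with z hz
    rw [sph_neg l n hm, hz]
    simp only [map_mul, map_pow, map_neg, map_one, Complex.conj_ofReal, Int.natAbs_natCast]
    have h1 : ((-1 : ℂ)) ^ n * (-1) ^ n = 1 := by rw [← mul_pow]; simp
    linear_combination (-(((Real.sqrt ((l - n)! / (l + n)!) : ℝ) : ℂ) * (conj (horiz z) ^ n *
        ((((Real.cosh s + height z * Real.sinh s) ^ n)⁻¹ *
          (legQ l n).eval (boostMap s (height z)) : ℝ) : ℂ)))) * h1

/-- The closed span is invariant under rotations. -/
lemma InSpan.comp_act {f : ℂ × ℂ → ℂ} (hf : InSpan f) {a : SL2C} (ha : a ∈ SU2) :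
    InSpan fun z => f (act (a : SL2C) z) := by
  obtain ⟨h1, h2⟩ := hf
  have hmp := measurePreserving_act_SU2 ha
  let L := Lp.compMeasurePreservingₗᵢ ℂ (E := ℂ) (p := 2) (actEquiv a) hmp
  have hL : ∀ {k : ℂ × ℂ → ℂ} (hk : MemLp k 2 sphMeasure),
      L (hk.toLp k) = (hk.comp_measurePreserving hmp).toLp _ := fun hk =>
    Lp.toLp_compMeasurePreserving hk hmp
  have hle : ySpan ≤ ySpan.comap L.toLinearMap := by
    refine Submodule.topologicalClosure_minimal _ ?_ ?_
    · rw [Submodule.span_le]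
      rintro _ ⟨j, rfl⟩
      change L (yLp j) ∈ ySpan
      rw [yLp, hL]
      have h3 : InSpan fun z => yFun j (act (a : SL2C) z) := by
        have h4 : InSpan fun z => (dm (oIdx j).1 : ℂ) *
            ∑ μ ∈ Finset.Icc (-((oIdx j).1 : ℤ)) (oIdx j).1, wignerT (oIdx j).1 μ (oIdx j).2 a *
              sph (oIdx j).1 μ z :=
          (InSpan.sum fun μ hμ => (inSpan_sph _ _ ((mem_Icc_iff_abs_le _ _).1 hμ)).const_mul _).const_mul _
        refine h4.congr (Filter.Eventually.of_forall fun z => ?_)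
        simp only [yFun]
        rw [sph_act _ _ (oIdx_abs_le j) ha]
        congr 1
        exact Finset.sum_congr rfl fun _ _ => mul_comm _ _
      exact h3.2
    · exact (Submodule.isClosed_topologicalClosure _).preimage L.continuous
  have h3 := hle h2
  change L _ ∈ ySpan at h3
  rw [hL] at h3
  exact ⟨h1.comp_measurePreserving hmp, h3⟩

lemma inSpan_sph_act (l : ℕ) (m : ℤ) (hm : |m| ≤ l) {k a : SL2C} (hk : k ∈ SU2) (ha : a ∈ SU2)
    (s : ℝ) : InSpan fun z => sph l m (act ((k * g03 s * a : SL2C) : Matrix (Fin 2) (Fin 2) ℂ) z) := by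
  have h : InSpan fun z => ∑ μ ∈ Finset.Icc (-(l : ℤ)) l,
      wignerT l μ m a * sph l μ (act (g03 s : SL2C) (act (k : SL2C) z)) :=
    InSpan.sum fun μ hμ =>
      ((inSpan_sph_g03 l μ ((mem_Icc_iff_abs_le _ _).1 hμ) s).comp_act hk).const_mul _
  refine h.congr (Filter.Eventually.of_forall fun z => ?_)
  simp only
  rw [Matrix.SpecialLinearGroup.coe_mul, act_mul, sph_act l m hm ha, Matrix.SpecialLinearGroup.coe_mul,
    act_mul]
  exact Finset.sum_congr rfl fun _ _ => mul_comm _ _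

/-- The multiplication rule for the matrix elements of `f ↦ f ∘ g`, from Parseval's identity. Both the
group law for `A` and the cocycle identity for `B` are cases of it. The factor `2 l + 1` is there because
the spherical harmonics `sph` have the squared norm `1 / (2 l + 1)`. -/
lemma hasSum_sphInt_mul (l : ℕ) (m : ℤ) (l' : ℕ) (m' : ℤ) (hm : |m| ≤ l) (hm' : |m'| ≤ l')
    (g : SL2C) {k a : SL2C} (hk : k ∈ SU2) (ha : a ∈ SU2) (s : ℝ) :
    HasSum (fun j : Option Idx => (2 * ((oIdx j).1 : ℂ) + 1) *
      (sphInt l m (oIdx j).1 (oIdx j).2 g * sphInt (oIdx j).1 (oIdx j).2 l' m' (k * g03 s * a)))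
      (sphInt l m l' m' (g * (k * g03 s * a))) := by
  have hIn := inSpan_sph_act l' m' hm' hk ha s
  generalize k * g03 s * a = h at hIn ⊢
  obtain ⟨hF, hF'⟩ := hIn
  -- the adjoint of composition with `g`, applied to the spherical harmonic on the left
  set u : ℂ × ℂ → ℂ := fun w => (jac g w : ℂ) * sph l m (act (g⁻¹ : SL2C) w) with hu
  have hu2 : MemLp u 2 sphMeasure := by
    obtain ⟨C, hC⟩ := jac_le g
    refine MemLp.of_bound (C := C) ?_ ?_
    · exact (Complex.continuous_ofReal.comp (continuous_jac g)).aestronglyMeasurable.mul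
        (memLp_sph_act l m hm g⁻¹).1
    · filter_upwards [ae_ne_zero] with z hz
      rw [hu, norm_mul, Complex.norm_real, Real.norm_of_nonneg (jac_nonneg g z)]
      have h1 := norm_sph_le l m hm (act_ne_zero g⁻¹ hz)
      have h2 := jac_nonneg g z
      have h3 := hC z
      nlinarith [norm_nonneg (sph l m (act (g⁻¹ : SL2C) z))]
  have hadj : ∀ f : ℂ × ℂ → ℂ, ∫ z, conj (u z) * f z ∂sphMeasure =
      ∫ z, conj (sph l m z) * f (act (g : SL2C) z) ∂sphMeasure := by
    intro f
    rw [integral_act_mul g f (fun z => conj (sph l m z))]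
    refine integral_congr_ae (Filter.Eventually.of_forall fun z => ?_)
    simp only [hu, map_mul, Complex.conj_ofReal]
  have key := hasSum_inner_mul_inner_of_mem orthonormal_yLp hF' (hu2.toLp u)
  rw [inner_toLp, hadj] at key
  have hgh : sphInt l m l' m' (g * h) = ∫ z, conj (sph l m z) *
      sph l' m' (act (h : SL2C) (act (g : SL2C) z)) ∂sphMeasure := by
    rw [sphInt]
    refine integral_congr_ae (Filter.Eventually.of_forall fun z => ?_)
    simp only
    rw [Matrix.SpecialLinearGroup.coe_mul, act_mul]
  rw [hgh]
  convert! key using 2 with j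
  rw [yLp, inner_toLp, inner_toLp, hadj]
  have e1 : ∀ z, conj (sph l m z) * yFun j (act (g : SL2C) z) = (dm (oIdx j).1 : ℂ) *
      (conj (sph l m z) * sph (oIdx j).1 (oIdx j).2 (act (g : SL2C) z)) := fun z => by
    rw [yFun]; ring
  have e2 : ∀ z, conj (yFun j z) * sph l' m' (act (h : SL2C) z) = (dm (oIdx j).1 : ℂ) *
      (conj (sph (oIdx j).1 (oIdx j).2 z) * sph l' m' (act (h : SL2C) z)) := fun z => by
    rw [yFun, map_mul, Complex.conj_ofReal]; ring
  simp only [e1, e2]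
  rw [integral_const_mul, integral_const_mul, ← sphInt, ← sphInt]
  have hd : (dm (oIdx j).1 : ℂ) * dm (oIdx j).1 = 2 * ((oIdx j).1 : ℂ) + 1 := by
    rw [← Complex.ofReal_mul, dm, Real.mul_self_sqrt (by positivity)]; push_cast; ring
  rw [← hd]
  ring


/-! ### The polar decomposition and the Euler angles -/

lemma exists_add_int_mul_mem_Icc (x : ℝ) {p : ℝ} (hp : 0 < p) :
    ∃ n : ℤ, x + n * p ∈ Set.Icc 0 p := by
  refine ⟨-⌊x / p⌋, ?_⟩
  have h1 := Int.floor_le (x / p)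
  have h2 := (Int.lt_floor_add_one (x / p)).le
  rw [le_div_iff₀ hp] at h1
  rw [div_le_iff₀ hp] at h2
  push_cast
  constructor <;> linarith

lemma exists_angle (w : ℂ) : ∃ θ ∈ Set.Icc (0 : ℝ) (2 * Real.pi),
    w = (‖w‖ : ℂ) * Complex.exp (θ * Complex.I) := by
  obtain ⟨n, hn⟩ := exists_add_int_mul_mem_Icc w.arg Real.two_pi_pos
  refine ⟨_, hn, ?_⟩
  have h := Complex.exp_int_mul_two_pi_mul_I n
  have h2 : (((w.arg + n * (2 * Real.pi) : ℝ) : ℂ)) * Complex.I =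
    w.arg * Complex.I + n * (2 * Real.pi * Complex.I) := by push_cast; ring
  rw [h2, Complex.exp_add, h, mul_one, Complex.norm_mul_exp_arg_mul_I]

/-- Polar coordinates in a half plane. -/
lemma exists_polar_of_nonneg (x : ℝ) {y : ℝ} (hy : 0 ≤ y) : ∃ f ∈ Set.Icc (0 : ℝ) Real.pi,
    x = Real.sqrt (x ^ 2 + y ^ 2) * Real.cos f ∧ y = Real.sqrt (x ^ 2 + y ^ 2) * Real.sin f := by
  refine ⟨Complex.arg ⟨x, y⟩, ⟨Complex.arg_nonneg_iff.2 hy, Complex.arg_le_pi _⟩, ?_⟩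
  have h : ‖(⟨x, y⟩ : ℂ)‖ = Real.sqrt (x ^ 2 + y ^ 2) := by
    rw [Complex.norm_def, Complex.normSq_mk]; congr 1; ring
  rw [← h, Complex.norm_mul_cos_arg, Complex.norm_mul_sin_arg]
  exact ⟨rfl, rfl⟩

lemma g12_apply (θ : ℝ) : (g12 θ : Matrix (Fin 2) (Fin 2) ℂ) =
    !![Complex.exp (((θ / 2 : ℝ) : ℂ) * Complex.I), 0;
      0, Complex.exp (-(((θ / 2 : ℝ) : ℂ) * Complex.I))] := rfl

lemma g13_apply (θ : ℝ) : (g13 θ : Matrix (Fin 2) (Fin 2) ℂ) =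
    !![((Real.cos (θ / 2) : ℝ) : ℂ), ((Real.sin (θ / 2) : ℝ) : ℂ);
      -((Real.sin (θ / 2) : ℝ) : ℂ), ((Real.cos (θ / 2) : ℝ) : ℂ)] := rfl

lemma g12_inv (θ : ℝ) : (g12 θ)⁻¹ = g12 (-θ) := by
  ext i j
  rw [Matrix.SpecialLinearGroup.coe_inv, g12_apply, g12_apply, Matrix.adjugate_fin_two_of]
  fin_cases i <;> fin_cases j <;> simp [neg_div]

lemma g13_inv (θ : ℝ) : (g13 θ)⁻¹ = g13 (-θ) := by
  ext i j
  rw [Matrix.SpecialLinearGroup.coe_inv, g13_apply, g13_apply, Matrix.adjugate_fin_two_of]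
  fin_cases i <;> fin_cases j <;> simp [neg_div, -Complex.ofReal_cos, -Complex.ofReal_sin]

lemma SU2_ext {k a : SL2C} (hk : k ∈ SU2) (ha : a ∈ SU2)
    (h0 : (k : Matrix (Fin 2) (Fin 2) ℂ) 0 0 = (a : Matrix (Fin 2) (Fin 2) ℂ) 0 0)
    (h1 : (k : Matrix (Fin 2) (Fin 2) ℂ) 0 1 = (a : Matrix (Fin 2) (Fin 2) ℂ) 0 1) : k = a := by
  obtain ⟨e1, e2⟩ := isQuaternionic_of_mem_SU2 hk
  obtain ⟨e3, e4⟩ := isQuaternionic_of_mem_SU2 ha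
  ext i j
  fin_cases i <;> fin_cases j <;> simp [e1, e2, e3, e4, h0, h1]

lemma exists_euler {k : SL2C} (hk : k ∈ SU2) : ∃ θ f ϑ : ℝ,
    θ ∈ Set.Icc 0 (4 * Real.pi) ∧ f ∈ Set.Icc 0 Real.pi ∧ ϑ ∈ Set.Icc 0 (2 * Real.pi) ∧
    k = g12 θ * g13 f * g12 ϑ := by
  set p := (k : Matrix (Fin 2) (Fin 2) ℂ) 0 0 with hp
  set q := (k : Matrix (Fin 2) (Fin 2) ℂ) 0 1 with hq
  have hone : ‖p‖ ^ 2 + ‖q‖ ^ 2 = 1 := by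
    have h1 := Matrix.mem_unitaryGroup_iff.1 (show (k : Matrix (Fin 2) (Fin 2) ℂ) ∈ _ from hk)
    have h2 := congrFun (congrFun h1 0) 0
    rw [Matrix.star_eq_conjTranspose, Matrix.mul_apply, Fin.sum_univ_two] at h2
    simp only [Matrix.conjTranspose_apply, Matrix.one_apply_eq, ← hp, ← hq] at h2
    rw [← starRingEnd_apply, ← starRingEnd_apply, Complex.mul_conj', Complex.mul_conj'] at h2
    exact_mod_cast h2
  obtain ⟨ψ, hψ, hc, hs⟩ := exists_polar_of_nonneg ‖p‖ (norm_nonneg q)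
  rw [hone, Real.sqrt_one, one_mul] at hc hs
  have hψ2 : ψ ≤ Real.pi / 2 := by
    by_contra hcon
    have := Real.cos_neg_of_pi_div_two_lt_of_lt (not_le.1 hcon)
      (by have := hψ.2; have := Real.pi_pos; linarith)
    have := norm_nonneg p
    linarith
  obtain ⟨n, hn⟩ := exists_add_int_mul_mem_Icc (p.arg - q.arg) Real.two_pi_pos
  obtain ⟨j, hj⟩ := exists_add_int_mul_mem_Icc (p.arg + q.arg + n * (2 * Real.pi))
    (show 0 < 4 * Real.pi by positivity)
  refine ⟨_, 2 * ψ, _, hj, ⟨by linarith [hψ.1], by linarith⟩, hn, ?_⟩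
  refine SU2_ext hk (mul_mem_SU2 (mul_mem_SU2 (g12_mem_SU2 _) (g13_mem_SU2 _)) (g12_mem_SU2 _)) ?_ ?_
  · rw [Matrix.SpecialLinearGroup.coe_mul, Matrix.SpecialLinearGroup.coe_mul, g12_apply, g13_apply,
      g12_apply]
    simp only [Matrix.mul_apply, Fin.sum_univ_two, Matrix.of_apply, Matrix.cons_val_zero,
      Matrix.cons_val_one, Matrix.cons_val', Matrix.cons_val_fin_one, mul_zero, zero_mul, add_zero,
      zero_add]
    rw [← hp, mul_div_cancel_left₀ _ (two_ne_zero), ← hc, mul_right_comm, ← Complex.exp_add]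
    have h2 : (((p.arg + q.arg + n * (2 * Real.pi) + j * (4 * Real.pi)) / 2 : ℝ) : ℂ) * Complex.I +
      (((p.arg - q.arg + n * (2 * Real.pi)) / 2 : ℝ) : ℂ) * Complex.I =
      p.arg * Complex.I + ((n + j : ℤ) : ℂ) * (2 * Real.pi * Complex.I) := by push_cast; ring
    rw [h2, Complex.exp_add, Complex.exp_int_mul_two_pi_mul_I, mul_one, mul_comm,
      Complex.norm_mul_exp_arg_mul_I]
  · rw [Matrix.SpecialLinearGroup.coe_mul, Matrix.SpecialLinearGroup.coe_mul, g12_apply, g13_apply,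
      g12_apply]
    simp only [Matrix.mul_apply, Fin.sum_univ_two, Matrix.of_apply, Matrix.cons_val_zero,
      Matrix.cons_val_one, Matrix.cons_val', Matrix.cons_val_fin_one, mul_zero, zero_mul, add_zero,
      zero_add]
    rw [← hq, mul_div_cancel_left₀ _ (two_ne_zero), ← hs, mul_right_comm, ← Complex.exp_add]
    have h2 : (((p.arg + q.arg + n * (2 * Real.pi) + j * (4 * Real.pi)) / 2 : ℝ) : ℂ) * Complex.I +
      -((((p.arg - q.arg + n * (2 * Real.pi)) / 2 : ℝ) : ℂ) * Complex.I) =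
      q.arg * Complex.I + (j : ℂ) * (2 * Real.pi * Complex.I) := by push_cast; ring
    rw [h2, Complex.exp_add, Complex.exp_int_mul_two_pi_mul_I, mul_one, mul_comm,
      Complex.norm_mul_exp_arg_mul_I]

lemma g03_apply (s : ℝ) : (g03 s : Matrix (Fin 2) (Fin 2) ℂ) =
    !![((Real.exp (s / 2) : ℝ) : ℂ), 0; 0, ((Real.exp (-(s / 2)) : ℝ) : ℂ)] := rfl

lemma g03_conjTranspose (s : ℝ) :
    (g03 s : Matrix (Fin 2) (Fin 2) ℂ).conjTranspose = (g03 s : SL2C) := by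
  rw [g03_apply]
  ext i j
  fin_cases i <;> fin_cases j <;> simp [Matrix.conjTranspose_apply, -Complex.ofReal_exp]

lemma g03_add (s t : ℝ) : g03 (s + t) = g03 s * g03 t := by
  ext i j
  rw [Matrix.SpecialLinearGroup.coe_mul, g03_apply, g03_apply, g03_apply]
  fin_cases i <;> fin_cases j <;>
    simp [Matrix.mul_apply, -Complex.ofReal_exp, add_div, Real.exp_add, mul_comm]

lemma g03_inv (s : ℝ) : (g03 s)⁻¹ = g03 (-s) := by
  rw [inv_eq_iff_mul_eq_one, ← g03_add, add_neg_cancel, g03_zero]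

/-- The positive matrix `g* g` is diagonalized by a rotation. -/
lemma exists_conjTranspose_mul_self (g : SL2C) : ∃ ϑ f s : ℝ,
    ϑ ∈ Set.Icc 0 (2 * Real.pi) ∧ f ∈ Set.Icc 0 Real.pi ∧ 0 ≤ s ∧
    (g : Matrix (Fin 2) (Fin 2) ℂ).conjTranspose * g =
      ((g13 f * g12 ϑ : SL2C) : Matrix (Fin 2) (Fin 2) ℂ).conjTranspose * (g03 (s + s) : SL2C) *
        (g13 f * g12 ϑ : SL2C) := by
  set p := (g : Matrix (Fin 2) (Fin 2) ℂ) 0 0 with hp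
  set q := (g : Matrix (Fin 2) (Fin 2) ℂ) 0 1 with hq
  set r := (g : Matrix (Fin 2) (Fin 2) ℂ) 1 0 with hr
  set t := (g : Matrix (Fin 2) (Fin 2) ℂ) 1 1 with ht
  have hdet : p * t - q * r = 1 := by
    have := g.det_coe
    rwa [Matrix.det_fin_two] at this
  -- The entries of `g* g` are `x + z`, `x - z` on the diagonal and `w` off it, and the determinant
  -- gives `x² - z² - |w|² = 1`. Hence `x = cosh s` with `sinh s` the length of `(z, w)`, and the
  -- direction of `(z, w)` gives the angles.
  set w := conj p * q + conj r * t with hw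
  set x := (Complex.normSq p + Complex.normSq r + Complex.normSq q + Complex.normSq t) / 2 with hx
  set z := (Complex.normSq p + Complex.normSq r - Complex.normSq q - Complex.normSq t) / 2 with hz
  have hx0 : 0 ≤ x := by
    have := Complex.normSq_nonneg p; have := Complex.normSq_nonneg q
    have := Complex.normSq_nonneg r; have := Complex.normSq_nonneg t
    positivity
  have hrel : x ^ 2 = 1 + (z ^ 2 + ‖w‖ ^ 2) := by
    rw [← Complex.normSq_eq_norm_sq]
    have h : (1 : ℂ) = (p * t - q * r) * conj (p * t - q * r) := by rw [hdet]; simp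
    apply Complex.ofReal_injective
    rw [hx, hz, hw]
    push_cast
    rw [← Complex.mul_conj, ← Complex.mul_conj, ← Complex.mul_conj, ← Complex.mul_conj,
      ← Complex.mul_conj, h]
    simp only [map_add, map_sub, map_mul, Complex.conj_conj]
    ring
  obtain ⟨ϑ, hϑ, hwϑ⟩ := exists_angle (conj w)
  obtain ⟨f, hf, hc, hs⟩ := exists_polar_of_nonneg z (norm_nonneg w)
  set ρ := Real.sqrt (z ^ 2 + ‖w‖ ^ 2) with hρ
  have hρ0 : 0 ≤ ρ := Real.sqrt_nonneg _
  have hρ2 : ρ ^ 2 = z ^ 2 + ‖w‖ ^ 2 := Real.sq_sqrt (by positivity)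
  set s := Real.arsinh ρ with hsdef
  have hsinh : Real.sinh s = ρ := Real.sinh_arsinh ρ
  have hcosh : Real.cosh s = x := by
    rw [hsdef, Real.cosh_arsinh, hρ2, ← hrel, Real.sqrt_sq hx0]
  refine ⟨ϑ, f, s, hϑ, hf, Real.arsinh_nonneg_iff.2 hρ0, ?_⟩
  have e1 : Real.exp s = x + ρ := by rw [← hcosh, ← hsinh, Real.cosh_add_sinh]
  have e2 : Real.exp (-s) = x - ρ := by rw [← hcosh, ← hsinh, Real.cosh_sub_sinh]
  have hcs := Real.cos_sq_add_sin_sq (f / 2)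
  have hcos : Real.cos f = Real.cos (f / 2) ^ 2 - Real.sin (f / 2) ^ 2 := by
    rw [← Real.cos_two_mul']; ring_nf
  have hsin : Real.sin f = 2 * Real.sin (f / 2) * Real.cos (f / 2) := by
    rw [← Real.sin_two_mul]; ring_nf
  set c2 := Real.cos (f / 2)
  set s2 := Real.sin (f / 2)
  set E := Complex.exp (((ϑ / 2 : ℝ) : ℂ) * Complex.I) with hE
  set F := Complex.exp (-(((ϑ / 2 : ℝ) : ℂ) * Complex.I)) with hF
  have hEF : E * F = 1 := by rw [hE, hF, ← Complex.exp_add, add_neg_cancel, Complex.exp_zero]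
  have hcE : conj E = F := by
    rw [hE, hF, ← Complex.exp_conj, map_mul, Complex.conj_ofReal, Complex.conj_I, mul_neg]
  have hcF : conj F = E := by rw [← hcE, Complex.conj_conj]
  have hE2 : Complex.exp (ϑ * Complex.I) = E * E := by
    rw [hE, ← Complex.exp_add]; congr 1; push_cast; ring
  have hw1 : conj w = ((ρ * (2 * s2 * c2) : ℝ) : ℂ) * (E * E) := by
    rw [hwϑ, hE2, RCLike.norm_conj, ← hsin, ← hs]
  have hw2 : w = ((ρ * (2 * s2 * c2) : ℝ) : ℂ) * (F * F) := by
    rw [← Complex.conj_conj w, hw1, map_mul, map_mul, hcE, Complex.conj_ofReal]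
  have hz' : z = ρ * (c2 ^ 2 - s2 ^ 2) := by rw [← hcos]; exact hc
  have h00 : conj p * p + conj r * r = ((x + z : ℝ) : ℂ) := by
    rw [mul_comm, mul_comm (conj r), Complex.mul_conj, Complex.mul_conj, ← Complex.ofReal_add]
    congr 1; rw [hx, hz]; ring
  have h11 : conj q * q + conj t * t = ((x - z : ℝ) : ℂ) := by
    rw [mul_comm, mul_comm (conj t), Complex.mul_conj, Complex.mul_conj, ← Complex.ofReal_add]
    congr 1; rw [hx, hz]; ring
  have h10 : conj q * p + conj t * r = conj w := by
    rw [hw]; simp only [map_add, map_mul, Complex.conj_conj]; ring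
  have hcs' : (c2 : ℂ) ^ 2 + (s2 : ℂ) ^ 2 = 1 := by exact_mod_cast hcs
  have h13 : (g13 f : Matrix (Fin 2) (Fin 2) ℂ) = !![(c2 : ℂ), s2; -s2, c2] := rfl
  have h12 : (g12 ϑ : Matrix (Fin 2) (Fin 2) ℂ) = !![E, 0; 0, F] := rfl
  rw [Matrix.SpecialLinearGroup.coe_mul, h13, h12, g03_apply,
    show (s + s) / 2 = s by ring, e1, e2]
  ext i j
  fin_cases i <;> fin_cases j
  · simp only [Fin.zero_eta, Fin.isValue, Fin.mk_one, Matrix.mul_apply, Fin.sum_univ_two, Matrix.conjTranspose_apply, Matrix.of_apply, Matrix.cons_val_zero,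
      Matrix.cons_val_one, Matrix.cons_val', Matrix.cons_val_fin_one, mul_zero, zero_mul, add_zero,
      zero_add, ← hp, ← hq, ← hr, ← ht, ← starRingEnd_apply, map_mul, map_neg, Complex.conj_ofReal,
      hcE, hcF]
    rw [h00, hz']
    push_cast
    linear_combination (-(c2 : ℂ) ^ 2 * (x + ρ) - s2 ^ 2 * (x - ρ)) * hEF - (x : ℂ) * hcs'
  · simp only [Fin.zero_eta, Fin.isValue, Fin.mk_one, Matrix.mul_apply, Fin.sum_univ_two, Matrix.conjTranspose_apply, Matrix.of_apply, Matrix.cons_val_zero,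
      Matrix.cons_val_one, Matrix.cons_val', Matrix.cons_val_fin_one, mul_zero, zero_mul, add_zero,
      zero_add, ← hp, ← hq, ← hr, ← ht, ← starRingEnd_apply, map_mul, map_neg, Complex.conj_ofReal,
      hcE, hcF]
    rw [← hw, hw2]
    push_cast
    ring
  · simp only [Fin.zero_eta, Fin.isValue, Fin.mk_one, Matrix.mul_apply, Fin.sum_univ_two, Matrix.conjTranspose_apply, Matrix.of_apply, Matrix.cons_val_zero,
      Matrix.cons_val_one, Matrix.cons_val', Matrix.cons_val_fin_one, mul_zero, zero_mul, add_zero,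
      zero_add, ← hp, ← hq, ← hr, ← ht, ← starRingEnd_apply, map_mul, map_neg, Complex.conj_ofReal,
      hcE, hcF]
    rw [h10, hw1]
    push_cast
    ring
  · simp only [Fin.zero_eta, Fin.isValue, Fin.mk_one, Matrix.mul_apply, Fin.sum_univ_two, Matrix.conjTranspose_apply, Matrix.of_apply, Matrix.cons_val_zero,
      Matrix.cons_val_one, Matrix.cons_val', Matrix.cons_val_fin_one, mul_zero, zero_mul, add_zero,
      zero_add, ← hp, ← hq, ← hr, ← ht, ← starRingEnd_apply, map_mul, map_neg, Complex.conj_ofReal,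
      hcE, hcF]
    rw [h11, hz']
    push_cast
    linear_combination (-(s2 : ℂ) ^ 2 * (x + ρ) - c2 ^ 2 * (x - ρ)) * hEF - (x : ℂ) * hcs'

theorem exists_euler_decomposition (g : SL2C) : ∃ θ₁ f₁ ϑ₁ ϑ f s : ℝ,
    θ₁ ∈ Set.Icc 0 (4 * Real.pi) ∧ f₁ ∈ Set.Icc 0 Real.pi ∧ ϑ₁ ∈ Set.Icc 0 (2 * Real.pi) ∧
    ϑ ∈ Set.Icc 0 (2 * Real.pi) ∧ f ∈ Set.Icc 0 Real.pi ∧ 0 ≤ s ∧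
    g = g12 θ₁ * g13 f₁ * g12 ϑ₁ * g12 (-ϑ) * g13 (-f) * g03 s * g13 f * g12 ϑ := by
  obtain ⟨ϑ, f, s, hϑ, hf, hs, hg⟩ := exists_conjTranspose_mul_self g
  set a : SL2C := g13 f * g12 ϑ with hadef
  have ha : a ∈ SU2 := mul_mem_SU2 (g13_mem_SU2 _) (g12_mem_SU2 _)
  have hainv := (mem_SU2_iff a).1 ha
  have hu : g * a⁻¹ * (g03 s)⁻¹ ∈ SU2 := by
    rw [SU2, Set.mem_ofPred_eq, Matrix.mem_unitaryGroup_iff', Matrix.star_eq_conjTranspose, g03_inv,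
      Matrix.SpecialLinearGroup.coe_mul, Matrix.SpecialLinearGroup.coe_mul,
      Matrix.conjTranspose_mul, Matrix.conjTranspose_mul, g03_conjTranspose]
    have h2 : ((a⁻¹ : SL2C) : Matrix (Fin 2) (Fin 2) ℂ).conjTranspose = a := by
      rw [hainv, Matrix.conjTranspose_conjTranspose]
    rw [h2]
    have h3 : ((g03 (-s) : SL2C) : Matrix (Fin 2) (Fin 2) ℂ) * ((a : Matrix (Fin 2) (Fin 2) ℂ) *
        (g : Matrix (Fin 2) (Fin 2) ℂ).conjTranspose) * ((g : Matrix (Fin 2) (Fin 2) ℂ) *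
        (a⁻¹ : SL2C) * (g03 (-s) : SL2C)) = (g03 (-s) : SL2C) * ((a : Matrix (Fin 2) (Fin 2) ℂ) *
        ((g : Matrix (Fin 2) (Fin 2) ℂ).conjTranspose * g) * (a⁻¹ : SL2C)) * (g03 (-s) : SL2C) := by
      simp only [Matrix.mul_assoc]
    rw [h3, hg, ← hainv, ← Matrix.SpecialLinearGroup.coe_mul, ← Matrix.SpecialLinearGroup.coe_mul,
      ← Matrix.SpecialLinearGroup.coe_mul, ← Matrix.SpecialLinearGroup.coe_mul,
      ← Matrix.SpecialLinearGroup.coe_mul, ← Matrix.SpecialLinearGroup.coe_mul,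
      ← Matrix.SpecialLinearGroup.coe_one]
    congr 1
    rw [← g03_inv, g03_add]
    group
    rfl
  obtain ⟨θ₁, f₁, ϑ₁, h1, h2, h3, hk⟩ := exists_euler (mul_mem_SU2 hu ha)
  refine ⟨θ₁, f₁, ϑ₁, ϑ, f, s, h1, h2, h3, hϑ, hf, hs, ?_⟩
  rw [← hk, ← g12_inv, ← g13_inv, hadef]
  group

lemma isPolar_polar (g : SL2C) : IsPolar g (polar g) := by
  refine Classical.epsilon_spec (p := IsPolar g) ?_
  obtain ⟨θ₁, f₁, ϑ₁, ϑ, f, s, -, -, -, -, -, hs, h⟩ := exists_euler_decomposition g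
  refine ⟨(g12 θ₁ * g13 f₁ * g12 ϑ₁ * g12 (-ϑ) * g13 (-f), s, g13 f * g12 ϑ), ?_, hs, ?_, ?_⟩
  · exact mul_mem_SU2 (mul_mem_SU2 (mul_mem_SU2 (mul_mem_SU2 (g12_mem_SU2 _) (g13_mem_SU2 _))
      (g12_mem_SU2 _)) (g12_mem_SU2 _)) (g13_mem_SU2 _)
  · exact mul_mem_SU2 (g13_mem_SU2 _) (g12_mem_SU2 _)
  · rw [h]; simp only [mul_assoc]


/-! ### Derivatives of the boost integrals -/

lemma hasDerivAt_legQ (l m : ℕ) (y : ℝ) :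
    HasDerivAt (fun y => (legQ l m).eval y) ((legQ l (m + 1)).eval y) y := by
  have := (legQ l m).hasDerivAt y
  rwa [derivative_legQ] at this

/-- Differentiation under the integral sign over the compact interval `[-1, 1]`. -/
lemma hasDerivAt_intervalIntegral {F F' : ℝ → ℝ → ℝ}
    (hF : ∀ s, ∀ y ∈ Set.Icc (-1 : ℝ) 1, HasDerivAt (fun s => F s y) (F' s y) s)
    (hFc : ∀ s, ContinuousOn (F s) (Set.Icc (-1) 1))
    (hF' : ContinuousOn (Function.uncurry F') (Set.univ ×ˢ Set.Icc (-1) 1)) (s₀ : ℝ) :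
    HasDerivAt (fun s => ∫ y in (-1 : ℝ)..1, F s y) (∫ y in (-1 : ℝ)..1, F' s₀ y) s₀ := by
  have hu : Set.uIoc (-1 : ℝ) 1 ⊆ Set.Icc (-1) 1 := by
    rw [Set.uIoc_of_le (by norm_num)]; exact Set.Ioc_subset_Icc_self
  have hFc' : ∀ s, ContinuousOn (F' s) (Set.Icc (-1) 1) := fun s =>
    hF'.comp (f := fun y => (s, y)) (by fun_prop) fun y hy => ⟨trivial, hy⟩
  obtain ⟨C, hC⟩ := (isCompact_Icc (a := s₀ - 1) (b := s₀ + 1)).prod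
    (isCompact_Icc (a := (-1 : ℝ)) (b := 1)) |>.exists_bound_of_continuousOn
      (hF'.mono (Set.prod_mono (Set.subset_univ _) subset_rfl))
  refine (intervalIntegral.hasDerivAt_integral_of_dominated_loc_of_deriv_le (F := F) (F' := F')
    (s := Set.Icc (s₀ - 1) (s₀ + 1)) (bound := fun _ => C) (Icc_mem_nhds (by linarith) (by linarith))
    (Filter.Eventually.of_forall fun s => ?_) ?_ ?_ ?_ ?_ ?_).2
  · exact ((hFc s).mono hu).aestronglyMeasurable measurableSet_uIoc
  · exact ContinuousOn.intervalIntegrable_of_Icc (by norm_num) (hFc s₀)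
  · exact ((hFc' s₀).mono hu).aestronglyMeasurable measurableSet_uIoc
  · exact Filter.Eventually.of_forall fun y hy s hs => hC (s, y) ⟨hs, hu hy⟩
  · exact intervalIntegrable_const
  · exact Filter.Eventually.of_forall fun y hy s _ => hF s y (hu hy)

lemma hasDerivAt_boostMap_left (s : ℝ) {y : ℝ} (hy : y ∈ Set.Icc (-1 : ℝ) 1) :
    HasDerivAt (fun s => boostMap s y) (1 - boostMap s y ^ 2) s := by
  have hD := (cosh_add_mul_sinh_pos s hy).ne'
  have h1 : HasDerivAt (fun s => Real.sinh s + y * Real.cosh s) (Real.cosh s + y * Real.sinh s) s :=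
    (Real.hasDerivAt_sinh s).add ((Real.hasDerivAt_cosh s).const_mul y)
  have h2 : HasDerivAt (fun s => Real.cosh s + y * Real.sinh s) (Real.sinh s + y * Real.cosh s) s :=
    (Real.hasDerivAt_cosh s).add ((Real.hasDerivAt_sinh s).const_mul y)
  convert! h1.div h2 hD using 1
  rw [boostMap, div_pow, eq_div_iff (pow_ne_zero 2 hD), sub_mul, div_mul_cancel₀ _ (pow_ne_zero 2 hD)]
  ring

/-- The derivative of the integrand of `boostInt` with respect to the hyperbolic angle. -/
def boostDeriv (l l' m : ℕ) (s y : ℝ) : ℝ :=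
  ((1 - y ^ 2) / (Real.cosh s + y * Real.sinh s)) ^ m * (legQ l m).eval y *
    ((1 - boostMap s y ^ 2) * (legQ l' (m + 1)).eval (boostMap s y) -
      m * boostMap s y * (legQ l' m).eval (boostMap s y))

lemma hasDerivAt_boostInt (l l' m : ℕ) (s₀ : ℝ) :
    HasDerivAt (boostInt l l' m) (∫ y in (-1 : ℝ)..1, boostDeriv l l' m s₀ y) s₀ := by
  refine hasDerivAt_intervalIntegral (F' := boostDeriv l l' m) ?_ (continuousOn_boostInt l l' m) ?_ s₀
  · intro s y hy
    have hD := (cosh_add_mul_sinh_pos s hy).ne'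
    have h2 : HasDerivAt (fun s => Real.cosh s + y * Real.sinh s) (Real.sinh s + y * Real.cosh s) s :=
      (Real.hasDerivAt_cosh s).add ((Real.hasDerivAt_sinh s).const_mul y)
    have h3 := (((hasDerivAt_const s (1 - y ^ 2)).div h2 hD).pow m).mul_const ((legQ l m).eval y)
    have h4 := h3.mul ((hasDerivAt_legQ l' m (boostMap s y)).comp s (hasDerivAt_boostMap_left s hy))
    convert! h4 using 1
    rw [boostDeriv]
    have hb : boostMap s y = (Real.sinh s + y * Real.cosh s) / (Real.cosh s + y * Real.sinh s) := rfl
    have e1 : (0 * (Real.cosh s + y * Real.sinh s) - (1 - y ^ 2) * (Real.sinh s + y * Real.cosh s)) /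
        (Real.cosh s + y * Real.sinh s) ^ 2 =
        -((1 - y ^ 2) / (Real.cosh s + y * Real.sinh s)) * boostMap s y := by
      rw [hb]; field_simp; ring
    rw [e1]
    rcases m with _ | m
    · simp only [pow_zero, Nat.cast_zero, zero_mul, one_mul, sub_zero, zero_add, Pi.pow_apply,
        Function.comp_apply]
      ring
    · simp only [Nat.add_sub_cancel, Function.comp_apply, Pi.div_apply, Pi.pow_apply]
      push_cast
      ring
  · have hD : ∀ q ∈ (Set.univ ×ˢ Set.Icc (-1) 1 : Set (ℝ × ℝ)),
        Real.cosh q.1 + q.2 * Real.sinh q.1 ≠ 0 := fun q hq => (cosh_add_mul_sinh_pos q.1 hq.2).ne'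
    have hDc : ContinuousOn (fun q : ℝ × ℝ => Real.cosh q.1 + q.2 * Real.sinh q.1)
        (Set.univ ×ˢ Set.Icc (-1) 1) := by fun_prop
    have hb : ContinuousOn (fun q : ℝ × ℝ => boostMap q.1 q.2) (Set.univ ×ˢ Set.Icc (-1) 1) := by
      unfold boostMap
      exact ContinuousOn.div (by fun_prop) hDc hD
    have hq : ∀ p : ℝ[X], ContinuousOn (fun q : ℝ × ℝ => p.eval (boostMap q.1 q.2))
        (Set.univ ×ˢ Set.Icc (-1) 1) := fun p => p.continuous.comp_continuousOn hb
    have hu : ContinuousOn (fun q : ℝ × ℝ => (1 - q.2 ^ 2) / (Real.cosh q.1 + q.2 * Real.sinh q.1))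
        (Set.univ ×ˢ Set.Icc (-1) 1) := ContinuousOn.div (by fun_prop) hDc hD
    have hl : ContinuousOn (fun q : ℝ × ℝ => (legQ l m).eval q.2)
        (Set.univ ×ˢ Set.Icc (-1) 1) := ((legQ l m).continuous.comp continuous_snd).continuousOn
    exact ((hu.pow m).mul hl).mul (((continuousOn_const.sub (hb.pow 2)).mul (hq _)).sub
      ((continuousOn_const.mul hb).mul (hq _)))

lemma continuous_boostInt (l l' m : ℕ) : Continuous (boostInt l l' m) :=
  continuous_iff_continuousAt.2 fun s => (hasDerivAt_boostInt l l' m s).continuousAt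

lemma hasDerivAt_boostMap (s : ℝ) {y : ℝ} (hy : y ∈ Set.Icc (-1 : ℝ) 1) :
    HasDerivAt (boostMap s) (1 / (Real.cosh s + y * Real.sinh s) ^ 2) y := by
  have hD := (cosh_add_mul_sinh_pos s hy).ne'
  have h1 : HasDerivAt (fun y => Real.sinh s + y * Real.cosh s) (1 * Real.cosh s) y :=
    ((hasDerivAt_id y).mul_const _).const_add _
  have h2 : HasDerivAt (fun y => Real.cosh s + y * Real.sinh s) (1 * Real.sinh s) y :=
    ((hasDerivAt_id y).mul_const _).const_add _
  convert! h1.div h2 hD using 1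
  have := Real.cosh_sq s
  congr 1
  linear_combination -this

/-- The generator of the boosts acts on the constant function by multiplication with `2 y`. -/
lemma integral_boostDeriv_zero (l : ℕ) (s : ℝ) :
    ∫ y in (-1 : ℝ)..1, boostDeriv 0 l 0 s y = 2 * boostInt 1 l 0 s := by
  have h1 : ∀ y ∈ Set.uIcc (-1 : ℝ) 1, HasDerivAt
      (fun y => (1 - y ^ 2) * (legQ l 0).eval (boostMap s y))
      (boostDeriv 0 l 0 s y - 2 * (((1 - y ^ 2) / (Real.cosh s + y * Real.sinh s)) ^ 0 *
        (legQ 1 0).eval y * (legQ l 0).eval (boostMap s y))) y := by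
    intro y hy
    rw [Set.uIcc_of_le (by norm_num)] at hy
    have hD := (cosh_add_mul_sinh_pos s hy).ne'
    have e1 : HasDerivAt (fun y : ℝ => 1 - y ^ 2) (-(2 * y)) y := by
      simpa using (hasDerivAt_pow 2 y).const_sub 1
    convert! e1.mul ((hasDerivAt_legQ l 0 (boostMap s y)).comp y (hasDerivAt_boostMap s hy)) using 1
    have e2 : (legQ 0 0).eval y = 1 := by simp [legQ, legPoly]
    have e3 : (legQ 1 0).eval y = y := by
      have := congrArg (eval y) (legQ_lower 0)
      simp only [eval_mul, eval_sub, eval_pow, eval_X, eval_one, eval_C, zero_add, Nat.cast_zero,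
        one_mul] at this
      have h01 : legQ 0 1 = 0 := by simp [legQ, legPoly]
      rw [e2, h01, eval_zero] at this
      linarith
    rw [boostDeriv, e2, e3, one_sub_boostMap_sq s hy]
    simp only [pow_zero, Nat.cast_zero, Function.comp_apply]
    field_simp
    ring
  have c1 : ContinuousOn (boostDeriv 0 l 0 s) (Set.Icc (-1) 1) := by
    unfold boostDeriv
    have hb := continuousOn_boostMap s
    have hq : ∀ p : ℝ[X], ContinuousOn (fun y => p.eval (boostMap s y))
        (Set.Icc (-1) 1) := fun p => p.continuous.comp_continuousOn hb
    simp only [pow_zero, one_mul]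
    exact (legQ 0 0).continuous.continuousOn.mul (((continuousOn_const.sub (hb.pow 2)).mul (hq _)).sub
      ((continuousOn_const.mul hb).mul (hq _)))
  have i1 : IntervalIntegrable (boostDeriv 0 l 0 s) volume (-1) 1 :=
    ContinuousOn.intervalIntegrable_of_Icc (by norm_num) c1
  have i2 : IntervalIntegrable (fun y => 2 * (((1 - y ^ 2) / (Real.cosh s + y * Real.sinh s)) ^ 0 *
        (legQ 1 0).eval y * (legQ l 0).eval (boostMap s y))) volume (-1) 1 :=
    ContinuousOn.intervalIntegrable_of_Icc (by norm_num)
      (continuousOn_const.mul (continuousOn_boostInt 1 l 0 s))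
  have := intervalIntegral.integral_eq_sub_of_hasDerivAt h1 (i1.sub i2)
  rw [intervalIntegral.integral_sub i1 i2, intervalIntegral.integral_const_mul, ← boostInt] at this
  norm_num at this
  linarith

lemma boostInt_zero_zero (l : ℕ) (hl : 1 ≤ l) : boostInt 0 l 0 0 = 0 := by
  obtain ⟨l, rfl⟩ : ∃ j, l = j + 1 := ⟨l - 1, by omega⟩
  refine Eq.trans ?_ (integral_legPoly_succ l)
  simp [boostInt, boostMap, legQ, legPoly]

lemma boostInt_zero_eq (l : ℕ) (hl : 1 ≤ l) (s : ℝ) :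
    boostInt 0 l 0 s = 2 * ∫ t in (0 : ℝ)..s, boostInt 1 l 0 t := by
  have h1 : ∀ t ∈ Set.uIcc 0 s, HasDerivAt (boostInt 0 l 0) (2 * boostInt 1 l 0 t) t := by
    intro t _
    rw [← integral_boostDeriv_zero]
    exact hasDerivAt_boostInt 0 l 0 t
  have h2 := intervalIntegral.integral_eq_sub_of_hasDerivAt h1
    ((continuous_const.mul (continuous_boostInt 1 l 0)).intervalIntegrable _ _)
  rw [boostInt_zero_zero l hl, sub_zero, intervalIntegral.integral_const_mul] at h2
  exact h2.symm

/-! ### The symmetry of the boosts for the energy norm -/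

/-- Green's identity: the weighted Laplace operators, applied to a function and to its boost,
have the same boundary form. -/
lemma integral_wronskian (l l' m : ℕ) (s : ℝ) :
    ∫ y in (-1 : ℝ)..1, ((1 - y ^ 2) / (Real.cosh s + y * Real.sinh s)) ^ m *
      (legQ l m).eval y * (legQ l' m).eval (boostMap s y) *
      ((l : ℝ) * (l + 1) - l' * (l' + 1) * (1 / (Real.cosh s + y * Real.sinh s)) ^ 2) = 0 := by
  set sh := Real.sinh s
  set ch := Real.cosh s
  have hcs : ch ^ 2 = sh ^ 2 + 1 := Real.cosh_sq s
  -- The integrand is the derivative of `(1 - y²)` times the Wronskian of `(1 - y²) ^ (m / 2)` times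
  -- the two functions, which vanishes at both ends of the interval. Below `K` is `1 / (ch + y sh)`.
  have hd : ∀ y ∈ Set.uIcc (-1 : ℝ) 1, HasDerivAt (fun y : ℝ => (1 - y ^ 2) ^ (m + 1) *
      ((legQ l m).eval y * ((1 / (ch + y * sh)) ^ (m + 1) *
        ((1 / (ch + y * sh)) * (legQ l' (m + 1)).eval (boostMap s y) -
          m * sh * (legQ l' m).eval (boostMap s y))) -
      (legQ l (m + 1)).eval y * ((1 / (ch + y * sh)) ^ m * (legQ l' m).eval (boostMap s y))))
      (((1 - y ^ 2) / (ch + y * sh)) ^ m *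
      (legQ l m).eval y * (legQ l' m).eval (boostMap s y) *
      ((l : ℝ) * (l + 1) - l' * (l' + 1) * (1 / (ch + y * sh)) ^ 2)) y := by
    intro y hy
    rw [Set.uIcc_of_le (by norm_num)] at hy
    have hD : ch + y * sh ≠ 0 := (cosh_add_mul_sinh_pos s hy).ne'
    have hK : HasDerivAt (fun y : ℝ => 1 / (ch + y * sh)) (-(sh * (1 / (ch + y * sh)) ^ 2)) y := by
      have h2 : HasDerivAt (fun y => ch + y * sh) (1 * sh) y :=
        ((hasDerivAt_id y).mul_const _).const_add _
      convert! (hasDerivAt_const y (1 : ℝ)).div h2 hD using 1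
      field_simp
      ring
    have hb : HasDerivAt (boostMap s) ((1 / (ch + y * sh)) ^ 2) y := by
      convert! hasDerivAt_boostMap s hy using 1
      rw [div_pow, one_pow]
    have hp : ∀ j : ℕ, HasDerivAt (fun y : ℝ => (1 / (ch + y * sh)) ^ j)
        (-(j * sh * (1 / (ch + y * sh)) ^ (j + 1))) y := by
      intro j
      convert! hK.pow j using 1
      rcases j with _ | j
      · simp
      · simp only [Nat.add_sub_cancel]; ring
    have hu : HasDerivAt (fun y : ℝ => (1 - y ^ 2) ^ (m + 1)) (-(2 * (m + 1) * y * (1 - y ^ 2) ^ m)) y := by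
      have e1 : HasDerivAt (fun y : ℝ => 1 - y ^ 2) (-(2 * y)) y := by
        simpa using (hasDerivAt_pow 2 y).const_sub 1
      convert! e1.pow (m + 1) using 1
      simp only [Nat.add_sub_cancel]; push_cast; ring
    have hQ : ∀ j, HasDerivAt (fun y => (legQ l' j).eval (boostMap s y))
        ((legQ l' (j + 1)).eval (boostMap s y) * (1 / (ch + y * sh)) ^ 2) y := fun j =>
      (hasDerivAt_legQ l' j (boostMap s y)).comp y hb
    have key := hu.mul (((hasDerivAt_legQ l m y).mul ((hp (m + 1)).mul
      ((hK.mul (hQ (m + 1))).sub ((hQ m).const_mul (m * sh))))).sub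
      ((hasDerivAt_legQ l (m + 1) y).mul ((hp m).mul (hQ m))))
    convert! key using 1
    -- The differential equations of the two functions.
    have o1 := congrArg (eval y) (legQ_ode l m)
    have o2 := congrArg (eval (boostMap s y)) (legQ_ode l' m)
    simp only [eval_mul, eval_sub, eval_add, eval_pow, eval_X, eval_one, eval_C] at o1 o2
    have r1 := one_sub_boostMap_sq s hy
    rw [show Real.cosh s = ch from rfl, show Real.sinh s = sh from rfl, div_eq_mul_one_div,
      ← one_div_pow] at r1
    have hb' : boostMap s y = (sh + y * ch) * (1 / (ch + y * sh)) := by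
      rw [boostMap, div_eq_mul_one_div]
    have hKD : (1 / (ch + y * sh)) * (ch + y * sh) = 1 := one_div_mul_cancel hD
    rw [div_eq_mul_one_div (1 - y ^ 2), mul_pow]
    simp only [Pi.mul_apply, Pi.sub_apply]
    push_cast
    generalize 1 / (ch + y * sh) = K at *
    have r2 : boostMap s y = y + (1 - y ^ 2) * sh * K := by
      rw [hb']; linear_combination y * hKD
    have r3 : 2 * y * sh * K + (1 - y ^ 2) * sh ^ 2 * K ^ 2 = 1 - K ^ 2 := by
      linear_combination (K * (ch + y * sh) + 1 - 2 * y * sh * K) * hKD - K ^ 2 * hcs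
    generalize (legQ l m).eval y = p0 at *
    generalize (legQ l (m + 1)).eval y = p1 at *
    rw [show m + 1 + 1 = m + 2 from rfl]
    generalize (legQ l (m + 2)).eval y = p2 at *
    generalize (legQ l' m).eval (boostMap s y) = q0 at *
    generalize (legQ l' (m + 1)).eval (boostMap s y) = q1 at *
    generalize (legQ l' (m + 2)).eval (boostMap s y) = q2 at *
    generalize boostMap s y = b at *
    clear key hQ hp hK hu hb hb'
    linear_combination (-((1 - y ^ 2) ^ m * K ^ m * q0)) * o1 +
      ((1 - y ^ 2) ^ m * p0 * K ^ (m + 2)) * o2 +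
      ((1 - y ^ 2) ^ m * p0 * K ^ (m + 2) * q2) * r1 -
      (2 * (m + 1) * (1 - y ^ 2) ^ m * p0 * K ^ (m + 2) * q1) * r2 -
      (m * (m + 1) * (1 - y ^ 2) ^ m * p0 * K ^ m * q0) * r3
  have hc : ContinuousOn (fun y : ℝ => ((1 - y ^ 2) / (ch + y * sh)) ^ m *
      (legQ l m).eval y * (legQ l' m).eval (boostMap s y) *
      ((l : ℝ) * (l + 1) - l' * (l' + 1) * (1 / (ch + y * sh)) ^ 2)) (Set.Icc (-1) 1) := by
    refine (continuousOn_boostInt l l' m s).mul (continuousOn_const.sub (continuousOn_const.mul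
      (ContinuousOn.pow (ContinuousOn.div (by fun_prop) (by fun_prop) fun y hy =>
        (cosh_add_mul_sinh_pos s hy).ne') 2)))
  have := intervalIntegral.integral_eq_sub_of_hasDerivAt hd
    (ContinuousOn.intervalIntegrable_of_Icc (by norm_num) hc)
  rw [this]
  norm_num


/-- The substitution `y ↦ boostMap s y` in a boost integral. -/
lemma boostInt_neg_eq (l l' m : ℕ) (s : ℝ) : boostInt l' l m (-s) = ∫ y in (-1 : ℝ)..1,
    ((1 - y ^ 2) / (Real.cosh s + y * Real.sinh s)) ^ m *
    (legQ l m).eval y * (legQ l' m).eval (boostMap s y) *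
    (1 / (Real.cosh s + y * Real.sinh s)) ^ 2 := by
  have hD0 : ∀ y ∈ Set.Icc (-1 : ℝ) 1, Real.cosh s + y * Real.sinh s ≠ 0 :=
    fun y hy => (cosh_add_mul_sinh_pos s hy).ne'
  have e1 : boostMap s (-1) = -1 := by
    have := hD0 (-1) (by norm_num)
    rw [boostMap, div_eq_iff this]; ring
  have e2 : boostMap s 1 = 1 := by
    have := hD0 1 (by norm_num)
    rw [boostMap, div_eq_iff this]; ring
  have hmem : ∀ y ∈ Set.Icc (-1 : ℝ) 1, boostMap s y ∈ Set.Icc (-1 : ℝ) 1 := by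
    intro y hy
    have h := one_sub_boostMap_sq s hy
    have h2 : 0 ≤ 1 - boostMap s y ^ 2 := by
      rw [h]
      have : 0 ≤ 1 - y ^ 2 := by nlinarith [hy.1, hy.2]
      positivity
    rw [Set.mem_Icc, ← abs_le, ← sq_le_one_iff_abs_le_one]
    linarith
  have h := intervalIntegral.integral_comp_mul_deriv' (a := -1) (b := 1) (f := boostMap s)
    (f' := fun y => 1 / (Real.cosh s + y * Real.sinh s) ^ 2)
    (g := fun y => ((1 - y ^ 2) / (Real.cosh (-s) + y * Real.sinh (-s))) ^ m *
      (legQ l' m).eval y * (legQ l m).eval (boostMap (-s) y))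
    (fun y hy => hasDerivAt_boostMap s (by rwa [Set.uIcc_of_le (by norm_num)] at hy))
    (by
      rw [Set.uIcc_of_le (by norm_num)]
      exact ContinuousOn.div (by fun_prop) (by fun_prop) fun y hy => pow_ne_zero 2 (hD0 y hy))
    (by
      rw [Set.uIcc_of_le (by norm_num)]
      refine (continuousOn_boostInt l' l m (-s)).mono ?_
      rintro _ ⟨y, hy, rfl⟩
      exact hmem y hy)
  rw [e1, e2, ← boostInt] at h
  rw [← h]
  refine intervalIntegral.integral_congr fun y hy => ?_
  rw [Set.uIcc_of_le (by norm_num)] at hy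
  have hD := hD0 y hy
  have hcs := Real.cosh_sq s
  have hND : boostMap s y * (Real.cosh s + y * Real.sinh s) = Real.sinh s + y * Real.cosh s :=
    div_mul_cancel₀ _ hD
  have h1 : Real.cosh (-s) + boostMap s y * Real.sinh (-s) =
      1 / (Real.cosh s + y * Real.sinh s) := by
    rw [Real.cosh_neg, Real.sinh_neg, eq_div_iff hD]
    linear_combination (-Real.sinh s) * hND + hcs
  have h2 : boostMap (-s) (boostMap s y) = y := by
    have h3 : (Real.sinh (-s) + boostMap s y * Real.cosh (-s)) =
        y / (Real.cosh s + y * Real.sinh s) := by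
      rw [Real.cosh_neg, Real.sinh_neg, eq_div_iff hD]
      linear_combination Real.cosh s * hND + y * hcs
    rw [boostMap, h1, h3]
    field_simp
  simp only [Function.comp_apply]
  rw [h1, h2, one_sub_boostMap_sq s hy]
  have h4 : (1 - y ^ 2) / (Real.cosh s + y * Real.sinh s) ^ 2 / (1 / (Real.cosh s + y * Real.sinh s))
      = (1 - y ^ 2) / (Real.cosh s + y * Real.sinh s) := by field_simp
  rw [h4, one_div_pow]
  ring

/-- The boosts are symmetric for the energy form `∫ |∇f|²`, in which the spherical harmonics have
the weight `l (l + 1)`: the energy is conformally invariant in two dimensions. -/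
lemma boostInt_symm (l l' m : ℕ) (s : ℝ) :
    (l : ℝ) * (l + 1) * boostInt l l' m s = l' * (l' + 1) * boostInt l' l m (-s) := by
  have hw := integral_wronskian l l' m s
  have hD2 : ContinuousOn (fun y : ℝ => (1 / (Real.cosh s + y * Real.sinh s)) ^ 2)
      (Set.Icc (-1) 1) :=
    ContinuousOn.pow (ContinuousOn.div (by fun_prop) (by fun_prop) fun y hy =>
      (cosh_add_mul_sinh_pos s hy).ne') 2
  have i1 : IntervalIntegrable (fun y : ℝ => (l : ℝ) * (l + 1) *
      (((1 - y ^ 2) / (Real.cosh s + y * Real.sinh s)) ^ m *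
      (legQ l m).eval y * (legQ l' m).eval (boostMap s y))) volume (-1) 1 :=
    ContinuousOn.intervalIntegrable_of_Icc (by norm_num)
      (continuousOn_const.mul (continuousOn_boostInt l l' m s))
  have i2 : IntervalIntegrable (fun y : ℝ => (l' : ℝ) * (l' + 1) *
      (((1 - y ^ 2) / (Real.cosh s + y * Real.sinh s)) ^ m *
      (legQ l m).eval y * (legQ l' m).eval (boostMap s y) *
      (1 / (Real.cosh s + y * Real.sinh s)) ^ 2)) volume (-1) 1 :=
    ContinuousOn.intervalIntegrable_of_Icc (by norm_num)
      (continuousOn_const.mul ((continuousOn_boostInt l l' m s).mul hD2))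
  rw [boostInt_neg_eq, boostInt, ← intervalIntegral.integral_const_mul, ← intervalIntegral.integral_const_mul,
    ← sub_eq_zero, ← intervalIntegral.integral_sub i1 i2, ← hw]
  refine intervalIntegral.integral_congr fun y _ => ?_
  ring

lemma boostEntry_neg {l l' : ℕ} (hl : 1 ≤ l) (hl' : 1 ≤ l') (m : ℤ) (hm : |m| ≤ l) (hm' : |m| ≤ l')
    (s : ℝ) : boostEntry l m l' m (-s) = boostEntry l' m l m s := by
  rw [boostEntry_eq_boostInt l l' m hm hm', boostEntry_eq_boostInt l' l m hm' hm]
  have h := boostInt_symm l' l m.natAbs s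
  have e1 := wt_pos hl
  have e2 := wt_pos hl'
  have e3 : (l : ℝ) * (l + 1) = wt l * wt l := by rw [wt, Real.mul_self_sqrt (by positivity)]
  have e4 : (l' : ℝ) * (l' + 1) = wt l' * wt l' := by rw [wt, Real.mul_self_sqrt (by positivity)]
  rw [e3, e4] at h
  rw [div_mul_eq_mul_div (wt l * dm l * dm l'), div_mul_eq_mul_div (wt l' * dm l' * dm l),
    div_eq_div_iff e2.ne' e1.ne']
  linear_combination -(dm l * dm l' * (1 / 2 * Real.sqrt ((l - m.natAbs)! / (l + m.natAbs)!) *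
      Real.sqrt ((l' - m.natAbs)! / (l' + m.natAbs)!))) * h

/-! ### The representation `A` -/

/-- Hence the matrix does not depend on the polar decomposition chosen in the definition of `A`. -/
lemma A_eq_aMat (g : SL2C) (α β : Idx) : A g α β = aMat g α β := by
  obtain ⟨h1, _, h3, h4⟩ := isPolar_polar g
  rw [A, kakEntry_eq_aMat h1 h3, ← h4]

theorem A_kak {k a : SL2C} (hk : k ∈ SU2) (ha : a ∈ SU2) (s : ℝ) (α β : Idx) :
    A (k * g03 s * a) α β = kakEntry k s a α β := by
  rw [A_eq_aMat, kakEntry_eq_aMat hk ha]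

theorem A_g03 (s : ℝ) (α β : Idx) : A (g03 s) α β = (boostEntry α.l α.m β.l β.m s : ℝ) := by
  rw [A_eq_aMat, aMat]
  by_cases h : α.m = β.m
  · have h1 : |α.m| ≤ (β.l : ℤ) := by rw [h]; exact β.abs_le
    rw [← h, boostEntry_eq_sphInt _ _ _ α.abs_le h1]
  · rw [sphInt_g03_of_ne _ _ _ _ α.abs_le β.abs_le s h, boostEntry, if_neg h]
    simp

lemma sphInt_SU2 (l : ℕ) (m : ℤ) (l' : ℕ) (m' : ℤ) (hm : |m| ≤ l) (hm' : |m'| ≤ l') {a : SL2C}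
    (ha : a ∈ SU2) : sphInt l m l' m' a =
      if l = l' then (1 / (2 * l + 1) : ℂ) * wignerT l m m' a else 0 := by
  have h := sphInt_mul_right l m l' m' hm hm' 1 ha
  rw [one_mul] at h
  rw [h]
  split_ifs with hl
  · subst hl
    rw [Finset.sum_eq_single_of_mem m ((mem_Icc_iff_abs_le _ _).2 hm), sphInt_one _ _ _ _ hm hm,
      if_pos ⟨rfl, rfl⟩]
    intro μ hμ hne
    rw [sphInt_one _ _ _ _ hm ((mem_Icc_iff_abs_le _ _).1 hμ), if_neg (by tauto), zero_mul]
  · refine Finset.sum_eq_zero fun μ hμ => ?_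
    rw [sphInt_one _ _ _ _ hm ((mem_Icc_iff_abs_le _ _).1 hμ), if_neg (by tauto), zero_mul]

lemma dm_mul_self (l : ℕ) : (dm l : ℂ) * dm l = 2 * l + 1 := by
  rw [← Complex.ofReal_mul, dm, Real.mul_self_sqrt (by positivity)]; push_cast; rfl

lemma two_mul_add_one_ne_zero (l : ℕ) : (2 * l + 1 : ℂ) ≠ 0 := by exact_mod_cast Nat.succ_ne_zero (2 * l)

theorem A_SU2 {a : SL2C} (ha : a ∈ SU2) (α β : Idx) : A a α β =
    if α.l = β.l then wignerT α.l α.m β.m (a : Matrix (Fin 2) (Fin 2) ℂ) else 0 := by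
  rw [A_eq_aMat, aMat, sphInt_SU2 _ _ _ _ α.abs_le β.abs_le ha]
  split_ifs with h
  · rw [← h]
    have h1 : (wt α.l : ℂ) ≠ 0 := by exact_mod_cast (wt_pos α.2.1).ne'
    have h2 := two_mul_add_one_ne_zero α.l
    have h3 := dm_mul_self α.l
    push_cast
    rw [mul_assoc (wt α.l : ℂ), h3]
    field_simp
  · simp

lemma A_one (α β : Idx) : A 1 α β = if α = β then 1 else 0 := by
  rw [A_SU2 one_mem_SU2]
  split_ifs with h1 h2 h2
  · rw [h2, Matrix.SpecialLinearGroup.coe_one, wignerT_one _ _ _ β.abs_le β.abs_le, if_pos rfl]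
  · have h3 : |β.m| ≤ (α.l : ℤ) := by rw [h1]; exact β.abs_le
    rw [Matrix.SpecialLinearGroup.coe_one, wignerT_one _ _ _ α.abs_le h3, if_neg]
    intro h
    exact h2 (Subtype.ext (Prod.ext h1 h))
  · exact absurd (by rw [h2]) h1
  · rfl

/-- The constant functions are invariant. -/
lemma sphInt_zero_right (l : ℕ) (hl : 1 ≤ l) (m : ℤ) (hm : |m| ≤ l) (g : SL2C) :
    sphInt l m 0 0 g = 0 := by
  have h : sphInt l m 0 0 g = sphInt l m 0 0 1 := by
    simp only [sphInt, sph_zero_zero]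
  rw [h, sphInt_one _ _ _ _ hm (by simp), if_neg (by omega)]

/-- The term of the constant function is split off from a sum over all degrees. -/
lemma hasSum_option {f : Option Idx → ℂ} {a : ℂ} (h : HasSum f a) :
    HasSum (fun α : Idx => f (some α)) (a - f none) := by
  have h1 := h.sub (hasSum_ite_eq (none : Option Idx) (f none))
  have h2 := ((Option.some_injective Idx).hasSum_iff (fun x hx => ?_)).2 h1
  · simpa [Function.comp_def] using h2
  · cases x with
    | none => simp
    | some α => exact absurd ⟨α, rfl⟩ hx

/-- The constant function does not contribute to the sum, because it is invariant and orthogonal to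
the others. -/
theorem A_mul (g h : SL2C) (α β : Idx) :
    HasSum (fun γ : Idx => A g α γ * A h γ β) (A (g * h) α β) := by
  obtain ⟨h1, _, h3, h4⟩ := isPolar_polar h
  have key := hasSum_sphInt_mul α.l α.m β.l β.m α.abs_le β.abs_le g h1 h3 (polar h).2.1
  rw [← h4] at key
  have key2 := (hasSum_option key).mul_left ((wt α.l * dm α.l * dm β.l / wt β.l : ℝ) : ℂ)
  simp only [oIdx, sphInt_zero_right _ α.2.1 _ α.abs_le, zero_mul, mul_zero, sub_zero] at key2
  rw [A_eq_aMat]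
  convert! key2 using 2 with γ
  rw [A_eq_aMat, A_eq_aMat, aMat, aMat, ← dm_mul_self]
  have e1 : (wt γ.l : ℂ) ≠ 0 := by exact_mod_cast (wt_pos γ.2.1).ne'
  push_cast
  field_simp

lemma coe_conjTranspose_of_mem_SU2 {a : SL2C} (ha : a ∈ SU2) :
    (a : Matrix (Fin 2) (Fin 2) ℂ).conjTranspose = (a⁻¹ : SL2C) := ((mem_SU2_iff a).1 ha).symm

/-- Unitarity, which for the boosts is the symmetry for the energy form. -/
theorem A_inv (g : SL2C) (α β : Idx) : A g⁻¹ α β = conj (A g β α) := by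
  obtain ⟨h1, _, h3, h4⟩ := isPolar_polar g
  have hinv : g⁻¹ = (polar g).2.2⁻¹ * g03 (-(polar g).2.1) * (polar g).1⁻¹ := by
    rw [← g03_inv]; conv_lhs => rw [h4]
    group
  rw [hinv, A_kak (inv_mem_SU2 h3) (inv_mem_SU2 h1), A, kakEntry, kakEntry, map_sum, min_comm]
  refine Finset.sum_congr rfl fun μ hμ => ?_
  have hμ' : |μ| ≤ (α.l : ℤ) ∧ |μ| ≤ (β.l : ℤ) := by
    rw [Finset.mem_Icc] at hμ
    simp only [abs_le]
    omega
  simp only [map_mul, Complex.conj_ofReal]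
  rw [conj_wignerT β.l β.m μ β.abs_le hμ'.2, conj_wignerT α.l μ α.m hμ'.1 α.abs_le, coe_conjTranspose_of_mem_SU2 h1, coe_conjTranspose_of_mem_SU2 h3,
    boostEntry_neg α.2.1 β.2.1 μ hμ'.1 hμ'.2]
  ring

theorem A_unitary_left (g : SL2C) (α β : Idx) :
    HasSum (fun γ : Idx => conj (A g γ α) * A g γ β) (if α = β then 1 else 0) := by
  have h := A_mul g⁻¹ g α β
  rw [inv_mul_cancel, A_one] at h
  simpa only [A_inv] using h

theorem A_unitary_right (g : SL2C) (α β : Idx) :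
    HasSum (fun γ : Idx => A g α γ * conj (A g β γ)) (if α = β then 1 else 0) := by
  have h := A_mul g g⁻¹ α β
  rw [mul_inv_cancel, A_one] at h
  simpa only [A_inv] using h

instance : FirstCountableTopology SL2C := by
  have : FirstCountableTopology (Matrix (Fin 2) (Fin 2) ℂ) :=
    inferInstanceAs (FirstCountableTopology (Fin 2 → Fin 2 → ℂ))
  exact TopologicalSpace.Subtype.firstCountableTopology _

lemma continuous_sphInt (l : ℕ) (m : ℤ) (l' : ℕ) (m' : ℤ) (hm : |m| ≤ l) (hm' : |m'| ≤ l') :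
    Continuous (sphInt l m l' m') := by
  refine continuous_of_dominated (bound := fun _ => 1)
    (fun g => (integrable_sph_mul l l' m m' hm hm' g).1) (fun g => ?_) (integrable_const _) ?_
  · filter_upwards [ae_ne_zero] with z hz
    rw [norm_mul, RCLike.norm_conj]
    exact mul_le_one₀ (norm_sph_le l m hm hz) (norm_nonneg _) (norm_sph_le l' m' hm' (act_ne_zero g hz))
  · filter_upwards [ae_ne_zero] with z hz
    refine continuous_const.mul ?_
    have hact : Continuous fun g : SL2C => act (g : SL2C) z := by
      have h0 : Continuous fun g : SL2C => (g : Matrix (Fin 2) (Fin 2) ℂ) := continuous_subtype_val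
      have h1 : ∀ i j, Continuous fun g : SL2C => (g : Matrix (Fin 2) (Fin 2) ℂ) i j := fun i j =>
        h0.matrix_elem i j
      simp only [act_apply]
      have := h1 0 0; have := h1 0 1; have := h1 1 0; have := h1 1 1
      fun_prop
    unfold sph
    refine Continuous.div ((continuous_wignerT l' 0 m').comp (continuous_rowMat.comp hact)) ?_ ?_
    · exact ((Complex.continuous_ofReal.comp (continuous_nsq.comp hact))).pow l'
    · intro g
      exact pow_ne_zero _ (by exact_mod_cast (nsq_pos (act_ne_zero g hz)).ne')

theorem continuous_A (α β : Idx) : Continuous fun g : SL2C => A g α β := by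
  simp only [A_eq_aMat, aMat]
  exact continuous_const.mul (continuous_sphInt _ _ _ _ α.abs_le β.abs_le)

/-! ### The cocycle `B` -/

lemma boostB_eq (e s : ℝ) (l : ℕ) (hl : 1 ≤ l) :
    boostB e s l 0 = Complex.I * e * (dm l / wt l : ℝ) * (boostInt 0 l 0 s : ℝ) := by
  rw [boostB, boostInt_zero_eq l hl]
  have h : ∀ t, boostEntry 1 0 l 0 t = (wt 1 * dm 1 * dm l / wt l / 2) * boostInt 1 l 0 t := by
    intro t
    rw [boostEntry_eq_boostInt 1 l 0 (by simp) (by simp)]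
    simp only [Int.natAbs_zero, Nat.sub_zero, Nat.add_zero]
    rw [div_self (by positivity), div_self (by positivity), Real.sqrt_one]
    ring
  simp only [h]
  rw [intervalIntegral.integral_const_mul]
  -- The normalization `√(8/3)` cancels that of the row of `l = 1`.
  have h2 : Real.sqrt (8 / 3) * (wt 1 * dm 1) = 4 := by
    rw [wt, dm, ← Real.sqrt_mul (by positivity), ← Real.sqrt_mul (by positivity)]
    rw [show (8 / 3 : ℝ) * ((((1 : ℕ) : ℝ) * (((1 : ℕ) : ℝ) + 1)) * (2 * ((1 : ℕ) : ℝ) + 1)) = 4 ^ 2 by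
      norm_num]
    exact Real.sqrt_sq (by norm_num)
  have h3 : (Real.sqrt (8 / 3) : ℂ) * ((wt 1 : ℂ) * dm 1) = 4 := by exact_mod_cast h2
  push_cast
  linear_combination (Complex.I * e * (dm l / wt l / 2) *
    ((∫ t in (0 : ℝ)..s, boostInt 1 l 0 t : ℝ) : ℂ)) * h3

lemma boostB_of_ne (e s : ℝ) (l : ℕ) (m : ℤ) (hm : m ≠ 0) : boostB e s l m = 0 := by
  have h : ∀ t, boostEntry 1 0 l m t = 0 := fun t => by rw [boostEntry, if_neg (Ne.symm hm)]
  simp [boostB, h]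

lemma wignerT_zero (k : Matrix (Fin 2) (Fin 2) ℂ) : wignerT 0 0 0 k = 1 := by
  simp [wignerT]

lemma sphInt_zero_kak (l : ℕ) (m : ℤ) (hm : |m| ≤ l) {k a : SL2C} (hk : k ∈ SU2) (ha : a ∈ SU2)
    (s : ℝ) : sphInt 0 0 l m (k * g03 s * a) = (1 / 2 * boostInt 0 l 0 s : ℝ) * wignerT l 0 m a := by
  rw [sphInt_mul_right 0 0 l m (by simp) hm _ ha,
    Finset.sum_eq_single_of_mem 0 ((mem_Icc_iff_abs_le _ _).2 (by simp))]
  · rw [sphInt_mul_left 0 0 l 0 (by simp) (by simp) _ hk]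
    simp only [Nat.cast_zero, neg_zero, Finset.Icc_self, Finset.sum_singleton]
    rw [wignerT_zero, one_mul, sphInt_g03 0 l 0 (by simp) (by simp)]
    simp only [Int.natAbs_zero, Nat.sub_zero, Nat.add_zero]
    rw [div_self (by positivity), div_self (by positivity), Real.sqrt_one]
    simp
  · intro μ hμ hne
    have hμ' := (mem_Icc_iff_abs_le _ _).1 hμ
    rw [sphInt_mul_left 0 0 l μ (by simp) hμ' _ hk]
    simp only [Nat.cast_zero, neg_zero, Finset.Icc_self, Finset.sum_singleton]
    rw [sphInt_g03_of_ne 0 0 l μ (by simp) hμ' s hne.symm]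
    simp

/-- `B` is, up to the weights, the row of the matrix of `f ↦ f ∘ g` that belongs to the constant
function. -/
lemma boostB_mul_wignerT {k a : SL2C} (hk : k ∈ SU2) (ha : a ∈ SU2) (e s : ℝ) (α : Idx) :
    boostB e s α.l 0 * wignerT α.l 0 α.m (a : Matrix (Fin 2) (Fin 2) ℂ) =
      2 * Complex.I * e * (dm α.l / wt α.l : ℝ) * sphInt 0 0 α.l α.m (k * g03 s * a) := by
  rw [sphInt_zero_kak _ _ α.abs_le hk ha, boostB_eq _ _ _ α.2.1]
  push_cast
  ring

lemma B_eq (e : ℝ) (g : SL2C) (α : Idx) :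
    B e g α = 2 * Complex.I * e * (dm α.l / wt α.l : ℝ) * sphInt 0 0 α.l α.m g := by
  obtain ⟨h1, _, h3, h4⟩ := isPolar_polar g
  rw [B, boostB_mul_wignerT h1 h3, ← h4]

theorem B_kak (e : ℝ) {k a : SL2C} (hk : k ∈ SU2) (ha : a ∈ SU2) (s : ℝ) (α : Idx) :
    B e (k * g03 s * a) α = boostB e s α.l 0 * A a (idx0 α.l α.2.1) α := by
  have h : A a (idx0 α.l α.2.1) α = wignerT α.l 0 α.m (a : Matrix (Fin 2) (Fin 2) ℂ) := by
    rw [A_SU2 ha]; exact if_pos rfl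
  rw [B_eq, ← boostB_mul_wignerT hk ha, h]

theorem B_g03 (e s : ℝ) (α : Idx) : B e (g03 s) α = boostB e s α.l α.m := by
  have h := B_kak e one_mem_SU2 one_mem_SU2 s α
  rw [one_mul, mul_one, A_one] at h
  rw [h]
  split_ifs with h1
  · have h2 : α.m = 0 := by rw [← h1]; rfl
    rw [h2, mul_one]
  · rw [mul_zero, boostB_of_ne]
    intro h2
    exact h1 (Subtype.ext (Prod.ext rfl h2.symm))

lemma eval_neg_legPoly (l : ℕ) (y : ℝ) : (legPoly l).eval (-y) = (-1) ^ l * (legPoly l).eval y := by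
  have h : ∀ n : ℕ, ∀ p : ℝ[X], derivative^[n] (p.comp (-X)) =
      (-1) ^ n * (derivative^[n] p).comp (-X) := by
    intro n
    induction n with
    | zero => simp
    | succ n ih =>
      intro p
      rw [Function.iterate_succ_apply, derivative_comp, Function.iterate_succ_apply]
      have h2 : derivative (-X : ℝ[X]) * (derivative p).comp (-X) = C (-1) * (derivative p).comp (-X) := by
        simp
      rw [h2, iterate_derivative_C_mul, ih]
      simp [pow_succ]
  have h1 : ((X ^ 2 - 1 : ℝ[X]) ^ l).comp (-X) = (X ^ 2 - 1) ^ l := by simp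
  have h2 := h l ((X ^ 2 - 1) ^ l)
  rw [h1] at h2
  have h3 := congrArg (eval y) h2
  simp only [eval_mul, eval_comp, eval_pow, eval_neg, eval_one, eval_X] at h3
  have h4 : ((-1 : ℝ)) ^ l * (-1) ^ l = 1 := by rw [← mul_pow]; simp
  rw [legPoly, eval_mul, eval_mul, h3, eval_C, eval_C]
  linear_combination -((1 / (2 ^ l * (l ! : ℝ))) * eval (-y) (derivative^[l] ((X ^ 2 - 1 : ℝ[X]) ^ l))) * h4

lemma boostInt_zero_neg (l : ℕ) (s : ℝ) : boostInt 0 l 0 (-s) = (-1) ^ l * boostInt 0 l 0 s := by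
  have h := intervalIntegral.integral_comp_neg (a := -1) (b := 1) (fun y => 
    ((1 - y ^ 2) / (Real.cosh (-s) + y * Real.sinh (-s))) ^ 0 *
    (legQ 0 0).eval y * (legQ l 0).eval (boostMap (-s) y))
  rw [neg_neg, ← boostInt] at h
  rw [← h, boostInt, ← intervalIntegral.integral_const_mul]
  refine intervalIntegral.integral_congr fun y _ => ?_
  have h2 : boostMap (-s) (-y) = -boostMap s y := by
    rw [boostMap, boostMap, Real.cosh_neg, Real.sinh_neg, ← neg_div]
    congr 1 <;> ring
  have h3 : (legQ l 0).eval (-boostMap s y) = (-1) ^ l * (legQ l 0).eval (boostMap s y) :=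
    eval_neg_legPoly l _
  have h4 : ∀ x, (legQ 0 0).eval x = 1 := by simp [legQ, legPoly]
  simp only [h2, h3, h4, pow_zero, one_mul]

theorem boostB_neg (e s : ℝ) (α : Idx) :
    boostB e s α.l α.m = (-1) ^ α.l * boostB e (-s) α.l α.m := by
  by_cases hm : α.m = 0
  · rw [hm, boostB_eq _ _ _ α.2.1, boostB_eq _ _ _ α.2.1, boostInt_zero_neg]
    have h4 : ((-1 : ℂ)) ^ α.l * (-1) ^ α.l = 1 := by rw [← mul_pow]; simp
    push_cast
    linear_combination -(Complex.I * e * (dm α.l / wt α.l) * (boostInt 0 α.l 0 s : ℂ)) * h4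
  · rw [boostB_of_ne _ _ _ _ hm, boostB_of_ne _ _ _ _ hm, mul_zero]

/-- The constant function contributes `B h` to the sum over all degrees, because its diagonal matrix
element is one. -/
theorem B_mul (e : ℝ) (g h : SL2C) (α : Idx) :
    HasSum (fun β : Idx => B e g β * A h β α) (B e (g * h) α - B e h α) := by
  obtain ⟨h1, _, h3, h4⟩ := isPolar_polar h
  have key := hasSum_sphInt_mul 0 0 α.l α.m (by simp) α.abs_le g h1 h3 (polar h).2.1
  rw [← h4] at key
  have key2 := (hasSum_option key).mul_left (2 * Complex.I * e * (dm α.l / wt α.l : ℝ))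
  have h00 : sphInt 0 0 0 0 g = 1 := by
    have : sphInt 0 0 0 0 g = sphInt 0 0 0 0 1 := by simp only [sphInt, sph_zero_zero]
    rw [this, sphInt_one 0 0 0 0 (by simp) (by simp)]
    simp
  simp only [oIdx, h00, Nat.cast_zero, mul_zero, zero_add, one_mul] at key2
  rw [mul_sub, ← B_eq, ← B_eq] at key2
  convert! key2 using 2 with γ
  rw [B_eq, A_eq_aMat, aMat, ← dm_mul_self]
  have e1 : (wt γ.l : ℂ) ≠ 0 := by exact_mod_cast (wt_pos γ.2.1).ne'
  push_cast
  field_simp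

theorem B_SU2 (e : ℝ) {a : SL2C} (ha : a ∈ SU2) (α : Idx) : B e a α = 0 := by
  have h := B_kak e one_mem_SU2 ha 0 α
  rw [g03_zero, one_mul, one_mul] at h
  rw [h, boostB]
  simp

theorem B_inv (e : ℝ) (g : SL2C) (α : Idx) :
    HasSum (fun β : Idx => B e g β * A g⁻¹ β α) (-B e g⁻¹ α) := by
  have h := B_mul e g g⁻¹ α
  rwa [mul_inv_cancel, B_SU2 e one_mem_SU2, zero_sub] at h

theorem B_kak_inv (e : ℝ) {k a : SL2C} (hk : k ∈ SU2) (ha : a ∈ SU2) (s : ℝ) (α : Idx) :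
    B e (k * g03 s * a)⁻¹ α = boostB e (-s) α.l 0 * A k⁻¹ (idx0 α.l α.2.1) α := by
  rw [← B_kak e (inv_mem_SU2 ha) (inv_mem_SU2 hk), ← g03_inv]
  congr 1
  group


/-! ### The generator of the boosts -/

lemma boostMap_zero (y : ℝ) : boostMap 0 y = y := by simp [boostMap]

lemma legQ_eq_zero {l m : ℕ} (h : l < m) : legQ l m = 0 :=
  iterate_derivative_eq_zero ((natDegree_legPoly_le l).trans_lt h)

/-- The normalization of the associated Legendre functions on `[-1, 1]`, up to `√2`. -/
def legNorm (l n : ℕ) : ℝ := Real.sqrt ((2 * l + 1) * ((l - n)! / (l + n)!))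

lemma legNorm_pos (l n : ℕ) : 0 < legNorm l n := by unfold legNorm; positivity

lemma legNorm_sq (l n : ℕ) : legNorm l n ^ 2 = (2 * l + 1) * ((l - n)! / (l + n)!) :=
  Real.sq_sqrt (by positivity)

lemma legNorm_eq (l n : ℕ) : legNorm l n = dm l * Real.sqrt ((l - n)! / (l + n)!) := by
  rw [legNorm, dm, Real.sqrt_mul (by positivity)]

lemma legNorm_succ_sq (l n : ℕ) (hn : n ≤ l) : legNorm (l + 1) n ^ 2 * ((2 * l + 1) * (l + 1 + n)) =
    legNorm l n ^ 2 * ((2 * l + 3) * (l + 1 - n)) := by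
  obtain ⟨k, rfl⟩ := Nat.exists_eq_add_of_le hn
  rw [legNorm_sq, legNorm_sq, show n + k + 1 - n = k + 1 by omega, show n + k - n = k by omega,
    show n + k + 1 + n = (n + k + n) + 1 by ring, Nat.factorial_succ, Nat.factorial_succ]
  push_cast
  have h1 : ((n + k + n)! : ℝ) ≠ 0 := by positivity
  have h2 : (n : ℝ) + k + n + 1 ≠ 0 := by positivity
  field_simp
  ring

lemma boostInt_at_zero {l l' n : ℕ} (hn : n ≤ l) (hn' : n ≤ l') :
    boostInt l l' n 0 = if l = l' then 2 / legNorm l n ^ 2 else 0 := by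
  have h := sphInt_g03_natCast l l' n hn hn' 0
  rw [g03_zero, sphInt_one _ _ _ _ (by simpa using hn) (by simpa using hn')] at h
  have p1 : 0 < Real.sqrt ((l - n)! / (l + n)!) := by positivity
  have p2 : 0 < Real.sqrt ((l' - n)! / (l' + n)!) := by positivity
  split_ifs with hl
  · subst hl
    rw [if_pos ⟨rfl, rfl⟩] at h
    have h' : (1 / (2 * l + 1) : ℝ) = 1 / 2 * Real.sqrt ((l - n)! / (l + n)!) *
      Real.sqrt ((l - n)! / (l + n)!) * boostInt l l n 0 := by
      apply Complex.ofReal_injective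
      rw [← h]
      push_cast
      rfl
    rw [mul_assoc (1 / 2 : ℝ), Real.mul_self_sqrt (by positivity)] at h'
    rw [eq_div_iff (by have := legNorm_pos l n; positivity), legNorm_sq]
    have h2 : (2 * l + 1 : ℝ) ≠ 0 := by positivity
    rw [div_eq_iff h2] at h'
    linear_combination -2 * h'
  · rw [if_neg (by tauto)] at h
    have h' : 0 = 1 / 2 * Real.sqrt ((l - n)! / (l + n)!) *
      Real.sqrt ((l' - n)! / (l' + n)!) * boostInt l l' n 0 := by exact_mod_cast h
    rcases mul_eq_zero.1 h'.symm with h3 | h3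
    · exact absurd h3 (by positivity)
    · exact h3

/-- The action of an infinitesimal boost on a Legendre function, integrated. -/
lemma integral_boostDeriv_at_zero (l l' n : ℕ) (hl' : 1 ≤ l') :
    (2 * (l' : ℝ) + 1) * ∫ y in (-1 : ℝ)..1, boostDeriv l l' n 0 y =
      (l' + 1) * (l' + n) * boostInt l (l' - 1) n 0 - l' * (l' + 1 - n) * boostInt l (l' + 1) n 0 := by
  obtain ⟨j, rfl⟩ : ∃ j, l' = j + 1 := ⟨l' - 1, by omega⟩
  have hc : ∀ (c : ℝ) (j : ℕ), IntervalIntegrable (fun y : ℝ => c *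
      (((1 - y ^ 2) / (Real.cosh 0 + y * Real.sinh 0)) ^ n *
      (legQ l n).eval y * (legQ j n).eval (boostMap 0 y))) volume (-1) 1 := fun c j =>
    ContinuousOn.intervalIntegrable_of_Icc (by norm_num)
      (continuousOn_const.mul (continuousOn_boostInt l j n 0))
  rw [Nat.add_sub_cancel, boostInt, boostInt, ← intervalIntegral.integral_const_mul,
    ← intervalIntegral.integral_const_mul, ← intervalIntegral.integral_const_mul,
    ← intervalIntegral.integral_sub (hc _ _) (hc _ _)]
  refine intervalIntegral.integral_congr fun y _ => ?_
  have h := congrArg (eval y) (legQ_boost j n)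
  simp only [eval_mul, eval_sub, eval_pow, eval_X, eval_one, eval_C] at h
  simp only [boostDeriv, boostMap_zero, Real.cosh_zero, Real.sinh_zero, mul_zero, add_zero, div_one]
  push_cast
  linear_combination ((1 - y ^ 2) ^ n * eval y (legQ l n)) * h

/-- The derivative at zero of the matrix element of a boost, in the form of the coefficients
`C_{l,m}`. -/
lemma boostEntry_deriv {l l' n : ℕ} (hl : 1 ≤ l) (hl' : 1 ≤ l') (hn : n ≤ l) (hn' : n ≤ l') :
    wt l / wt l' * (1 / 2 * legNorm l n * legNorm l' n) * ∫ y in (-1 : ℝ)..1, boostDeriv l l' n 0 y =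
    if l' = l + 1 then
      Real.sqrt (((l' : ℝ) ^ 2 - 1) / (4 * (l' : ℝ) ^ 2 - 1)) * Real.sqrt ((l' : ℝ) ^ 2 - (n : ℝ) ^ 2)
    else if l = l' + 1 then
      -(Real.sqrt (((l : ℝ) ^ 2 - 1) / (4 * (l : ℝ) ^ 2 - 1)) * Real.sqrt ((l : ℝ) ^ 2 - (n : ℝ) ^ 2))
    else 0 := by
  have h := integral_boostDeriv_at_zero l l' n hl'
  have e1 : boostInt l (l' - 1) n 0 = if l = l' - 1 then 2 / legNorm l n ^ 2 else 0 := by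
    by_cases hc : n ≤ l' - 1
    · exact boostInt_at_zero hn hc
    · rw [boostInt, legQ_eq_zero (by omega : l' - 1 < n), if_neg (by omega)]
      simp
  rw [e1, boostInt_at_zero hn (by omega : n ≤ l' + 1)] at h
  have w1 := wt_pos hl
  have w2 := wt_pos hl'
  have N1 := legNorm_pos l n
  have N2 := legNorm_pos l' n
  have hpos : (0 : ℝ) < 2 * l' + 1 := by positivity
  have hw : ∀ l : ℕ, wt l ^ 2 = (l : ℝ) * (l + 1) := fun l => Real.sq_sqrt (by positivity)
  -- Both sides are square roots of rational functions of `l` and `n`, so it suffices to compare the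
  -- squares.
  split_ifs with h1 h2
  · subst h1
    rw [if_pos (by omega), if_neg (by omega), mul_zero, sub_zero] at h
    rw [← Real.sqrt_mul' _ (by
      have : (n : ℝ) ≤ ((l + 1 : ℕ) : ℝ) := by exact_mod_cast hn'
      have h0 : (0 : ℝ) ≤ n := by positivity
      nlinarith)]
    have h3 : ∫ y in (-1 : ℝ)..1, boostDeriv l (l + 1) n 0 y =
      (((l + 1 : ℕ) : ℝ) + 1) * (((l + 1 : ℕ) : ℝ) + n) * (2 / legNorm l n ^ 2) /
        (2 * ((l + 1 : ℕ) : ℝ) + 1) := by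
      rw [eq_div_iff hpos.ne', mul_comm]; exact h
    symm
    rw [h3, Real.sqrt_eq_iff_mul_self_eq_of_pos]
    · have hs := legNorm_succ_sq l n hn
      have hl0 : (l : ℝ) ≠ 0 := by exact_mod_cast (by omega : l ≠ 0)
      have g1 := hw l
      have g2 := hw (l + 1)
      have g3 : legNorm (l + 1) n ^ 2 = legNorm l n ^ 2 * ((2 * l + 3) * (l + 1 - n)) /
        ((2 * l + 1) * (l + 1 + n)) := by
        rw [eq_div_iff (by positivity)]; exact hs
      have g4 : (4 * ((l + 1 : ℕ) : ℝ) ^ 2 - 1) = (2 * l + 1) * (2 * l + 3) := by push_cast; ring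
      rw [g4, ← pow_two, mul_pow, mul_pow, mul_pow, div_pow, div_pow, g1, g2, g3]
      push_cast
      have hx : (2 * (l : ℝ) + 1) ≠ 0 := by positivity
      have hy : (l : ℝ) + 1 + n ≠ 0 := by positivity
      have hz : (2 * ((l : ℝ) + 1) + 1) ≠ 0 := by positivity
      have hz' : (2 * (l : ℝ) + 3) ≠ 0 := by positivity
      field_simp
      ring
    · positivity
  · subst h2
    rw [if_neg (by omega), if_pos rfl, mul_zero, zero_sub] at h
    rw [← Real.sqrt_mul' _ (by
      have : (n : ℝ) ≤ ((l' + 1 : ℕ) : ℝ) := by exact_mod_cast hn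
      have h0 : (0 : ℝ) ≤ n := by positivity
      nlinarith)]
    have hc : (n : ℝ) ≤ l' := by exact_mod_cast hn'
    have h3 : ∫ y in (-1 : ℝ)..1, boostDeriv (l' + 1) l' n 0 y =
      -((l' : ℝ) * (l' + 1 - n) * (2 / legNorm (l' + 1) n ^ 2) / (2 * l' + 1)) := by
      rw [← neg_div, eq_div_iff hpos.ne', mul_comm, h]
    rw [h3, mul_neg]
    congr 1
    symm
    rw [Real.sqrt_eq_iff_mul_self_eq_of_pos]
    · have hs := legNorm_succ_sq l' n hn'
      have hl0 : (l' : ℝ) ≠ 0 := by exact_mod_cast (by omega : l' ≠ 0)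
      have g1 := hw l'
      have g2 := hw (l' + 1)
      have hm : (l' : ℝ) + 1 - n ≠ 0 := by linarith
      have g3 : legNorm l' n ^ 2 = legNorm (l' + 1) n ^ 2 * ((2 * l' + 1) * (l' + 1 + n)) /
        ((2 * l' + 3) * (l' + 1 - n)) := by
        rw [eq_div_iff (mul_ne_zero (by positivity) hm)]; exact hs.symm
      have g4 : (4 * ((l' + 1 : ℕ) : ℝ) ^ 2 - 1) = (2 * l' + 1) * (2 * l' + 3) := by push_cast; ring
      rw [g4, ← pow_two, mul_pow, mul_pow, mul_pow, div_pow, div_pow, g1, g2, g3]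
      push_cast
      have hx : (2 * (l' : ℝ) + 1) ≠ 0 := by positivity
      have hz' : (2 * (l' : ℝ) + 3) ≠ 0 := by positivity
      field_simp
      ring
    · have hm : 0 < (l' : ℝ) + 1 - n := by linarith
      have hl0 : (0 : ℝ) < l' := by exact_mod_cast (by omega : 0 < l')
      positivity
  · rw [if_neg (by omega), if_neg (by omega)] at h
    have h3 : ∫ y in (-1 : ℝ)..1, boostDeriv l l' n 0 y = 0 := by
      rcases mul_eq_zero.1 (h.trans (by ring)) with h4 | h4
      · exact absurd h4 hpos.ne'
      · exact h4
    rw [h3, mul_zero]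

theorem hasDerivAt_A_g03 (α β : Idx) :
    HasDerivAt (fun s : ℝ => A (g03 s) α β) ((boostGenerator α β : ℝ) : ℂ) 0 := by
  simp only [A_g03]
  refine HasDerivAt.ofReal_comp (f := boostEntry α.l α.m β.l β.m) ?_
  by_cases hm : α.m = β.m
  · have hb : |α.m| ≤ (β.l : ℤ) := by rw [hm]; exact β.abs_le
    have hf : boostEntry α.l α.m β.l β.m = fun s => wt α.l / wt β.l *
        (1 / 2 * legNorm α.l α.m.natAbs * legNorm β.l α.m.natAbs) * boostInt α.l β.l α.m.natAbs s := by
      funext s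
      rw [← hm, boostEntry_eq_boostInt _ _ _ α.abs_le hb, legNorm_eq, legNorm_eq]
      ring
    rw [hf]
    have hd := (hasDerivAt_boostInt α.l β.l α.m.natAbs 0).const_mul (wt α.l / wt β.l *
        (1 / 2 * legNorm α.l α.m.natAbs * legNorm β.l α.m.natAbs))
    have hn : α.m.natAbs ≤ α.l := by have := α.abs_le; rw [_root_.abs_le] at this; omega
    have hn' : α.m.natAbs ≤ β.l := by rw [_root_.abs_le] at hb; omega
    have hsq : ((α.m.natAbs : ℕ) : ℝ) ^ 2 = (α.m : ℝ) ^ 2 := by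
      rw [Nat.cast_natAbs, Int.cast_abs, sq_abs]
    rw [boostEntry_deriv α.2.1 β.2.1 hn hn', hsq] at hd
    rw [boostGenerator, if_pos hm, ← hm]
    exact hd
  · have hf : boostEntry α.l α.m β.l β.m = fun _ => 0 := by
      funext s; rw [boostEntry, if_neg hm]
    rw [hf, boostGenerator, if_neg hm]
    exact hasDerivAt_const _ _


/-! ### The norm of the cocycle -/

lemma height_g12 (θ : ℝ) (z : ℂ × ℂ) : height (act (g12 θ : SL2C) z) = height z := by
  have h1 : ∀ x : ℝ, Complex.normSq (Complex.exp (x * Complex.I)) = 1 := fun x => by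
    rw [Complex.normSq_eq_norm_sq, Complex.norm_exp_ofReal_mul_I, one_pow]
  have h2 : act (g12 θ : SL2C) z = (z.1 * Complex.exp (((θ / 2 : ℝ) : ℂ) * Complex.I),
      z.2 * Complex.exp (((-(θ / 2) : ℝ) : ℂ) * Complex.I)) := by
    rw [act_apply, g12_apply]; simp
  rw [height, height, nsq_act (g12_mem_SU2 θ), h2]
  simp only [map_mul, h1, mul_one]

/-- Functions of the height are orthogonal to the spherical harmonics of nonzero order. -/
lemma integral_conj_sph_mul_height (l : ℕ) (m : ℤ) (hm : |m| ≤ l) (h0 : m ≠ 0) (f : ℝ → ℝ) :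
    ∫ z, conj (sph l m z) * (f (height z) : ℂ) ∂sphMeasure = 0 := by
  have h1 := integral_act_SU2 (g12_mem_SU2 (Real.pi / m)) fun z => conj (sph l m z) * (f (height z) : ℂ)
  have hm0 : (m : ℂ) ≠ 0 := by exact_mod_cast h0
  have h2 : ∀ z, conj (sph l m (act (g12 (Real.pi / m) : SL2C) z)) *
      (f (height (act (g12 (Real.pi / m) : SL2C) z)) : ℂ) =
      -(conj (sph l m z) * (f (height z) : ℂ)) := by
    intro z
    rw [height_g12, sph_act l m hm (g12_mem_SU2 _),
      Finset.sum_eq_single_of_mem m ((mem_Icc_iff_abs_le _ _).2 hm)]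
    · rw [wignerT_g12 l m m hm hm, if_pos rfl]
      have h3 : Complex.exp (-((m : ℂ) * ((Real.pi / m : ℝ) : ℂ) * Complex.I)) = -1 := by
        rw [Complex.exp_neg, Complex.ofReal_div, Complex.ofReal_intCast, mul_div_cancel₀ _ hm0,
          Complex.exp_pi_mul_I]
        norm_num
      rw [h3]
      simp
    · intro μ hμ hne
      rw [wignerT_g12 l μ m ((mem_Icc_iff_abs_le _ _).1 hμ) hm, if_neg hne, mul_zero]
  simp only [h2] at h1
  rw [integral_neg] at h1
  exact self_eq_neg.1 h1.symm

lemma integral_conj_sph_zero_mul_height (l : ℕ) {f : ℝ → ℝ} (hf : ContinuousOn f (Set.Icc (-1) 1)) :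
    ∫ z, conj (sph l 0 z) * (f (height z) : ℂ) ∂sphMeasure =
      ((1 / 2 * ∫ y in (-1 : ℝ)..1, (legPoly l).eval y * f y : ℝ) : ℂ) := by
  rw [← integral_comp_height (f := fun y => (legPoly l).eval y * f y)
    ((legPoly l).continuous.continuousOn.mul hf), ← integral_complex_ofReal]
  refine integral_congr_ae ?_
  filter_upwards [ae_ne_zero] with z hz
  rw [sph_zero_order l hz, Complex.conj_ofReal, Complex.ofReal_mul]

lemma cosh_sub_mul_sinh_pos (s : ℝ) {y : ℝ} (hy : y ∈ Set.Icc (-1 : ℝ) 1) :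
    0 < Real.cosh s - y * Real.sinh s := by
  have := cosh_add_mul_sinh_pos (-s) hy
  rw [Real.cosh_neg, Real.sinh_neg] at this
  linarith

/-- The Jacobian of the boost on the sphere. -/
def boostJac (s y : ℝ) : ℝ := (1 / (Real.cosh s - y * Real.sinh s)) ^ 2

/-- The potential whose Laplacian is `1 - boostJac s`. -/
def boostLog (s y : ℝ) : ℝ := -Real.log (Real.cosh s - y * Real.sinh s)

lemma continuousOn_boostJac (s : ℝ) : ContinuousOn (boostJac s) (Set.Icc (-1) 1) := by
  unfold boostJac
  exact ContinuousOn.pow (ContinuousOn.div (by fun_prop) (by fun_prop) fun y hy =>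
    (cosh_sub_mul_sinh_pos s hy).ne') 2

lemma continuousOn_boostLog (s : ℝ) : ContinuousOn (boostLog s) (Set.Icc (-1) 1) := by
  unfold boostLog
  exact (ContinuousOn.log (by fun_prop) fun y hy => (cosh_sub_mul_sinh_pos s hy).ne').neg

lemma integral_legPoly_mul_boostJac (l : ℕ) (s : ℝ) :
    ∫ y in (-1 : ℝ)..1, (legPoly l).eval y * boostJac s y = boostInt 0 l 0 s := by
  have h := boostInt_neg_eq l 0 0 (-s)
  rw [neg_neg] at h
  rw [h]
  refine intervalIntegral.integral_congr fun y _ => ?_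
  have h4 : ∀ x, (legQ 0 0).eval x = 1 := by simp [legQ, legPoly]
  simp only [h4, boostJac, Real.cosh_neg, Real.sinh_neg, pow_zero, mul_one, one_mul, mul_neg,
    ← sub_eq_add_neg]
  rfl

lemma hasDerivAt_cosh_sub (s y : ℝ) :
    HasDerivAt (fun y => Real.cosh s - y * Real.sinh s) (-Real.sinh s) y := by
  simpa using ((hasDerivAt_id y).mul_const (Real.sinh s)).const_sub (Real.cosh s)

lemma hasDerivAt_boostLog (s : ℝ) {y : ℝ} (hy : y ∈ Set.Icc (-1 : ℝ) 1) :
    HasDerivAt (boostLog s) (Real.sinh s / (Real.cosh s - y * Real.sinh s)) y := by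
  have h := ((hasDerivAt_cosh_sub s y).log (cosh_sub_mul_sinh_pos s hy).ne').neg
  convert! h using 1
  ring

/-- Green's identity for a Legendre polynomial and the potential `boostLog`. -/
lemma boostInt_zero_eq_log (l : ℕ) (hl : 1 ≤ l) (s : ℝ) :
    boostInt 0 l 0 s = l * (l + 1) * ∫ y in (-1 : ℝ)..1, (legPoly l).eval y * boostLog s y := by
  have hcs := Real.cosh_sq s
  have hd : ∀ y ∈ Set.uIcc (-1 : ℝ) 1, HasDerivAt (fun y : ℝ => (1 - y ^ 2) *
      ((legPoly l).eval y * (Real.sinh s * (1 / (Real.cosh s - y * Real.sinh s))) -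
        (legQ l 1).eval y * boostLog s y))
      ((legPoly l).eval y - (legPoly l).eval y * boostJac s y +
        l * (l + 1) * ((legPoly l).eval y * boostLog s y)) y := by
    intro y hy
    rw [Set.uIcc_of_le (by norm_num)] at hy
    have hD := (cosh_sub_mul_sinh_pos s hy).ne'
    have h0 : HasDerivAt (fun y => (legPoly l).eval y) ((legQ l 1).eval y) y := hasDerivAt_legQ l 0 y
    have e1 : HasDerivAt (fun y : ℝ => 1 - y ^ 2) (-(2 * y)) y := by
      simpa using (hasDerivAt_pow 2 y).const_sub 1
    have e2 := ((hasDerivAt_const y (1 : ℝ)).div (hasDerivAt_cosh_sub s y) hD).const_mul (Real.sinh s)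
    convert! e1.mul ((h0.mul e2).sub ((hasDerivAt_legQ l 1 y).mul (hasDerivAt_boostLog s hy))) using 1
    have o1 := congrArg (eval y) (legQ_ode l 0)
    simp only [eval_mul, eval_sub, eval_add, eval_pow, eval_X, eval_one, eval_C] at o1
    rw [show legQ l 0 = legPoly l from rfl] at o1
    simp only [Pi.div_apply, Pi.mul_apply, Pi.sub_apply, boostJac]
    norm_num at o1 ⊢
    field_simp
    linear_combination (-(boostLog s y) * (Real.cosh s - y * Real.sinh s) ^ 2) * o1 + eval y (legPoly l) * hcs
  have i0 : IntervalIntegrable (fun y => (legPoly l).eval y) volume (-1) 1 :=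
    (legPoly l).continuous.intervalIntegrable _ _
  have i1 : IntervalIntegrable (fun y => (legPoly l).eval y * boostJac s y) volume (-1) 1 :=
    ContinuousOn.intervalIntegrable_of_Icc (by norm_num)
      ((legPoly l).continuous.continuousOn.mul (continuousOn_boostJac s))
  have i2 : IntervalIntegrable (fun y => (l : ℝ) * (l + 1) * ((legPoly l).eval y * boostLog s y))
      volume (-1) 1 :=
    ContinuousOn.intervalIntegrable_of_Icc (by norm_num)
      (continuousOn_const.mul ((legPoly l).continuous.continuousOn.mul (continuousOn_boostLog s)))
  have h := intervalIntegral.integral_eq_sub_of_hasDerivAt hd ((i0.sub i1).add i2)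
  rw [intervalIntegral.integral_add (i0.sub i1) i2, intervalIntegral.integral_sub i0 i1,
    intervalIntegral.integral_const_mul, integral_legPoly_mul_boostJac] at h
  obtain ⟨j, rfl⟩ : ∃ j, l = j + 1 := ⟨l - 1, by omega⟩
  rw [integral_legPoly_succ] at h
  norm_num at h ⊢
  linarith

lemma integral_boostLog {s : ℝ} (hs : s ≠ 0) :
    ∫ y in (-1 : ℝ)..1, boostLog s y = 2 - 2 * (s * (Real.cosh s / Real.sinh s)) := by
  have hsh : Real.sinh s ≠ 0 := Real.sinh_ne_zero.2 hs
  have hd : ∀ y ∈ Set.uIcc (-1 : ℝ) 1, HasDerivAt (fun y : ℝ => -(Real.cosh s - y * Real.sinh s) *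
      (boostLog s y + 1) / Real.sinh s) (boostLog s y) y := by
    intro y hy
    rw [Set.uIcc_of_le (by norm_num)] at hy
    have hD := (cosh_sub_mul_sinh_pos s hy).ne'
    convert! ((hasDerivAt_cosh_sub s y).neg.mul ((hasDerivAt_boostLog s hy).add_const 1)).div_const
      (Real.sinh s) using 1
    have h1 : (Real.cosh s - y * Real.sinh s) * (Real.sinh s / (Real.cosh s - y * Real.sinh s)) =
      Real.sinh s := by field_simp
    simp only [Pi.neg_apply]
    rw [eq_div_iff hsh]
    linear_combination h1
  have h := intervalIntegral.integral_eq_sub_of_hasDerivAt hd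
    (ContinuousOn.intervalIntegrable_of_Icc (by norm_num) (continuousOn_boostLog s))
  rw [h, boostLog, boostLog, one_mul, neg_one_mul, sub_neg_eq_add, Real.cosh_sub_sinh,
    Real.cosh_add_sinh, Real.log_exp, Real.log_exp, Real.cosh_eq]
  field_simp
  rw [Real.sinh_eq]
  ring

lemma integral_boostJac_mul_boostLog {s : ℝ} (hs : s ≠ 0) :
    ∫ y in (-1 : ℝ)..1, boostJac s y * boostLog s y = 2 * (s * (Real.cosh s / Real.sinh s)) - 2 := by
  have hsh : Real.sinh s ≠ 0 := Real.sinh_ne_zero.2 hs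
  have hd : ∀ y ∈ Set.uIcc (-1 : ℝ) 1, HasDerivAt (fun y : ℝ => (boostLog s y - 1) *
      (1 / (Real.cosh s - y * Real.sinh s)) / Real.sinh s) (boostJac s y * boostLog s y) y := by
    intro y hy
    rw [Set.uIcc_of_le (by norm_num)] at hy
    have hD := (cosh_sub_mul_sinh_pos s hy).ne'
    convert! (((hasDerivAt_boostLog s hy).sub_const 1).mul
      ((hasDerivAt_const y (1 : ℝ)).div (hasDerivAt_cosh_sub s y) hD)).div_const
      (Real.sinh s) using 1
    simp only [boostJac, Pi.div_apply]
    field_simp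
    ring
  have h := intervalIntegral.integral_eq_sub_of_hasDerivAt hd
    (ContinuousOn.intervalIntegrable_of_Icc (by norm_num)
      ((continuousOn_boostJac s).mul (continuousOn_boostLog s)))
  rw [h, boostLog, boostLog, one_mul, neg_one_mul, sub_neg_eq_add, Real.cosh_sub_sinh,
    Real.cosh_add_sinh, Real.log_exp, Real.log_exp, Real.cosh_eq, one_div, one_div, ← Real.exp_neg,
    ← Real.exp_neg, neg_neg]
  field_simp
  rw [Real.sinh_eq]
  ring

lemma inSpan_comp_height {f : ℝ → ℝ} (hf : ContinuousOn f (Set.Icc (-1) 1)) :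
    InSpan fun z => (f (height z) : ℂ) := by
  have h := inSpan_horiz_pow_mul 0 hf
  simpa only [pow_zero, one_mul] using h

/-- Up to the factor `4 e²` the norm of `B` is the energy of the potential `boostLog s`: up to
`2 i e` the components of `B` are those of `boostJac s`, divided by `√(l (l + 1))`. Parseval's identity turns the sum of their squares into
`∫ boostJac s · boostLog s` minus the product of the mean values. -/
lemma hasSum_norm_B_g03 (e : ℝ) {s : ℝ} (hs : s ≠ 0) :
    HasSum (fun α : Idx => ‖B e (g03 s) α‖ ^ 2)
      (8 * e ^ 2 * (s * (Real.cosh s / Real.sinh s) - 1)) := by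
  obtain ⟨hu, -⟩ := inSpan_comp_height (continuousOn_boostJac s)
  obtain ⟨hw, hw'⟩ := inSpan_comp_height (continuousOn_boostLog s)
  have key := hasSum_inner_mul_inner_of_mem orthonormal_yLp hw' (hu.toLp _)
  -- The components of a function of the height.
  have hcoef : ∀ {f : ℝ → ℝ} (hf : ContinuousOn f (Set.Icc (-1) 1))
      (hf2 : MemLp (fun z => (f (height z) : ℂ)) 2 sphMeasure) (j : Option Idx),
      inner ℂ (yLp j) (hf2.toLp _) = if (oIdx j).2 = 0 then ((dm (oIdx j).1 *
        (1 / 2 * ∫ y in (-1 : ℝ)..1, (legPoly (oIdx j).1).eval y * f y) : ℝ) : ℂ) else 0 := by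
    intro f hf hf2 j
    rw [yLp, inner_toLp]
    have e1 : ∀ z, conj (yFun j z) * (f (height z) : ℂ) = (dm (oIdx j).1 : ℂ) *
        (conj (sph (oIdx j).1 (oIdx j).2 z) * (f (height z) : ℂ)) := fun z => by
      rw [yFun, map_mul, Complex.conj_ofReal]; ring
    simp only [e1]
    rw [integral_const_mul]
    split_ifs with h0
    · rw [h0, integral_conj_sph_zero_mul_height _ hf, Complex.ofReal_mul (dm _)]
    · rw [integral_conj_sph_mul_height _ _ (oIdx_abs_le j) h0, mul_zero]
  have htot : inner ℂ (hu.toLp _) (hw.toLp _) =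
      ((s * (Real.cosh s / Real.sinh s) - 1 : ℝ) : ℂ) := by
    rw [inner_toLp]
    have e1 : ∀ z, conj (boostJac s (height z) : ℂ) * (boostLog s (height z) : ℂ) =
      ((boostJac s (height z) * boostLog s (height z) : ℝ) : ℂ) := fun z => by
        rw [Complex.conj_ofReal, Complex.ofReal_mul]
    simp only [e1]
    rw [integral_complex_ofReal, integral_comp_height (f := fun y => boostJac s y * boostLog s y)
      ((continuousOn_boostJac s).mul (continuousOn_boostLog s)), integral_boostJac_mul_boostLog hs]
    congr 1
    ring
  rw [htot] at key
  have key2 := hasSum_option key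
  -- The term of the constant function: the mean values are `1` and `1 - s coth s`.
  have hnone : inner ℂ (hu.toLp _) (yLp none) * inner ℂ (yLp none) (hw.toLp _) =
      ((1 - s * (Real.cosh s / Real.sinh s) : ℝ) : ℂ) := by
    rw [← inner_conj_symm, hcoef (continuousOn_boostJac s), hcoef (continuousOn_boostLog s)]
    have e0 : ∀ y : ℝ, (legPoly 0).eval y = 1 := by simp [legPoly]
    have e1 : boostInt 0 0 0 s = 2 := by
      simp only [boostInt, show ∀ y : ℝ, (legQ 0 0).eval y = 1 from e0]
      norm_num
    have e2 : dm 0 = 1 := by simp [dm]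
    have e3 : ∫ y in (-1 : ℝ)..1, boostJac s y = 2 := by
      have := integral_legPoly_mul_boostJac 0 s
      simpa only [e0, one_mul, e1] using this
    simp only [oIdx, if_true, e3, e2, e0, one_mul,
      integral_boostLog hs, Complex.conj_ofReal, ← Complex.ofReal_mul]
    congr 1
    ring
  rw [hnone, ← Complex.ofReal_sub] at key2
  -- `boostInt_zero_eq_log` gives the components of `boostLog s` from those of `boostJac s`.
  have hterm : ∀ α : Idx, inner ℂ (hu.toLp _) (yLp (some α)) * inner ℂ (yLp (some α)) (hw.toLp _) =
      ((if α.m = 0 then (dm α.l / wt α.l * (1 / 2 * boostInt 0 α.l 0 s)) ^ 2 else 0 : ℝ) : ℂ) := by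
    intro α
    rw [← inner_conj_symm, hcoef (continuousOn_boostJac s), hcoef (continuousOn_boostLog s)]
    by_cases h0 : α.m = 0
    · rw [if_pos (show (oIdx (some α)).2 = 0 from h0), if_pos (show (oIdx (some α)).2 = 0 from h0),
        if_pos h0, Complex.conj_ofReal, ← Complex.ofReal_mul, integral_legPoly_mul_boostJac]
      change ((dm α.l * (1 / 2 * boostInt 0 α.l 0 s) * (dm α.l * (1 / 2 * ∫ y in (-1 : ℝ)..1,
        (legPoly α.l).eval y * boostLog s y)) : ℝ) : ℂ) = _
      congr 1
      have hl := boostInt_zero_eq_log α.l α.2.1 s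
      have hw := wt_pos α.2.1
      have hw2 : (α.l : ℝ) * (α.l + 1) = wt α.l ^ 2 := by rw [wt, Real.sq_sqrt (by positivity)]
      rw [hw2] at hl
      set J := ∫ y in (-1 : ℝ)..1, (legPoly α.l).eval y * boostLog s y
      have hJ : J = boostInt 0 α.l 0 s / wt α.l ^ 2 := by
        rw [eq_div_iff (by positivity), hl]; ring
      rw [hJ]
      field_simp
    · rw [if_neg (show ¬(oIdx (some α)).2 = 0 from h0), if_neg h0]
      simp
  simp only [hterm] at key2
  have key3 := (Complex.hasSum_ofReal.1 key2).mul_left (4 * e ^ 2)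
  rw [show 8 * e ^ 2 * (s * (Real.cosh s / Real.sinh s) - 1) = 4 * e ^ 2 *
    (s * (Real.cosh s / Real.sinh s) - 1 - (1 - s * (Real.cosh s / Real.sinh s))) by ring]
  convert! key3 using 2 with α
  · rw [B_g03]
    split_ifs with h0
    · rw [h0, boostB_eq _ _ _ α.2.1, norm_mul, norm_mul, norm_mul, Complex.norm_I, Complex.norm_real,
        Complex.norm_real, Complex.norm_real, Real.norm_eq_abs, Real.norm_eq_abs, Real.norm_eq_abs,
        one_mul, mul_pow, mul_pow, sq_abs, sq_abs, sq_abs]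
      ring
    · rw [boostB_of_ne _ _ _ _ h0]; simp


/-! ### The one-particle space -/

/-- The space of square-summable families indexed by `(l, m)`. -/
abbrev OneParticle : Type := lp (fun _ : Idx => ℂ) 2

lemma memℓp_two_of_hasSum {x : Idx → ℂ} {a : ℝ} (h : HasSum (fun α => ‖x α‖ ^ 2) a) :
    Memℓp x 2 := by
  refine memℓp_gen ?_
  simpa using h.summable

lemma norm_sq_eq_of_hasSum {x : OneParticle} {a : ℝ} (h : HasSum (fun α => ‖x α‖ ^ 2) a) :
    ‖x‖ ^ 2 = a := by
  have h1 := lp.hasSum_norm (p := 2) (by norm_num) x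
  simp only [ENNReal.toReal_ofNat, Real.rpow_two] at h1
  exact h1.unique h

/-- The basis vector of `OneParticle` with index `α`. -/
def basisVec (α : Idx) : OneParticle := lp.single 2 α 1

lemma inner_basisVec (α : Idx) (x : OneParticle) : inner ℂ (basisVec α) x = x α := by
  rw [basisVec, lp.inner_single_left]
  simp

lemma hasSum_basisVec (x : OneParticle) : HasSum (fun α => x α • basisVec α) x := by
  have h := lp.hasSum_single (p := 2) (by norm_num) x
  convert! h using 2 with α
  rw [basisVec, ← lp.single_smul, smul_eq_mul, mul_one]

lemma orthonormal_basisVec : Orthonormal ℂ basisVec := by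
  rw [orthonormal_iff_ite]
  intro α β
  rw [inner_basisVec, basisVec]
  by_cases h : α = β
  · subst h; rw [lp.single_apply_self, if_pos rfl]
  · rw [lp.single_apply_ne _ _ _ h, if_neg h]

/-- The columns of the complex conjugate of the matrix `A g`. -/
def colA (g : SL2C) (β : Idx) : OneParticle :=
  ⟨fun α => conj (A g α β), memℓp_two_of_hasSum (a := 1) (by
    have h := A_unitary_left g β β
    rw [if_pos rfl] at h
    rw [← Complex.hasSum_ofReal]
    convert! h using 2 with α
    rw [RCLike.norm_conj, Complex.ofReal_pow, ← Complex.conj_mul'])⟩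

lemma colA_apply (g : SL2C) (β α : Idx) : colA g β α = conj (A g α β) := rfl

lemma orthonormal_colA (g : SL2C) : Orthonormal ℂ (colA g) := by
  rw [orthonormal_iff_ite]
  intro α β
  have h1 := lp.hasSum_inner (𝕜 := ℂ) (colA g α) (colA g β)
  have h2 := A_unitary_left g β α
  refine h1.unique ?_
  have h3 : (if α = β then (1 : ℂ) else 0) = if β = α then 1 else 0 := by simp only [eq_comm]
  rw [h3]
  convert! h2 using 2 with γ
  rw [RCLike.inner_apply, colA_apply, colA_apply, Complex.conj_conj]

/-- The isometry of the one-particle space with the matrix `conj (A g)`. -/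
def isoA (g : SL2C) : OneParticle →ₗᵢ[ℂ] OneParticle :=
  (orthonormal_colA g).orthogonalFamily.linearIsometry

lemma hasSum_isoA (g : SL2C) (x : OneParticle) : HasSum (fun β => x β • colA g β) (isoA g x) :=
  (orthonormal_colA g).orthogonalFamily.hasSum_linearIsometry x

lemma hasSum_isoA_apply (g : SL2C) (x : OneParticle) (α : Idx) :
    HasSum (fun β => conj (A g α β) * x β) (isoA g x α) := by
  have h := (hasSum_isoA g x).mapL (innerSL ℂ (basisVec α))
  simp only [innerSL_apply_apply, inner_smul_right, inner_basisVec] at h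
  convert! h using 2 with β
  rw [colA_apply, mul_comm]

lemma isoA_basisVec (g : SL2C) (β : Idx) : isoA g (basisVec β) = colA g β := by
  ext α
  have h := hasSum_isoA_apply g (basisVec β) α
  have h2 : HasSum (fun γ => conj (A g α γ) * basisVec β γ) (conj (A g α β)) := by
    have := hasSum_ite_eq β (conj (A g α β))
    convert! this using 2 with γ
    rw [basisVec]
    split_ifs with h
    · subst h; rw [lp.single_apply_self, mul_one]
    · rw [lp.single_apply_ne _ _ _ h, mul_zero]
  exact h.unique h2

lemma ext_basisVec {F : Type*} [NormedAddCommGroup F] [NormedSpace ℂ F] {S T : OneParticle →L[ℂ] F}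
    (h : ∀ β, S (basisVec β) = T (basisVec β)) : S = T := by
  ext x
  have h1 := (hasSum_basisVec x).mapL S
  have h2 := (hasSum_basisVec x).mapL T
  simp only [map_smul, h] at h1 h2
  exact h1.unique h2

lemma isoA_mul (g h : SL2C) (x : OneParticle) : isoA (g * h) x = isoA g (isoA h x) := by
  have : (isoA (g * h)).toContinuousLinearMap =
      (isoA g).toContinuousLinearMap ∘L (isoA h).toContinuousLinearMap := by
    refine ext_basisVec fun β => ?_
    change isoA (g * h) (basisVec β) = isoA g (isoA h (basisVec β))
    rw [isoA_basisVec, isoA_basisVec]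
    ext α
    refine HasSum.unique ?_ (hasSum_isoA_apply g (colA h β) α)
    have := (A_mul g h α β).map (starRingEnd ℂ) Complex.continuous_conj
    convert! this using 2 with γ
    simp [colA_apply]
  exact DFunLike.congr_fun this x

lemma isoA_one (x : OneParticle) : isoA 1 x = x := by
  have : (isoA 1).toContinuousLinearMap = ContinuousLinearMap.id ℂ _ := by
    refine ext_basisVec fun β => ?_
    change isoA 1 (basisVec β) = basisVec β
    rw [isoA_basisVec]
    ext α
    rw [colA_apply, A_one, basisVec]
    split_ifs with h
    · subst h; rw [lp.single_apply_self, map_one]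
    · rw [lp.single_apply_ne _ _ _ h, map_zero]
  exact DFunLike.congr_fun this x

/-- The unitary representation of `SL(2, ℂ)` on the one-particle space by the complex conjugates
of the matrices `A g`. -/
def repA : SL2C →* (OneParticle ≃ₗᵢ[ℂ] OneParticle) where
  toFun g := { (isoA g).toLinearMap with
    invFun := isoA g⁻¹
    left_inv := fun x => by
      change isoA g⁻¹ (isoA g x) = x
      rw [← isoA_mul, inv_mul_cancel, isoA_one]
    right_inv := fun x => by
      change isoA g (isoA g⁻¹ x) = x
      rw [← isoA_mul, mul_inv_cancel, isoA_one]
    norm_map' := (isoA g).norm_map }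
  map_one' := by ext1 x; exact isoA_one x
  map_mul' g h := by ext1 x; exact isoA_mul g h x

lemma repA_apply (g : SL2C) (x : OneParticle) : repA g x = isoA g x := rfl

lemma repA_mul_apply (g h : SL2C) (x : OneParticle) : repA (g * h) x = repA g (repA h x) :=
  isoA_mul g h x

lemma repA_one_apply (x : OneParticle) : repA 1 x = x := isoA_one x

lemma repA_apply_inv (g : SL2C) (x : OneParticle) : repA g (repA g⁻¹ x) = x := by
  rw [← repA_mul_apply, mul_inv_cancel, repA_one_apply]

lemma inner_repA_left (g : SL2C) (x y : OneParticle) :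
    inner ℂ (repA g x) y = inner ℂ x (repA g⁻¹ y) := by
  rw [← (repA g).inner_map_map x, repA_apply_inv]

/-- The orbits of a family of isometries are continuous if they are so for the vectors of a total
set: uniform limits of continuous maps are continuous. -/
lemma continuous_apply_of_dense {X E F : Type*} [TopologicalSpace X] [NormedAddCommGroup E]
    [NormedSpace ℂ E] [NormedAddCommGroup F] [NormedSpace ℂ F] {U : X → E →ₗᵢ[ℂ] F}
    {S : Set E} (hS : Dense (Submodule.span ℂ S : Set E))
    (h : ∀ x ∈ S, Continuous fun g => U g x) (x : E) : Continuous fun g => U g x := by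
  have h1 : ∀ y ∈ Submodule.span ℂ S, Continuous fun g => U g y := by
    intro y hy
    induction hy using Submodule.span_induction with
    | mem y hy => exact h y hy
    | zero => simpa using continuous_const
    | add y z _ _ hy hz => simp only [map_add]; exact hy.add hz
    | smul a y _ hy => simp only [map_smul]; exact hy.const_smul a
  refine continuous_of_uniform_approx_of_continuous fun u hu => ?_
  obtain ⟨ε, hε, hu⟩ := Metric.mem_uniformity_dist.1 hu
  obtain ⟨y, hy, hxy⟩ := Metric.mem_closure_iff.1 (hS x) ε hε
  refine ⟨fun g => U g y, h1 y hy, fun g => hu ?_⟩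
  rwa [(U g).dist_map]

lemma dense_span_basisVec : Dense (Submodule.span ℂ (Set.range basisVec) : Set OneParticle) := by
  intro x
  refine mem_closure_of_tendsto (hasSum_basisVec x) (Filter.Eventually.of_forall fun s => ?_)
  exact Submodule.sum_mem _ fun α _ => Submodule.smul_mem _ _ (Submodule.subset_span ⟨α, rfl⟩)

/-- A weakly continuous family of unitary operators is strongly continuous. -/
lemma continuous_repA (x : OneParticle) : Continuous fun g => repA g x := by
  refine continuous_apply_of_dense (U := fun g => (repA g).toLinearIsometry) dense_span_basisVec ?_ x
  rintro _ ⟨β, rfl⟩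
  change Continuous fun g => repA g (basisVec β)
  rw [continuous_iff_continuousAt]
  intro g₀
  rw [ContinuousAt, tendsto_iff_norm_sub_tendsto_zero]
  have hn : ‖basisVec β‖ = 1 := orthonormal_basisVec.1 β
  have hkey : ∀ g, ‖repA g (basisVec β) - repA g₀ (basisVec β)‖ =
      Real.sqrt (2 - 2 * (A (g₀⁻¹ * g) β β).re) := by
    intro g
    rw [← Real.sqrt_sq (norm_nonneg (_ - _))]
    congr 1
    rw [@norm_sub_sq ℂ, LinearIsometryEquiv.norm_map, LinearIsometryEquiv.norm_map, hn,
      ← inner_conj_symm, inner_repA_left, ← repA_mul_apply,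
      inner_basisVec, repA_apply, isoA_basisVec, colA_apply, Complex.conj_conj]
    simp only [RCLike.re_eq_complex_re]
    ring
  have hc : Continuous fun g : SL2C => Real.sqrt (2 - 2 * (A (g₀⁻¹ * g) β β).re) := by
    have h1 : Continuous fun g : SL2C => A (g₀⁻¹ * g) β β :=
      (continuous_A β β).comp (continuous_const.mul continuous_id)
    exact Real.continuous_sqrt.comp (continuous_const.sub (continuous_const.mul
      (Complex.continuous_re.comp h1)))
  simp only [hkey]
  have := hc.tendsto g₀
  simpa [A_one] using this

/-! ### The cocycle in the one-particle space -/

lemma B_eq_mul (e : ℝ) (g : SL2C) (α : Idx) : B e g α = e * B 1 g α := by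
  rw [B_eq, B_eq]; push_cast; ring

lemma exists_bVec_g03 (s : ℝ) : ∃ x : OneParticle, ∀ α, x α = B 1 (g03 s) α := by
  rcases eq_or_ne s 0 with rfl | hs
  · refine ⟨0, fun α => ?_⟩
    rw [g03_zero, B_SU2 1 one_mem_SU2]
    rfl
  · exact ⟨⟨fun α => B 1 (g03 s) α, memℓp_two_of_hasSum (hasSum_norm_B_g03 1 hs)⟩, fun α => rfl⟩

lemma conj_A_inv (g : SL2C) (α β : Idx) : conj (A g⁻¹ α β) = A g β α := by
  rw [A_inv, Complex.conj_conj]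

/-- The cocycle identity with `B = 0` on `SU(2)` gives `B (k g a) = B g · A a`, so that the
square-summability and the norm of `B` need to be known for boosts only. -/
lemma exists_bVec_kak {k a : SL2C} (hk : k ∈ SU2) (s : ℝ) :
    ∃ x y : OneParticle, (∀ α, x α = B 1 (k * g03 s * a) α - B 1 a α) ∧ (∀ α, y α = B 1 (g03 s) α) ∧
      x = repA a⁻¹ y := by
  obtain ⟨y, hy⟩ := exists_bVec_g03 s
  refine ⟨repA a⁻¹ y, y, fun α => ?_, hy, rfl⟩
  have h1 : B 1 (k * g03 s) = B 1 (g03 s) := by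
    funext β
    have h2 := B_mul 1 k (g03 s) β
    simp only [B_SU2 1 hk, zero_mul] at h2
    have := h2.unique hasSum_zero
    exact sub_eq_zero.1 this
  have h3 := B_mul 1 (k * g03 s) a α
  refine HasSum.unique (hasSum_isoA_apply a⁻¹ y α) ?_
  convert! h3 using 2 with β
  rw [h1, hy, conj_A_inv, mul_comm]

lemma exists_bVec (g : SL2C) : ∃ x : OneParticle, ∀ α, x α = B 1 g α := by
  obtain ⟨h1, _, h3, h4⟩ := isPolar_polar g
  obtain ⟨x, y, hx, -, -⟩ := exists_bVec_kak (a := (polar g).2.2) h1 (polar g).2.1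
  refine ⟨x, fun α => ?_⟩
  rw [hx, ← h4, B_SU2 1 h3, sub_zero]

/-- The vector `B(g)` for the charge one, as an element of the one-particle space. -/
def bVec (g : SL2C) : OneParticle := ⟨B 1 g, by
  obtain ⟨x, hx⟩ := exists_bVec g
  rw [← funext hx]
  exact x.2⟩

lemma bVec_apply (g : SL2C) (α : Idx) : bVec g α = B 1 g α := rfl

lemma norm_bVec_kak {k a : SL2C} (hk : k ∈ SU2) (ha : a ∈ SU2) (s : ℝ) :
    ‖bVec (k * g03 s * a)‖ = ‖bVec (g03 s)‖ := by
  obtain ⟨x, y, hx, hy, hxy⟩ := exists_bVec_kak (a := a) hk s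
  have e1 : bVec (k * g03 s * a) = x := by
    ext α; rw [hx, bVec_apply, B_SU2 1 ha, sub_zero]
  have e2 : bVec (g03 s) = y := by ext α; rw [hy, bVec_apply]
  rw [e1, e2, hxy, LinearIsometryEquiv.norm_map]

theorem hasSum_norm_B (e : ℝ) {k a : SL2C} (hk : k ∈ SU2) (ha : a ∈ SU2) {s : ℝ} (hs : s ≠ 0) :
    HasSum (fun α : Idx => ‖B e (k * g03 s * a) α‖ ^ 2)
      (8 * e ^ 2 * (s * (Real.cosh s / Real.sinh s) - 1)) := by
  have h1 : ‖bVec (g03 s)‖ ^ 2 = 8 * 1 ^ 2 * (s * (Real.cosh s / Real.sinh s) - 1) :=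
    norm_sq_eq_of_hasSum (hasSum_norm_B_g03 1 hs)
  have h2 := lp.hasSum_norm (p := 2) (by norm_num) (bVec (k * g03 s * a))
  simp only [ENNReal.toReal_ofNat, Real.rpow_two] at h2
  rw [norm_bVec_kak hk ha, h1] at h2
  have h3 := h2.mul_left (e ^ 2)
  rw [show 8 * e ^ 2 * (s * (Real.cosh s / Real.sinh s) - 1) =
    e ^ 2 * (8 * 1 ^ 2 * (s * (Real.cosh s / Real.sinh s) - 1)) by ring]
  convert! h3 using 2 with α
  rw [B_eq_mul, norm_mul, mul_pow, Complex.norm_real, Real.norm_eq_abs, sq_abs, bVec_apply]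

lemma bVec_mul (g h : SL2C) : bVec (g * h) = repA h⁻¹ (bVec g) + bVec h := by
  rw [← sub_eq_iff_eq_add]
  ext α
  refine HasSum.unique ?_ (hasSum_isoA_apply h⁻¹ (bVec g) α)
  convert! B_mul 1 g h α using 2 with β
  rw [conj_A_inv, mul_comm, bVec_apply]

lemma bVec_one : bVec 1 = 0 := by
  ext α
  rw [bVec_apply, B_SU2 1 one_mem_SU2]
  rfl

/-- The vector `conj (A g) (B g)` as an element of the one-particle space. -/
def vVec (g : SL2C) : OneParticle := repA g (bVec g)

lemma vVec_apply (g : SL2C) (α : Idx) : vVec g α = phaseShift g α :=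
  (hasSum_isoA_apply g (bVec g) α).tsum_eq.symm

lemma vVec_eq_neg (g : SL2C) : vVec g = -bVec g⁻¹ := by
  have h := bVec_mul g g⁻¹
  rw [mul_inv_cancel, bVec_one, inv_inv] at h
  exact eq_neg_of_add_eq_zero_left h.symm

/-- The vectors `vVec` form a cocycle for the representation `repA`. -/
lemma vVec_mul (g h : SL2C) : vVec (g * h) = vVec g + repA g (vVec h) := by
  rw [vVec, bVec_mul, map_add, repA_mul_apply, repA_mul_apply,
    repA_apply_inv, vVec, vVec]

lemma sphInt_zero_neg (l : ℕ) (m : ℤ) (hm : |m| ≤ l) (g : SL2C) :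
    sphInt 0 0 l (-m) g = (-1) ^ m.natAbs * conj (sphInt 0 0 l m g) := by
  rw [sphInt, sphInt, ← integral_conj, ← integral_const_mul]
  refine integral_congr_ae (Filter.Eventually.of_forall fun z => ?_)
  simp only [sph_zero_zero, map_one, one_mul]
  exact sph_neg l m hm _

/-- The change of sign of the order. -/
def negIdx : Idx ≃ Idx where
  toFun α := ⟨(α.l, -α.m), α.2.1, by rw [abs_neg]; exact α.2.2⟩
  invFun α := ⟨(α.l, -α.m), α.2.1, by rw [abs_neg]; exact α.2.2⟩
  left_inv α := Subtype.ext (Prod.ext rfl (neg_neg _))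
  right_inv α := Subtype.ext (Prod.ext rfl (neg_neg _))

lemma B_negIdx (g : SL2C) (α : Idx) : B 1 g (negIdx α) = -((-1) ^ α.m.natAbs * conj (B 1 g α)) := by
  rw [B_eq, B_eq]
  change 2 * Complex.I * ((1 : ℝ) : ℂ) * (dm α.l / wt α.l : ℝ) * sphInt 0 0 α.l (-α.m) g = _
  rw [sphInt_zero_neg _ _ α.abs_le]
  simp only [map_mul, Complex.conj_ofReal, Complex.conj_I, map_ofNat]
  ring

/-- The vectors `B g` lie in a real subspace on which the inner product is real. -/
lemma conj_inner_bVec (g h : SL2C) : conj (inner ℂ (bVec g) (bVec h)) = inner ℂ (bVec g) (bVec h) := by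
  have h1 := lp.hasSum_inner (𝕜 := ℂ) (bVec g) (bVec h)
  have h2 := h1.map (starRingEnd ℂ) Complex.continuous_conj
  refine h2.unique ?_
  rw [← negIdx.hasSum_iff]  at h1
  convert! h1 using 1
  funext α
  simp only [Function.comp_apply, RCLike.inner_apply, bVec_apply, B_negIdx, map_mul, map_neg, map_pow,
    map_one, Complex.conj_conj]
  have h4 : ((-1 : ℂ)) ^ α.m.natAbs * (-1) ^ α.m.natAbs = 1 := by rw [← mul_pow]; simp
  linear_combination -(conj (B 1 h α) * B 1 g α) * h4

lemma conj_inner_vVec (g h : SL2C) :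
    conj (inner ℂ (vVec g) (repA g (vVec h))) = inner ℂ (vVec g) (repA g (vVec h)) := by
  have h1 : repA g (vVec h) = vVec (g * h) - vVec g := by rw [vVec_mul, add_sub_cancel_left]
  rw [h1, inner_sub_right, map_sub]
  simp only [vVec_eq_neg, inner_neg_neg, conj_inner_bVec]

/-- A bound for the norm of the cocycle that is continuous in the group element and vanishes on
`SU(2)`. -/
lemma norm_bVec_sq_le (g : SL2C) : ‖bVec g‖ ^ 2 ≤
    4 * ((g : Matrix (Fin 2) (Fin 2) ℂ).conjTranspose * (g : Matrix (Fin 2) (Fin 2) ℂ)).trace.re - 8 := by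
  obtain ⟨hk, h0, ha, hg⟩ := isPolar_polar g
  generalize (polar g).1 = k at hk hg
  generalize (polar g).2.1 = s at h0 hg
  generalize (polar g).2.2 = a at ha hg
  subst hg
  -- The trace of `g* g` is `2 cosh s`, and `s coth s ≤ cosh s`.
  have htr : (((k * g03 s * a : SL2C) : Matrix (Fin 2) (Fin 2) ℂ).conjTranspose *
      ((k * g03 s * a : SL2C) : Matrix (Fin 2) (Fin 2) ℂ)).trace.re = 2 * Real.cosh s := by
    have hk' : (k : Matrix (Fin 2) (Fin 2) ℂ).conjTranspose * k = 1 := by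
      have := Matrix.mem_unitaryGroup_iff'.1 (show (k : Matrix (Fin 2) (Fin 2) ℂ) ∈ _ from hk)
      rwa [Matrix.star_eq_conjTranspose] at this
    have ha' : (a : Matrix (Fin 2) (Fin 2) ℂ) * (a : Matrix (Fin 2) (Fin 2) ℂ).conjTranspose = 1 := by
      have := Matrix.mem_unitaryGroup_iff.1 (show (a : Matrix (Fin 2) (Fin 2) ℂ) ∈ _ from ha)
      rwa [Matrix.star_eq_conjTranspose] at this
    rw [Matrix.SpecialLinearGroup.coe_mul, Matrix.SpecialLinearGroup.coe_mul,
      Matrix.conjTranspose_mul, Matrix.conjTranspose_mul, g03_conjTranspose]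
    generalize (k : Matrix (Fin 2) (Fin 2) ℂ) = k at *
    generalize (a : Matrix (Fin 2) (Fin 2) ℂ) = a at *
    have h3 : ∀ G : Matrix (Fin 2) (Fin 2) ℂ, (a.conjTranspose * (G * k.conjTranspose) * (k * G * a)) =
        a.conjTranspose * (G * (k.conjTranspose * k) * G) * a := by
      intro G; simp only [Matrix.mul_assoc]
    rw [h3, hk', Matrix.mul_one, Matrix.trace_mul_comm, ← Matrix.mul_assoc, ha', Matrix.one_mul,
      ← Matrix.SpecialLinearGroup.coe_mul, ← g03_add, g03_apply, show (s + s) / 2 = s by ring,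
      Matrix.trace_fin_two_of, Complex.add_re, Complex.ofReal_re, Complex.ofReal_re, Real.cosh_eq]
    ring
  rw [htr, norm_bVec_kak hk ha]
  rcases h0.eq_or_lt with h0 | h0
  · subst h0
    rw [g03_zero, bVec_one]
    simp
    norm_num
  · have h1 : ‖bVec (g03 s)‖ ^ 2 = 8 * 1 ^ 2 * (s * (Real.cosh s / Real.sinh s) - 1) :=
      norm_sq_eq_of_hasSum (hasSum_norm_B_g03 1 h0.ne')
    have h2 : s * (Real.cosh s / Real.sinh s) ≤ Real.cosh s := by
      have h3 := Real.self_le_sinh_iff.2 h0.le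
      have h4 : 0 < Real.sinh s := Real.sinh_pos_iff.2 h0
      rw [← mul_div_assoc, div_le_iff₀ h4]
      nlinarith [Real.cosh_pos s]
    rw [h1]
    linarith

/-- By the cocycle identity continuity is needed at the neutral element only, where the bound
`norm_bVec_sq_le` gives it. -/
lemma continuous_vVec : Continuous vVec := by
  rw [continuous_iff_continuousAt]
  intro g₀
  rw [ContinuousAt, tendsto_iff_norm_sub_tendsto_zero]
  have hb : ∀ g, ‖vVec g - vVec g₀‖ ≤ Real.sqrt (4 * (((g₀⁻¹ * g : SL2C) :
      Matrix (Fin 2) (Fin 2) ℂ).conjTranspose * ((g₀⁻¹ * g : SL2C) : Matrix (Fin 2) (Fin 2) ℂ)).trace.re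
        - 8) := by
    intro g
    have h1 : vVec g = vVec g₀ + repA g₀ (vVec (g₀⁻¹ * g)) := by
      rw [← vVec_mul, mul_inv_cancel_left]
    rw [h1, add_sub_cancel_left, LinearIsometryEquiv.norm_map, vVec, LinearIsometryEquiv.norm_map]
    exact Real.le_sqrt_of_sq_le (norm_bVec_sq_le _)
  refine squeeze_zero (fun _ => norm_nonneg _) hb ?_
  have hc : Continuous fun g : SL2C => Real.sqrt (4 * (((g₀⁻¹ * g : SL2C) :
      Matrix (Fin 2) (Fin 2) ℂ).conjTranspose * ((g₀⁻¹ * g : SL2C) : Matrix (Fin 2) (Fin 2) ℂ)).trace.re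
        - 8) := by
    have h0 : Continuous fun g : SL2C => ((g₀⁻¹ * g : SL2C) : Matrix (Fin 2) (Fin 2) ℂ) :=
      continuous_subtype_val.comp (continuous_const.mul continuous_id)
    exact Real.continuous_sqrt.comp ((continuous_const.mul (Complex.continuous_re.comp
      ((h0.matrix_conjTranspose.matrix_mul h0).matrix_trace))).sub continuous_const)
  have := hc.tendsto g₀
  convert! this using 2
  rw [inv_mul_cancel, Matrix.SpecialLinearGroup.coe_one]
  simp
  norm_num


/-! ### Coherent states -/

/-- The vectors `E n u` are coherent states: they are orthogonal for different `n`, have the inner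
products `exp (c ⟪u, w⟫)` for the same `n`, and span a dense subspace. -/
structure IsCoherent {K H : Type} [NormedAddCommGroup K] [InnerProductSpace ℂ K]
    [NormedAddCommGroup H] [InnerProductSpace ℂ H] (c : ℝ) (E : ℤ × K → H) : Prop where
  inner_eq : ∀ x y, inner ℂ (E x) (E y) =
    if x.1 = y.1 then Complex.exp (c * inner ℂ x.2 y.2) else 0
  dense : Dense (Submodule.span ℂ (Set.range E) : Set H)

/-- Positive semidefinite scalar kernels. -/
def IsPosKernel {X : Type} (k : X → X → ℂ) : Prop :=
  ∀ (s : Finset X) (a : X → ℂ), 0 ≤ (∑ x ∈ s, ∑ y ∈ s, conj (a x) * a y * k x y).re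

lemma isPosKernel_one {X : Type} : IsPosKernel fun _ _ : X => 1 := by
  intro s a
  have h : ∑ x ∈ s, ∑ y ∈ s, conj (a x) * a y * 1 = conj (∑ x ∈ s, a x) * ∑ x ∈ s, a x := by
    simp only [mul_one]
    rw [map_sum, Finset.sum_mul_sum]
  rw [h, Complex.conj_mul', ← Complex.ofReal_pow, Complex.ofReal_re]
  positivity

lemma IsPosKernel.of_hasSum {X ι : Type} {k : X → X → ℂ} {f : ι → X → X → ℂ}
    (hf : ∀ i, IsPosKernel (f i)) (h : ∀ x y, HasSum (fun i => f i x y) (k x y)) :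
    IsPosKernel k := by
  intro s a
  have h1 : HasSum (fun i => ∑ x ∈ s, ∑ y ∈ s, conj (a x) * a y * f i x y)
      (∑ x ∈ s, ∑ y ∈ s, conj (a x) * a y * k x y) :=
    hasSum_sum fun x _ => hasSum_sum fun y _ => (h x y).mul_left _
  exact (Complex.hasSum_re h1).nonneg fun i => hf i s a

/-- The product of a positive semidefinite kernel with a kernel given by feature maps. -/
lemma IsPosKernel.mul_of_hasSum {X ι : Type} {k k' : X → X → ℂ} (hk : IsPosKernel k) {f : ι → X → ℂ}
    (h : ∀ x y, HasSum (fun i => conj (f i x) * f i y) (k' x y)) :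
    IsPosKernel fun x y => k x y * k' x y := by
  refine IsPosKernel.of_hasSum (f := fun i x y => k x y * (conj (f i x) * f i y)) (fun i s a => ?_)
    fun x y => (h x y).mul_left _
  have := hk s fun x => a x * f i x
  refine this.trans_eq (congrArg Complex.re ?_)
  refine Finset.sum_congr rfl fun x _ => Finset.sum_congr rfl fun y _ => ?_
  rw [map_mul]
  ring

lemma IsPosKernel.const_mul {X : Type} {k : X → X → ℂ} (hk : IsPosKernel k) {r : ℝ} (hr : 0 ≤ r) :
    IsPosKernel fun x y => r * k x y := by
  intro s a
  have h : ∑ x ∈ s, ∑ y ∈ s, conj (a x) * a y * (r * k x y) =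
      r * ∑ x ∈ s, ∑ y ∈ s, conj (a x) * a y * k x y := by
    simp only [Finset.mul_sum]
    exact Finset.sum_congr rfl fun x _ => Finset.sum_congr rfl fun y _ => by ring
  rw [h, Complex.re_ofReal_mul]
  exact mul_nonneg hr (hk s a)

/-- The kernel of the coherent states. -/
def cohKernel (c : ℝ) (x y : ℤ × OneParticle) : ℂ :=
  if x.1 = y.1 then Complex.exp (c * inner ℂ x.2 y.2) else 0

/-- The kernel is a power series with nonnegative coefficients in the kernel `⟪x, y⟫`. -/
lemma isPosKernel_cohKernel {c : ℝ} (hc : 0 ≤ c) : IsPosKernel (cohKernel c) := by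
  have h1 : IsPosKernel fun x y : ℤ × OneParticle => if x.1 = y.1 then (1 : ℂ) else 0 := by
    have := isPosKernel_one.mul_of_hasSum (X := ℤ × OneParticle) (ι := ℤ)
      (k' := fun x y => if x.1 = y.1 then (1 : ℂ) else 0)
      (f := fun j x => if x.1 = j then 1 else 0) (fun x y => by
        have := hasSum_ite_eq x.1 (if x.1 = y.1 then (1 : ℂ) else 0)
        convert! this using 2 with j
        by_cases hj : j = x.1
        · subst hj; simp [eq_comm]
        · rw [if_neg (Ne.symm hj), if_neg hj, map_zero, zero_mul])
    simpa using this
  have h2 : ∀ j : ℕ, IsPosKernel fun x y : ℤ × OneParticle =>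
      (if x.1 = y.1 then (1 : ℂ) else 0) * inner ℂ x.2 y.2 ^ j := by
    intro j
    induction j with
    | zero => simpa using h1
    | succ j ih =>
      have := ih.mul_of_hasSum (k' := fun x y => inner ℂ x.2 y.2) (f := fun α x => x.2 α)
        fun x y => by
          convert! lp.hasSum_inner (𝕜 := ℂ) x.2 y.2 using 2 with α
          rw [RCLike.inner_apply, mul_comm]
      simpa only [pow_succ, mul_assoc] using this
  refine IsPosKernel.of_hasSum (ι := ℕ) (f := fun j x y => ((c ^ j / j ! : ℝ) : ℂ) *
    ((if x.1 = y.1 then (1 : ℂ) else 0) * inner ℂ x.2 y.2 ^ j))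
    (fun j => (h2 j).const_mul (by positivity)) fun x y => ?_
  rw [cohKernel]
  split_ifs with h
  · have := NormedSpace.expSeries_div_hasSum_exp ((c : ℂ) * inner ℂ x.2 y.2)
    rw [← Complex.exp_eq_exp_ℂ] at this
    convert! this using 2 with j
    push_cast
    rw [mul_pow]
    ring
  · simp

/-- The kernel of the coherent states with operator values. -/
def cohMatrix (c : ℝ) : Matrix (ℤ × OneParticle) (ℤ × OneParticle) (ℂ →L[ℂ] ℂ) :=
  Matrix.of fun x y => cohKernel c x y • ContinuousLinearMap.id ℂ ℂ

lemma conj_cohKernel (c : ℝ) (x y : ℤ × OneParticle) : conj (cohKernel c x y) = cohKernel c y x := by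
  rw [cohKernel, cohKernel]
  by_cases h : x.1 = y.1
  · rw [if_pos h, if_pos h.symm, ← Complex.exp_conj, map_mul, Complex.conj_ofReal, inner_conj_symm]
  · rw [if_neg h, if_neg (Ne.symm h), map_zero]

lemma posSemidef_cohMatrix {c : ℝ} (hc : 0 ≤ c) : (cohMatrix c).PosSemidef := by
  refine ((RKHS.posSemidef_tfae (K := cohMatrix c)).out 0 2).2 (And.intro ?_ fun a => ?_)
  · ext x y
    simp only [Matrix.conjTranspose_apply, cohMatrix, Matrix.of_apply, star_smul]
    rw [ContinuousLinearMap.star_eq_adjoint]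
    simp [conj_cohKernel, ContinuousLinearMap.adjoint_id]
  · have := isPosKernel_cohKernel hc a.support a
    convert! this using 1
    simp only [RCLike.re_eq_complex_re, Finsupp.sum]
    congr 1
    refine Finset.sum_congr rfl fun x _ => Finset.sum_congr rfl fun y _ => ?_
    simp only [cohMatrix, Matrix.of_apply, FunLike.coe_smul, Pi.smul_apply,
      ContinuousLinearMap.id_apply, RCLike.inner_apply, smul_eq_mul, map_mul, conj_cohKernel]
    ring

/-- For every `c ≥ 0` there are coherent states over the one-particle space. -/
theorem exists_isCoherent {c : ℝ} (hc : 0 ≤ c) :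
    ∃ (H : Type) (_ : NormedAddCommGroup H) (_ : InnerProductSpace ℂ H) (_ : CompleteSpace H)
      (E : ℤ × OneParticle → H), IsCoherent c E := by
  have : Fact (cohMatrix c).PosSemidef := ⟨posSemidef_cohMatrix hc⟩
  refine ⟨RKHS.OfKernel (cohMatrix c), inferInstance, inferInstance, inferInstance,
    fun x => RKHS.kerFun (RKHS.OfKernel (cohMatrix c)) x 1, fun x y => ?_, ?_⟩
  · rw [RKHS.kerFun_inner, RKHS.kerFun_apply, RKHS.OfKernel.kernel_ofKernel]
    simp only [cohMatrix, cohKernel, Matrix.of_apply]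
    split_ifs <;> simp
  · rw [Submodule.dense_iff_topologicalClosure_eq_top, eq_top_iff,
      ← RKHS.kerFun_dense (H := RKHS.OfKernel (cohMatrix c))]
    refine Submodule.topologicalClosure_mono (Submodule.span_le.2 ?_)
    rintro _ ⟨x, v, rfl⟩
    have : RKHS.kerFun (RKHS.OfKernel (cohMatrix c)) x v =
        v • RKHS.kerFun (RKHS.OfKernel (cohMatrix c)) x 1 := by
      rw [← map_smul, smul_eq_mul, mul_one]
    rw [this]
    exact Submodule.smul_mem _ _ (Submodule.subset_span ⟨x, rfl⟩)


/-! ### Unitary operators on coherent states -/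

section
variable {K H : Type} [NormedAddCommGroup K] [InnerProductSpace ℂ K]
  [NormedAddCommGroup H] [InnerProductSpace ℂ H]

/-- Two total families of vectors with the same Gram matrix are related by a unitary operator. -/
lemma exists_unitary_of_inner_eq [CompleteSpace H] {X : Type} {v w : X → H}
    (h : ∀ x y, inner ℂ (w x) (w y) = inner ℂ (v x) (v y))
    (hv : Dense (Submodule.span ℂ (Set.range v) : Set H))
    (hw : Dense (Submodule.span ℂ (Set.range w) : Set H)) :
    ∃ T : H ≃ₗᵢ[ℂ] H, ∀ x, T (v x) = w x := by
  have hd : ∀ v : X → H, Dense (Submodule.span ℂ (Set.range v) : Set H) →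
      DenseRange (Finsupp.linearCombination ℂ v) := by
    intro v hv
    rwa [← Finsupp.range_linearCombination, LinearMap.coe_range] at hv
  have hn : ∀ x, ‖Finsupp.linearCombination ℂ w (LinearEquiv.refl ℂ _ x)‖ =
      ‖Finsupp.linearCombination ℂ v x‖ := by
    intro x
    have h1 : inner ℂ (Finsupp.linearCombination ℂ w x) (Finsupp.linearCombination ℂ w x) =
        inner ℂ (Finsupp.linearCombination ℂ v x) (Finsupp.linearCombination ℂ v x) := by
      simp only [Finsupp.linearCombination_apply, Finsupp.sum, sum_inner, inner_sum, inner_smul_left,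
        inner_smul_right, h]
    rw [LinearEquiv.refl_apply, @norm_eq_sqrt_re_inner ℂ, @norm_eq_sqrt_re_inner ℂ, h1]
  refine ⟨LinearEquiv.extendOfIsometry (LinearEquiv.refl ℂ _) _ _ (hd v hv) (hd w hw) hn, fun x => ?_⟩
  have := LinearEquiv.extendOfIsometry_eq (LinearEquiv.refl ℂ _) _ _ (hd v hv) (hd w hw) hn
    (Finsupp.single x 1)
  simpa using this

variable {c : ℝ} {E : ℤ × K → H}

lemma IsCoherent.ext_unitary (hE : IsCoherent c E) {S T : H ≃ₗᵢ[ℂ] H} (h : ∀ x, S (E x) = T (E x)) :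
    S = T := by
  have : (S : H →L[ℂ] H) = T := by
    refine ContinuousLinearMap.ext_on hE.dense ?_
    rintro _ ⟨x, rfl⟩
    exact h x
  ext x
  exact DFunLike.congr_fun this x

/-- A vector is determined by its inner products with the coherent states. -/
lemma IsCoherent.ext_inner (hE : IsCoherent c E) {x y : H}
    (h : ∀ p, inner ℂ (E p) x = inner ℂ (E p) y) : x = y := by
  have : innerSL ℂ x = innerSL ℂ y := by
    refine ContinuousLinearMap.ext_on hE.dense ?_
    rintro _ ⟨p, rfl⟩
    simp only [innerSL_apply_apply]
    rw [← inner_conj_symm, h, inner_conj_symm]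
  refine ext_inner_right ℂ fun v => ?_
  simpa using DFunLike.congr_fun this v

lemma IsCoherent.continuous (hE : IsCoherent c E) (n : ℤ) : Continuous fun u => E (n, u) := by
  rw [continuous_iff_continuousAt]
  intro u₀
  rw [ContinuousAt, tendsto_iff_norm_sub_tendsto_zero]
  have h : ∀ u, ‖E (n, u) - E (n, u₀)‖ = Real.sqrt (Complex.exp (c * inner ℂ u u)
      - Complex.exp (c * inner ℂ u u₀) - Complex.exp (c * inner ℂ u₀ u)
      + Complex.exp (c * inner ℂ u₀ u₀)).re := by
    intro u
    rw [@norm_eq_sqrt_re_inner ℂ, inner_sub_sub_self]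
    simp only [hE.inner_eq, if_true]
    rfl
  simp only [h]
  have hc : Continuous fun u => Real.sqrt (Complex.exp (c * inner ℂ u u)
      - Complex.exp (c * inner ℂ u u₀) - Complex.exp (c * inner ℂ u₀ u)
      + Complex.exp (c * inner ℂ u₀ u₀)).re := by fun_prop
  have := hc.tendsto u₀
  simpa using this

/-- The factor by which the coherent state with the displaced label has to be multiplied for the
displacement to be isometric. -/
def transCoeff (c : ℝ) (R : K ≃ₗᵢ[ℂ] K) (d : ℤ → K) (x : ℤ × K) : ℂ :=
  Complex.exp (-(c * (inner ℂ (d x.1) (d x.1) / 2 + inner ℂ (d x.1) (R x.2))))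

/-- The shift of `n` by `k` and the affine transformation of the label `u`. -/
def transPt (k : ℤ) (R : K ≃ₗᵢ[ℂ] K) (d : ℤ → K) (x : ℤ × K) : ℤ × K := (x.1 + k, R x.2 + d x.1)

/-- The factor `transCoeff` makes the inner products invariant. -/
lemma IsCoherent.exists_trans [CompleteSpace H] (hE : IsCoherent c E) (k : ℤ) (R : K ≃ₗᵢ[ℂ] K)
    (d : ℤ → K) :
    ∃ T : H ≃ₗᵢ[ℂ] H, ∀ x, T (E x) = transCoeff c R d x • E (transPt k R d x) := by
  refine exists_unitary_of_inner_eq (fun x y => ?_) hE.dense ?_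
  · rw [inner_smul_left, inner_smul_right, hE.inner_eq, hE.inner_eq]
    have h1 : (transPt k R d x).1 = (transPt k R d y).1 ↔ x.1 = y.1 := by
      simp [transPt]
    by_cases h : x.1 = y.1
    · rw [if_pos h, if_pos (h1.2 h), transCoeff, transCoeff, ← Complex.exp_conj, ← Complex.exp_add,
        ← Complex.exp_add]
      congr 1
      simp only [transPt, map_neg, map_mul, map_add, Complex.conj_ofReal, map_div₀, inner_conj_symm,
        map_ofNat, inner_add_left, inner_add_right, LinearIsometryEquiv.inner_map_map, h]
      ring
    · rw [if_neg h, if_neg (h1.not.2 h), mul_zero, mul_zero]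
  · refine hE.dense.mono ?_
    rw [SetLike.coe_subset_coe, Submodule.span_le]
    rintro _ ⟨y, rfl⟩
    have h2 : transPt k R d (y.1 - k, R.symm (y.2 - d (y.1 - k))) = y := by
      simp [transPt]
    have h3 : (transCoeff c R d (y.1 - k, R.symm (y.2 - d (y.1 - k))))⁻¹ •
        (transCoeff c R d (y.1 - k, R.symm (y.2 - d (y.1 - k))) •
          E (transPt k R d (y.1 - k, R.symm (y.2 - d (y.1 - k))))) = E y := by
      rw [inv_smul_smul₀ (show transCoeff c R d _ ≠ 0 from Complex.exp_ne_zero _), h2]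
    rw [← h3]
    exact Submodule.smul_mem _ _ (Submodule.subset_span ⟨_, rfl⟩)

/-- The unitary operator with
`E (n, u) ↦ exp (-c (‖d n‖² / 2 + ⟪d n, R u⟫)) E (n + k, R u + d n)`. -/
def IsCoherent.trans [CompleteSpace H] (hE : IsCoherent c E) (k : ℤ) (R : K ≃ₗᵢ[ℂ] K)
    (d : ℤ → K) : H ≃ₗᵢ[ℂ] H := (hE.exists_trans k R d).choose

lemma inner_unitary_right (T : H ≃ₗᵢ[ℂ] H) (x y : H) : inner ℂ x (T y) = inner ℂ (T⁻¹ x) y := by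
  have h : T (T⁻¹ x) = x := T.apply_symm_apply x
  rw [← T.inner_map_map (T⁻¹ x) y, h]

variable [CompleteSpace H]

lemma IsCoherent.trans_apply (hE : IsCoherent c E) (k : ℤ) (R : K ≃ₗᵢ[ℂ] K) (d : ℤ → K) (x : ℤ × K) :
    hE.trans k R d (E x) = transCoeff c R d x • E (transPt k R d x) :=
  (hE.exists_trans k R d).choose_spec x

/-- The composition law: the phase factors cancel if the inner products of the displacements
are real. -/
lemma IsCoherent.trans_mul (hE : IsCoherent c E) (k k' : ℤ) (R R' : K ≃ₗᵢ[ℂ] K) (d d' : ℤ → K)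
    (h : ∀ n, conj (inner ℂ (d (n + k')) (R (d' n))) = inner ℂ (d (n + k')) (R (d' n))) :
    hE.trans k R d * hE.trans k' R' d' =
      hE.trans (k + k') (R * R') (fun n => d (n + k') + R (d' n)) := by
  refine hE.ext_unitary fun x => ?_
  rw [LinearIsometryEquiv.coe_mul, Function.comp_apply, hE.trans_apply, map_smul, hE.trans_apply,
    hE.trans_apply, smul_smul]
  congr 1
  · rw [transCoeff, transCoeff, transCoeff, ← Complex.exp_add]
    congr 1
    have h1 := h x.1
    rw [inner_conj_symm] at h1
    simp only [transPt, LinearIsometryEquiv.coe_mul, Function.comp_apply, map_add, inner_add_left,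
      inner_add_right, LinearIsometryEquiv.inner_map_map, h1]
    ring
  · simp only [transPt, LinearIsometryEquiv.coe_mul, Function.comp_apply, map_add]
    congr 2
    · ring
    · abel

lemma IsCoherent.trans_one (hE : IsCoherent c E) : hE.trans 0 1 (fun _ => 0) = 1 := by
  refine hE.ext_unitary fun x => ?_
  rw [hE.trans_apply]
  simp [transCoeff, transPt]

/-- The displacement of the inverse of `trans k R d`. -/
def invDispl (k : ℤ) (R : K ≃ₗᵢ[ℂ] K) (d : ℤ → K) (n : ℤ) : K := -R⁻¹ (d (n - k))

lemma IsCoherent.trans_inv (hE : IsCoherent c E) (k : ℤ) (R : K ≃ₗᵢ[ℂ] K) (d : ℤ → K) :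
    (hE.trans k R d)⁻¹ = hE.trans (-k) R⁻¹ (invDispl k R d) := by
  rw [inv_eq_iff_mul_eq_one]
  have hR : ∀ x, R (R⁻¹ x) = x := R.apply_symm_apply
  rw [hE.trans_mul _ _ _ _ _ _ fun n => by
    rw [invDispl, map_neg, hR, ← sub_eq_add_neg, inner_neg_right, map_neg, inner_conj_symm]]
  rw [← hE.trans_one, add_neg_cancel, mul_inv_cancel]
  congr 1
  funext n
  rw [invDispl, map_neg, hR, ← sub_eq_add_neg n, add_neg_cancel]

lemma IsCoherent.inner_trans (hE : IsCoherent c E) (k : ℤ) (R : K ≃ₗᵢ[ℂ] K) (d : ℤ → K) (n : ℤ)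
    (w : K) (x : H) :
    inner ℂ (E (n, w)) (hE.trans k R d x) =
      Complex.exp (-(c * (inner ℂ (invDispl k R d n) (invDispl k R d n) / 2
        + inner ℂ (R⁻¹ w) (invDispl k R d n)))) *
      inner ℂ (E (n - k, R⁻¹ w + invDispl k R d n)) x := by
  rw [inner_unitary_right, hE.trans_inv, hE.trans_apply, inner_smul_left, transCoeff, transPt,
    ← Complex.exp_conj, ← sub_eq_add_neg]
  simp only [map_neg, map_mul, map_add, Complex.conj_ofReal, map_div₀, inner_conj_symm,
        map_ofNat]

end


/-! ### The domain and the operators on it -/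

section
variable {K H : Type} [NormedAddCommGroup K] [InnerProductSpace ℂ K]
  [NormedAddCommGroup H] [InnerProductSpace ℂ H]

/-- The vectors `c⁺(v₁) ⋯ c⁺(v_q) E (n, u)`. A creation operator is the derivative of `E (n, u)` in
the label, which is written here as a Cauchy integral. -/
def coh (E : ℤ × K → H) (n : ℤ) : List K → K → H
  | [], u => E (n, u)
  | v :: vs, u => (2 * Real.pi * Complex.I : ℂ)⁻¹ •
      ∮ z in C(0, 1), (1 / z ^ 2) • coh E n vs (u + z • v)

variable {c : ℝ} {E : ℤ × K → H}

lemma continuous_one_div_circleMap_sq :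
    Continuous fun θ : ℝ => 1 / circleMap (0 : ℂ) 1 θ ^ 2 := by
  refine continuous_const.div₀ ((continuous_circleMap 0 1).pow 2) fun θ => pow_ne_zero 2 ?_
  exact circleMap_ne_center one_ne_zero

lemma IsCoherent.continuous_coh (hE : IsCoherent c E) (n : ℤ) (vs : List K) :
    Continuous (coh E n vs) := by
  induction vs with
  | nil => exact hE.continuous n
  | cons v vs ih =>
    refine Continuous.const_smul ?_ _
    refine intervalIntegral.continuous_parametric_intervalIntegral_of_continuous' ?_ _ _
    simp only [deriv_circleMap, Function.uncurry_def]
    refine Continuous.smul (((continuous_circleMap 0 1).comp continuous_snd).mul continuous_const) ?_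
    refine (continuous_one_div_circleMap_sq.comp continuous_snd).smul (ih.comp ?_)
    exact continuous_fst.add (((continuous_circleMap 0 1).comp continuous_snd).smul continuous_const)

variable [CompleteSpace H]

/-- Creation operators act on the functions `⟪E (m, w), ·⟫` by multiplication with `c ⟪w, v⟫`. -/
lemma IsCoherent.inner_coh (hE : IsCoherent c E) (m n : ℤ) (w : K) (vs : List K) (u : K) :
    inner ℂ (E (m, w)) (coh E n vs u) =
      if m = n then (vs.map fun v => (c : ℂ) * inner ℂ w v).prod * Complex.exp (c * inner ℂ w u)
      else 0 := by
  induction vs generalizing u with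
  | nil => simp [coh, hE.inner_eq]
  | cons v vs ih =>
    have hcont : Continuous fun θ : ℝ => deriv (circleMap 0 1) θ •
        ((1 / circleMap (0 : ℂ) 1 θ ^ 2) • coh E n vs (u + circleMap 0 1 θ • v)) := by
      simp only [deriv_circleMap]
      refine Continuous.smul ((continuous_circleMap 0 1).mul continuous_const) ?_
      refine continuous_one_div_circleMap_sq.smul ((hE.continuous_coh n vs).comp ?_)
      exact continuous_const.add ((continuous_circleMap 0 1).smul continuous_const)
    have h1 : inner ℂ (E (m, w)) (coh E n (v :: vs) u) = (2 * Real.pi * Complex.I : ℂ)⁻¹ •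
        ∮ z in C(0, 1), (1 / z ^ 2) • inner ℂ (E (m, w)) (coh E n vs (u + z • v)) := by
      rw [coh, inner_smul_right, smul_eq_mul]
      congr 1
      rw [circleIntegral, ← innerSL_apply_apply (𝕜 := ℂ), 
        ← ContinuousLinearMap.intervalIntegral_comp_comm _ (hcont.intervalIntegrable _ _)]
      simp only [map_smul, innerSL_apply_apply]
      rfl
    rw [h1]
    simp only [ih]
    by_cases h : m = n
    · simp only [if_pos h]
      have hd : Differentiable ℂ fun z : ℂ => (vs.map fun v => (c : ℂ) * inner ℂ w v).prod *
          Complex.exp (c * inner ℂ w (u + z • v)) := by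
        simp only [inner_add_right, inner_smul_right]
        fun_prop
      -- The Cauchy integral is the derivative at `z = 0` in the direction of `v`.
      have h3 : HasDerivAt (fun z : ℂ => (vs.map fun v => (c : ℂ) * inner ℂ w v).prod *
          Complex.exp (c * inner ℂ w (u + z • v)))
          ((vs.map fun v => (c : ℂ) * inner ℂ w v).prod *
            (Complex.exp (c * inner ℂ w (u + (0 : ℂ) • v)) * (c * (1 * inner ℂ w v)))) 0 := by
        simp only [inner_add_right, inner_smul_right]
        exact ((((hasDerivAt_id (0 : ℂ)).mul_const _).const_add _).const_mul _).cexp.const_mul _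
      have h4 := hd.differentiableOn.deriv_eq_smul_circleIntegral (c := 0) one_pos
      simp only [sub_zero] at h4
      rw [h4, inv_smul_smul₀ Complex.two_pi_I_ne_zero, h3.deriv, List.map_cons, List.prod_cons]
      simp only [zero_smul, add_zero]
      ring
    · simp [if_neg h, circleIntegral]

/-- The common domain of the operators. -/
def cohSpan (E : ℤ × K → H) : Submodule ℂ H :=
  Submodule.span ℂ (Set.range fun p : ℤ × List K × K => coh E p.1 p.2.1 p.2.2)

omit [CompleteSpace H] in
lemma coh_mem (n : ℤ) (vs : List K) (u : K) : coh E n vs u ∈ cohSpan E :=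
  Submodule.subset_span ⟨(n, vs, u), rfl⟩

end


section
variable {K H : Type} [NormedAddCommGroup K] [InnerProductSpace ℂ K]
  [NormedAddCommGroup H] [InnerProductSpace ℂ H] {c : ℝ} {E : ℤ × K → H}

/-- A linear relation that is single-valued and defined on all of `D` is the graph of an operator
on `D`. -/
lemma exists_linearMap_of_rel {D : Submodule ℂ H} {R : H → H → Prop}
    (huniq : ∀ x y z, R x y → R x z → y = z) (hadd : ∀ x y x' y', R x y → R x' y' → R (x + x') (y + y'))
    (hsmul : ∀ (a : ℂ) x y, R x y → R (a • x) (a • y)) (hex : ∀ x ∈ D, ∃ y ∈ D, R x y) :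
    ∃ T : D →ₗ[ℂ] D, ∀ x : D, R x (T x) := by
  choose! f hf hR using hex
  refine ⟨⟨⟨fun x => ⟨f x, hf x x.2⟩, fun x y => ?_⟩, fun a x => ?_⟩, fun x => hR x x.2⟩
  · exact Subtype.ext (huniq _ _ _ (hR _ (x + y).2) (hadd _ _ _ _ (hR _ x.2) (hR _ y.2)))
  · exact Subtype.ext (huniq _ _ _ (hR _ (a • x).2) (hsmul _ _ _ (hR _ x.2)))

/-- The vector `y` is the image of `x` under multiplication with `χ`: the function `p ↦ ⟪E p, y⟫` is
the product of `χ` and `p ↦ ⟪E p, x⟫`. -/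
def IsMul (E : ℤ × K → H) (χ : ℤ × K → ℂ) (x y : H) : Prop :=
  ∀ p, inner ℂ (E p) y = χ p * inner ℂ (E p) x

/-- The vector `y` is the derivative of `x` in the direction of `v`: the function
`(n, w) ↦ ⟪E (n, w), y⟫` is the derivative of `(n, w) ↦ ⟪E (n, w), x⟫` in the
direction of `v`. -/
def IsDer (E : ℤ × K → H) (v : K) (x y : H) : Prop :=
  ∀ n w, HasDerivAt (fun s : ℝ => inner ℂ (E (n, w + (s : ℂ) • v)) x) (inner ℂ (E (n, w)) y) 0

lemma IsMul.add {χ : ℤ × K → ℂ} {x y x' y' : H} (h : IsMul E χ x y) (h' : IsMul E χ x' y') :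
    IsMul E χ (x + x') (y + y') := fun p => by
  rw [inner_add_right, inner_add_right, h p, h' p, mul_add]

lemma IsMul.smul {χ : ℤ × K → ℂ} {x y : H} (a : ℂ) (h : IsMul E χ x y) :
    IsMul E χ (a • x) (a • y) := fun p => by
  rw [inner_smul_right, inner_smul_right, h p, mul_left_comm]

lemma IsMul.unique (hE : IsCoherent c E) {χ : ℤ × K → ℂ} {x y z : H} (h : IsMul E χ x y)
    (h' : IsMul E χ x z) : y = z := hE.ext_inner fun p => by rw [h p, h' p]

lemma IsDer.add {v : K} {x y x' y' : H} (h : IsDer E v x y) (h' : IsDer E v x' y') :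
    IsDer E v (x + x') (y + y') := fun n w => by
  simp only [inner_add_right]
  exact (h n w).add (h' n w)

lemma IsDer.smul {v : K} {x y : H} (a : ℂ) (h : IsDer E v x y) :
    IsDer E v (a • x) (a • y) := fun n w => by
  simp only [inner_smul_right]
  exact (h n w).const_mul a

lemma IsDer.zero (v : K) : IsDer E v 0 0 := fun n w => by
  simp only [inner_zero_right]
  exact hasDerivAt_const _ _

lemma IsDer.unique (hE : IsCoherent c E) {v : K} {x y z : H} (h : IsDer E v x y)
    (h' : IsDer E v x z) : y = z := hE.ext_inner fun p => (h p.1 p.2).unique (h' p.1 p.2)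

lemma hasDerivAt_inner_line (w v u : K) :
    HasDerivAt (fun s : ℝ => inner ℂ (w + (s : ℂ) • v) u) (inner ℂ v u) 0 := by
  simp only [inner_add_left, inner_smul_left, Complex.conj_ofReal]
  have := ((Complex.ofRealCLM.hasDerivAt (x := 0)).mul_const (inner ℂ v u)).const_add (inner ℂ w u)
  simpa using this

/-- The commutator of a derivative and a multiplication operator. -/
lemma IsDer.isMul {v u : K} {x y z z' : H} (h : IsDer E v x y)
    (hx : IsMul E (fun p => c * inner ℂ p.2 u) x z) (hy : IsMul E (fun p => c * inner ℂ p.2 u) y z') :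
    IsDer E v z (z' + (c * inner ℂ v u : ℂ) • x) := fun n w => by
  rw [inner_add_right, inner_smul_right, hy]
  have h1 := ((hasDerivAt_inner_line w v u).const_mul (c : ℂ)).mul (h n w)
  simp only [Complex.ofReal_zero, zero_smul, add_zero] at h1
  refine (h1.congr_of_eventuallyEq (Filter.Eventually.of_forall fun s => ?_)).congr_deriv ?_
  · exact hx _
  · ring

variable [CompleteSpace H]

lemma IsCoherent.isMul_coh (hE : IsCoherent c E) (n : ℤ) (v : K) (vs : List K) (u : K) :
    IsMul E (fun p => c * inner ℂ p.2 v) (coh E n vs u) (coh E n (v :: vs) u) := fun p => by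
  rw [hE.inner_coh p.1 n p.2, hE.inner_coh p.1 n p.2, List.map_cons, List.prod_cons]
  split_ifs
  · ring
  · ring

lemma IsCoherent.isMul_fst (hE : IsCoherent c E) (ψ : ℤ → ℂ) (n : ℤ) (vs : List K) (u : K) :
    IsMul E (fun p => ψ p.1) (coh E n vs u) (ψ n • coh E n vs u) := fun p => by
  rw [inner_smul_right, hE.inner_coh p.1 n p.2]
  split_ifs with h
  · beta_reduce; rw [h]
  · ring

lemma exists_isMul {χ : ℤ × K → ℂ} (h : ∀ n vs u, ∃ y ∈ cohSpan E, IsMul E χ (coh E n vs u) y) :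
    ∀ x ∈ cohSpan E, ∃ y ∈ cohSpan E, IsMul E χ x y := by
  intro x hx
  induction hx using Submodule.span_induction with
  | mem x hx => obtain ⟨⟨n, vs, u⟩, rfl⟩ := hx; exact h n vs u
  | zero => exact ⟨0, zero_mem _, fun p => by simp⟩
  | add x y _ _ hx hy =>
    obtain ⟨x', hx', h1⟩ := hx
    obtain ⟨y', hy', h2⟩ := hy
    exact ⟨x' + y', add_mem hx' hy', h1.add h2⟩
  | smul a x _ hx =>
    obtain ⟨x', hx', h1⟩ := hx
    exact ⟨a • x', Submodule.smul_mem _ _ hx', h1.smul a⟩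

lemma IsCoherent.exists_cre (hE : IsCoherent c E) (v : K) :
    ∃ T : cohSpan E →ₗ[ℂ] cohSpan E, ∀ x : cohSpan E, IsMul E (fun p => c * inner ℂ p.2 v) x (T x) :=
  exists_linearMap_of_rel (fun _ _ _ h h' => h.unique hE h') (fun _ _ _ _ h h' => h.add h')
    (fun a _ _ h => h.smul a)
    (exists_isMul fun n vs u => ⟨_, coh_mem n (v :: vs) u, hE.isMul_coh n v vs u⟩)

/-- The creation operator of the one-particle vector `v`. -/
def IsCoherent.cre (hE : IsCoherent c E) (v : K) : cohSpan E →ₗ[ℂ] cohSpan E :=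
  (hE.exists_cre v).choose

lemma IsCoherent.isMul_cre (hE : IsCoherent c E) (v : K) (x : cohSpan E) :
    IsMul E (fun p => c * inner ℂ p.2 v) (x : H) (hE.cre v x : H) := (hE.exists_cre v).choose_spec x

lemma IsCoherent.cre_coh (hE : IsCoherent c E) (v : K) (n : ℤ) (vs : List K) (u : K) :
    hE.cre v ⟨coh E n vs u, coh_mem n vs u⟩ = ⟨coh E n (v :: vs) u, coh_mem n _ u⟩ :=
  Subtype.ext ((hE.isMul_cre v _).unique hE (hE.isMul_coh n v vs u))

lemma IsCoherent.exists_num (hE : IsCoherent c E) (ψ : ℤ → ℂ) :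
    ∃ T : cohSpan E →ₗ[ℂ] cohSpan E, ∀ x : cohSpan E, IsMul E (fun p => ψ p.1) x (T x) :=
  exists_linearMap_of_rel (fun _ _ _ h h' => h.unique hE h') (fun _ _ _ _ h h' => h.add h')
    (fun a _ _ h => h.smul a)
    (exists_isMul fun n vs u => ⟨_, Submodule.smul_mem _ _ (coh_mem n vs u), hE.isMul_fst ψ n vs u⟩)

/-- The operator with the eigenvalues `ψ n` on the vectors with label `n`. -/
def IsCoherent.num (hE : IsCoherent c E) (ψ : ℤ → ℂ) : cohSpan E →ₗ[ℂ] cohSpan E :=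
  (hE.exists_num ψ).choose

lemma IsCoherent.isMul_num (hE : IsCoherent c E) (ψ : ℤ → ℂ) (x : cohSpan E) :
    IsMul E (fun p => ψ p.1) (x : H) (hE.num ψ x : H) := (hE.exists_num ψ).choose_spec x

lemma cohSpan_induction {P : cohSpan E → Prop} (coh : ∀ n vs u, P ⟨coh E n vs u, coh_mem n vs u⟩)
    (zero : P 0) (add : ∀ x y, P x → P y → P (x + y)) (smul : ∀ (a : ℂ) x, P x → P (a • x))
    (x : cohSpan E) : P x := by
  obtain ⟨x, hx⟩ := x
  induction hx using Submodule.span_induction with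
  | mem x hx => obtain ⟨⟨n, vs, u⟩, rfl⟩ := hx; exact coh n vs u
  | zero => exact zero
  | add x y hx hy h1 h2 => exact add ⟨x, hx⟩ ⟨y, hy⟩ h1 h2
  | smul a x hx h1 => exact smul a ⟨x, hx⟩ h1

/-- Induction over the vectors obtained from coherent states by creation operators. -/
lemma IsCoherent.induction_cre (hE : IsCoherent c E) {P : cohSpan E → Prop}
    (base : ∀ n u, P ⟨E (n, u), coh_mem n [] u⟩) (cre : ∀ v x, P x → P (hE.cre v x))
    (zero : P 0) (add : ∀ x y, P x → P y → P (x + y)) (smul : ∀ (a : ℂ) x, P x → P (a • x))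
    (x : cohSpan E) : P x := by
  refine cohSpan_induction (fun n vs u => ?_) zero add smul x
  induction vs with
  | nil => exact base n u
  | cons v vs ih => rw [← hE.cre_coh]; exact cre v _ ih

omit [CompleteSpace H] in
lemma IsCoherent.isDer_coh (hE : IsCoherent c E) (v : K) (n : ℤ) (u : K) :
    IsDer E v (E (n, u)) ((c * inner ℂ v u : ℂ) • E (n, u)) := fun m w => by
  rw [inner_smul_right]
  simp only [hE.inner_eq]
  split_ifs with h
  · have h1 := ((hasDerivAt_inner_line w v u).const_mul (c : ℂ)).cexp
    simp only [Complex.ofReal_zero, zero_smul, add_zero] at h1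
    exact h1.congr_deriv (by ring)
  · rw [mul_zero]; exact hasDerivAt_const _ _

/-- A finite sum `∑ ⟪v, a⟫ y` over the pairs `(a, y)` in a list. -/
def antilin (l : List (K × cohSpan E)) (v : K) : cohSpan E :=
  (l.map fun p => (inner ℂ v p.1 : ℂ) • p.2).sum

/-- The derivatives of a vector of the domain in all directions exist in the domain, and they are
antilinear of finite rank in the direction. -/
lemma IsCoherent.exists_antilin (hE : IsCoherent c E) (x : cohSpan E) :
    ∃ l : List (K × cohSpan E), ∀ v, IsDer E v (x : H) (antilin l v : H) := by
  induction x using hE.induction_cre with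
  | base n u =>
    refine ⟨[((c : ℂ) • u, ⟨E (n, u), coh_mem n [] u⟩)], fun v => ?_⟩
    have := hE.isDer_coh v n u
    simpa [antilin, inner_smul_right] using this
  | cre u x ih =>
    obtain ⟨l, hl⟩ := ih
    refine ⟨((c : ℂ) • u, x) :: l.map fun p => (p.1, hE.cre u p.2), fun v => ?_⟩
    have h1 := (hl v).isMul (hE.isMul_cre u x) (hE.isMul_cre u _)
    have h2 : antilin (((c : ℂ) • u, x) :: l.map fun p => (p.1, hE.cre u p.2)) v =
        hE.cre u (antilin l v) + (c * inner ℂ v u : ℂ) • x := by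
      simp only [antilin, List.map_cons, List.sum_cons, List.map_map, map_list_sum, inner_smul_right,
        Function.comp_def, map_smul]
      rw [add_comm]
    rw [h2]
    exact h1
  | zero => exact ⟨[], fun v => IsDer.zero v⟩
  | add x y hx hy =>
    obtain ⟨l, hl⟩ := hx
    obtain ⟨l', hl'⟩ := hy
    refine ⟨l ++ l', fun v => ?_⟩
    have : antilin (l ++ l') v = antilin l v + antilin l' v := by simp [antilin]
    rw [this]
    exact (hl v).add (hl' v)
  | smul a x hx =>
    obtain ⟨l, hl⟩ := hx
    refine ⟨l.map fun p => (p.1, a • p.2), fun v => ?_⟩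
    have : antilin (l.map fun p => (p.1, a • p.2)) v = a • antilin l v := by
      simp only [antilin, List.map_map, Function.comp_def, List.smul_sum, smul_comm _ a]
    rw [this]
    exact (hl v).smul a

lemma IsCoherent.exists_ann (hE : IsCoherent c E) (v : K) :
    ∃ T : cohSpan E →ₗ[ℂ] cohSpan E, ∀ x : cohSpan E, IsDer E v x (T x) :=
  exists_linearMap_of_rel (fun _ _ _ h h' => h.unique hE h') (fun _ _ _ _ h h' => h.add h')
    (fun a _ _ h => h.smul a) fun x hx => by
      obtain ⟨l, hl⟩ := hE.exists_antilin ⟨x, hx⟩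
      exact ⟨antilin l v, (antilin l v).2, hl v⟩

/-- The annihilation operator of the one-particle vector `v`. -/
def IsCoherent.ann (hE : IsCoherent c E) (v : K) : cohSpan E →ₗ[ℂ] cohSpan E :=
  (hE.exists_ann v).choose

lemma IsCoherent.isDer_ann (hE : IsCoherent c E) (v : K) (x : cohSpan E) :
    IsDer E v (x : H) (hE.ann v x : H) := (hE.exists_ann v).choose_spec x

lemma IsCoherent.exists_ann_eq (hE : IsCoherent c E) (x : cohSpan E) :
    ∃ l : List (K × cohSpan E), ∀ v, hE.ann v x = antilin l v := by
  obtain ⟨l, hl⟩ := hE.exists_antilin x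
  exact ⟨l, fun v => Subtype.ext ((hE.isDer_ann v x).unique hE (hl v))⟩

/-! ### The commutation relations -/

lemma IsCoherent.cre_cre (hE : IsCoherent c E) (v u : K) (x : cohSpan E) :
    hE.cre v (hE.cre u x) = hE.cre u (hE.cre v x) :=
  Subtype.ext (hE.ext_inner fun p => by
    rw [hE.isMul_cre, hE.isMul_cre, hE.isMul_cre, hE.isMul_cre]; ring)

lemma IsCoherent.num_cre (hE : IsCoherent c E) (ψ : ℤ → ℂ) (u : K) (x : cohSpan E) :
    hE.num ψ (hE.cre u x) = hE.cre u (hE.num ψ x) :=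
  Subtype.ext (hE.ext_inner fun p => by
    rw [hE.isMul_num, hE.isMul_cre, hE.isMul_cre, hE.isMul_num]; ring)

lemma IsCoherent.num_ann (hE : IsCoherent c E) (ψ : ℤ → ℂ) (v : K) (x : cohSpan E) :
    hE.num ψ (hE.ann v x) = hE.ann v (hE.num ψ x) := by
  refine Subtype.ext (IsDer.unique hE (v := v) (x := hE.num ψ x) (fun n w => ?_) (hE.isDer_ann v _))
  rw [hE.isMul_num]
  simp only [hE.isMul_num ψ x _]
  exact (hE.isDer_ann v x n w).const_mul _

/-- The product rule, for the derivative `c(v)` and the multiplication operator `c⁺(u)`. -/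
lemma IsCoherent.ann_cre (hE : IsCoherent c E) (v u : K) (x : cohSpan E) :
    hE.ann v (hE.cre u x) = hE.cre u (hE.ann v x) + (c * inner ℂ v u : ℂ) • x :=
  Subtype.ext ((hE.isDer_ann v _).unique hE
    ((hE.isDer_ann v x).isMul (hE.isMul_cre u x) (hE.isMul_cre u _)))

lemma IsCoherent.cre_add (hE : IsCoherent c E) (v u : K) (x : cohSpan E) :
    hE.cre (v + u) x = hE.cre v x + hE.cre u x :=
  Subtype.ext (hE.ext_inner fun p => by
    rw [Submodule.coe_add, inner_add_right, hE.isMul_cre, hE.isMul_cre, hE.isMul_cre]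
    beta_reduce
    rw [inner_add_right]
    ring)

lemma IsCoherent.cre_smul (hE : IsCoherent c E) (a : ℂ) (v : K) (x : cohSpan E) :
    hE.cre (a • v) x = a • hE.cre v x :=
  Subtype.ext (hE.ext_inner fun p => by
    rw [Submodule.coe_smul, inner_smul_right, hE.isMul_cre, hE.isMul_cre]
    beta_reduce
    rw [inner_smul_right]
    ring)

lemma IsCoherent.ann_add (hE : IsCoherent c E) (v u : K) (x : cohSpan E) :
    hE.ann (v + u) x = hE.ann v x + hE.ann u x := by
  obtain ⟨l, hl⟩ := hE.exists_ann_eq x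
  simp only [hl, antilin, inner_add_left, add_smul, List.sum_map_add]

lemma IsCoherent.ann_smul (hE : IsCoherent c E) (a : ℂ) (v : K) (x : cohSpan E) :
    hE.ann (a • v) x = conj a • hE.ann v x := by
  obtain ⟨l, hl⟩ := hE.exists_ann_eq x
  simp only [hl, antilin, inner_smul_left, mul_smul, List.smul_sum, List.map_map, Function.comp_def]

end


/-! ### The transformation of the operators -/

section
variable {K H : Type} [NormedAddCommGroup K] [InnerProductSpace ℂ K]
  [NormedAddCommGroup H] [InnerProductSpace ℂ H] {c : ℝ} {E : ℤ × K → H} [CompleteSpace H]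

lemma IsMul.trans (hE : IsCoherent c E) (k : ℤ) (R : K ≃ₗᵢ[ℂ] K) (d : ℤ → K) {χ : ℤ × K → ℂ}
    {x y : H} (h : IsMul E χ x y) :
    IsMul E (fun p => χ (p.1 - k, R⁻¹ p.2 + invDispl k R d p.1)) (hE.trans k R d x)
      (hE.trans k R d y) := fun p => by
  rw [hE.inner_trans k R d p.1 p.2, hE.inner_trans k R d p.1 p.2, h]
  ring

/-- The transformation of a creation operator. It is stated for `IsMul`, since the invariance of the
domain, which is needed to apply `cre` to a transformed vector, is derived from it. -/
lemma IsMul.trans_cre (hE : IsCoherent c E) (k : ℤ) (R : K ≃ₗᵢ[ℂ] K) (d : ℤ → K) {v : K}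
    {x y : H} (h : IsMul E (fun p => c * inner ℂ p.2 v) x y) (z : cohSpan E)
    (hz : hE.trans k R d x = z) :
    hE.trans k R d y = hE.cre (R v) z + hE.num (fun n => c * inner ℂ (invDispl k R d n) v) z := by
  refine hE.ext_inner fun p => ?_
  have hR : inner ℂ (R⁻¹ p.2) v = inner ℂ p.2 (R v) := (inner_unitary_right R p.2 v).symm
  rw [h.trans hE k R d p, inner_add_right, hE.isMul_cre, hE.isMul_num, hz]
  beta_reduce
  rw [inner_add_left, hR]
  ring

lemma IsCoherent.trans_mem (hE : IsCoherent c E) (k : ℤ) (R : K ≃ₗᵢ[ℂ] K) (d : ℤ → K)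
    (x : cohSpan E) : hE.trans k R d x ∈ cohSpan E := by
  induction x using hE.induction_cre with
  | base n u =>
    rw [hE.trans_apply]
    exact Submodule.smul_mem _ _ (coh_mem _ [] _)
  | cre v x ih =>
    rw [(hE.isMul_cre v x).trans_cre hE k R d ⟨_, ih⟩ rfl]
    exact add_mem (Submodule.coe_mem _) (Submodule.coe_mem _)
  | zero => simp
  | add x y hx hy => rw [Submodule.coe_add, map_add]; exact add_mem hx hy
  | smul a x hx => rw [Submodule.coe_smul, map_smul]; exact Submodule.smul_mem _ _ hx

lemma IsCoherent.trans_cre (hE : IsCoherent c E) (k : ℤ) (R : K ≃ₗᵢ[ℂ] K) (d : ℤ → K) (v : K)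
    (x z : cohSpan E) (hz : hE.trans k R d x = z) :
    hE.trans k R d (hE.cre v x) =
      hE.cre (R v) z + hE.num (fun n => c * inner ℂ (invDispl k R d n) v) z :=
  (hE.isMul_cre v x).trans_cre hE k R d z hz

/-- The transformation of an annihilation operator: the exponential factor of the transformation
contributes the second term to the derivative. -/
lemma IsCoherent.trans_ann (hE : IsCoherent c E) (k : ℤ) (R : K ≃ₗᵢ[ℂ] K) (d : ℤ → K) (v : K)
    (x z : cohSpan E) (hz : hE.trans k R d x = z) :
    hE.trans k R d (hE.ann v x) =
      hE.ann (R v) z + hE.num (fun n => c * inner ℂ v (invDispl k R d n)) z := by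
  rw [← sub_eq_iff_eq_add]
  refine IsDer.unique hE (v := R v) (x := z) (fun n w => ?_) (hE.isDer_ann _ _)
  have hR : ∀ s : ℝ, R⁻¹ (w + (s : ℂ) • R v) = R⁻¹ w + (s : ℂ) • v := fun s => by
    rw [map_add, map_smul]
    congr 2
    exact R.symm_apply_apply v
  rw [← hz]
  simp only [hE.inner_trans k R d n, inner_sub_right, hR, hE.isMul_num _ z _]
  rw [← hz, hE.inner_trans]
  have h1 := hE.isDer_ann v x (n - k) (R⁻¹ w + invDispl k R d n)
  have h2 := ((((hasDerivAt_inner_line (R⁻¹ w) v (invDispl k R d n)).const_add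
    (inner ℂ (invDispl k R d n) (invDispl k R d n) / 2)).const_mul (c : ℂ)).neg.cexp).mul h1
  simp only [Complex.ofReal_zero, zero_smul, add_zero, Pi.neg_apply] at h2
  refine (h2.congr_of_eventuallyEq (Filter.Eventually.of_forall fun s => ?_)).congr_deriv ?_
  · change _ = Complex.exp _ * inner ℂ (E (n - k, R⁻¹ w + invDispl k R d n + (s : ℂ) • v)) (x : H)
    rw [add_right_comm]
  · ring

lemma IsMul.trans_num (hE : IsCoherent c E) (k : ℤ) (R : K ≃ₗᵢ[ℂ] K) (d : ℤ → K) (ψ : ℤ → ℂ)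
    (x z : cohSpan E) (hz : hE.trans k R d x = z) :
    hE.trans k R d (hE.num ψ x) = hE.num (fun n => ψ (n - k)) z := by
  refine hE.ext_inner fun p => ?_
  rw [(hE.isMul_num ψ x).trans hE k R d p, hE.isMul_num, hz]

/-! ### Displacement operators -/

/-- The one-parameter group of displacements in the direction of `d`. -/
def IsCoherent.weyl (hE : IsCoherent c E) (d : K) (s : ℝ) : H ≃ₗᵢ[ℂ] H :=
  hE.trans 0 1 fun _ => (s : ℂ) • d

lemma IsCoherent.weyl_add (hE : IsCoherent c E) (d : K) (s t : ℝ) :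
    hE.weyl d (s + t) = hE.weyl d s * hE.weyl d t := by
  rw [weyl, weyl, weyl, hE.trans_mul]
  · simp only [LinearIsometryEquiv.coe_one, id_eq, add_zero, mul_one, ← add_smul, ← Complex.ofReal_add]
  · intro n
    simp only [LinearIsometryEquiv.coe_one, id_eq, inner_smul_left, inner_smul_right, map_mul,
      Complex.conj_ofReal, inner_conj_symm]

lemma IsCoherent.weyl_zero (hE : IsCoherent c E) (d : K) : hE.weyl d 0 = 1 := by
  rw [weyl, ← hE.trans_one]
  simp

lemma IsCoherent.weyl_mem (hE : IsCoherent c E) (d : K) (s : ℝ) (x : cohSpan E) :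
    hE.weyl d s x ∈ cohSpan E := hE.trans_mem _ _ _ _

/-- The generator `c⁺(d) - c(d)` of the displacements. -/
def IsCoherent.gen (hE : IsCoherent c E) (d : K) (x : cohSpan E) : cohSpan E :=
  hE.cre d x - hE.ann d x

lemma IsCoherent.hasDerivAt_inner_weyl_zero (hE : IsCoherent c E) (d : K) (x : cohSpan E)
    (p : ℤ × K) :
    HasDerivAt (fun s : ℝ => inner ℂ (E p) (hE.weyl d s x)) (inner ℂ (E p) (hE.gen d x)) 0 := by
  obtain ⟨n, w⟩ := p
  have h0 : ∀ s : ℝ, inner ℂ (E (n, w)) (hE.weyl d s x) =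
      Complex.exp (-(c * ((s : ℂ) ^ 2 * inner ℂ d d / 2 - s * inner ℂ w d))) *
        inner ℂ (E (n, w + ((-s : ℝ) : ℂ) • d)) x := by
    intro s
    rw [weyl, hE.inner_trans, invDispl, inv_one, sub_zero]
    simp only [LinearIsometryEquiv.coe_one, id_eq, inner_neg_left, inner_neg_right, inner_smul_left,
      inner_smul_right, Complex.conj_ofReal, Complex.ofReal_neg, neg_smul]
    congr 2
    ring
  simp only [h0]
  have h1 : HasDerivAt (fun s : ℝ => inner ℂ (E (n, w + ((-s : ℝ) : ℂ) • d)) (x : H))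
      (-inner ℂ (E (n, w)) (hE.ann d x : H)) 0 := by
    have := HasDerivAt.scomp (h := fun s : ℝ => -s) (h' := -1)
      (g₁ := fun s : ℝ => inner ℂ (E (n, w + (s : ℂ) • d)) (x : H))
      (g₁' := inner ℂ (E (n, w)) (hE.ann d x : H)) (0 : ℝ)
      (by rw [neg_zero]; exact hE.isDer_ann d x n w) (hasDerivAt_neg 0)
    rw [neg_one_smul] at this
    exact this
  have h2 : HasDerivAt (fun s : ℝ => (s : ℂ)) 1 0 := Complex.ofRealCLM.hasDerivAt
  have h3 := ((((((h2.pow 2).mul_const (inner ℂ d d)).div_const 2).sub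
    (h2.mul_const (inner ℂ w d))).const_mul (c : ℂ)).neg.cexp).mul h1
  refine h3.congr_deriv ?_
  rw [gen, AddSubgroupClass.coe_sub, inner_sub_right, hE.isMul_cre]
  simp
  ring

/-- The derivative at `r` follows from that at zero, since the adjoint of `weyl d r` maps a coherent
state to a multiple of a coherent state. -/
lemma IsCoherent.hasDerivAt_inner_weyl (hE : IsCoherent c E) (d : K) (x : cohSpan E) (p : ℤ × K)
    (r : ℝ) :
    HasDerivAt (fun s : ℝ => inner ℂ (E p) (hE.weyl d s x))
      (inner ℂ (E p) (hE.weyl d r (hE.gen d x))) r := by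
  have h0 : ∀ s, hE.weyl d s x = hE.weyl d r (hE.weyl d (s - r) x) := fun s => by
    change _ = (hE.weyl d r * hE.weyl d (s - r)) x
    rw [← hE.weyl_add]
    congr 2
    ring
  have h1 : ∀ y : H, inner ℂ (E p) (hE.weyl d r y) =
      conj (transCoeff c 1⁻¹ (invDispl 0 1 fun _ => (r : ℂ) • d) p) *
      inner ℂ (E (transPt (-0) 1⁻¹ (invDispl 0 1 fun _ => (r : ℂ) • d) p)) y := fun y => by
    rw [inner_unitary_right, weyl, hE.trans_inv, hE.trans_apply, inner_smul_left]
  rw [h1, funext fun s => (congrArg (inner ℂ (E p)) (h0 s)).trans (h1 _)]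
  refine HasDerivAt.const_mul _ ?_
  refine HasDerivAt.comp_sub_const (f := fun s : ℝ => inner ℂ _ (hE.weyl d s x)) r r ?_
  rw [sub_self]
  exact hE.hasDerivAt_inner_weyl_zero d x _

lemma IsCoherent.continuous_weyl (hE : IsCoherent c E) (d : K) (x : H) :
    Continuous fun s : ℝ => hE.weyl d s x := by
  refine continuous_apply_of_dense (U := fun s => (hE.weyl d s).toLinearIsometry) hE.dense ?_ x
  rintro _ ⟨⟨n, u⟩, rfl⟩
  change Continuous fun s : ℝ => hE.weyl d s (E (n, u))
  simp only [weyl, hE.trans_apply, transCoeff, transPt, LinearIsometryEquiv.coe_one, id_eq]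
  refine Continuous.smul (by fun_prop) ((hE.continuous _).comp (by fun_prop))

/-- The weak derivatives and the strong continuity give `weyl d s x = x + ∫ weyl d r (gen d x) dr`,
and hence the derivative in norm. -/
lemma IsCoherent.hasDerivAt_weyl (hE : IsCoherent c E) (d : K) (x : cohSpan E) :
    HasDerivAt (fun s : ℝ => hE.weyl d s x) (hE.gen d x : H) 0 := by
  have hc := hE.continuous_weyl d (hE.gen d x)
  have h1 : ∀ s : ℝ, hE.weyl d s x = (∫ r in (0 : ℝ)..s, hE.weyl d r (hE.gen d x)) + x := by
    intro s
    refine hE.ext_inner fun p => ?_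
    rw [inner_add_right, ← innerSL_apply_apply (𝕜 := ℂ) (E p) (∫ r in (0 : ℝ)..s, _),
      ← ContinuousLinearMap.intervalIntegral_comp_comm _ (hc.intervalIntegrable _ _)]
    simp only [innerSL_apply_apply]
    rw [intervalIntegral.integral_eq_sub_of_hasDerivAt
      (fun r _ => hE.hasDerivAt_inner_weyl d x p r)
      ((continuous_const.inner hc).intervalIntegrable _ _), hE.weyl_zero]
    simp
  rw [funext h1]
  have h2 := intervalIntegral.integral_hasDerivAt_right (hc.intervalIntegrable 0 0)
    (hc.stronglyMeasurableAtFilter _ _) hc.continuousAt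
  rw [hE.weyl_zero] at h2
  exact h2.add_const _

/-! ### Adjoints and norms -/

/-- The generator of a group of unitary operators is skew-symmetric. -/
lemma IsCoherent.gen_skew (hE : IsCoherent c E) (d : K) (x y : cohSpan E) :
    inner ℂ (x : H) (hE.gen d y : H) + inner ℂ (hE.gen d x : H) (y : H) = 0 := by
  have h := (hE.hasDerivAt_weyl d x).inner ℂ (hE.hasDerivAt_weyl d y)
  simp only [LinearIsometryEquiv.inner_map_map, hE.weyl_zero] at h
  exact h.unique (hasDerivAt_const _ _)

/-- The skew symmetry of the generators for `v` and `i v` is the adjointness of `c(v)` and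
`c⁺(v)`. -/
lemma IsCoherent.inner_ann_left (hE : IsCoherent c E) (v : K) (x y : cohSpan E) :
    inner ℂ (hE.ann v x : H) (y : H) = inner ℂ (x : H) (hE.cre v y : H) := by
  have h1 := hE.gen_skew v x y
  have h2 := hE.gen_skew (Complex.I • v) x y
  simp only [gen, hE.cre_smul, hE.ann_smul, AddSubgroupClass.coe_sub, Submodule.coe_smul,
    inner_sub_left, inner_sub_right, inner_smul_left, inner_smul_right, Complex.conj_I, neg_smul,
    map_neg, NegMemClass.coe_neg, inner_neg_left, inner_neg_right] at h1 h2
  have h3 : Complex.I * Complex.I = -1 := Complex.I_mul_I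
  linear_combination (-1 / 2) * h1 + (Complex.I / 2) * h2 + (-1 / 2) *
    (inner ℂ (x : H) (hE.cre v y : H) + inner ℂ (x : H) (hE.ann v y : H)
      - inner ℂ (hE.cre v x : H) (y : H) - inner ℂ (hE.ann v x : H) (y : H)) * h3

lemma IsCoherent.dense_cohSpan (hE : IsCoherent c E) : Dense (cohSpan E : Set H) := by
  refine hE.dense.mono ?_
  rw [SetLike.coe_subset_coe, Submodule.span_le]
  rintro _ ⟨⟨n, u⟩, rfl⟩
  exact coh_mem n [] u

lemma IsCoherent.ext_cohSpan (hE : IsCoherent c E) {x y : cohSpan E}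
    (h : ∀ z : cohSpan E, inner ℂ (x : H) (z : H) = inner ℂ (y : H) (z : H)) : x = y :=
  Subtype.ext (hE.ext_inner fun p => by
    rw [← inner_conj_symm, h ⟨E p, coh_mem p.1 [] p.2⟩, inner_conj_symm])

lemma IsCoherent.ann_ann (hE : IsCoherent c E) (v u : K) (x : cohSpan E) :
    hE.ann v (hE.ann u x) = hE.ann u (hE.ann v x) :=
  hE.ext_cohSpan fun z => by simp only [hE.inner_ann_left, hE.cre_cre]

/-- The dependence on `v` is of finite rank. -/
lemma IsCoherent.continuous_ann (hE : IsCoherent c E) (x : cohSpan E) :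
    Continuous fun v => (hE.ann v x : H) := by
  obtain ⟨l, hl⟩ := hE.exists_ann_eq x
  simp only [hl]
  clear hl
  induction l with
  | nil => simpa [antilin] using continuous_const
  | cons p l ih =>
    simp only [antilin, List.map_cons, List.sum_cons, Submodule.coe_add, Submodule.coe_smul] at ih ⊢
    exact (Continuous.smul (by fun_prop) continuous_const).add ih

/-- Adjointness and the commutation relation. -/
lemma IsCoherent.norm_cre_sq (hE : IsCoherent c E) (v : K) (x : cohSpan E) :
    ‖(hE.cre v x : H)‖ ^ 2 = c * ‖v‖ ^ 2 * ‖(x : H)‖ ^ 2 + ‖(hE.ann v x : H)‖ ^ 2 := by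
  have h : inner ℂ (hE.cre v x : H) (hE.cre v x : H) =
      c * inner ℂ v v * inner ℂ (x : H) (x : H) + inner ℂ (hE.ann v x : H) (hE.ann v x : H) := by
    rw [← hE.inner_ann_left, hE.ann_cre, Submodule.coe_add, inner_add_left, Submodule.coe_smul,
      inner_smul_left, hE.inner_ann_left v x, ← inner_conj_symm (hE.cre v _ : H), ← hE.inner_ann_left,
      inner_conj_symm, map_mul, Complex.conj_ofReal, inner_conj_symm]
    ring
  simp only [inner_self_eq_norm_sq_to_K] at h
  rw [← Complex.ofReal_inj]
  push_cast
  exact h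

lemma IsCoherent.continuous_cre (hE : IsCoherent c E) (x : cohSpan E) :
    Continuous fun v => (hE.cre v x : H) := by
  rw [continuous_iff_continuousAt]
  intro v₀
  rw [ContinuousAt, tendsto_iff_norm_sub_tendsto_zero]
  have h0 : ∀ v, (hE.cre v x : H) - hE.cre v₀ x = hE.cre (v - v₀) x := fun v => by
    rw [sub_eq_iff_eq_add, ← Submodule.coe_add, ← hE.cre_add, sub_add_cancel]
  have h1 : ∀ v, ‖(hE.cre v x : H) - hE.cre v₀ x‖ =
      Real.sqrt (c * ‖v - v₀‖ ^ 2 * ‖(x : H)‖ ^ 2 + ‖(hE.ann (v - v₀) x : H)‖ ^ 2) := fun v => by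
    rw [h0, ← hE.norm_cre_sq, Real.sqrt_sq (norm_nonneg _)]
  simp only [h1]
  have h2 : Continuous fun v => Real.sqrt (c * ‖v - v₀‖ ^ 2 * ‖(x : H)‖ ^ 2 +
      ‖(hE.ann (v - v₀) x : H)‖ ^ 2) := by
    have := (hE.continuous_ann x).comp (continuous_id.sub (continuous_const (y := v₀)))
    exact Real.continuous_sqrt.comp ((by fun_prop : Continuous fun v => c * ‖v - v₀‖ ^ 2 *
      ‖(x : H)‖ ^ 2).add (this.norm.pow 2))
  have h3 := h2.tendsto v₀
  have h4 : hE.ann (0 : K) x = 0 := by simpa using hE.ann_smul 0 0 x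
  simpa [h4] using h3

end


/-! ### Completeness of the vectors created from the vacua -/

section
variable {K H : Type} [NormedAddCommGroup K] [InnerProductSpace ℂ K]
  [NormedAddCommGroup H] [InnerProductSpace ℂ H] {c : ℝ} {E : ℤ × K → H}

/-- The coherent state with label `0` as an element of the domain. -/
def vacAt (E : ℤ × K → H) (n : ℤ) : cohSpan E := ⟨E (n, 0), coh_mem n [] 0⟩

variable [CompleteSpace H]

lemma IsCoherent.ann_vacAt (hE : IsCoherent c E) (v : K) (n : ℤ) : hE.ann v (vacAt E n) = 0 := by
  refine Subtype.ext ((hE.isDer_ann v _).unique hE ?_)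
  have := hE.isDer_coh v n 0
  rwa [inner_zero_right, mul_zero, zero_smul] at this

lemma IsCoherent.ann_cre_pow (hE : IsCoherent c E) (u : K) (n : ℤ) (k : ℕ) :
    hE.ann u ((hE.cre u ^ (k + 1)) (vacAt E n)) =
      ((k + 1 : ℂ) * (c * inner ℂ u u)) • (hE.cre u ^ k) (vacAt E n) := by
  induction k with
  | zero => simp [hE.ann_cre, hE.ann_vacAt]
  | succ k ih =>
    rw [pow_succ', Module.End.mul_apply, hE.ann_cre, ih, map_smul, ← Module.End.mul_apply, ← pow_succ',
      ← add_smul]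
    congr 1
    push_cast
    ring

lemma IsCoherent.norm_cre_pow (hE : IsCoherent c E) (u : K) (n : ℤ) (k : ℕ) :
    ‖((hE.cre u ^ k) (vacAt E n) : H)‖ ^ 2 = k ! * (c * ‖u‖ ^ 2) ^ k := by
  have h : ∀ k : ℕ, inner ℂ ((hE.cre u ^ k) (vacAt E n) : H) ((hE.cre u ^ k) (vacAt E n) : H) =
      k ! * (c * inner ℂ u u) ^ k := by
    intro k
    induction k with
    | zero =>
      rw [pow_zero, Module.End.one_apply, vacAt, hE.inner_eq]
      simp
    | succ k ih =>
      have h1 : inner ℂ ((hE.cre u ^ (k + 1)) (vacAt E n) : H) ((hE.cre u ^ (k + 1)) (vacAt E n) : H)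
          = inner ℂ (hE.ann u ((hE.cre u ^ (k + 1)) (vacAt E n)) : H)
            ((hE.cre u ^ k) (vacAt E n) : H) := by
        rw [hE.inner_ann_left, ← Module.End.mul_apply, ← pow_succ']
      rw [h1, hE.ann_cre_pow, Submodule.coe_smul, inner_smul_left, ih, Nat.factorial_succ]
      simp only [map_mul, map_add, map_natCast, map_one, Complex.conj_ofReal, inner_conj_symm]
      push_cast
      ring
  have h2 := h k
  simp only [inner_self_eq_norm_sq_to_K] at h2
  rw [← Complex.ofReal_inj]
  push_cast
  exact h2

/-- The exponential series of a coherent state. -/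
lemma IsCoherent.hasSum_cre_pow (hE : IsCoherent c E) (hc : 0 ≤ c) (n : ℤ) (u : K) :
    HasSum (fun k : ℕ => ((k ! : ℂ)⁻¹) • ((hE.cre u ^ k) (vacAt E n) : H)) (E (n, u)) := by
  have hs : Summable fun k : ℕ => ((k ! : ℂ)⁻¹) • ((hE.cre u ^ k) (vacAt E n) : H) := by
    set r : ℝ := c * ‖u‖ ^ 2 with hr
    have hr0 : 0 ≤ r := by positivity
    refine Summable.of_norm_bounded
      (((NormedSpace.expSeries_div_summable (2 * r)).add summable_geometric_two).mul_left (1 / 2))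
      fun k => ?_
    have h1 : ‖((k ! : ℂ)⁻¹) • ((hE.cre u ^ k) (vacAt E n) : H)‖ ^ 2 =
        ((2 * r) ^ k / k !) * (1 / 2) ^ k := by
      rw [norm_smul, mul_pow, hE.norm_cre_pow, norm_inv, Complex.norm_natCast, ← hr, mul_pow]
      have : (2 : ℝ) ^ k * (1 / 2) ^ k = 1 := by rw [← mul_pow]; norm_num
      have h2 : (k ! : ℝ) ≠ 0 := by positivity
      field_simp
      linear_combination (-r ^ k) * this
    -- the inequality of the arithmetic and geometric means
    have h3 : 0 ≤ (2 * r) ^ k / k ! := by positivity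
    have h4 : (0 : ℝ) ≤ (1 / 2) ^ k := by positivity
    refine (sq_le_sq₀ (norm_nonneg _) (by positivity)).1 ?_
    rw [h1]
    nlinarith [sq_nonneg ((2 * r) ^ k / (k ! : ℝ) - (1 / 2) ^ k)]
  have h0 : (∑' k : ℕ, ((k ! : ℂ)⁻¹) • ((hE.cre u ^ k) (vacAt E n) : H)) = E (n, u) := by
    refine hE.ext_inner fun p => ?_
    have h1 := hs.hasSum.mapL (innerSL ℂ (E p))
    simp only [innerSL_apply_apply, inner_smul_right] at h1
    refine h1.unique ?_
    have h2 : ∀ k : ℕ, inner ℂ (E p) ((hE.cre u ^ k) (vacAt E n) : H) =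
        (c * inner ℂ p.2 u) ^ k * if p.1 = n then 1 else 0 := by
      intro k
      induction k with
      | zero => simp [vacAt, hE.inner_eq]
      | succ k ih => rw [pow_succ', Module.End.mul_apply, hE.isMul_cre, ih, pow_succ']; ring
    simp only [h2, hE.inner_eq]
    split_ifs
    · have := NormedSpace.expSeries_div_hasSum_exp ((c : ℂ) * inner ℂ p.2 u)
      rw [← Complex.exp_eq_exp_ℂ] at this
      convert! this using 2 with k
      rw [mul_one, div_eq_inv_mul]
    · simp
  rw [← h0]
  exact hs.hasSum

/-- Creation operators of a total family, applied to the vacua, give a total family. -/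
lemma IsCoherent.dense_words (hE : IsCoherent c E) (hc : 0 ≤ c) {ι : Type} {b : ι → K}
    (hb : Dense (Submodule.span ℂ (Set.range b) : Set K)) :
    Dense (Submodule.span ℂ {z : H | ∃ (n : ℤ) (αs : List ι),
      z = (αs.foldr (fun α w => hE.cre (b α) w) (vacAt E n) : cohSpan E)} : Set H) := by
  set W : Submodule ℂ (cohSpan E) := Submodule.span ℂ {z : cohSpan E | ∃ (n : ℤ) (αs : List ι),
      z = αs.foldr (fun α w => hE.cre (b α) w) (vacAt E n)} with hW
  set M : Submodule ℂ H := Submodule.span ℂ {z : H | ∃ (n : ℤ) (αs : List ι),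
      z = (αs.foldr (fun α w => hE.cre (b α) w) (vacAt E n) : cohSpan E)} with hM
  have h1 : ∀ u ∈ Submodule.span ℂ (Set.range b), ∀ x ∈ W, hE.cre u x ∈ W := by
    intro u hu x hx
    induction hu using Submodule.span_induction with
    | mem u hu =>
      obtain ⟨α, rfl⟩ := hu
      induction hx using Submodule.span_induction with
      | mem x hx =>
        obtain ⟨n, αs, rfl⟩ := hx
        exact Submodule.subset_span ⟨n, α :: αs, rfl⟩
      | zero => rw [map_zero]; exact zero_mem _
      | add x y _ _ hx hy => rw [map_add]; exact add_mem hx hy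
      | smul a x _ hx => rw [map_smul]; exact Submodule.smul_mem _ _ hx
    | zero => have := hE.cre_smul 0 0 x; simp only [smul_zero, zero_smul] at this; rw [this]; exact zero_mem _
    | add u v _ _ hu hv => rw [hE.cre_add]; exact add_mem hu hv
    | smul a u _ hu => rw [hE.cre_smul]; exact Submodule.smul_mem _ _ hu
  have h2 : ∀ u ∈ Submodule.span ℂ (Set.range b), ∀ (n : ℤ) (k : ℕ), (hE.cre u ^ k) (vacAt E n) ∈ W := by
    intro u hu n k
    induction k with
    | zero => exact Submodule.subset_span ⟨n, [], rfl⟩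
    | succ k ih => rw [pow_succ', Module.End.mul_apply]; exact h1 u hu _ ih
  have h3 : ∀ x ∈ W, (x : H) ∈ M := by
    intro x hx
    induction hx using Submodule.span_induction with
    | mem x hx =>
      obtain ⟨n, αs, rfl⟩ := hx
      exact Submodule.subset_span ⟨n, αs, rfl⟩
    | zero => exact zero_mem _
    | add x y _ _ hx hy => exact add_mem hx hy
    | smul a x _ hx => exact Submodule.smul_mem _ _ hx
  have h4 : ∀ (n : ℤ), ∀ u ∈ Submodule.span ℂ (Set.range b), E (n, u) ∈ closure (M : Set H) := by
    intro n u hu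
    refine mem_closure_of_tendsto (hE.hasSum_cre_pow hc n u) (Filter.Eventually.of_forall fun s => ?_)
    exact Submodule.sum_mem _ fun k _ => Submodule.smul_mem _ _ (h3 _ (h2 u hu n k))
  have h5 : ∀ p, E p ∈ closure (M : Set H) := by
    rintro ⟨n, u⟩
    have h6 : IsClosed {u : K | E (n, u) ∈ closure (M : Set H)} :=
      isClosed_closure.preimage (hE.continuous n)
    exact h6.closure_subset_iff.2 (h4 n) (hb u)
  have h6 : (Submodule.span ℂ (Set.range E) : Set H) ⊆ closure (M : Set H) := by
    rw [← Submodule.topologicalClosure_coe, SetLike.coe_subset_coe, Submodule.span_le]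
    rintro _ ⟨p, rfl⟩
    exact h5 p
  exact dense_closure.1 (hE.dense.mono h6)

/-- Operators with real eigenvalues on the labels are symmetric. -/
lemma IsCoherent.num_symm (hE : IsCoherent c E) {ψ : ℤ → ℂ} (hψ : ∀ n, conj (ψ n) = ψ n)
    (x y : cohSpan E) : inner ℂ (hE.num ψ x : H) (y : H) = inner ℂ (x : H) (hE.num ψ y : H) := by
  induction y using hE.induction_cre generalizing x with
  | base n u =>
    have h : (hE.num ψ ⟨E (n, u), coh_mem n [] u⟩ : H) = ψ n • E (n, u) :=
      (hE.isMul_num ψ _).unique hE (hE.isMul_fst ψ n [] u)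
    rw [h, inner_smul_right, ← inner_conj_symm, hE.isMul_num, map_mul, inner_conj_symm]
    exact congrArg (· * _) (hψ n)
  | cre v y ih =>
    rw [hE.num_cre, ← hE.inner_ann_left, ← hE.inner_ann_left, ← ih, hE.num_ann]
  | zero => simp
  | add y z hy hz => simp only [map_add, Submodule.coe_add, inner_add_right, hy, hz]
  | smul a y hy => simp only [map_smul, Submodule.coe_smul, inner_smul_right, hy]

lemma IsCoherent.num_zero (hE : IsCoherent c E) (x : cohSpan E) : hE.num (fun _ => 0) x = 0 :=
  Subtype.ext (hE.ext_inner fun p => by rw [hE.isMul_num]; simp)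

lemma IsCoherent.num_eq_smul (hE : IsCoherent c E) (a : ℂ) (ψ : ℤ → ℂ) (x : cohSpan E) :
    hE.num (fun n => a * ψ n) x = a • hE.num ψ x :=
  Subtype.ext (hE.ext_inner fun p => by
    rw [Submodule.coe_smul, inner_smul_right, hE.isMul_num, hE.isMul_num]; ring)

lemma IsCoherent.num_sub_one (hE : IsCoherent c E) (x : cohSpan E) :
    hE.num (fun n => ((n - 1 : ℤ) : ℂ)) x = hE.num (fun n => (n : ℂ)) x - x :=
  Subtype.ext (hE.ext_inner fun p => by
    rw [AddSubgroupClass.coe_sub, inner_sub_right, hE.isMul_num, hE.isMul_num]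
    push_cast
    ring)

/-- The phase operator `E (n, u) ↦ E (n + 1, u)`. -/
def IsCoherent.shift (hE : IsCoherent c E) : H ≃ₗᵢ[ℂ] H := hE.trans 1 1 fun _ => 0

lemma invDispl_zero (k : ℤ) (R : K ≃ₗᵢ[ℂ] K) (n : ℤ) : invDispl k R (fun _ => 0) n = 0 := by
  rw [invDispl, map_zero, neg_zero]

lemma IsCoherent.shift_apply (hE : IsCoherent c E) (n : ℤ) (u : K) :
    hE.shift (E (n, u)) = E (n + 1, u) := by
  rw [shift, hE.trans_apply]
  simp [transCoeff, transPt]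

lemma IsCoherent.shift_zpow (hE : IsCoherent c E) (n : ℤ) :
    (hE.shift ^ n) (E (0, 0)) = E (n, 0) := by
  induction n using Int.induction_on with
  | zero => rfl
  | succ n ih =>
    rw [add_comm, zpow_add, zpow_one, LinearIsometryEquiv.coe_mul, Function.comp_apply, ih,
      hE.shift_apply, add_comm]
  | pred n ih =>
    rw [sub_eq_neg_add, zpow_add, zpow_neg_one, LinearIsometryEquiv.coe_mul, Function.comp_apply, ih]
    refine hE.shift.injective ?_
    rw [hE.shift_apply]
    exact (hE.shift.apply_symm_apply _).trans (by congr 2; ring)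

lemma IsCoherent.shift_cre (hE : IsCoherent c E) (v : K) (x z : cohSpan E) (hz : hE.shift x = z) :
    hE.shift (hE.cre v x) = hE.cre v z := by
  rw [shift, hE.trans_cre _ _ _ _ _ z hz]
  simp only [invDispl_zero, inner_zero_left, mul_zero, hE.num_zero]
  simp

lemma IsCoherent.shift_ann (hE : IsCoherent c E) (v : K) (x z : cohSpan E) (hz : hE.shift x = z) :
    hE.shift (hE.ann v x) = hE.ann v z := by
  rw [shift, hE.trans_ann _ _ _ _ _ z hz]
  simp only [invDispl_zero, inner_zero_right, mul_zero, hE.num_zero]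
  simp

lemma IsCoherent.shift_mem (hE : IsCoherent c E) (x : cohSpan E) : hE.shift x ∈ cohSpan E :=
  hE.trans_mem _ _ _ _

lemma IsCoherent.shift_symm_mem (hE : IsCoherent c E) (x : cohSpan E) :
    hE.shift.symm x ∈ cohSpan E := by
  change (hE.shift⁻¹) (x : H) ∈ cohSpan E
  rw [shift, hE.trans_inv]
  exact hE.trans_mem _ _ _ _

lemma IsCoherent.shift_num (hE : IsCoherent c E) (x z : cohSpan E) (hz : hE.shift x = z) :
    hE.shift (hE.num (fun n => (n : ℂ)) x) = hE.num (fun n => (n : ℂ)) z - z := by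
  rw [shift, IsMul.trans_num hE _ _ _ _ x z hz, hE.num_sub_one]
  rfl

end

/-! ### The quantum Coulomb field -/

section
variable {H : Type} [NormedAddCommGroup H] [InnerProductSpace ℂ H] [CompleteSpace H] {e : ℝ}
  {E : ℤ × OneParticle → H}

/-- The realization of the axioms on coherent states. -/
def IsCoherent.coulombField (hE : IsCoherent (4 * Real.pi * e ^ 2) E) : CoulombField e H where
  D := cohSpan E
  dense_D := hE.dense_cohSpan
  Q := (e : ℂ) • hE.num fun n => (n : ℂ)
  c α := hE.ann (basisVec α)
  cd α := hE.cre (basisVec α)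
  V := hE.shift
  V_mem := hE.shift_mem
  V_symm_mem := hE.shift_symm_mem
  vac := vacAt E 0
  norm_vac := by
    have : ‖E ((0 : ℤ), (0 : OneParticle))‖ = Real.sqrt 1 := by
      rw [@norm_eq_sqrt_re_inner ℂ, hE.inner_eq]; simp
    simpa [vacAt] using this
  Q_symm x y := by
    simp only [LinearMap.smul_apply, Submodule.coe_smul, inner_smul_left, inner_smul_right,
      Complex.conj_ofReal]
    rw [hE.num_symm fun n => by simp]
  cd_adjoint α x y := hE.inner_ann_left _ x y
  Q_V x := by
    simp only [LinearMap.smul_apply, Submodule.coe_smul, map_smul]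
    rw [hE.shift_num x ⟨_, hE.shift_mem x⟩ rfl, smul_sub, sub_add_cancel]
  Q_c α x := by
    simp only [LinearMap.smul_apply, map_smul, hE.num_ann]
  Q_cd α x := by
    simp only [LinearMap.smul_apply, map_smul, hE.num_cre]
  V_c α x := (hE.shift_ann _ x _ rfl).symm
  V_cd α x := (hE.shift_cre _ x _ rfl).symm
  c_c α β x := hE.ann_ann _ _ x
  cd_cd α β x := hE.cre_cre _ _ x
  c_cd α β x := by
    rw [hE.ann_cre, add_sub_cancel_left, (orthonormal_iff_ite.1 orthonormal_basisVec) α β]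
    congr 1
    split_ifs <;> simp
  c_vac α := hE.ann_vacAt _ _
  Q_vac := by
    refine Subtype.ext (hE.ext_inner fun p => ?_)
    have : inner ℂ (E p) (hE.num (fun n => (n : ℂ)) (vacAt E 0) : H) = 0 := by
      rw [hE.isMul_num, vacAt, hE.inner_eq]
      split_ifs with h
      · beta_reduce; rw [h]; simp
      · simp
    simp [inner_smul_right, this]
  complete := by
    have h := hE.dense_words (by positivity) dense_span_basisVec
    convert! h using 4
    refine Set.ext fun z => ⟨?_, ?_⟩
    · rintro ⟨n, αs, y, hy, rfl⟩
      refine ⟨n, αs, ?_⟩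
      have : y = vacAt E n := Subtype.ext (hy.trans (hE.shift_zpow n))
      rw [this]
    · rintro ⟨n, αs, rfl⟩
      exact ⟨n, αs, vacAt E n, (hE.shift_zpow n).symm, rfl⟩

end


/-! ### The action of the Lorentz group -/

/-- The displacement of the coherent states of charge number one. The factor `-1 / (4 π)` makes
`4 π e² ⟪v, d⟫` equal to `-e ⟪v, e vVec⟫`, as the transformation rule of the operators `c` demands. -/
def dVec (g : SL2C) : OneParticle := (-(1 / (4 * Real.pi) : ℝ) : ℂ) • vVec g

lemma dVec_mul (g h : SL2C) : dVec (g * h) = dVec g + repA g (dVec h) := by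
  rw [dVec, vVec_mul, smul_add, dVec, dVec, map_smul]

lemma dVec_one : dVec 1 = 0 := by
  have h := dVec_mul 1 1
  rw [mul_one, repA_one_apply] at h
  exact left_eq_add.1 h

lemma conj_inner_dVec (g h : SL2C) :
    conj (inner ℂ (dVec g) (repA g (dVec h))) = inner ℂ (dVec g) (repA g (dVec h)) := by
  simp only [dVec, map_smul, inner_smul_left, inner_smul_right, map_mul, map_neg, Complex.conj_ofReal,
    conj_inner_vVec]

lemma continuous_dVec : Continuous dVec := by
  unfold dVec
  exact Continuous.const_smul (M := ℂ) continuous_vVec _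

/-- The displacement of the inverse transformation is given by the vector `B`. -/
lemma invDispl_dVec (g : SL2C) (n : ℤ) : invDispl 0 (repA g) (fun n => (n : ℂ) • dVec g) n =
    ((n : ℂ) * (1 / (4 * Real.pi) : ℝ)) • bVec g := by
  have h : (repA g)⁻¹ (vVec g) = bVec g := (repA g).symm_apply_apply (bVec g)
  rw [invDispl, sub_zero, dVec, map_smul, map_smul, h, smul_smul, ← neg_smul]
  congr 1
  ring

section
variable {H : Type} [NormedAddCommGroup H] [InnerProductSpace ℂ H] [CompleteSpace H] {e : ℝ}
  {E : ℤ × OneParticle → H}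

/-- The unitary operator of a group element: it acts on the labels by `u ↦ repA g u + n • dVec g`, so
that the displacement is proportional to the charge. -/
def IsCoherent.lorentz {c : ℝ} (hE : IsCoherent c E) (g : SL2C) : H ≃ₗᵢ[ℂ] H :=
  hE.trans 0 (repA g) fun n => (n : ℂ) • dVec g

/-- The phase factors cancel because the inner products of the cocycle are real. -/
lemma IsCoherent.lorentz_mul {c : ℝ} (hE : IsCoherent c E) (g h : SL2C) :
    hE.lorentz (g * h) = hE.lorentz g * hE.lorentz h := by
  rw [lorentz, lorentz, lorentz, hE.trans_mul, map_mul, add_zero]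
  · congr 1
    funext n
    rw [dVec_mul, smul_add, map_smul, add_zero]
  · intro n
    simp only [map_smul, inner_smul_left, inner_smul_right, map_mul, conj_inner_dVec, map_intCast]

lemma IsCoherent.lorentz_one {c : ℝ} (hE : IsCoherent c E) : hE.lorentz 1 = 1 := by
  rw [lorentz, map_one, ← hE.trans_one]
  congr 1
  funext n
  rw [dVec_one, smul_zero]

lemma IsCoherent.continuous_lorentz {c : ℝ} (hE : IsCoherent c E) (x : H) :
    Continuous fun g => hE.lorentz g x := by
  refine continuous_apply_of_dense (U := fun g => (hE.lorentz g).toLinearIsometry) hE.dense ?_ x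
  rintro _ ⟨⟨n, u⟩, rfl⟩
  change Continuous fun g => hE.lorentz g (E (n, u))
  simp only [lorentz, hE.trans_apply, transCoeff, transPt]
  have h1 := continuous_dVec
  have h2 := continuous_repA u
  refine Continuous.smul (by fun_prop) ((hE.continuous _).comp (by fun_prop))

/-- Since `c(v) x` is continuous and antilinear in `v`, it can be expanded in the basis. -/
lemma IsCoherent.hasSum_ann {c : ℝ} (hE : IsCoherent c E) (x : cohSpan E) (v : OneParticle) :
    HasSum (fun β => conj (v β) • (hE.ann (basisVec β) x : H)) (hE.ann v x : H) := by
  have h := (hasSum_basisVec v).map (AddMonoidHom.mk' (fun v => (hE.ann v x : H)) fun v u => by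
    rw [hE.ann_add, Submodule.coe_add]) (hE.continuous_ann x)
  convert! h using 2 with β
  exact (congrArg Subtype.val (hE.ann_smul (v β) (basisVec β) x)).symm

/-- Since `c⁺(v) x` is continuous and linear in `v`, it can be expanded in the basis. -/
lemma IsCoherent.hasSum_cre {c : ℝ} (hE : IsCoherent c E) (x : cohSpan E) (v : OneParticle) :
    HasSum (fun β => v β • (hE.cre (basisVec β) x : H)) (hE.cre v x : H) := by
  have h := (hasSum_basisVec v).map (AddMonoidHom.mk' (fun v => (hE.cre v x : H)) fun v u => by
    rw [hE.cre_add, Submodule.coe_add]) (hE.continuous_cre x)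
  convert! h using 2 with β
  exact (congrArg Subtype.val (hE.cre_smul (v β) (basisVec β) x)).symm

lemma repA_basisVec_apply (g : SL2C) (α β : Idx) : repA g (basisVec α) β = conj (A g β α) := by
  rw [repA_apply, isoA_basisVec, colA_apply]

lemma IsCoherent.gen_dVec {c : ℝ} (hE : IsCoherent c E) (g : SL2C) (x : cohSpan E) :
    (hE.gen (dVec g) x : H) =
      ((1 / (4 * Real.pi) : ℝ) : ℂ) • ((hE.ann (vVec g) x : H) - hE.cre (vVec g) x) := by
  rw [IsCoherent.gen, dVec, hE.cre_smul, hE.ann_smul, AddSubgroupClass.coe_sub, Submodule.coe_smul,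
    Submodule.coe_smul, map_neg, Complex.conj_ofReal, neg_smul, neg_smul, smul_sub]
  abel

/-- The phase operator raises the charge number by one, and therefore picks up one more displacement
by `dVec g`. -/
lemma IsCoherent.lorentz_shift {c : ℝ} (hE : IsCoherent c E) (g : SL2C) :
    hE.lorentz g * hE.shift * (hE.lorentz g)⁻¹ = hE.shift * hE.weyl (dVec g) 1 := by
  rw [mul_inv_eq_iff_eq_mul, mul_assoc, lorentz, shift, weyl, hE.trans_mul, hE.trans_mul, hE.trans_mul]
  · rw [mul_one, one_mul, one_mul]
    congr 1
    funext n
    simp only [LinearIsometryEquiv.coe_one, id_eq, map_zero, add_zero, zero_add, Complex.ofReal_one,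
      one_smul]
    push_cast
    rw [add_smul, one_smul, add_comm]
  · intro n
    simp
  · intro n
    simp only [LinearIsometryEquiv.coe_one, id_eq, inner_smul_left, inner_smul_right, map_mul,
      Complex.conj_ofReal, inner_conj_symm, map_intCast]
  · intro n
    simp

/-- The unitary implementation of the transformation rules. -/
def IsCoherent.lorentzAction (hE : IsCoherent (4 * Real.pi * e ^ 2) E) :
    LorentzAction hE.coulombField where
  U := ⟨⟨hE.lorentz, hE.lorentz_one⟩, hE.lorentz_mul⟩
  continuous_U := hE.continuous_lorentz
  U_mem g x := hE.trans_mem _ _ _ x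
  U_vac g := by
    change hE.trans 0 (repA g) (fun n => (n : ℂ) • dVec g) (E (0, 0)) = E (0, 0)
    rw [hE.trans_apply]
    simp [transCoeff, transPt]
  U_Q g x := by
    have h := IsMul.trans_num hE 0 (repA g) (fun n => (n : ℂ) • dVec g) (fun n => (n : ℂ)) x
      ⟨_, hE.trans_mem _ _ _ x⟩ rfl
    simp only [sub_zero] at h
    change hE.trans 0 (repA g) _ ((e : ℂ) • (hE.num (fun n => (n : ℂ)) x : H)) =
      (e : ℂ) • (hE.num (fun n => (n : ℂ)) _ : H)
    rw [map_smul, h]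
    rfl
  U_c g α x := by
    have h := hE.trans_ann 0 (repA g) (fun n => (n : ℂ) • dVec g) (basisVec α) x
      ⟨_, hE.trans_mem _ _ _ x⟩ rfl
    have h1 := hE.hasSum_ann ⟨_, hE.trans_mem 0 (repA g) (fun n => (n : ℂ) • dVec g) x⟩
      (repA g (basisVec α))
    simp only [repA_basisVec_apply, Complex.conj_conj] at h1
    convert! h1 using 1
    rw [sub_eq_iff_eq_add]
    refine h.trans (congrArg₂ _ rfl ?_)
    -- `4 π e² · n / (4 π) · b = (e b) (e n)`, where `e n` are the eigenvalues of `Q`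
    have h2 : (fun n : ℤ => ((4 * Real.pi * e ^ 2 : ℝ) : ℂ) * inner ℂ (basisVec α)
        (invDispl 0 (repA g) (fun n => (n : ℂ) • dVec g) n)) = fun n : ℤ => (B e g α * e) * (n : ℂ) := by
      funext n
      rw [invDispl_dVec, inner_smul_right, inner_basisVec, bVec_apply, B_eq_mul e]
      have := Real.pi_ne_zero
      push_cast
      field_simp
    rw [h2, hE.num_eq_smul, Submodule.coe_smul, mul_smul]
    rfl
  U_cd g α x := by
    have h := hE.trans_cre 0 (repA g) (fun n => (n : ℂ) • dVec g) (basisVec α) x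
      ⟨_, hE.trans_mem _ _ _ x⟩ rfl
    have h1 := hE.hasSum_cre ⟨_, hE.trans_mem 0 (repA g) (fun n => (n : ℂ) • dVec g) x⟩
      (repA g (basisVec α))
    simp only [repA_basisVec_apply] at h1
    convert! h1 using 1
    rw [sub_eq_iff_eq_add]
    refine h.trans (congrArg₂ _ rfl ?_)
    have h2 : (fun n : ℤ => ((4 * Real.pi * e ^ 2 : ℝ) : ℂ) * inner ℂ
        (invDispl 0 (repA g) (fun n => (n : ℂ) • dVec g) n) (basisVec α)) =
        fun n : ℤ => (conj (B e g α) * e) * (n : ℂ) := by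
      funext n
      rw [invDispl_dVec, inner_smul_left, ← inner_conj_symm, inner_basisVec, bVec_apply, B_eq_mul e]
      have := Real.pi_ne_zero
      simp only [map_mul, Complex.conj_ofReal, map_intCast]
      push_cast
      field_simp
    rw [h2, hE.num_eq_smul, Submodule.coe_smul, mul_smul]
    rfl
  U_V g := by
    refine ⟨fun x => hE.gen (dVec g) x, hE.weyl (dVec g) 1, fun x => ?_,
      ⟨hE.weyl (dVec g), hE.weyl_add _, hE.weyl_mem _, hE.hasDerivAt_weyl _, rfl⟩,
      hE.lorentz_shift g⟩
    have h1 := ((hE.hasSum_ann x (vVec g)).sub (hE.hasSum_cre x (vVec g))).const_smul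
      ((1 / (4 * Real.pi) : ℝ) : ℂ)
    simp only [vVec_apply] at h1
    convert! h1 using 1
    exact hE.gen_dVec g x

theorem exists_lorentzAction (e : ℝ) :
    ∃ (H : Type) (_ : NormedAddCommGroup H) (_ : InnerProductSpace ℂ H) (_ : CompleteSpace H)
      (F : CoulombField e H), Nonempty (LorentzAction F) := by
  obtain ⟨H, h1, h2, h3, E, hE⟩ := exists_isCoherent (c := 4 * Real.pi * e ^ 2) (by positivity)
  exact ⟨H, h1, h2, h3, hE.coulombField, ⟨hE.lorentzAction⟩⟩

end


end Coulomb

end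

theorem mainTheorem3 :
    -- the decomposition of the elements of `SL(2, ℂ)`
    (∀ g : Coulomb.SL2C, ∃ θ₁ φ₁ ϑ₁ ϑ φ s : ℝ,
      θ₁ ∈ Set.Icc 0 (4 * Real.pi) ∧ φ₁ ∈ Set.Icc 0 Real.pi ∧ ϑ₁ ∈ Set.Icc 0 (2 * Real.pi) ∧
      ϑ ∈ Set.Icc 0 (2 * Real.pi) ∧ φ ∈ Set.Icc 0 Real.pi ∧ 0 ≤ s ∧
      g = Coulomb.g12 θ₁ * Coulomb.g13 φ₁ * Coulomb.g12 ϑ₁ *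
        Coulomb.g12 (-ϑ) * Coulomb.g13 (-φ) * Coulomb.g03 s * Coulomb.g13 φ * Coulomb.g12 ϑ) ∧
    -- `A` is well defined, with the explicit matrix elements of `U^{(1,0)}`
    (∀ k ∈ Coulomb.SU2, ∀ a ∈ Coulomb.SU2, ∀ (s : ℝ) (α β : Coulomb.Idx),
      Coulomb.A (k * Coulomb.g03 s * a) α β = Coulomb.kakEntry k s a α β) ∧
    (∀ (s : ℝ) (α β : Coulomb.Idx),
      Coulomb.A (Coulomb.g03 s) α β = (Coulomb.boostEntry α.l α.m β.l β.m s : ℝ)) ∧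
    (∀ a ∈ Coulomb.SU2, ∀ α β : Coulomb.Idx,
      Coulomb.A a α β = if α.l = β.l then
        Coulomb.wignerT α.l α.m β.m (a : Matrix (Fin 2) (Fin 2) ℂ) else 0) ∧
    (∀ α β : Coulomb.Idx,
      HasDerivAt (fun s : ℝ => Coulomb.A (Coulomb.g03 s) α β)
        ((Coulomb.boostGenerator α β : ℝ) : ℂ) 0) ∧
    -- `A` is a continuous unitary matrix representation; (I)
    (∀ α β : Coulomb.Idx, Continuous fun g : Coulomb.SL2C => Coulomb.A g α β) ∧
    (∀ (g : Coulomb.SL2C) (α β : Coulomb.Idx),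
      HasSum (fun γ : Coulomb.Idx => starRingEnd ℂ (Coulomb.A g γ α) * Coulomb.A g γ β)
        (if α = β then 1 else 0)) ∧
    (∀ (g : Coulomb.SL2C) (α β : Coulomb.Idx),
      HasSum (fun γ : Coulomb.Idx => Coulomb.A g α γ * starRingEnd ℂ (Coulomb.A g β γ))
        (if α = β then 1 else 0)) ∧
    (∀ (g h : Coulomb.SL2C) (α β : Coulomb.Idx),
      HasSum (fun γ : Coulomb.Idx => Coulomb.A g α γ * Coulomb.A h γ β)
        (Coulomb.A (g * h) α β)) ∧
    ∀ e : ℝ,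
      -- `B` is well defined, with its explicit values
      (∀ k ∈ Coulomb.SU2, ∀ a ∈ Coulomb.SU2, ∀ (s : ℝ) (α : Coulomb.Idx),
        Coulomb.B e (k * Coulomb.g03 s * a) α =
          Coulomb.boostB e s α.l 0 *
            Coulomb.A a (Coulomb.idx0 α.l α.2.1) α) ∧
      (∀ (s : ℝ) (α : Coulomb.Idx),
        Coulomb.B e (Coulomb.g03 s) α = Coulomb.boostB e s α.l α.m) ∧
      (∀ (s : ℝ) (α : Coulomb.Idx),
        Coulomb.boostB e s α.l α.m = (-1) ^ α.l * Coulomb.boostB e (-s) α.l α.m) ∧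
      -- (II)
      (∀ (g h : Coulomb.SL2C) (α : Coulomb.Idx),
        HasSum (fun β : Coulomb.Idx => Coulomb.B e g β * Coulomb.A h β α)
          (Coulomb.B e (g * h) α - Coulomb.B e h α)) ∧
      -- (III)
      (∀ a ∈ Coulomb.SU2, ∀ α : Coulomb.Idx, Coulomb.B e a α = 0) ∧
      -- the identity `B(g) A(g⁻¹) = -B(g⁻¹)`, with `B(g⁻¹) = B(-s) A(k⁻¹)` for `g = k g₀₃(s) a`
      (∀ (g : Coulomb.SL2C) (α : Coulomb.Idx),
        HasSum (fun β : Coulomb.Idx => Coulomb.B e g β * Coulomb.A g⁻¹ β α)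
          (-Coulomb.B e g⁻¹ α)) ∧
      (∀ k ∈ Coulomb.SU2, ∀ a ∈ Coulomb.SU2, ∀ (s : ℝ) (α : Coulomb.Idx),
        Coulomb.B e (k * Coulomb.g03 s * a)⁻¹ α =
          Coulomb.boostB e (-s) α.l 0 *
            Coulomb.A k⁻¹ (Coulomb.idx0 α.l α.2.1) α) ∧
      -- the norm of `B`
      (∀ k ∈ Coulomb.SU2, ∀ a ∈ Coulomb.SU2, ∀ s : ℝ, s ≠ 0 →
        HasSum (fun α : Coulomb.Idx => ‖Coulomb.B e (k * Coulomb.g03 s * a) α‖ ^ 2)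
          (8 * e ^ 2 * (s * (Real.cosh s / Real.sinh s) - 1))) ∧
      -- the axioms have a unitary implementation
      (∃ (H : Type) (_ : NormedAddCommGroup H) (_ : InnerProductSpace ℂ H) (_ : CompleteSpace H)
        (F : Coulomb.CoulombField e H), Nonempty (Coulomb.LorentzAction F)) := by
  refine ⟨Coulomb.exists_euler_decomposition, fun k hk a ha => Coulomb.A_kak hk ha, Coulomb.A_g03,
    fun a ha => Coulomb.A_SU2 ha, Coulomb.hasDerivAt_A_g03, Coulomb.continuous_A,
    Coulomb.A_unitary_left, Coulomb.A_unitary_right, Coulomb.A_mul, fun e => ?_⟩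
  exact ⟨fun k hk a ha => Coulomb.B_kak e hk ha, Coulomb.B_g03 e, Coulomb.boostB_neg e,
    Coulomb.B_mul e, fun a ha => Coulomb.B_SU2 e ha, Coulomb.B_inv e,
    fun k hk a ha => Coulomb.B_kak_inv e hk ha,
    fun k hk a ha s hs => Coulomb.hasSum_norm_B e hk ha hs, Coulomb.exists_lorentzAction e⟩
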